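/- Let $\mathbb N=\{1,2,\dots\}$. For $\alpha,s\in\mathbb N$ let $H_{\alpha,s}([0,1]^s)$ be the unweighted unanchored Sobolev space, i.e. the $s$-fold tensor product of the space of functions on $[0,1]$ with absolutely continuous derivatives up to order $\alpha-1$ and square integrable derivative of order $\alpha$. It consists of the continuous functions $F:[0,1]^s\to\mathbb R$ all of whose weak mixed derivatives $F^{(\tau)}$, $\tau\in\{0,\dots,\alpha\}^s$, are square integrable, with norm $$\|F\|_{H_{\alpha,s}}^2=\sum_{\tau\in\{0,\dots,\alpha\}^s}\int_{[0,1]^{\mathfrak v}}\Big(\int_{[0,1]^{\{1,\dots,s\}\setminus\mathfrak v}}F^{(\tau)}(y)\,dy_{-\mathfrak v}\Big)^2dy_{\mathfrak v},\qquad \mathfrak v=\mathfrak v(\tau)=\{j:\tau_j=\alpha\}.$$ Identify $k=\sum_i\kappa_i2^i\in\mathbb N_0$, $\kappa_i\in\{0,1\}$, with the polynomial $k(x)=\sum_i\kappa_ix^i\in\mathbb Z_2[x]$, and for a formal Laurent series put $\vartheta_m(\sum_{i\ge\ell}w_ix^{-i})=\sum_{i=\max(1,\ell)}^m w_i2^{-i}$.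 For $y_1,\dots,y_\alpha\in[0,1)$ with binary digits $y_j=\sum_{i\ge1}\xi_{i,j}2^{-i}$ (not eventually equal to $1$) let $\mathscr D_\alpha(y_1,\dots,y_\alpha)=\sum_{i\ge1}\sum_{j=1}^\alpha\xi_{i,j}2^{-\alpha(i-1)-j}$, and let $\mathscr D_\alpha:[0,1)^{\alpha s}\to[0,1)^s$ act on consecutive blocks of $\alpha$ coordinates. An interlaced polynomial lattice rule of order $\alpha$ with $n=2^m$ points is given by an irreducible modulus $p\in\mathbb Z_2[x]$ with $\deg p=m$ and a generating vector $q=(q_1,\dots,q_{\alpha s})$ of polynomials over $\mathbb Z_2$ of degree less than $m$; it is the rule $$Q_{p,q}(F)=\frac1n\sum_{k=0}^{n-1}F(y^{(k)}),\qquad y^{(k)}=\mathscr D_\alpha\Big(\vartheta_m\big(\tfrac{k q_1}{p}\big),\dots,\vartheta_m\big(\tfrac{k q_{\alpha s}}{p}\big)\Big),$$ where the quotients are expanded as Laurent series in $x^{-1}$. **Theorem.** There are an algorithm and an absolute constant $C$ such that for all $\alpha,s,m\in\mathbb N$ with $\alpha\ge2$, and with $n=2^m$, the algorithm constructs from the input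 $(\alpha,s,m)$, at cost at most $C\,\alpha\,s\,n\log n$, the modulus $p$ and the generating vector $q$ of an interlaced polynomial lattice rule of order $\alpha$ with $n$ points, such that for every $\lambda\in[1,\alpha)$ and every $F\in H_{\alpha,s}([0,1]^s)$ $$\Big|\int_{[0,1]^s}F(y)\,dy-Q_{p,q}(F)\Big|\le\frac{\widetilde C_{\alpha,\lambda,s}}{n^\lambda}\,\|F\|_{H_{\alpha,s}},\qquad \widetilde C_{\alpha,\lambda,s}=4^\lambda\,2^{\alpha(\alpha-1)s/2}\left[\Big(1+\frac1{2^{\alpha/\lambda}-2}\Big)^{\alpha s}-1\right]^\lambda.$$ Here an algorithm is a single program for a random access machine with arrays of natural numbers and arrays of exact real numbers, all initially zero except for the input, and indirect addressing by natural numbers. The cost is the number of operations performed, each at unit cost: reading and writing a cell, tests and branches, natural number literals; addition, truncated subtraction, halving (rounded down), bitwise exclusive or and comparison of natural numbers; conversion of a natural number to a real number; and addition, subtraction, multiplication, division, square root and comparison of real numbers. The polynomials $p$ and $q_j$ are output as the natural numbers identified with them. -/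

import Mathlib

open MeasureTheory

noncomputable section

namespace QMC

/-! ### The unanchored Sobolev space of dominating mixed smoothness on the unit cube -/

/-- The closed unit cube `[0,1]^s`. -/
def cube (s : ℕ) : Set (Fin s → ℝ) := Set.Icc 0 1

/-- The classical partial derivative in direction `j`. -/
def partialDeriv {s : ℕ} (j : Fin s) (φ : (Fin s → ℝ) → ℝ) : (Fin s → ℝ) → ℝ :=
  fun x => fderiv ℝ φ x (Pi.single j 1)

/-- The classical mixed partial derivative `∂^τ φ`, differentiating `τ j` times in direction `j`
(only applied to smooth functions, for which the order of differentiation is irrelevant). -/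
def mixedPartial {s : ℕ} (τ : Fin s → ℕ) (φ : (Fin s → ℝ) → ℝ) : (Fin s → ℝ) → ℝ :=
  (List.finRange s).foldr (fun j g => (partialDeriv j)^[τ j] g) φ

/-- Smooth test functions with compact support in the open cube `(0,1)^s`. -/
def IsTestFunction {s : ℕ} (φ : (Fin s → ℝ) → ℝ) : Prop :=
  ContDiff ℝ ((⊤ : ℕ∞) : WithTop ℕ∞) φ ∧ HasCompactSupport φ ∧
    tsupport φ ⊆ Set.univ.pi (fun _ => Set.Ioo (0 : ℝ) 1)

/-- `g ∈ L²([0,1]^s)` is the weak mixed derivative `F^{(τ)}` of `F` on the cube. -/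
def HasWeakDeriv {s : ℕ} (τ : Fin s → ℕ) (F g : (Fin s → ℝ) → ℝ) : Prop :=
  MemLp g 2 (volume.restrict (cube s)) ∧
    ∀ φ : (Fin s → ℝ) → ℝ, IsTestFunction φ →
      ∫ y in cube s, F y * mixedPartial τ φ y
        = (-1 : ℝ) ^ (∑ j, τ j) * ∫ y in cube s, g y * φ y

/-- Membership in `H_{α,s}([0,1]^s)`, the `s`-fold tensor product of the univariate unanchored
Sobolev space: `F` is continuous on the cube and every weak mixed derivative `F^{(τ)}`,
`τ ∈ {0,…,α}^s`, exists and is square integrable. -/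
def MemH {s : ℕ} (α : ℕ) (F : (Fin s → ℝ) → ℝ) : Prop :=
  ContinuousOn F (cube s) ∧
    ∀ τ : Fin s → Fin (α + 1), ∃ g, HasWeakDeriv (fun j => (τ j : ℕ)) F g

open scoped Classical in
/-- The weak derivative `F^{(τ)}` (unique up to a null set of the cube; `0` if there is none). -/
def weakDeriv {s : ℕ} (τ : Fin s → ℕ) (F : (Fin s → ℝ) → ℝ) : (Fin s → ℝ) → ℝ :=
  if h : ∃ g, HasWeakDeriv τ F g then h.choose else 0

/-- The point of the cube with coordinates `u j` for `τ j = α` and `w j` for `τ j ≠ α`. -/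
def glue {s α : ℕ} (τ : Fin s → Fin (α + 1)) (u : {j // τ j = Fin.last α} → ℝ)
    (w : {j // τ j ≠ Fin.last α} → ℝ) : Fin s → ℝ :=
  fun j => if h : τ j = Fin.last α then u ⟨j, h⟩ else w ⟨j, h⟩

/-- The squared norm of `H_{α,s}([0,1]^s)`: with `𝔳 = {j : τ_j = α}`,
`∑_{τ ∈ {0,…,α}^s} ∫_{[0,1]^𝔳} (∫_{[0,1]^{-𝔳}} F^{(τ)}(y) dy_{-𝔳})² dy_𝔳`. -/
def normSqH {s : ℕ} (α : ℕ) (F : (Fin s → ℝ) → ℝ) : ℝ :=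
  ∑ τ : Fin s → Fin (α + 1),
    ∫ u in Set.Icc (0 : {j // τ j = Fin.last α} → ℝ) 1,
      (∫ w in Set.Icc (0 : {j // τ j ≠ Fin.last α} → ℝ) 1,
        weakDeriv (fun j => (τ j : ℕ)) F (glue τ u w)) ^ 2

/-- The norm of `H_{α,s}([0,1]^s)`. -/
def normH {s : ℕ} (α : ℕ) (F : (Fin s → ℝ) → ℝ) : ℝ := Real.sqrt (normSqH α F)

/-! ### Interlaced polynomial lattice rules over the field with two elements -/

/-- The polynomial `κ₀ + κ₁ x + κ₂ x² + ⋯` over `ℤ/2` identified with the integer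
`k = κ₀ + κ₁ 2 + κ₂ 2² + ⋯`. -/
def polyOfNat (k : ℕ) : Polynomial (ZMod 2) :=
  ∑ i ∈ Finset.range k.size, if k.testBit i then (Polynomial.X : Polynomial (ZMod 2)) ^ i else 0

/-- A polynomial in `x`, as a formal Laurent series in the variable `x⁻¹`. -/
def toLaurentInv (f : Polynomial (ZMod 2)) : LaurentSeries (ZMod 2) :=
  Polynomial.aeval (HahnSeries.single (-1 : ℤ) (1 : ZMod 2) : LaurentSeries (ZMod 2)) f

/-- `ϑ_m (∑_{i ≥ ℓ} w_i x^{-i}) = ∑_{1 ≤ i ≤ m} w_i 2^{-i}`. -/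
def vartheta (m : ℕ) (w : LaurentSeries (ZMod 2)) : ℝ :=
  ∑ i ∈ Finset.Icc 1 m, ((w.coeff (i : ℤ)).val : ℝ) / 2 ^ i

/-- The `k`-th point of the polynomial lattice point set with modulus `p` (of degree `m`) and
generating vector `q`. -/
def polyLatticePoint {d : ℕ} (m : ℕ) (p : Polynomial (ZMod 2))
    (q : Fin d → Polynomial (ZMod 2)) (k : ℕ) : Fin d → ℝ :=
  fun j => vartheta m (toLaurentInv (polyOfNat k * q j) / toLaurentInv p)

/-- The `i`-th binary digit (`i ≥ 1`) of `y ∈ [0,1)`, in the expansion which is not eventually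
constant equal to `1`. -/
def binDigit (i : ℕ) (y : ℝ) : ℝ := ((⌊2 ^ i * y⌋ % 2 : ℤ) : ℝ)

/-- The digit interlacing function `[0,1)^α → [0,1)`. Indices are shifted by one: the digit
`ξ_{i+1,j+1}` goes to position `α i + (j + 1)`. -/
def interlace {α : ℕ} (y : Fin α → ℝ) : ℝ :=
  ∑' i : ℕ, ∑ j : Fin α, binDigit (i + 1) (y j) / 2 ^ (α * i + ((j : ℕ) + 1))

/-- The digit interlacing function `[0,1)^{α s} → [0,1)^s`, acting on consecutive blocks of `α`
coordinates (`finProdFinEquiv (i, j)` is the index `j + α * i`). -/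
def interlaceVec {α s : ℕ} (y : Fin (s * α) → ℝ) : Fin s → ℝ :=
  fun i => interlace (fun j : Fin α => y (finProdFinEquiv (i, j)))

/-- `p` and `q` are the modulus and the generating vector of an interlaced polynomial lattice rule
of order `α` in dimension `s` with `2^m` points. -/
def IsIPLR (α s m : ℕ) (p : Polynomial (ZMod 2)) (q : Fin (s * α) → Polynomial (ZMod 2)) : Prop :=
  Irreducible p ∧ p.natDegree = m ∧ ∀ j, (q j).degree < (m : WithBot ℕ)

/-- The `k`-th point of the interlaced polynomial lattice point set, `0 ≤ k < 2^m`. -/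
def iplrPoint {α s : ℕ} (m : ℕ) (p : Polynomial (ZMod 2)) (q : Fin (s * α) → Polynomial (ZMod 2))
    (k : ℕ) : Fin s → ℝ :=
  interlaceVec (polyLatticePoint m p q k)

/-- The interlaced polynomial lattice rule: the equal weight cubature rule on its `2^m` points. -/
def iplrRule {α s : ℕ} (m : ℕ) (p : Polynomial (ZMod 2)) (q : Fin (s * α) → Polynomial (ZMod 2))
    (F : (Fin s → ℝ) → ℝ) : ℝ :=
  1 / 2 ^ m * ∑ k ∈ Finset.range (2 ^ m), F (iplrPoint m p q k)

/-- The constant `C̃_{α,λ,s}`. -/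
def Ctilde (α : ℕ) (lam : ℝ) (s : ℕ) : ℝ :=
  (4 : ℝ) ^ lam * (2 : ℝ) ^ ((α : ℝ) * ((α : ℝ) - 1) * (s : ℝ) / 2) *
    ((1 + 1 / ((2 : ℝ) ^ ((α : ℝ) / lam) - 2)) ^ (α * s) - 1) ^ lam

/-! ### The cost model: a unit-cost real random access machine

Programs are finite syntactic objects, written in a structured imperative language. The memory
consists of arrays of natural numbers and arrays of exact real numbers (a program names its finitely
many arrays by literals), with
indirect addressing by natural numbers. On reals: `+`, `-`, `*`, `/`, square root, comparison,
conversion from a natural number, each at unit cost; there are no real constants in programs, and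
there is no conversion (rounding) from reals to integers. On natural numbers: `+`, truncated `-`,
halving, bitwise exclusive or, comparison, each at unit cost; there is no multiplication, so that
numbers grow by at most one bit per operation. -/

/-- Contents of the memory: natural number array `a`, cell `i`, and real array `a`, cell `i`. -/
structure Memory where
  nat : ℕ → ℕ → ℕ
  real : ℕ → ℕ → ℝ

/-- Expressions with natural number values. -/
inductive NExp : Type where
  | lit (k : ℕ)
  | get (a : ℕ) (i : NExp)
  | add (e f : NExp)
  | sub (e f : NExp)
  | half (e : NExp)
  | xor (e f : NExp)

/-- The value of a natural number expression. -/
def NExp.eval (σ : Memory) : NExp → ℕ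
  | .lit k => k
  | .get a i => σ.nat a (i.eval σ)
  | .add e f => e.eval σ + f.eval σ
  | .sub e f => e.eval σ - f.eval σ
  | .half e => e.eval σ / 2
  | .xor e f => Nat.xor (e.eval σ) (f.eval σ)

/-- The cost of evaluation is the number of operations, i.e., of nodes of the expression. -/
def NExp.cost : NExp → ℕ
  | .lit _ => 1
  | .get _ i => i.cost + 1
  | .add e f => e.cost + f.cost + 1
  | .sub e f => e.cost + f.cost + 1
  | .half e => e.cost + 1
  | .xor e f => e.cost + f.cost + 1

/-- Expressions with real values. -/
inductive RExp : Type where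
  | ofNat (e : NExp)
  | get (a : ℕ) (i : NExp)
  | add (x y : RExp)
  | sub (x y : RExp)
  | mul (x y : RExp)
  | div (x y : RExp)
  | sqrt (x : RExp)

/-- The value of a real expression. -/
def RExp.eval (σ : Memory) : RExp → ℝ
  | .ofNat e => (e.eval σ : ℝ)
  | .get a i => σ.real a (i.eval σ)
  | .add x y => x.eval σ + y.eval σ
  | .sub x y => x.eval σ - y.eval σ
  | .mul x y => x.eval σ * y.eval σ
  | .div x y => x.eval σ / y.eval σ
  | .sqrt x => Real.sqrt (x.eval σ)

/-- The number of operations of a real expression. -/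
def RExp.cost : RExp → ℕ
  | .ofNat e => e.cost + 1
  | .get _ i => i.cost + 1
  | .add x y => x.cost + y.cost + 1
  | .sub x y => x.cost + y.cost + 1
  | .mul x y => x.cost + y.cost + 1
  | .div x y => x.cost + y.cost + 1
  | .sqrt x => x.cost + 1

/-- Tests. -/
inductive BExp : Type where
  | ltN (e f : NExp)
  | ltR (x y : RExp)
  | not (b : BExp)
  | and (b c : BExp)

/-- The truth of a test. -/
def BExp.holds (σ : Memory) : BExp → Prop
  | .ltN e f => e.eval σ < f.eval σ
  | .ltR x y => x.eval σ < y.eval σ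
  | .not b => ¬ b.holds σ
  | .and b c => b.holds σ ∧ c.holds σ

/-- The number of operations of a test. -/
def BExp.cost : BExp → ℕ
  | .ltN e f => e.cost + f.cost + 1
  | .ltR x y => x.cost + y.cost + 1
  | .not b => b.cost + 1
  | .and b c => b.cost + c.cost + 1

/-- Programs: `setN a i e` and `setR a i x` store a value in cell `i` of the natural number array
`a`, respectively of the real array `a`. -/
inductive Program : Type where
  | skip
  | setN (a : ℕ) (i : NExp) (e : NExp)
  | setR (a : ℕ) (i : NExp) (x : RExp)
  | seq (P Q : Program)
  | ite (b : BExp) (P Q : Program)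
  | loop (b : BExp) (P : Program)

/-- The memory after storing the natural number `v` in cell `i` of the array `a`. -/
def Memory.writeN (σ : Memory) (a i v : ℕ) : Memory :=
  { σ with nat := Function.update σ.nat a (Function.update (σ.nat a) i v) }

/-- The memory after storing the real number `v` in cell `i` of the array `a`. -/
def Memory.writeR (σ : Memory) (a i : ℕ) (v : ℝ) : Memory :=
  { σ with real := Function.update σ.real a (Function.update (σ.real a) i v) }

/-- `Runs P σ t σ'`: started on the memory `σ`, the program `P` halts with memory `σ'` after a total
cost of exactly `t` operations; `loop b P` executes `P` as long as `b` holds. -/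
inductive Runs : Program → Memory → ℕ → Memory → Prop where
  | skip (σ : Memory) : Runs .skip σ 1 σ
  | setN (σ : Memory) (a : ℕ) (i e : NExp) :
      Runs (.setN a i e) σ (i.cost + e.cost + 1) (σ.writeN a (i.eval σ) (e.eval σ))
  | setR (σ : Memory) (a : ℕ) (i : NExp) (x : RExp) :
      Runs (.setR a i x) σ (i.cost + x.cost + 1) (σ.writeR a (i.eval σ) (x.eval σ))
  | seq {P Q : Program} {σ σ' σ'' : Memory} {t t' : ℕ} :
      Runs P σ t σ' → Runs Q σ' t' σ'' → Runs (.seq P Q) σ (t + t') σ''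
  | iteTrue {b : BExp} {P Q : Program} {σ σ' : Memory} {t : ℕ} :
      b.holds σ → Runs P σ t σ' → Runs (.ite b P Q) σ (b.cost + t + 1) σ'
  | iteFalse {b : BExp} {P Q : Program} {σ σ' : Memory} {t : ℕ} :
      ¬ b.holds σ → Runs Q σ t σ' → Runs (.ite b P Q) σ (b.cost + t + 1) σ'
  | loopStep {b : BExp} {P : Program} {σ σ' σ'' : Memory} {t t' : ℕ} :
      b.holds σ → Runs P σ t σ' → Runs (.loop b P) σ' t' σ'' →
        Runs (.loop b P) σ (b.cost + t + t' + 1) σ''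
  | loopDone {b : BExp} {P : Program} {σ : Memory} :
      ¬ b.holds σ → Runs (.loop b P) σ (b.cost + 1) σ

/-- The initial memory on input `(α, s, m)`: the natural number array `0` starts with `α, s, m`,
and all other cells are zero. -/
def inputMemory (α s m : ℕ) : Memory where
  nat := fun a i =>
    if a = 0 ∧ i = 0 then α else if a = 0 ∧ i = 1 then s else if a = 0 ∧ i = 2 then m else 0
  real := fun _ _ => 0

/-- The modulus which is read off from the final memory: cell `0` of the natural number array `1`,
as a polynomial. -/
def outputModulus (σ : Memory) : Polynomial (ZMod 2) := polyOfNat (σ.nat 1 0)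

/-- The generating vector which is read off from the final memory: cells `1, 2, …, α s` of the
natural number array `1`, as polynomials. -/
def outputVector (α s : ℕ) (σ : Memory) : Fin (s * α) → Polynomial (ZMod 2) :=
  fun j => polyOfNat (σ.nat 1 ((j : ℕ) + 1))

end QMC

end

/-! ### Decay of Walsh coefficients in one variable -/

noncomputable section

namespace QMC

/-! ### Walsh functions and their iterated antiderivatives -/

/-! The integration error is expanded in Walsh functions. In one variable, `α` integrations by parts
write `f ↦ ∫ f * wal S` as a combination of the means of `f^(τ)`, `τ < α`, and of the integral of
`f^(α)` against the `α`-fold periodic antiderivative of `wal S`. As long as there are fewer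
antiderivatives than digits in `S`, all means vanish; each antiderivative gains the size of one
binary digit (`iterate_antider_wal_bound`). Beyond that, mean and antiderivative together form an
`L²` contraction (`IsNice.sq_add_integral_antider_sq_le`). Hence the dual norm of the functional is
at most `2^(-∑_{i ∈ U} (i+1))` for every `U ⊆ S` with at most `α` elements (`sum_sq_walsh_le`), with
constant one, so nothing accumulates when tensor products are taken
(`abs_integral_mul_prod_wal_le`). Since weak derivatives may only be tested against smooth functions
supported in the open cube, products of Walsh functions are mollified and shrunk into the cube
before passing to the limit (`integral_mul_prod_wal`).

Interlacing converts this decay into product weights over all `α s` components, at the price of a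
factor `2^(α(α-1)/2)` per coordinate (`exists_subset_sum_ge`). The character sums of a polynomial
lattice are zero or one, and the rule sees only the lowest `m` digits of a frequency. Grouping
frequencies by these digits bounds the error by a sum over the dual lattice in the field `ℤ₂[x]/p`,
a frequency having weight `b^(number of digits)` with `b = 2^(-α)`, and `T` being the weight of all
frequencies of a class beyond the resolution (`abs_integral_sub_iplrRule_le`).

The components are chosen greedily. As `p` is irreducible, multiplication by a nonzero class
permutes the nonzero classes, so the mean of the criterion over all candidates can be computed, and
the minimum does not exceed it. Before averaging, the inequality `(∑ a)^κ ≤ ∑ a^κ` with `κ = 1/λ`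
replaces the base `b` by `b^κ`. The criterion itself depends neither on `λ` nor on `T`, so one
vector serves all `λ < α` (`dualSum_greedy_rpow_le`, `dualSum_sub_one_le_of_greedy`).

For the cost, let `n = 2^m`. A modulus is found by sieving, with about `n` marks for each degree of
a factor (`modulusProg_ends`). A generator of the multiplicative group is found by listing the
powers of every class that is not a power of an earlier one. In a cyclic group the classes tried
have different orders dividing `n - 1`, so the lists have total length at most the divisor sum of `n
- 1`, which is at most `n m` (`sum_not_covered_le`, `generatorProg_ends`). With classes written as
powers of the generator, the criterion for all candidates at once is a convolution of real sequences
(`greedy_of_powers`). It is evaluated by a fast Fourier transform whose twiddle factors are computed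
by square roots alone (`fourier_convolution`, `componentProg_ends`). The programs are verified in a
small calculus of pre- and postconditions with cost bounds (`Ends`). -/

/-- The Rademacher function of the binary digit in position `i + 1`. -/
def rad (i : ℕ) (x : ℝ) : ℝ := if Even ⌊2 ^ (i + 1) * x⌋ then 1 else -1

/-- The Walsh function whose index has the binary digits in `S` equal to `1`. -/
def wal (S : Finset ℕ) (x : ℝ) : ℝ := ∏ i ∈ S, rad i x

/-- The `1`-periodic antiderivative of `∫ g - g` vanishing at the integers. -/
def antider (g : ℝ → ℝ) (x : ℝ) : ℝ := -((∫ y in (0 : ℝ)..x, g y) - x * ∫ y in (0 : ℝ)..1, g y)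

/-- Bounded measurable functions of period one. -/
structure IsNice (g : ℝ → ℝ) : Prop where
  meas : Measurable g
  per : Function.Periodic g 1
  bdd : ∃ B, ∀ x, |g x| ≤ B

lemma IsNice.intervalIntegrable {g : ℝ → ℝ} (hg : IsNice g) (a b : ℝ) :
    IntervalIntegrable g volume a b := by
  obtain ⟨B, hB⟩ := hg.bdd
  exact (intervalIntegrable_const (c := B)).mono_fun hg.meas.aestronglyMeasurable
    (Filter.Eventually.of_forall fun x => by
      simpa using (hB x).trans (le_abs_self B))

lemma IsNice.continuous_antider {g : ℝ → ℝ} (hg : IsNice g) : Continuous (antider g) := by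
  unfold antider
  have := intervalIntegral.continuous_primitive (fun a b => hg.intervalIntegrable a b) 0
  fun_prop

lemma antider_zero (g : ℝ → ℝ) : antider g 0 = 0 := by simp [antider]

lemma antider_one (g : ℝ → ℝ) : antider g 1 = 0 := by simp [antider]

lemma IsNice.periodic_antider {g : ℝ → ℝ} (hg : IsNice g) :
    Function.Periodic (antider g) 1 := by
  intro x
  unfold antider
  have h := hg.per.intervalIntegral_add_eq x 0
  rw [← intervalIntegral.integral_add_adjacent_intervals (hg.intervalIntegrable 0 x)
    (hg.intervalIntegrable x (x + 1)), h, zero_add]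
  ring

lemma isNice_antider {g : ℝ → ℝ} (hg : IsNice g) : IsNice (antider g) := by
  refine ⟨hg.continuous_antider.measurable, hg.periodic_antider, ?_⟩
  obtain ⟨B, hB⟩ := isCompact_Icc.exists_bound_of_continuousOn
    (s := Set.Icc (0 : ℝ) 1) hg.continuous_antider.continuousOn
  refine ⟨B, fun x => ?_⟩
  obtain ⟨y, hy, hxy⟩ := hg.periodic_antider.exists_mem_Ico₀ one_pos x
  rw [hxy]
  exact hB y ⟨hy.1, hy.2.le⟩

lemma IsNice.iterate {g : ℝ → ℝ} (hg : IsNice g) (t : ℕ) : IsNice (antider^[t] g) := by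
  induction t with
  | zero => exact hg
  | succ t ih => rw [Function.iterate_succ_apply']; exact isNice_antider ih

lemma abs_rad (i : ℕ) (x : ℝ) : |rad i x| = 1 := by
  unfold rad; split_ifs <;> simp

lemma measurable_rad (i : ℕ) : Measurable (rad i) := by
  unfold rad
  refine Measurable.ite ?_ measurable_const measurable_const
  have h : Measurable fun x : ℝ => ⌊2 ^ (i + 1) * x⌋ := by fun_prop
  exact h (MeasurableSet.of_discrete (s := {z : ℤ | Even z}))

lemma rad_add_one (i : ℕ) (x : ℝ) : rad i (x + 1) = rad i x := by
  unfold rad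
  have : (2 : ℝ) ^ (i + 1) * (x + 1) = 2 ^ (i + 1) * x + ((2 ^ (i + 1) : ℤ) : ℝ) := by
    push_cast; ring
  rw [this, Int.floor_add_intCast]
  simp [Int.even_add, pow_succ]

lemma rad_succ (i : ℕ) (x : ℝ) : rad (i + 1) x = rad i (2 * x) := by
  unfold rad
  rw [show (2 : ℝ) ^ (i + 1 + 1) * x = 2 ^ (i + 1) * (2 * x) by ring]

lemma abs_wal (S : Finset ℕ) (x : ℝ) : |wal S x| = 1 := by
  simp [wal, Finset.abs_prod, abs_rad]

lemma isNice_wal (S : Finset ℕ) : IsNice (wal S) where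
  meas := by
    unfold wal
    exact Finset.measurable_prod _ fun i _ => measurable_rad i
  per := fun x => by simp [wal, rad_add_one]
  bdd := ⟨1, fun x => (abs_wal S x).le⟩

/-- The digit positions of a Walsh function after removing the first digit. -/
def shiftDown (S : Finset ℕ) : Finset ℕ := S.preimage (· + 1) (add_left_injective 1).injOn

lemma mem_shiftDown {S : Finset ℕ} {i : ℕ} : i ∈ shiftDown S ↔ i + 1 ∈ S := by
  simp [shiftDown]

lemma eq_shiftDown_map (S : Finset ℕ) :
    S.erase 0 = (shiftDown S).map (addRightEmbedding 1) := by
  ext i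
  simp only [Finset.mem_erase, Finset.mem_map, mem_shiftDown, addRightEmbedding_apply]
  constructor
  · rintro ⟨h0, h⟩
    exact ⟨i - 1, by rwa [Nat.sub_add_cancel (Nat.pos_of_ne_zero h0)],
      Nat.sub_add_cancel (Nat.pos_of_ne_zero h0)⟩
  · rintro ⟨j, hj, rfl⟩
    exact ⟨by omega, hj⟩

lemma prod_eq_shiftDown {M : Type*} [CommMonoid M] (S : Finset ℕ) (f : ℕ → M) :
    ∏ i ∈ S, f i = (if 0 ∈ S then f 0 else 1) * ∏ i ∈ shiftDown S, f (i + 1) := by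
  have h : ∏ i ∈ S.erase 0, f i = ∏ i ∈ shiftDown S, f (i + 1) := by
    rw [eq_shiftDown_map, Finset.prod_map]; rfl
  rw [← h]
  split_ifs with h0
  · exact (Finset.mul_prod_erase S f h0).symm
  · rw [Finset.erase_eq_of_notMem h0, one_mul]

lemma sum_eq_shiftDown {M : Type*} [AddCommMonoid M] (S : Finset ℕ) (f : ℕ → M) :
    ∑ i ∈ S, f i = (if 0 ∈ S then f 0 else 0) + ∑ i ∈ shiftDown S, f (i + 1) :=
  prod_eq_shiftDown (M := Multiplicative M) S f

lemma card_shiftDown (S : Finset ℕ) : S.card = (if 0 ∈ S then 1 else 0) + (shiftDown S).card := by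
  simpa only [Finset.card_eq_sum_ones] using sum_eq_shiftDown S (fun _ => 1)

lemma wal_eq_shiftDown (S : Finset ℕ) (x : ℝ) :
    wal S x = (if 0 ∈ S then rad 0 x else 1) * wal (shiftDown S) (2 * x) := by
  unfold wal
  rw [prod_eq_shiftDown]
  simp only [rad_succ]

lemma integral_comp_two_mul (h : ℝ → ℝ) (a b : ℝ) :
    ∫ y in a..b, h (2 * y) = 1 / 2 * ∫ y in (2 * a)..(2 * b), h y := by
  rw [intervalIntegral.integral_comp_mul_left _ two_ne_zero]
  simp

lemma IsNice.integral_zero_two {h : ℝ → ℝ} (hh : IsNice h) :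
    ∫ y in (0 : ℝ)..2, h y = 2 * ∫ y in (0 : ℝ)..1, h y := by
  have h1 := hh.per.intervalIntegral_add_eq 1 0
  rw [← intervalIntegral.integral_add_adjacent_intervals (hh.intervalIntegrable 0 1)
    (hh.intervalIntegrable 1 2)]
  norm_num at h1
  rw [h1]; ring

lemma IsNice.antider_comp_two_mul {h : ℝ → ℝ} (hh : IsNice h) (x : ℝ) :
    antider (fun y => h (2 * y)) x = 1 / 2 * antider h (2 * x) := by
  unfold antider
  rw [integral_comp_two_mul, integral_comp_two_mul]
  norm_num
  rw [hh.integral_zero_two]; ring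

lemma antider_congr {g g' : ℝ → ℝ} (h : ∀ x ∈ Set.Ico (0 : ℝ) 1, g x = g' x) {x : ℝ}
    (hx : x ∈ Set.Icc (0 : ℝ) 1) : antider g x = antider g' x := by
  have key : ∀ z ∈ Set.Icc (0 : ℝ) 1, ∫ y in (0 : ℝ)..z, g y = ∫ y in (0 : ℝ)..z, g' y := by
    intro z hz
    apply intervalIntegral.integral_congr_ae
    filter_upwards [Measure.ae_ne volume (1 : ℝ)] with y hy1 hy
    rw [Set.uIoc_of_le hz.1] at hy
    exact h y ⟨hy.1.le, lt_of_le_of_ne (hy.2.trans hz.2) hy1⟩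
  unfold antider
  rw [key x hx, key 1 ⟨zero_le_one, le_rfl⟩]

lemma rad_zero_left {x : ℝ} (h0 : 0 ≤ x) (h1 : x < 1 / 2) : rad 0 x = 1 := by
  unfold rad
  have : ⌊(2 : ℝ) ^ (0 + 1) * x⌋ = 0 := by
    rw [Int.floor_eq_iff]; norm_num; constructor <;> linarith
  rw [this]; simp

lemma rad_zero_right {x : ℝ} (h0 : 1 / 2 ≤ x) (h1 : x < 1) : rad 0 x = -1 := by
  unfold rad
  have : ⌊(2 : ℝ) ^ (0 + 1) * x⌋ = 1 := by
    rw [Int.floor_eq_iff]; norm_num; constructor <;> linarith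
  rw [this]; simp

lemma isNice_rad_mul {h : ℝ → ℝ} (hh : IsNice h) : IsNice fun y => rad 0 y * h (2 * y) where
  meas := (measurable_rad 0).mul (hh.meas.comp (measurable_const_mul 2))
  per := fun x => by
    have h2 : h (2 * (x + 1)) = h (2 * x) := by
      rw [show 2 * (x + 1) = 2 * x + 1 + 1 by ring, hh.per, hh.per]
    simp only [rad_add_one, h2]
  bdd := by
    obtain ⟨B, hB⟩ := hh.bdd
    exact ⟨B, fun x => by rw [abs_mul, abs_rad, one_mul]; exact hB _⟩

lemma IsNice.integral_rad_mul_left {h : ℝ → ℝ} {x : ℝ} (h0 : 0 ≤ x) (h1 : x ≤ 1 / 2) :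
    ∫ y in (0 : ℝ)..x, rad 0 y * h (2 * y) = 1 / 2 * ∫ y in (0 : ℝ)..(2 * x), h y := by
  have : ∫ y in (0 : ℝ)..x, rad 0 y * h (2 * y) = ∫ y in (0 : ℝ)..x, h (2 * y) := by
    apply intervalIntegral.integral_congr_ae
    filter_upwards [Measure.ae_ne volume (1 / 2 : ℝ)] with y hy1 hy
    rw [Set.uIoc_of_le h0] at hy
    rw [rad_zero_left hy.1.le (lt_of_le_of_ne (hy.2.trans h1) hy1), one_mul]
  rw [this, integral_comp_two_mul, mul_zero]

lemma IsNice.integral_rad_mul_right {h : ℝ → ℝ} (hh : IsNice h) {x : ℝ} (h0 : 1 / 2 ≤ x)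
    (h1 : x ≤ 1) :
    ∫ y in (0 : ℝ)..x, rad 0 y * h (2 * y)
      = (∫ y in (0 : ℝ)..1, h y) - 1 / 2 * ∫ y in (0 : ℝ)..(2 * x), h y := by
  have e : ∫ y in (1 / 2 : ℝ)..x, rad 0 y * h (2 * y) = ∫ y in (1 / 2 : ℝ)..x, -h (2 * y) := by
    apply intervalIntegral.integral_congr_ae
    filter_upwards [Measure.ae_ne volume (1 : ℝ)] with y hy1 hy
    rw [Set.uIoc_of_le h0] at hy
    rw [rad_zero_right hy.1.le (lt_of_le_of_ne (hy.2.trans h1) hy1), neg_one_mul]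
  rw [← intervalIntegral.integral_add_adjacent_intervals
    ((isNice_rad_mul hh).intervalIntegrable 0 (1 / 2))
    ((isNice_rad_mul hh).intervalIntegrable (1 / 2) x), e,
    IsNice.integral_rad_mul_left (by norm_num) le_rfl, intervalIntegral.integral_neg,
    integral_comp_two_mul,
    ← intervalIntegral.integral_add_adjacent_intervals (hh.intervalIntegrable 0 1)
      (hh.intervalIntegrable 1 (2 * x))]
  norm_num
  ring

lemma IsNice.integral_rad_mul {h : ℝ → ℝ} (hh : IsNice h) :
    ∫ y in (0 : ℝ)..1, rad 0 y * h (2 * y) = 0 := by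
  rw [hh.integral_rad_mul_right (by norm_num) le_rfl, mul_one, hh.integral_zero_two]
  ring

/-- The first digit flips the sign on the second half of the interval. Because `h` has mean zero,
its antiderivative is back at zero at the midpoint, so the two halves fit together and the product
form survives integration. -/
lemma IsNice.antider_rad_mul {h : ℝ → ℝ} (hh : IsNice h) (hm : ∫ y in (0 : ℝ)..1, h y = 0)
    {x : ℝ} (hx : x ∈ Set.Ico (0 : ℝ) 1) :
    antider (fun y => rad 0 y * h (2 * y)) x = 1 / 2 * (rad 0 x * antider h (2 * x)) := by
  unfold antider
  rw [hh.integral_rad_mul, hm]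
  rcases lt_or_ge x (1 / 2) with h1 | h1
  · rw [IsNice.integral_rad_mul_left hx.1 h1.le, rad_zero_left hx.1 h1]; ring
  · rw [hh.integral_rad_mul_right h1 hx.2.le, rad_zero_right h1 hx.2, hm]; ring

/-- Without mean zero for `h` the product form is lost, but the total integral of the product still
vanishes. One may thus integrate from the nearer endpoint, over a length of at most `1 / 2`. -/
lemma IsNice.abs_antider_rad_mul_le {h : ℝ → ℝ} (hh : IsNice h) {B : ℝ}
    (hB : ∀ x, |h x| ≤ B) {x : ℝ} (hx : x ∈ Set.Ico (0 : ℝ) 1) :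
    |antider (fun y => rad 0 y * h (2 * y)) x| ≤ 1 / 2 * B := by
  have hB0 : 0 ≤ B := (abs_nonneg _).trans (hB 0)
  have hg := isNice_rad_mul hh
  have hb : ∀ a b : ℝ, |∫ y in a..b, rad 0 y * h (2 * y)| ≤ B * |b - a| := fun a b =>
    intervalIntegral.norm_integral_le_of_norm_le_const (C := B)
      (f := fun y => rad 0 y * h (2 * y)) fun y _ => by
        rw [Real.norm_eq_abs, abs_mul, abs_rad, one_mul]; exact hB (2 * y)
  unfold antider
  rw [hh.integral_rad_mul, mul_zero, sub_zero, abs_neg]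
  rcases lt_or_ge x (1 / 2) with h1 | h1
  · refine (hb 0 x).trans ?_
    rw [sub_zero, abs_of_nonneg hx.1]; nlinarith
  · have e := intervalIntegral.integral_add_adjacent_intervals (hg.intervalIntegrable 0 x)
      (hg.intervalIntegrable x 1)
    rw [hh.integral_rad_mul] at e
    rw [eq_neg_of_add_eq_zero_left e, abs_neg]
    refine (hb x 1).trans ?_
    rw [abs_of_nonneg (by linarith [hx.2])]; nlinarith

/-- Up to the number of digits of the index, the iterated antiderivatives of a Walsh function are
again of product form. -/
lemma iterate_antider_wal (S : Finset ℕ)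
    (hm : ∀ t < (shiftDown S).card, ∫ y in (0 : ℝ)..1, antider^[t] (wal (shiftDown S)) y = 0)
    {t : ℕ} (ht : t ≤ (shiftDown S).card) {x : ℝ} (hx : x ∈ Set.Ico (0 : ℝ) 1) :
    antider^[t] (wal S) x = (1 / 2) ^ t *
      ((if 0 ∈ S then rad 0 x else 1) * antider^[t] (wal (shiftDown S)) (2 * x)) := by
  induction t generalizing x with
  | zero => simpa using wal_eq_shiftDown S x
  | succ t ih =>
    have hN := (isNice_wal (shiftDown S)).iterate t
    rw [Function.iterate_succ_apply', Function.iterate_succ_apply',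
      antider_congr (fun y hy => ih (by omega) hy) ⟨hx.1, hx.2.le⟩]
    have hs : ∀ (c : ℝ) (g : ℝ → ℝ), antider (fun y => c * g y) x = c * antider g x := by
      intro c g
      simp only [antider, intervalIntegral.integral_const_mul]; ring
    rw [hs]
    split_ifs with h0
    · rw [hN.antider_rad_mul (hm t (by omega)) hx]; ring
    · simp only [one_mul]
      rw [hN.antider_comp_two_mul]; ring

/-- Induction by removing the first digit. The dilation by two contributes `2^(-t)` to the `t`-th
antiderivative, and shifting `U` down lowers its exponent by `U.card ≤ t`. If `0 ∈ S`, there is one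
antiderivative more than the shifted set provides; `IsNice.abs_antider_rad_mul_le` handles it. Means
and bounds are proved together since the product form requires the vanishing means. -/
lemma iterate_antider_wal_bound (L : ℕ) : ∀ S : Finset ℕ, S ⊆ Finset.range L →
    (∀ t < S.card, ∫ y in (0 : ℝ)..1, antider^[t] (wal S) y = 0) ∧
    ∀ t ≤ S.card, ∀ U ⊆ S, U.card ≤ t → ∀ x,
      |antider^[t] (wal S) x| ≤ (1 / 2) ^ (∑ i ∈ U, (i + 1)) := by
  induction L with
  | zero =>
    intro S hS
    obtain rfl : S = ∅ := by simpa using hS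
    refine ⟨by simp, fun t ht U hU _ x => ?_⟩
    obtain rfl : U = ∅ := by simpa using hU
    obtain rfl : t = 0 := by simpa using ht
    simp [abs_wal]
  | succ L ih =>
    intro S hS
    obtain ⟨hm, hb⟩ := ih (shiftDown S) fun i hi => by
      have := hS (mem_shiftDown.1 hi); simp at this ⊢; omega
    have hcard := card_shiftDown S
    have hcongr : ∀ t ≤ (shiftDown S).card, ∫ y in (0 : ℝ)..1, antider^[t] (wal S) y
        = ∫ y in (0 : ℝ)..1, (1 / 2) ^ t *
          ((if 0 ∈ S then rad 0 y else 1) * antider^[t] (wal (shiftDown S)) (2 * y)) := by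
      intro t ht
      apply intervalIntegral.integral_congr_ae
      filter_upwards [Measure.ae_ne volume (1 : ℝ)] with y hy1 hy
      rw [Set.uIoc_of_le zero_le_one] at hy
      exact iterate_antider_wal S hm ht ⟨hy.1.le, lt_of_le_of_ne hy.2 hy1⟩
    constructor
    · intro t ht
      have ht' : t ≤ (shiftDown S).card := by split_ifs at hcard <;> omega
      rw [hcongr t ht', intervalIntegral.integral_const_mul]
      have hN := (isNice_wal (shiftDown S)).iterate t
      split_ifs at hcard ⊢ with h0
      · rw [hN.integral_rad_mul, mul_zero]
      · simp only [one_mul]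
        rw [integral_comp_two_mul, mul_zero, mul_one, hN.integral_zero_two, hm t (by omega)]
        simp
    · intro t ht U hU hUt x
      obtain ⟨y, hy, hxy⟩ := ((isNice_wal S).iterate t).per.exists_mem_Ico₀ one_pos x
      rw [hxy]
      have hsum : ∑ i ∈ U, (i + 1) = ∑ i ∈ shiftDown U, (i + 1) + U.card := by
        rw [card_shiftDown U, sum_eq_shiftDown]
        simp only [Finset.sum_add_distrib, Finset.sum_const, smul_eq_mul, mul_one, zero_add]
        ring
      have hUS : shiftDown U ⊆ shiftDown S := fun i hi =>
        mem_shiftDown.2 (hU (mem_shiftDown.1 hi))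
      have hUc : (shiftDown U).card ≤ U.card := by rw [card_shiftDown U]; omega
      have hpow : ∀ c : ℝ, c ≤ (1 / 2) ^ (∑ i ∈ shiftDown U, (i + 1)) →
          (1 / 2 : ℝ) ^ t * c ≤ (1 / 2) ^ (∑ i ∈ U, (i + 1)) := by
        intro c hc
        rw [hsum, pow_add, mul_comm]
        gcongr ?_ * ?_
        exact pow_le_pow_of_le_one (by norm_num) (by norm_num) hUt
      rcases le_or_gt t (shiftDown S).card with h1 | h1
      · rw [iterate_antider_wal S hm h1 hy, abs_mul, abs_of_nonneg (by positivity : (0 : ℝ) ≤ _),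
          abs_mul]
        apply hpow
        have : |if 0 ∈ S then rad 0 y else 1| = 1 := by split_ifs <;> simp [abs_rad]
        rw [this, one_mul]
        exact hb t h1 _ hUS (hUc.trans hUt) _
      · have h0 : 0 ∈ S := by
          by_contra h0; rw [if_neg h0] at hcard; omega
        rw [if_pos h0] at hcard
        obtain rfl : t = (shiftDown S).card + 1 := by omega
        set d := (shiftDown S).card with hd
        rw [Function.iterate_succ_apply',
          antider_congr (fun y hy => iterate_antider_wal S hm le_rfl hy) ⟨hy.1, hy.2.le⟩]
        have hs : ∀ (c : ℝ) (g : ℝ → ℝ), antider (fun y => c * g y) y = c * antider g y := by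
          intro c g
          simp only [antider, intervalIntegral.integral_const_mul]; ring
        rw [hs, abs_mul, abs_of_nonneg (by positivity : (0 : ℝ) ≤ _)]
        simp only [h0, if_true]
        have := ((isNice_wal (shiftDown S)).iterate d).abs_antider_rad_mul_le
          (hb d le_rfl _ hUS (Finset.card_le_card hUS)) hy
        refine le_trans ?_ (hpow _ le_rfl)
        rw [pow_succ, mul_assoc]
        gcongr

lemma integral_iterate_antider_wal (S : Finset ℕ) {t : ℕ} (ht : t < S.card) :
    ∫ y in (0 : ℝ)..1, antider^[t] (wal S) y = 0 :=
  (iterate_antider_wal_bound (S.sup id + 1) S fun i hi => by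
    have : i ≤ S.sup id := Finset.le_sup (f := id) hi
    simp; omega).1 t ht

lemma abs_iterate_antider_wal_le (S : Finset ℕ) {t : ℕ} (ht : t ≤ S.card) {U : Finset ℕ}
    (hU : U ⊆ S) (hUt : U.card ≤ t) (x : ℝ) :
    |antider^[t] (wal S) x| ≤ (1 / 2) ^ (∑ i ∈ U, (i + 1)) :=
  (iterate_antider_wal_bound (S.sup id + 1) S fun i hi => by
    have : i ≤ S.sup id := Finset.le_sup (f := id) hi
    simp; omega).2 t ht U hU hUt x

lemma IsNice.intervalIntegrable_sub_sq {g : ℝ → ℝ} (hg : IsNice g) (c a b : ℝ) :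
    IntervalIntegrable (fun y => (g y - c) ^ 2) volume a b := by
  have : IsNice fun y => (g y - c) ^ 2 := by
    refine ⟨(hg.meas.sub_const c).pow_const 2, fun x => by simp [hg.per x], ?_⟩
    obtain ⟨B, hB⟩ := hg.bdd
    refine ⟨(B + |c|) ^ 2, fun x => ?_⟩
    rw [abs_pow]
    gcongr
    exact (abs_sub _ _).trans (by gcongr; exact hB x)
  exact this.intervalIntegrable a b

/-- The mean and the antiderivative are jointly a contraction in the mean square. -/
lemma IsNice.sq_add_integral_antider_sq_le {g : ℝ → ℝ} (hg : IsNice g) :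
    (∫ y in (0 : ℝ)..1, g y) ^ 2 + ∫ x in (0 : ℝ)..1, (antider g x) ^ 2
      ≤ ∫ y in (0 : ℝ)..1, (g y) ^ 2 := by
  set c := ∫ y in (0 : ℝ)..1, g y with hc
  have hi := hg.intervalIntegrable
  have hsq := hg.intervalIntegrable_sub_sq
  have hsq0 : ∀ a b, IntervalIntegrable (fun y => (g y) ^ 2) volume a b := fun a b => by
    simpa using hsq 0 a b
  have hexp : ∀ d x : ℝ, ∫ y in (0 : ℝ)..x, (g y - d) ^ 2
      = (∫ y in (0 : ℝ)..x, (g y) ^ 2) - 2 * d * (∫ y in (0 : ℝ)..x, g y) + d ^ 2 * x := by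
    intro d x
    have : ∀ y, (g y - d) ^ 2 = (g y) ^ 2 - 2 * d * g y + d ^ 2 := fun y => by ring
    simp only [this]
    rw [intervalIntegral.integral_add ((hsq0 0 x).sub ((hi 0 x).const_mul _)) (by simp),
      intervalIntegral.integral_sub (hsq0 0 x) ((hi 0 x).const_mul _),
      intervalIntegral.integral_const_mul]
    simp [mul_comm]
  have hvar := hexp c 1
  rw [← hc] at hvar
  -- With `I = ∫₀ˣ (g - c)`, nonnegativity of `∫₀ˣ (g - c - I)²` gives `∫₀ˣ (g - c)² ≥ (2 - x) I² ≥
  -- I²`. The shift `I` in place of the optimal `I / x` avoids a division.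
  have hpt : ∀ x ∈ Set.Icc (0 : ℝ) 1, (antider g x) ^ 2 ≤ ∫ y in (0 : ℝ)..1, (g y - c) ^ 2 := by
    intro x hx
    set I := (∫ y in (0 : ℝ)..x, g y) - x * c with hI
    have h1 : ∫ y in (0 : ℝ)..x, (g y - c) ^ 2 ≤ ∫ y in (0 : ℝ)..1, (g y - c) ^ 2 :=
      intervalIntegral.integral_mono_interval le_rfl hx.1 hx.2
        (Filter.Eventually.of_forall fun y => sq_nonneg _) (hsq c 0 1)
    have h2 : 0 ≤ ∫ y in (0 : ℝ)..x, (g y - (c + I)) ^ 2 :=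
      intervalIntegral.integral_nonneg hx.1 fun y _ => sq_nonneg _
    rw [hexp] at h1 h2
    have h3 : antider g x = -I := rfl
    rw [h3]
    have h4 : (∫ y in (0 : ℝ)..x, g y) = I + x * c := by rw [hI]; ring
    rw [h4] at h1 h2
    nlinarith [mul_nonneg (sub_nonneg.2 hx.2) (sq_nonneg I)]
  have hA := isNice_antider hg
  have h5 : ∫ x in (0 : ℝ)..1, (antider g x) ^ 2
      ≤ ∫ _x in (0 : ℝ)..1, ∫ y in (0 : ℝ)..1, (g y - c) ^ 2 :=
    intervalIntegral.integral_mono_on zero_le_one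
      (by simpa using hA.intervalIntegrable_sub_sq 0 0 1) (by simp) hpt
  rw [intervalIntegral.integral_const] at h5
  simp only [sub_zero, one_smul] at h5
  rw [hvar] at h5
  nlinarith

lemma IsNice.sum_sq_add_le {g : ℝ → ℝ} (hg : IsNice g) (t n : ℕ) :
    ∑ τ ∈ Finset.range n, (∫ y in (0 : ℝ)..1, antider^[t + τ] g y) ^ 2
      + ∫ y in (0 : ℝ)..1, (antider^[t + n] g y) ^ 2
      ≤ ∫ y in (0 : ℝ)..1, (antider^[t] g y) ^ 2 := by
  induction n with
  | zero => simp
  | succ n ih =>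
    rw [Finset.sum_range_succ, ← Nat.add_assoc, Function.iterate_succ_apply']
    have := (hg.iterate (t + n)).sq_add_integral_antider_sq_le
    linarith

/-- The squared norm of the functional `f ↦ ∫ f · wal S` on the univariate Sobolev space. -/
lemma sum_sq_walsh_le (α : ℕ) {S U : Finset ℕ} (hU : U ⊆ S) (hUα : U.card ≤ α) :
    ∑ τ ∈ Finset.range α, (∫ y in (0 : ℝ)..1, antider^[τ] (wal S) y) ^ 2
      + ∫ y in (0 : ℝ)..1, (antider^[α] (wal S) y) ^ 2 ≤ ((1 / 2) ^ (∑ i ∈ U, (i + 1))) ^ 2 := by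
  -- The means of the antiderivatives below `t` vanish; the contraction bounds all the rest by the
  -- mean square of the `t`-th antiderivative.
  set t := min S.card α with ht
  have htα : t ≤ α := min_le_right _ _
  have hsplit : ∑ τ ∈ Finset.range α, (∫ y in (0 : ℝ)..1, antider^[τ] (wal S) y) ^ 2
      = ∑ τ ∈ Finset.range (α - t), (∫ y in (0 : ℝ)..1, antider^[t + τ] (wal S) y) ^ 2 := by
    rw [← Finset.sum_range_add_sum_Ico _ htα, Finset.sum_Ico_eq_sum_range,
      Finset.sum_eq_zero, zero_add]
    intro τ hτ
    rw [integral_iterate_antider_wal S (lt_of_lt_of_le (Finset.mem_range.1 hτ) (min_le_left _ _))]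
    simp
  have h1 := (isNice_wal S).sum_sq_add_le t (α - t)
  rw [Nat.add_sub_cancel' htα, ← hsplit] at h1
  refine h1.trans ?_
  have h2 : ∫ y in (0 : ℝ)..1, (antider^[t] (wal S) y) ^ 2
      ≤ ∫ _y in (0 : ℝ)..1, ((1 / 2 : ℝ) ^ (∑ i ∈ U, (i + 1))) ^ 2 := by
    refine intervalIntegral.integral_mono_on zero_le_one
      (by simpa using ((isNice_wal S).iterate t).intervalIntegrable_sub_sq 0 0 1) (by simp) ?_
    intro y _
    rw [← sq_abs]
    gcongr
    exact abs_iterate_antider_wal_le S (min_le_left _ _) hU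
      (le_min (Finset.card_le_card hU) hUα) y
  simpa using h2

/-- One integration by parts against a bounded measurable function. -/
lemma IsNice.integral_mul_eq {g : ℝ → ℝ} (hg : IsNice g) {f : ℝ → ℝ} (hf : ContDiff ℝ 1 f) :
    ∫ y in (0 : ℝ)..1, f y * g y
      = (∫ y in (0 : ℝ)..1, f y) * (∫ y in (0 : ℝ)..1, g y)
        + ∫ y in (0 : ℝ)..1, deriv f y * antider g y := by
  set c := ∫ y in (0 : ℝ)..1, g y with hc
  have hgc : IntervalIntegrable (fun y => g y - c) volume 0 1 :=
    (hg.intervalIntegrable 0 1).sub (by simp)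
  -- As `g` is only bounded and measurable, its primitive is merely absolutely continuous.
  -- Subtracting the mean first makes this primitive vanish at both endpoints, so no boundary terms
  -- remain.
  have hAC := hgc.absolutelyContinuousOnInterval_intervalIntegral (c := 0) (by simp)
  have hprim : ∀ x, ∫ y in (0 : ℝ)..x, (g y - c) = -antider g x := by
    intro x
    rw [intervalIntegral.integral_sub (hg.intervalIntegrable 0 x) (by simp)]
    simp [antider, hc]
  have hd : ∀ᵐ x, x ∈ Set.uIcc (0 : ℝ) 1 →
      HasDerivAt (fun x => ∫ y in (0 : ℝ)..x, (g y - c)) (g x - c) x := by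
    filter_upwards [hgc.ae_hasDerivAt_integral] with x hx h
    exact hx h 0 (by simp)
  have hparts := AbsolutelyContinuousOnInterval.integral_mul_deriv_eq_deriv_mul
    (hf.contDiffOn.absolutelyContinuousOnInterval (a := 0) (b := 1)) hAC
  have hl : ∫ x in (0 : ℝ)..1, f x * deriv (fun x => ∫ y in (0 : ℝ)..x, (g y - c)) x
      = ∫ x in (0 : ℝ)..1, f x * (g x - c) := by
    apply intervalIntegral.integral_congr_ae
    filter_upwards [hd] with x hx h
    rw [(hx (Set.uIoc_subset_uIcc h)).deriv]
  rw [hl] at hparts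
  simp only [hprim, antider_zero, antider_one] at hparts
  have hfi : IntervalIntegrable f volume 0 1 := hf.continuous.intervalIntegrable 0 1
  have hfg : IntervalIntegrable (fun y => f y * g y) volume 0 1 :=
    (hg.intervalIntegrable 0 1).continuousOn_mul hf.continuous.continuousOn
  have : ∫ x in (0 : ℝ)..1, f x * (g x - c)
      = (∫ x in (0 : ℝ)..1, f x * g x) - (∫ x in (0 : ℝ)..1, f x) * c := by
    rw [← intervalIntegral.integral_mul_const, ← intervalIntegral.integral_sub hfg
      (hfi.mul_const c)]
    simp only [mul_sub]
  rw [this] at hparts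
  simp only [mul_neg, intervalIntegral.integral_neg] at hparts
  linarith

lemma IsNice.integral_mul_eq_sum {g : ℝ → ℝ} (hg : IsNice g) {f : ℝ → ℝ}
    (hf : ContDiff ℝ (⊤ : ℕ∞) f) (α : ℕ) :
    ∫ y in (0 : ℝ)..1, f y * g y
      = ∑ τ ∈ Finset.range α, (∫ y in (0 : ℝ)..1, iteratedDeriv τ f y)
            * (∫ y in (0 : ℝ)..1, antider^[τ] g y)
        + ∫ y in (0 : ℝ)..1, iteratedDeriv α f y * antider^[α] g y := by
  induction α with
  | zero => simp
  | succ α ih =>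
    rw [ih, (hg.iterate α).integral_mul_eq, Finset.sum_range_succ, iteratedDeriv_succ,
      Function.iterate_succ_apply', add_assoc]
    rw [iteratedDeriv_eq_iterate]
    exact ContDiff.iterate_deriv' 1 α (hf.of_le (by exact_mod_cast le_top))

end QMC

end

/-! ### From smooth functions to weak derivatives: mollified Walsh products -/

noncomputable section

namespace QMC

open Filter Topology
/-! ### Mixed partial derivatives of products of univariate functions -/

lemma contDiff_prod_apply {s : ℕ} {u : Fin s → ℝ → ℝ}
    (hu : ∀ i, ContDiff ℝ ((⊤ : ℕ∞) : WithTop ℕ∞) (u i)) :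
    ContDiff ℝ ((⊤ : ℕ∞) : WithTop ℕ∞) fun x : Fin s → ℝ => ∏ i, u i (x i) :=
  contDiff_prod fun i _ => (hu i).comp (contDiff_apply ℝ ℝ i)

lemma partialDeriv_prod {s : ℕ} (j : Fin s) {u : Fin s → ℝ → ℝ}
    (hu : ∀ i, ContDiff ℝ ((⊤ : ℕ∞) : WithTop ℕ∞) (u i)) :
    partialDeriv j (fun x : Fin s → ℝ => ∏ i, u i (x i))
      = fun x => ∏ i, Function.update u j (deriv (u j)) i (x i) := by
  funext x
  have hd : DifferentiableAt ℝ (fun x : Fin s → ℝ => ∏ i, u i (x i)) x :=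
    ((contDiff_prod_apply hu).differentiable (by simp)) x
  unfold partialDeriv
  rw [← hd.lineDeriv_eq_fderiv, lineDeriv]
  have e1 : (fun t : ℝ => ∏ i, u i ((x + t • (Pi.single j (1 : ℝ) : Fin s → ℝ)) i))
      = fun t => u j (x j + t) * ∏ i ∈ Finset.univ.erase j, u i (x i) := by
    funext t
    rw [← Finset.mul_prod_erase _ _ (Finset.mem_univ j)]
    congr 1
    · simp
    · refine Finset.prod_congr rfl fun i hi => ?_
      simp [(Finset.mem_erase.1 hi).1]
  rw [e1, deriv_mul_const, deriv_comp_const_add, add_zero,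
    ← Finset.mul_prod_erase _ _ (Finset.mem_univ j)]
  · congr 1
    · simp
    · refine Finset.prod_congr rfl fun i hi => ?_
      simp [Function.update_of_ne (Finset.mem_erase.1 hi).1]
  · have := ((hu j).differentiable (by simp)) (x j + 0)
    exact DifferentiableAt.comp (0 : ℝ) this (by fun_prop)

lemma contDiff_iteratedDeriv {f : ℝ → ℝ} (hf : ContDiff ℝ ((⊤ : ℕ∞) : WithTop ℕ∞) f) (k : ℕ) :
    ContDiff ℝ ((⊤ : ℕ∞) : WithTop ℕ∞) (iteratedDeriv k f) := by
  rw [iteratedDeriv_eq_iterate]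
  exact hf.iterate_deriv k

lemma iterate_partialDeriv_prod {s : ℕ} (j : Fin s) (k : ℕ) {u : Fin s → ℝ → ℝ}
    (hu : ∀ i, ContDiff ℝ ((⊤ : ℕ∞) : WithTop ℕ∞) (u i)) :
    (partialDeriv j)^[k] (fun x : Fin s → ℝ => ∏ i, u i (x i))
      = fun x => ∏ i, Function.update u j (iteratedDeriv k (u j)) i (x i) := by
  induction k with
  | zero => simp
  | succ k ih =>
    rw [Function.iterate_succ_apply', ih, partialDeriv_prod]
    · simp [iteratedDeriv_succ]
    · intro i
      rcases eq_or_ne i j with rfl | h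
      · simpa using contDiff_iteratedDeriv (hu i) k
      · simpa [h] using hu i

lemma mixedPartial_prod {s : ℕ} (τ : Fin s → ℕ) {u : Fin s → ℝ → ℝ}
    (hu : ∀ i, ContDiff ℝ ((⊤ : ℕ∞) : WithTop ℕ∞) (u i)) :
    mixedPartial τ (fun x : Fin s → ℝ => ∏ i, u i (x i))
      = fun x => ∏ i, iteratedDeriv (τ i) (u i) (x i) := by
  have key : ∀ l : List (Fin s), l.Nodup →
      l.foldr (fun j g => (partialDeriv j)^[τ j] g) (fun x : Fin s → ℝ => ∏ i, u i (x i))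
        = fun x => ∏ i, (if i ∈ l then iteratedDeriv (τ i) (u i) else u i) (x i) := by
    intro l
    induction l with
    | nil => intro _; simp
    | cons j l ih =>
      intro hl
      obtain ⟨hj, hl⟩ := List.nodup_cons.1 hl
      rw [List.foldr_cons, ih hl, iterate_partialDeriv_prod]
      · funext x
        refine Finset.prod_congr rfl fun i _ => ?_
        rcases eq_or_ne i j with rfl | h
        · simp [hj]
        · simp [h]
      · intro i
        split_ifs
        · exact contDiff_iteratedDeriv (hu i) _
        · exact hu i
  unfold mixedPartial
  rw [key _ (List.nodup_finRange s)]
  simp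

/-! ### Mollification of functions on the unit interval -/

/-- The convolution with `u` of a function on the unit interval extended by zero. -/
def unitConv (u G : ℝ → ℝ) (x : ℝ) : ℝ := ∫ y in (0 : ℝ)..1, u (x - y) * G y

open Convolution in
lemma unitConv_eq (u G : ℝ → ℝ) :
    unitConv u G = u ⋆[ContinuousLinearMap.lsmul ℝ ℝ] (Set.Ioc (0 : ℝ) 1).indicator G := by
  funext x
  rw [convolution_eq_swap, unitConv, intervalIntegral.integral_of_le zero_le_one,
    ← integral_indicator measurableSet_Ioc]
  congr 1
  funext y
  by_cases hy : y ∈ Set.Ioc (0 : ℝ) 1 <;> simp [hy]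

/-- Bounded measurable functions. -/
structure IsBddMeas (G : ℝ → ℝ) : Prop where
  meas : Measurable G
  bdd : ∃ B, ∀ x, |G x| ≤ B

lemma IsNice.isBddMeas {g : ℝ → ℝ} (hg : IsNice g) : IsBddMeas g := ⟨hg.meas, hg.bdd⟩

lemma isBddMeas_const (c : ℝ) : IsBddMeas fun _ => c := ⟨measurable_const, |c|, fun _ => le_rfl⟩

lemma IsBddMeas.integrable_indicator {G : ℝ → ℝ} (hG : IsBddMeas G) :
    Integrable ((Set.Ioc (0 : ℝ) 1).indicator G) := by
  rw [integrable_indicator_iff measurableSet_Ioc]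
  obtain ⟨B, hB⟩ := hG.bdd
  exact Measure.integrableOn_of_bounded (M := B) (by simp) hG.meas.aestronglyMeasurable
    (Eventually.of_forall fun x => hB x)

section

variable {u G : ℝ → ℝ}

lemma contDiff_unitConv (hu : ContDiff ℝ ((⊤ : ℕ∞) : WithTop ℕ∞) u) (hc : HasCompactSupport u)
    (hG : IsBddMeas G) : ContDiff ℝ ((⊤ : ℕ∞) : WithTop ℕ∞) (unitConv u G) := by
  rw [unitConv_eq]
  exact hc.contDiff_convolution_left _ hu hG.integrable_indicator.locallyIntegrable

lemma hasCompactSupport_iteratedDeriv (hc : HasCompactSupport u) (k : ℕ) :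
    HasCompactSupport (iteratedDeriv k u) := by
  induction k with
  | zero => simpa
  | succ k ih => rw [iteratedDeriv_succ]; exact ih.deriv

lemma iteratedDeriv_unitConv (hu : ContDiff ℝ ((⊤ : ℕ∞) : WithTop ℕ∞) u)
    (hc : HasCompactSupport u) (hG : IsBddMeas G) (k : ℕ) :
    iteratedDeriv k (unitConv u G) = unitConv (iteratedDeriv k u) G := by
  induction k with
  | zero => simp
  | succ k ih =>
    rw [iteratedDeriv_succ, ih, iteratedDeriv_succ, unitConv_eq, unitConv_eq]
    funext x
    exact ((hasCompactSupport_iteratedDeriv hc k).hasDerivAt_convolution_left _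
      ((contDiff_iteratedDeriv hu k).of_le (by exact_mod_cast le_top))
      hG.integrable_indicator.locallyIntegrable x).deriv

end

/-- The coefficients in the representation of the functional `f ↦ ∫ f · wal S` on the univariate
Sobolev space of order `α`. -/
def walDual (α : ℕ) (S : Finset ℕ) (τ : ℕ) (y : ℝ) : ℝ :=
  if τ = α then antider^[α] (wal S) y else ∫ x in (0 : ℝ)..1, antider^[τ] (wal S) x

lemma isBddMeas_walDual (α : ℕ) (S : Finset ℕ) (τ : ℕ) : IsBddMeas (walDual α S τ) := by
  unfold walDual
  split_ifs
  · exact ((isNice_wal S).iterate α).isBddMeas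
  · exact isBddMeas_const _

/-- Integration by parts for `y ↦ u (x - y)`; each differentiation of the reflected function
produces a sign. -/
lemma unitConv_wal {u : ℝ → ℝ} (hu : ContDiff ℝ ((⊤ : ℕ∞) : WithTop ℕ∞) u) (α : ℕ)
    (S : Finset ℕ) (x : ℝ) :
    unitConv u (wal S) x
      = ∑ τ ∈ Finset.range (α + 1), (-1) ^ τ * unitConv (iteratedDeriv τ u) (walDual α S τ) x := by
  have hf : ContDiff ℝ ((⊤ : ℕ∞) : WithTop ℕ∞) fun y => u (x - y) := by fun_prop
  unfold unitConv
  rw [(isNice_wal S).integral_mul_eq_sum hf α, Finset.sum_range_succ]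
  simp only [iteratedDeriv_comp_const_sub, smul_eq_mul]
  congr 1
  · refine Finset.sum_congr rfl fun τ hτ => ?_
    have : τ ≠ α := (Finset.mem_range.1 hτ).ne
    simp only [walDual, if_neg this, intervalIntegral.integral_mul_const,
      intervalIntegral.integral_const_mul]
    ring
  · simp only [walDual, if_true, mul_assoc, intervalIntegral.integral_const_mul]

/-- The mollifiers. -/
def bump (n : ℕ) : ContDiffBump (0 : ℝ) where
  rIn := 1 / (2 * (n + 1))
  rOut := 1 / (n + 1)
  rIn_pos := by positivity
  rIn_lt_rOut := by
    apply one_div_lt_one_div_of_lt (by positivity)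
    have : (0 : ℝ) < n + 1 := by positivity
    linarith

/-- The factor of the dilation which moves the support of a mollified function into `(0,1)`. -/
def dil (n : ℕ) : ℝ := 1 + 4 * (bump n).rOut

/-- Smooth functions with compact support in `(0,1)` approximating `G`. -/
def mol (n : ℕ) (G : ℝ → ℝ) (x : ℝ) : ℝ :=
  unitConv ((bump n).normed volume) G (dil n * (x - 1 / 2) + 1 / 2)

lemma dil_pos (n : ℕ) : 1 < dil n := by
  have := (bump n).rOut_pos
  unfold dil; linarith

lemma tendsto_rOut_bump : Filter.Tendsto (fun n => (bump n).rOut) Filter.atTop (nhds 0) :=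
  tendsto_one_div_add_atTop_nhds_zero_nat

lemma tendsto_dil : Filter.Tendsto dil Filter.atTop (nhds 1) := by
  have h := (tendsto_rOut_bump.const_mul 4).const_add 1
  rw [mul_zero, add_zero] at h
  exact h

section

variable {G : ℝ → ℝ}

lemma contDiff_mol (hG : IsBddMeas G) (n : ℕ) :
    ContDiff ℝ ((⊤ : ℕ∞) : WithTop ℕ∞) (mol n G) := by
  have := contDiff_unitConv (u := (bump n).normed volume) (bump n).contDiff_normed
    (bump n).hasCompactSupport_normed hG
  exact this.comp (by fun_prop)

lemma iteratedDeriv_mol (hG : IsBddMeas G) (n k : ℕ) (x : ℝ) :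
    iteratedDeriv k (mol n G) x = dil n ^ k *
      unitConv (iteratedDeriv k ((bump n).normed volume)) G (dil n * (x - 1 / 2) + 1 / 2) := by
  have hs := contDiff_unitConv (u := (bump n).normed volume) (bump n).contDiff_normed
    (bump n).hasCompactSupport_normed hG
  rw [← iteratedDeriv_unitConv (bump n).contDiff_normed (bump n).hasCompactSupport_normed hG]
  set h := unitConv ((bump n).normed volume) G
  have e : mol n G = fun x => (fun z => (fun w => h (w + (1 / 2 - dil n / 2))) (dil n * z)) x := by
    funext x
    simp only [mol, h]
    congr 1; ring
  rw [e, iteratedDeriv_comp_const_mul]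
  · simp only [iteratedDeriv_comp_add_const]
    congr 2; ring
  · exact (hs.of_le (by exact_mod_cast le_top)).comp (by fun_prop)

lemma abs_mol_le (n : ℕ) {B : ℝ} (hB : ∀ x, |G x| ≤ B) (x : ℝ) :
    |mol n G x| ≤ B := by
  have hB0 : 0 ≤ B := (abs_nonneg _).trans (hB 0)
  unfold mol unitConv
  set z := dil n * (x - 1 / 2) + 1 / 2
  rw [intervalIntegral.integral_of_le zero_le_one]
  have hint : Integrable (fun y => (bump n).normed volume (z - y) * B) :=
    ((bump n).integrable_normed.comp_sub_left z).mul_const B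
  calc |∫ y in Set.Ioc (0 : ℝ) 1, (bump n).normed volume (z - y) * G y|
      ≤ ∫ y in Set.Ioc (0 : ℝ) 1, |(bump n).normed volume (z - y) * G y| :=
        abs_integral_le_integral_abs
    _ ≤ ∫ y in Set.Ioc (0 : ℝ) 1, (bump n).normed volume (z - y) * B := by
        refine integral_mono_of_nonneg (Filter.Eventually.of_forall fun y => abs_nonneg _)
          hint.integrableOn (Filter.Eventually.of_forall fun y => ?_)
        simp only [abs_mul, abs_of_nonneg ((bump n).nonneg_normed _)]
        exact mul_le_mul_of_nonneg_left (hB y) ((bump n).nonneg_normed _)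
    _ ≤ ∫ y, (bump n).normed volume (z - y) * B :=
        setIntegral_le_integral hint (Filter.Eventually.of_forall fun y =>
          mul_nonneg ((bump n).nonneg_normed _) hB0)
    _ = B := by
        rw [integral_mul_const, integral_sub_left_eq_self ((bump n).normed volume) volume z,
          (bump n).integral_normed, one_mul]

lemma mol_eq_zero (n : ℕ) {x : ℝ} (hx : 1 / 2 * dil n < dil n * |x - 1 / 2| + (bump n).rOut) :
    mol n G x = 0 := by
  have hd := dil_pos n
  unfold mol unitConv
  apply intervalIntegral.integral_zero_ae
  refine Filter.Eventually.of_forall fun y hy => ?_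
  rw [Set.uIoc_of_le zero_le_one] at hy
  have : (bump n).normed volume (dil n * (x - 1 / 2) + 1 / 2 - y) = 0 := by
    rw [← Function.notMem_support, (bump n).support_normed_eq, Metric.mem_ball, dist_zero_right,
      Real.norm_eq_abs, not_lt]
    have h1 : dil n = 1 + 4 * (bump n).rOut := rfl
    have h2 : dil n * |x - 1 / 2| = |dil n * (x - 1 / 2)| := by
      rw [abs_mul, abs_of_pos (by linarith : 0 < dil n)]
    have h3 : |dil n * (x - 1 / 2)| ≤ |dil n * (x - 1 / 2) + 1 / 2 - y| + |y - 1 / 2| := by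
      have := abs_add_le (dil n * (x - 1 / 2) + 1 / 2 - y) (y - 1 / 2)
      rwa [show dil n * (x - 1 / 2) + 1 / 2 - y + (y - 1 / 2) = dil n * (x - 1 / 2) by ring] at this
    have h4 : |y - 1 / 2| ≤ 1 / 2 := by rw [abs_le]; constructor <;> linarith [hy.1, hy.2]
    have h5 := (bump n).rOut_pos
    linarith
  rw [this, zero_mul]

/-- The dilation more than compensates the spread caused by the mollifier. The interval does not
depend on `G`, so products with different factors have a common compact support. -/
lemma support_mol_subset (n : ℕ) : ∃ c d : ℝ, 0 < c ∧ d < 1 ∧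
    ∀ G x, mol n G x ≠ 0 → x ∈ Set.Icc c d := by
  have hd := dil_pos n
  have hr := (bump n).rOut_pos
  have hd0 : 0 < dil n := by linarith
  set r := (bump n).rOut / dil n with hrd
  have hr' : 0 < r := div_pos hr hd0
  refine ⟨r, 1 - r, hr', by linarith, fun G x hx => ?_⟩
  have h1 : dil n * |x - 1 / 2| + (bump n).rOut ≤ 1 / 2 * dil n := by
    by_contra h
    exact hx (mol_eq_zero n (not_le.1 h))
  have h2 : (bump n).rOut = r * dil n := by rw [hrd]; field_simp
  have h3 : |x - 1 / 2| ≤ 1 / 2 - r := by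
    rw [h2] at h1
    by_contra h
    push Not at h
    nlinarith
  rw [abs_le] at h3
  constructor <;> linarith [h3.1, h3.2]

lemma tendsto_mol (hG : IsBddMeas G) {x : ℝ} (hx : x ∈ Set.Ioo (0 : ℝ) 1)
    (hc : ContinuousAt G x) :
    Filter.Tendsto (fun n => mol n G x) Filter.atTop (nhds (G x)) := by
  unfold mol
  simp only [unitConv_eq]
  apply ContDiffBump.convolution_tendsto_right tendsto_rOut_bump
  · exact Filter.Eventually.of_forall fun _ => hG.integrable_indicator.aestronglyMeasurable
  · have : Filter.Tendsto ((Set.Ioc (0 : ℝ) 1).indicator G) (nhds x) (nhds (G x)) := by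
      refine hc.tendsto.congr' ?_
      filter_upwards [Ioo_mem_nhds hx.1 hx.2] with y hy
      rw [Set.indicator_of_mem (show y ∈ Set.Ioc (0 : ℝ) 1 from ⟨hy.1, hy.2.le⟩)]
    exact this.comp Filter.tendsto_snd
  · have := (tendsto_dil.mul_const (x - 1 / 2)).add_const (1 / 2)
    simpa using this

end

/-- Derivatives of a convolution may fall on the mollifier, so integration by parts exhibits a
mollified Walsh function as a combination of derivatives of test functions. The powers of `(dil
n)⁻¹` undo the chain rule. -/
lemma mol_wal (n α : ℕ) (S : Finset ℕ) (x : ℝ) :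
    mol n (wal S) x = ∑ τ ∈ Finset.range (α + 1),
      (-(dil n)⁻¹) ^ τ * iteratedDeriv τ (mol n (walDual α S τ)) x := by
  have hd : dil n ≠ 0 := by have := dil_pos n; linarith
  rw [mol, unitConv_wal (u := (bump n).normed volume) (bump n).contDiff_normed α]
  refine Finset.sum_congr rfl fun τ _ => ?_
  rw [iteratedDeriv_mol (isBddMeas_walDual α S τ), ← mul_assoc, ← mul_pow]
  congr 2
  field_simp

/-! ### Walsh coefficients through weak derivatives -/

lemma isTestFunction_prod_mol {s : ℕ} (n : ℕ) {G : Fin s → ℝ → ℝ} (hG : ∀ i, IsBddMeas (G i)) :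
    IsTestFunction fun x : Fin s → ℝ => ∏ i, mol n (G i) (x i) := by
  obtain ⟨c, d, hc, hd, h⟩ := support_mol_subset n
  have hsub : tsupport (fun x : Fin s → ℝ => ∏ i, mol n (G i) (x i))
      ⊆ Set.univ.pi fun _ => Set.Icc c d := by
    refine closure_minimal (fun x hx i _ => ?_) (isClosed_set_pi fun _ _ => isClosed_Icc)
    exact h (G i) _ (Finset.prod_ne_zero_iff.1 hx i (Finset.mem_univ i))
  refine ⟨contDiff_prod_apply fun i => contDiff_mol (hG i) n, ?_, hsub.trans ?_⟩
  · exact (isCompact_univ_pi fun _ => isCompact_Icc).of_isClosed_subset (isClosed_tsupport _) hsub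
  · exact Set.pi_mono fun _ _ => Set.Icc_subset_Ioo hc hd

lemma hasWeakDeriv_weakDeriv {s α : ℕ} {F : (Fin s → ℝ) → ℝ} (hF : MemH α F)
    (τ : Fin s → Fin (α + 1)) :
    HasWeakDeriv (fun j => (τ j : ℕ)) F (weakDeriv (fun j => (τ j : ℕ)) F) := by
  unfold weakDeriv
  rw [dif_pos (hF.2 τ)]
  exact (hF.2 τ).choose_spec

lemma volume_cube_lt_top (s : ℕ) : volume (cube s) < ⊤ :=
  isCompact_Icc.measure_lt_top

instance isFiniteMeasure_cube (s : ℕ) : IsFiniteMeasure (volume.restrict (cube s)) :=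
  ⟨by simpa using volume_cube_lt_top s⟩

lemma measurableSet_cube (s : ℕ) : MeasurableSet (cube s) := measurableSet_Icc

lemma MemH.integrableOn {s α : ℕ} {F : (Fin s → ℝ) → ℝ} (hF : MemH α F) :
    IntegrableOn F (cube s) := hF.1.integrableOn_compact isCompact_Icc

lemma HasWeakDeriv.integrableOn {s : ℕ} {τ : Fin s → ℕ} {F g : (Fin s → ℝ) → ℝ}
    (h : HasWeakDeriv τ F g) : IntegrableOn g (cube s) :=
  h.1.integrable one_le_two

lemma integrableOn_mul_prod {s : ℕ} {H : (Fin s → ℝ) → ℝ} (hH : IntegrableOn H (cube s))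
    {u : Fin s → ℝ → ℝ} (hu : ∀ i, IsBddMeas (u i)) :
    IntegrableOn (fun x => H x * ∏ i, u i (x i)) (cube s) := by
  choose B hB using fun i => (hu i).bdd
  refine hH.mul_bdd (c := ∏ i, B i) ?_ (Filter.Eventually.of_forall fun x => ?_)
  · exact (Finset.measurable_prod _ fun i _ =>
      (hu i).meas.comp (measurable_pi_apply i)).aestronglyMeasurable
  · rw [Real.norm_eq_abs, Finset.abs_prod]
    exact Finset.prod_le_prod (fun i _ => abs_nonneg _) fun i _ => hB i _

lemma isBddMeas_mol {G : ℝ → ℝ} (hG : IsBddMeas G) (n : ℕ) : IsBddMeas (mol n G) := by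
  obtain ⟨B, hB⟩ := hG.bdd
  exact ⟨(contDiff_mol hG n).continuous.measurable, B, abs_mol_le n hB⟩

lemma isBddMeas_iteratedDeriv_mol {G : ℝ → ℝ} (hG : IsBddMeas G) (n k : ℕ) :
    IsBddMeas (iteratedDeriv k (mol n G)) := by
  have hc := contDiff_iteratedDeriv (contDiff_mol hG n) k
  obtain ⟨c, d, -, -, h⟩ := support_mol_subset n
  have hs : HasCompactSupport (mol n G) :=
    isCompact_Icc.of_isClosed_subset (isClosed_tsupport _)
      (closure_minimal (fun x hx => h G x hx) isClosed_Icc)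
  obtain ⟨B, hB⟩ := hc.continuous.bounded_above_of_compact_support
    (hasCompactSupport_iteratedDeriv hs k)
  exact ⟨hc.continuous.measurable, B, fun x => hB x⟩

/-- Multiplying out the factors gives mixed partial derivatives of product test functions, to which
the definition of the weak derivative applies. Its sign cancels those of `mol_wal`. -/
lemma integral_mul_prod_mol_wal {s α : ℕ} {F : (Fin s → ℝ) → ℝ} (hF : MemH α F)
    (S : Fin s → Finset ℕ) (n : ℕ) :
    ∫ y in cube s, F y * ∏ j, mol n (wal (S j)) (y j)
      = ∑ τ : Fin s → Fin (α + 1), ((dil n)⁻¹) ^ (∑ j, (τ j : ℕ)) *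
          ∫ y in cube s, weakDeriv (fun j => (τ j : ℕ)) F y *
            ∏ j, mol n (walDual α (S j) (τ j)) (y j) := by
  have hd := fun j (τ : ℕ) => isBddMeas_walDual α (S j) τ
  have e1 : ∀ y : Fin s → ℝ, F y * ∏ j, mol n (wal (S j)) (y j)
      = ∑ τ : Fin s → Fin (α + 1), (∏ j, (-(dil n)⁻¹) ^ (τ j : ℕ)) *
        (F y * mixedPartial (fun j => (τ j : ℕ))
          (fun x => ∏ j, mol n (walDual α (S j) (τ j)) (x j)) y) := by
    intro y
    simp only [fun j => mol_wal n α (S j), Finset.sum_range, Finset.prod_univ_sum,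
      Fintype.piFinset_univ, Finset.mul_sum]
    refine Finset.sum_congr rfl fun τ _ => ?_
    rw [mixedPartial_prod _ fun j => contDiff_mol (hd j _) n, Finset.prod_mul_distrib]
    ring
  simp only [e1]
  rw [integral_finsetSum]
  · refine Finset.sum_congr rfl fun τ _ => ?_
    rw [integral_const_mul, (hasWeakDeriv_weakDeriv hF τ).2 _
      (isTestFunction_prod_mol n fun j => hd j _), ← mul_assoc, Finset.prod_pow_eq_pow_sum,
      ← mul_pow]
    simp
  · intro τ _
    refine Integrable.const_mul ?_ _
    rw [mixedPartial_prod _ fun j => contDiff_mol (hd j _) n]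
    exact integrableOn_mul_prod hF.integrableOn fun j => isBddMeas_iteratedDeriv_mol (hd j _) n _

/-- The points whose binary expansion is finite. -/
def dyadicPoints : Set ℝ := ⋃ i : ℕ, Set.range fun z : ℤ => (z : ℝ) / 2 ^ i

lemma countable_dyadicPoints : dyadicPoints.Countable :=
  Set.countable_iUnion fun _ => Set.countable_range _

lemma continuousAt_rad (i : ℕ) {x : ℝ} (hx : x ∉ dyadicPoints) : ContinuousAt (rad i) x := by
  have hp : (0 : ℝ) < 2 ^ (i + 1) := by positivity
  have h1 : (⌊2 ^ (i + 1) * x⌋ : ℝ) < 2 ^ (i + 1) * x := by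
    refine lt_of_le_of_ne (Int.floor_le _) fun h => hx ?_
    refine Set.mem_iUnion.2 ⟨i + 1, ⌊2 ^ (i + 1) * x⌋, ?_⟩
    simp only
    rw [h]; field_simp
  have h2 := Int.lt_floor_add_one (2 ^ (i + 1) * x)
  have hc : ContinuousAt (fun y : ℝ => 2 ^ (i + 1) * y) x := by fun_prop
  have he : ∀ᶠ y in nhds x, rad i x = rad i y := by
    filter_upwards [hc.eventually (Ioo_mem_nhds h1 h2)] with y hy
    have : ⌊(2 : ℝ) ^ (i + 1) * y⌋ = ⌊(2 : ℝ) ^ (i + 1) * x⌋ := by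
      rw [Int.floor_eq_iff]; exact ⟨hy.1.le, hy.2⟩
    simp only [rad, this]
  exact continuousAt_const.congr he

lemma continuousAt_wal (S : Finset ℕ) {x : ℝ} (hx : x ∉ dyadicPoints) :
    ContinuousAt (wal S) x := by
  unfold wal
  exact tendsto_finsetProd _ fun i _ => continuousAt_rad i hx

lemma continuousAt_walDual (α : ℕ) (S : Finset ℕ) (τ : ℕ) {x : ℝ} (hx : x ∉ dyadicPoints) :
    ContinuousAt (walDual α S τ) x := by
  unfold walDual
  split_ifs
  · rcases α with _ | α
    · exact continuousAt_wal S hx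
    · rw [Function.iterate_succ_apply']
      exact ((isNice_wal S).iterate α).continuous_antider.continuousAt
  · exact continuousAt_const

lemma ae_notMem_dyadicPoints (s : ℕ) :
    ∀ᵐ x ∂(volume.restrict (cube s)), ∀ j, x j ∈ Set.Ioo (0 : ℝ) 1 ∧ x j ∉ dyadicPoints := by
  rw [ae_restrict_iff' (measurableSet_cube s)]
  have h : ∀ j : Fin s, ∀ᵐ x : Fin s → ℝ, x j ∉ dyadicPoints := fun j =>
    (Measure.tendsto_eval_ae_ae (μ := fun _ : Fin s => (volume : Measure ℝ)) (i := j)).eventually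
      (countable_dyadicPoints.ae_notMem volume)
  filter_upwards [ae_all_iff.2 h] with x hx hc j
  refine ⟨⟨lt_of_le_of_ne (hc.1 j) ?_, lt_of_le_of_ne (hc.2 j) ?_⟩, hx j⟩
  · intro h0
    exact hx j (Set.mem_iUnion.2 ⟨0, 0, by simpa using h0⟩)
  · intro h0
    exact hx j (Set.mem_iUnion.2 ⟨0, 1, by simpa using h0.symm⟩)

/-- Dominated convergence: mollification does not increase the bounds of the factors, and it
converges at points of continuity, hence off the null set of points with a dyadic coordinate. -/
lemma tendsto_integral_mul_prod_mol {s : ℕ} {H : (Fin s → ℝ) → ℝ}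
    (hH : IntegrableOn H (cube s)) {u : Fin s → ℝ → ℝ} (hu : ∀ i, IsBddMeas (u i))
    (hc : ∀ i, ∀ x ∉ dyadicPoints, ContinuousAt (u i) x) :
    Filter.Tendsto (fun n => ∫ y in cube s, H y * ∏ j, mol n (u j) (y j)) Filter.atTop
      (nhds (∫ y in cube s, H y * ∏ j, u j (y j))) := by
  choose B hB using fun i => (hu i).bdd
  refine tendsto_integral_of_dominated_convergence (fun y => ‖H y‖ * ∏ j, B j)
    (fun n => (integrableOn_mul_prod hH fun j => isBddMeas_mol (hu j) n).aestronglyMeasurable)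
    (hH.norm.mul_const _) (fun n => Filter.Eventually.of_forall fun x => ?_) ?_
  · rw [norm_mul, Real.norm_eq_abs (∏ j, _), Finset.abs_prod]
    gcongr with j
    exact abs_mol_le n (hB j) _
  · filter_upwards [ae_notMem_dyadicPoints s] with x hx
    exact (tendsto_finsetProd _ fun j _ =>
      tendsto_mol (hu j) (hx j).1 (hc j _ (hx j).2)).const_mul _

/-- The Walsh coefficients of a function in the Sobolev space in terms of its weak derivatives. -/
theorem integral_mul_prod_wal {s α : ℕ} {F : (Fin s → ℝ) → ℝ} (hF : MemH α F)
    (S : Fin s → Finset ℕ) :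
    ∫ y in cube s, F y * ∏ j, wal (S j) (y j)
      = ∑ τ : Fin s → Fin (α + 1), ∫ y in cube s, weakDeriv (fun j => (τ j : ℕ)) F y *
            ∏ j, walDual α (S j) (τ j) (y j) := by
  have h1 := tendsto_integral_mul_prod_mol hF.integrableOn
    (fun j => (isNice_wal (S j)).isBddMeas) fun j x hx => continuousAt_wal (S j) hx
  simp only [integral_mul_prod_mol_wal hF S] at h1
  refine tendsto_nhds_unique h1 (tendsto_finsetSum _ fun τ _ => ?_)
  have h2 := tendsto_integral_mul_prod_mol (hasWeakDeriv_weakDeriv hF τ).integrableOn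
    (fun j => isBddMeas_walDual α (S j) (τ j)) fun j x hx => continuousAt_walDual α (S j) _ hx
  have h3 := (tendsto_dil.inv₀ one_ne_zero).pow (∑ j, (τ j : ℕ))
  simpa using h3.mul h2

end QMC

end

/-! ### From Walsh coefficients to the error of a cubature rule -/

noncomputable section

namespace QMC

/-! ### The bound on Walsh coefficients -/

lemma integral_mul_sq_le {X : Type*} [MeasurableSpace X] {μ : Measure X} {f g : X → ℝ}
    (hf : Integrable (fun x => f x ^ 2) μ) (hg : Integrable (fun x => g x ^ 2) μ)
    (hfg : Integrable (fun x => f x * g x) μ) :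
    (∫ x, f x * g x ∂μ) ^ 2 ≤ (∫ x, f x ^ 2 ∂μ) * ∫ x, g x ^ 2 ∂μ := by
  have h : ∀ t : ℝ, 0 ≤ (∫ x, g x ^ 2 ∂μ) * (t * t) + (2 * ∫ x, f x * g x ∂μ) * t
      + ∫ x, f x ^ 2 ∂μ := by
    intro t
    have h0 : 0 ≤ ∫ x, (f x + t * g x) ^ 2 ∂μ := integral_nonneg fun x => sq_nonneg _
    have e : ∀ x, (f x + t * g x) ^ 2 = f x ^ 2 + 2 * t * (f x * g x) + t ^ 2 * g x ^ 2 :=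
      fun x => by ring
    simp only [e] at h0
    have h1 : Integrable (fun x => f x ^ 2 + 2 * t * (f x * g x)) μ := hf.add (hfg.const_mul _)
    rw [integral_add h1 (hg.const_mul _), integral_add hf (hfg.const_mul _), integral_const_mul,
      integral_const_mul] at h0
    linarith
  have := discrim_le_zero h
  unfold discrim at this
  nlinarith

lemma sq_integral_le {X : Type*} [MeasurableSpace X] {μ : Measure X} [IsProbabilityMeasure μ]
    {f : X → ℝ} (hf : Integrable f μ) (hf2 : Integrable (fun x => f x ^ 2) μ) :
    (∫ x, f x ∂μ) ^ 2 ≤ ∫ x, f x ^ 2 ∂μ := by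
  have := integral_mul_sq_le hf2 (g := fun _ => (1 : ℝ)) (by simp) (by simpa using hf)
  simpa using this

lemma integrable_sq_integral {X Y : Type*} [MeasurableSpace X] [MeasurableSpace Y]
    {μ : Measure X} {ν : Measure Y} [IsProbabilityMeasure μ] [IsProbabilityMeasure ν]
    {G : X × Y → ℝ} (hG : Integrable G (μ.prod ν))
    (hG2 : Integrable (fun z => G z ^ 2) (μ.prod ν)) :
    Integrable (fun x => (∫ y, G (x, y) ∂ν) ^ 2) μ := by
  refine hG2.integral_prod_left.mono' (hG.integral_prod_left.aestronglyMeasurable.pow 2) ?_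
  filter_upwards [hG.prod_right_ae, hG2.prod_right_ae] with x h1 h2
  rw [Real.norm_eq_abs, abs_of_nonneg (sq_nonneg _)]
  exact sq_integral_le h1 h2

/-- As `ψ` depends on the first variable only, the second one is integrated out before
Cauchy–Schwarz is applied. This is why the norm needs only squares of partial integrals. -/
lemma sq_integral_prod_mul_le {X Y : Type*} [MeasurableSpace X] [MeasurableSpace Y]
    {μ : Measure X} {ν : Measure Y} [IsProbabilityMeasure μ] [IsProbabilityMeasure ν]
    {G : X × Y → ℝ} (hG : Integrable G (μ.prod ν))
    (hG2 : Integrable (fun z => G z ^ 2) (μ.prod ν)) {ψ : X → ℝ} (hψ : Measurable ψ)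
    {B : ℝ} (hB : ∀ x, |ψ x| ≤ B) :
    (∫ z, G z * ψ z.1 ∂(μ.prod ν)) ^ 2
      ≤ (∫ x, ψ x ^ 2 ∂μ) * ∫ x, (∫ y, G (x, y) ∂ν) ^ 2 ∂μ := by
  have hGψ : Integrable (fun z : X × Y => G z * ψ z.1) (μ.prod ν) :=
    hG.mul_bdd (hψ.comp measurable_fst).aestronglyMeasurable
      (Filter.Eventually.of_forall fun z => hB z.1)
  rw [integral_prod _ hGψ]
  have e : ∀ x, ∫ y, G (x, y) * ψ x ∂ν = ψ x * ∫ y, G (x, y) ∂ν := fun x => by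
    rw [integral_mul_const, mul_comm]
  simp only [e]
  refine integral_mul_sq_le ?_ (integrable_sq_integral hG hG2) ?_
  · refine Integrable.of_bound (hψ.pow_const 2).aestronglyMeasurable (B ^ 2)
      (Filter.Eventually.of_forall fun x => ?_)
    rw [norm_pow]
    exact pow_le_pow_left₀ (norm_nonneg _) (hB x) 2
  · exact hG.integral_prod_left.bdd_mul hψ.aestronglyMeasurable
      (Filter.Eventually.of_forall fun x => hB x)

lemma isProbabilityMeasure_Icc (ι : Type*) [Fintype ι] :
    IsProbabilityMeasure (volume.restrict (Set.Icc (0 : ι → ℝ) 1)) :=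
  ⟨by simp [Real.volume_Icc_pi]⟩

lemma integral_Icc_prod {ι : Type*} [Fintype ι] (f : ι → ℝ → ℝ) :
    ∫ u in Set.Icc (0 : ι → ℝ) 1, ∏ j, f j (u j) = ∏ j, ∫ y in (0 : ℝ)..1, f j y := by
  have h : (volume.restrict (Set.Icc (0 : ι → ℝ) 1))
      = Measure.pi fun _ : ι => (volume.restrict (Set.Icc (0 : ℝ) 1)) := by
    rw [← Set.pi_univ_Icc, volume_pi, Measure.restrict_pi_pi]
    rfl
  rw [h, integral_fintype_prod_eq_prod]
  refine Finset.prod_congr rfl fun j _ => ?_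
  rw [intervalIntegral.integral_of_le zero_le_one, integral_Icc_eq_integral_Ioc]

lemma HasWeakDeriv.integrableOn_sq {s : ℕ} {τ : Fin s → ℕ} {F g : (Fin s → ℝ) → ℝ}
    (h : HasWeakDeriv τ F g) : IntegrableOn (fun x => g x ^ 2) (cube s) :=
  h.1.integrable_sq

/-- The part of the squared norm which belongs to the multi-index `τ`. -/
def normPart {s α : ℕ} (F : (Fin s → ℝ) → ℝ) (τ : Fin s → Fin (α + 1)) : ℝ :=
  ∫ u in Set.Icc (0 : {j // τ j = Fin.last α} → ℝ) 1,
    (∫ w in Set.Icc (0 : {j // τ j ≠ Fin.last α} → ℝ) 1,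
      weakDeriv (fun j => (τ j : ℕ)) F (glue τ u w)) ^ 2

lemma normSqH_eq {s α : ℕ} (F : (Fin s → ℝ) → ℝ) :
    normSqH α F = ∑ τ : Fin s → Fin (α + 1), normPart F τ := rfl

lemma normPart_nonneg {s α : ℕ} (F : (Fin s → ℝ) → ℝ) (τ : Fin s → Fin (α + 1)) :
    0 ≤ normPart F τ := integral_nonneg fun _ => sq_nonneg _

/-- The squared mean square of `walDual`. -/
def walDualSq (α : ℕ) (S : Finset ℕ) (t : Fin (α + 1)) : ℝ :=
  if t = Fin.last α then ∫ y in (0 : ℝ)..1, (antider^[α] (wal S) y) ^ 2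
  else (∫ y in (0 : ℝ)..1, antider^[t] (wal S) y) ^ 2

lemma walDualSq_nonneg (α : ℕ) (S : Finset ℕ) (t : Fin (α + 1)) : 0 ≤ walDualSq α S t := by
  unfold walDualSq
  split_ifs
  · exact intervalIntegral.integral_nonneg zero_le_one fun _ _ => sq_nonneg _
  · exact sq_nonneg _

lemma sum_walDualSq_le (α : ℕ) {S U : Finset ℕ} (hU : U ⊆ S) (hUα : U.card ≤ α) :
    ∑ t, walDualSq α S t ≤ ((1 / 2) ^ (∑ i ∈ U, (i + 1))) ^ 2 := by
  refine le_trans (le_of_eq ?_) (sum_sq_walsh_le α hU hUα)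
  rw [Fin.sum_univ_castSucc, Finset.sum_range]
  congr 1
  · refine Finset.sum_congr rfl fun t _ => ?_
    rw [walDualSq, if_neg (Fin.castSucc_lt_last t).ne]
    rfl
  · rw [walDualSq, if_pos rfl]

lemma glue_mem_cube_iff {s α : ℕ} (τ : Fin s → Fin (α + 1)) (u : {j // τ j = Fin.last α} → ℝ)
    (w : {j // τ j ≠ Fin.last α} → ℝ) :
    glue τ u w ∈ cube s ↔ u ∈ Set.Icc (0 : {j // τ j = Fin.last α} → ℝ) 1 ∧
      w ∈ Set.Icc (0 : {j // τ j ≠ Fin.last α} → ℝ) 1 := by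
  have hg1 : ∀ j : {j // τ j = Fin.last α}, glue τ u w j = u j := fun j => by
    simp only [glue, dif_pos j.2]
  have hg2 : ∀ j : {j // τ j ≠ Fin.last α}, glue τ u w j = w j := fun j => by
    simp only [glue, dif_neg j.2]
  constructor
  · rintro ⟨h0, h1⟩
    exact ⟨⟨fun j => (h0 j.1).trans_eq (hg1 j), fun j => (hg1 j).symm.trans_le (h1 j.1)⟩,
      ⟨fun j => (h0 j.1).trans_eq (hg2 j), fun j => (hg2 j).symm.trans_le (h1 j.1)⟩⟩
  · rintro ⟨⟨h0, h1⟩, ⟨h2, h3⟩⟩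
    constructor
    · intro j
      by_cases hj : τ j = Fin.last α
      · exact (h0 ⟨j, hj⟩).trans_eq (hg1 ⟨j, hj⟩).symm
      · exact (h2 ⟨j, hj⟩).trans_eq (hg2 ⟨j, hj⟩).symm
    · intro j
      by_cases hj : τ j = Fin.last α
      · exact (hg1 ⟨j, hj⟩).trans_le (h1 ⟨j, hj⟩)
      · exact (hg2 ⟨j, hj⟩).trans_le (h3 ⟨j, hj⟩)

/-- In every direction with `τ j ≠ α` the factor `walDual` is constant. After splitting the
coordinates into two groups, the product is a function of the group `τ j = α` alone, the situation
of `sq_integral_prod_mul_le`. -/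
lemma sq_integral_weakDeriv_mul_le {s α : ℕ} {F : (Fin s → ℝ) → ℝ} (hF : MemH α F)
    (S : Fin s → Finset ℕ) (τ : Fin s → Fin (α + 1)) :
    (∫ y in cube s, weakDeriv (fun j => (τ j : ℕ)) F y * ∏ j, walDual α (S j) (τ j) (y j)) ^ 2
      ≤ (∏ j, walDualSq α (S j) (τ j)) * normPart F τ := by
  set g := weakDeriv (fun j => (τ j : ℕ)) F with hg
  have hw := hasWeakDeriv_weakDeriv hF τ
  set p : Fin s → Prop := fun j => τ j = Fin.last α with hp
  set X := {j // p j} → ℝ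
  set Y := {j // ¬ p j} → ℝ
  let e := MeasurableEquiv.piEquivPiSubtypeProd (fun _ : Fin s => ℝ) p
  have he : MeasurePreserving e volume volume :=
    volume_preserving_piEquivPiSubtypeProd (fun _ : Fin s => ℝ) p
  set R : Set (X × Y) := Set.Icc 0 1 ×ˢ Set.Icc 0 1 with hR
  have hpre : e.symm ⁻¹' cube s = R := by
    ext ⟨u, w⟩
    exact glue_mem_cube_iff τ u w
  have hsymm : MeasurePreserving e.symm (volume.restrict R) (volume.restrict (cube s)) := by
    rw [← hpre]
    exact he.symm.restrict_preimage (measurableSet_cube s)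
  have hemb := e.symm.measurableEmbedding
  have hprod : (volume.restrict R : Measure (X × Y))
      = (volume.restrict (Set.Icc (0 : X) 1)).prod (volume.restrict (Set.Icc (0 : Y) 1)) := by
    rw [hR, Measure.prod_restrict]; rfl
  have i1 : IsProbabilityMeasure (volume.restrict (Set.Icc (0 : X) 1)) :=
    isProbabilityMeasure_Icc _
  have i2 : IsProbabilityMeasure (volume.restrict (Set.Icc (0 : Y) 1)) :=
    isProbabilityMeasure_Icc _
  have hG : Integrable (g ∘ e.symm) (volume.restrict R) :=
    (hsymm.integrable_comp_emb hemb).2 hw.integrableOn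
  have hG2 : Integrable (fun z => (g ∘ e.symm) z ^ 2) (volume.restrict R) :=
    (hsymm.integrable_comp_emb hemb).2 hw.integrableOn_sq
  rw [← hsymm.integral_comp hemb]
  rw [hprod] at hG hG2 ⊢
  have hglue : ∀ u w, e.symm (u, w) = glue τ u w := fun u w => rfl
  set c : ℝ := ∏ j : {j // ¬ p j}, walDual α (S j) (τ j) 0 with hc
  set ψ : X → ℝ := fun u => c * ∏ j : {j // p j}, antider^[α] (wal (S j)) (u j) with hψ
  have hval : ∀ z : X × Y, ∏ j, walDual α (S j) (τ j) (e.symm z j) = ψ z.1 := by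
    rintro ⟨u, w⟩
    rw [hglue, ← Fintype.prod_subtype_mul_prod_subtype p, hψ, mul_comm]
    congr 1
    · refine Finset.prod_congr rfl fun j _ => ?_
      have : (τ j : ℕ) ≠ α := fun h => j.2 (Fin.ext h)
      simp only [walDual, if_neg this]
    · refine Finset.prod_congr rfl fun j _ => ?_
      have : (τ j : ℕ) = α := by rw [j.2]; rfl
      have hj : τ j = Fin.last α := j.2
      simp only [walDual, if_pos this, glue, dif_pos hj]
      rfl
  have hnice := fun j => (isNice_wal (S j)).iterate α
  choose B hB using fun j => (hnice j).bdd
  have key := sq_integral_prod_mul_le hG hG2 (ψ := ψ)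
    (measurable_const.mul (Finset.measurable_prod _ fun j _ =>
      (hnice j).meas.comp (measurable_pi_apply j)))
    (B := |c| * ∏ j : {j // p j}, B j) (fun u => by
      rw [hψ, abs_mul]
      refine mul_le_mul_of_nonneg_left ?_ (abs_nonneg c)
      rw [Finset.abs_prod]
      exact Finset.prod_le_prod (fun _ _ => abs_nonneg _) fun j _ => hB j _)
  have e3 : ∀ z : X × Y, g (e.symm z) * ∏ j, walDual α (S j) (τ j) (e.symm z j)
      = (g ∘ e.symm) z * ψ z.1 := fun z => by rw [hval]; rfl
  simp only [e3]
  refine key.trans (le_of_eq ?_)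
  congr 1
  simp only [hψ, mul_pow, ← Finset.prod_pow]
  rw [integral_const_mul, integral_Icc_prod (fun (j : {j // p j}) y => antider^[α] (wal (S j)) y ^ 2),
    ← Fintype.prod_subtype_mul_prod_subtype p, mul_comm, hc, ← Finset.prod_pow]
  congr 1
  · refine Finset.prod_congr rfl fun j _ => ?_
    have hj : τ j = Fin.last α := j.2
    rw [walDualSq, if_pos hj]
  · refine Finset.prod_congr rfl fun j _ => ?_
    have : (τ j : ℕ) ≠ α := fun h => j.2 (Fin.ext h)
    have hj : τ j ≠ Fin.last α := j.2
    rw [walDualSq, if_neg hj, walDual, if_neg this]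

/-- The Walsh coefficients of functions in the Sobolev space decay like `2^{-μ_α}`. -/
theorem abs_integral_mul_prod_wal_le {s α : ℕ} {F : (Fin s → ℝ) → ℝ} (hF : MemH α F)
    {S U : Fin s → Finset ℕ} (hU : ∀ j, U j ⊆ S j) (hUα : ∀ j, (U j).card ≤ α) :
    |∫ y in cube s, F y * ∏ j, wal (S j) (y j)|
      ≤ (∏ j, (1 / 2) ^ (∑ i ∈ U j, (i + 1))) * normH α F := by
  rw [integral_mul_prod_wal hF]
  set I : (Fin s → Fin (α + 1)) → ℝ := fun τ =>
    ∫ y in cube s, weakDeriv (fun j => (τ j : ℕ)) F y * ∏ j, walDual α (S j) (τ j) (y j)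
  have h1 : ∀ τ, |I τ| ≤ √(∏ j, walDualSq α (S j) (τ j)) * √(normPart F τ) := by
    intro τ
    rw [← Real.sqrt_mul (Finset.prod_nonneg fun j _ => walDualSq_nonneg _ _ _)]
    exact Real.abs_le_sqrt (sq_integral_weakDeriv_mul_le hF S τ)
  calc |∑ τ, I τ| ≤ ∑ τ, √(∏ j, walDualSq α (S j) (τ j)) * √(normPart F τ) :=
        (Finset.abs_sum_le_sum_abs _ _).trans (Finset.sum_le_sum fun τ _ => h1 τ)
    -- Cauchy–Schwarz over the multi-indices. The first sum then factors into univariate sums, each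
    -- of them bounded with constant one.
    _ ≤ √(∑ τ : Fin s → Fin (α + 1), ∏ j, walDualSq α (S j) (τ j)) *
          √(∑ τ : Fin s → Fin (α + 1), normPart F τ) :=
        Real.sum_sqrt_mul_sqrt_le _
          (fun τ => Finset.prod_nonneg fun j _ => walDualSq_nonneg _ _ _)
          (fun τ => normPart_nonneg F τ)
    _ ≤ (∏ j, (1 / 2) ^ (∑ i ∈ U j, (i + 1))) * normH α F := by
        rw [normH, normSqH_eq]
        gcongr
        refine Real.sqrt_le_iff.2 ⟨by positivity, ?_⟩
        rw [← Finset.prod_pow, ← Fintype.piFinset_univ, ← Finset.prod_univ_sum]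
        exact Finset.prod_le_prod (fun j _ => Finset.sum_nonneg fun t _ => walDualSq_nonneg _ _ _)
          fun j _ => sum_walDualSq_le α (hU j) (hUα j)

/-! ### Partial sums of Walsh series -/

/-- The Walsh-Dirichlet kernel. -/
def walKernel (L : ℕ) (x y : ℝ) : ℝ := ∏ i ∈ Finset.range L, (1 + rad i x * rad i y)

lemma walKernel_eq_sum (L : ℕ) (x y : ℝ) :
    walKernel L x y = ∑ S ∈ (Finset.range L).powerset, wal S x * wal S y := by
  simp only [walKernel, Finset.prod_one_add, wal, Finset.prod_mul_distrib]

lemma walKernel_nonneg (L : ℕ) (x y : ℝ) : 0 ≤ walKernel L x y := by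
  refine Finset.prod_nonneg fun i _ => ?_
  unfold rad; split_ifs <;> norm_num

lemma integral_walKernel (L : ℕ) (x : ℝ) : ∫ y in (0 : ℝ)..1, walKernel L x y = 1 := by
  simp only [walKernel_eq_sum]
  rw [intervalIntegral.integral_finsetSum fun S _ =>
    ((isNice_wal S).intervalIntegrable 0 1).const_mul _]
  simp only [intervalIntegral.integral_const_mul]
  rw [Finset.sum_eq_single ∅]
  · simp [wal]
  · intro S _ hS
    have := integral_iterate_antider_wal S (t := 0) (Finset.card_pos.2
      (Finset.nonempty_iff_ne_empty.2 hS))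
    simp only [Function.iterate_zero, id] at this
    rw [this, mul_zero]
  · simp

/-- Doubling both points, and subtracting one if they lie in the upper half, removes the common
first digit and doubles their distance. -/
lemma abs_sub_le_of_rad_eq (L : ℕ) : ∀ {x y : ℝ}, x ∈ Set.Ico (0 : ℝ) 1 → y ∈ Set.Ico (0 : ℝ) 1 →
    (∀ i < L, rad i x = rad i y) → |x - y| ≤ (1 / 2) ^ L := by
  induction L with
  | zero =>
    intro x y hx hy _
    rw [abs_le, pow_zero]; constructor <;> linarith [hx.1, hx.2, hy.1, hy.2]
  | succ L ih =>
    intro x y hx hy h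
    have h0 := h 0 (Nat.succ_pos L)
    have hs : ∀ i < L, rad i (2 * x) = rad i (2 * y) := fun i hi => by
      rw [← rad_succ, ← rad_succ]; exact h (i + 1) (by omega)
    rw [pow_succ]
    rcases lt_or_ge x (1 / 2) with hx2 | hx2 <;> rcases lt_or_ge y (1 / 2) with hy2 | hy2
    · have := ih (x := 2 * x) (y := 2 * y) ⟨by linarith [hx.1], by linarith⟩
        ⟨by linarith [hy.1], by linarith⟩ hs
      rw [abs_le] at this ⊢; constructor <;> linarith [this.1, this.2]
    · rw [rad_zero_left hx.1 hx2, rad_zero_right hy2 hy.2] at h0; norm_num at h0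
    · rw [rad_zero_right hx2 hx.2, rad_zero_left hy.1 hy2] at h0; norm_num at h0
    · have := ih (x := 2 * x - 1) (y := 2 * y - 1) ⟨by linarith [hx.1], by linarith [hx.2]⟩
        ⟨by linarith [hy.1], by linarith [hy.2]⟩ fun i hi => by
          rw [← rad_add_one i (2 * x - 1), ← rad_add_one i (2 * y - 1), sub_add_cancel,
            sub_add_cancel]
          exact hs i hi
      rw [abs_le] at this ⊢; constructor <;> linarith [this.1, this.2]

lemma abs_sub_le_of_walKernel_ne_zero {L : ℕ} {x y : ℝ} (hx : x ∈ Set.Ico (0 : ℝ) 1)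
    (hy : y ∈ Set.Ico (0 : ℝ) 1) (h : walKernel L x y ≠ 0) : |x - y| ≤ (1 / 2) ^ L := by
  refine abs_sub_le_of_rad_eq L hx hy fun i hi => ?_
  have := Finset.prod_ne_zero_iff.1 h i (Finset.mem_range.2 hi)
  unfold rad at this ⊢
  split_ifs at this ⊢ <;> first | rfl | norm_num at this

lemma isBddMeas_walKernel (L : ℕ) (x : ℝ) : IsBddMeas (walKernel L x) where
  meas := Finset.measurable_prod _ fun i _ =>
    measurable_const.add (measurable_const.mul (measurable_rad i))
  bdd := by
    refine ⟨2 ^ L, fun y => ?_⟩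
    rw [walKernel, Finset.abs_prod, ← Finset.card_range L, ← Finset.prod_const, Finset.card_range]
    refine Finset.prod_le_prod (fun _ _ => abs_nonneg _) fun i _ => ?_
    unfold rad; split_ifs <;> norm_num

/-- The partial sums of the Walsh series. -/
def walSum {s : ℕ} (F : (Fin s → ℝ) → ℝ) (L : ℕ) (x : Fin s → ℝ) : ℝ :=
  ∑ S ∈ Fintype.piFinset fun _ : Fin s => (Finset.range L).powerset,
    (∫ y in cube s, F y * ∏ j, wal (S j) (y j)) * ∏ j, wal (S j) (x j)

lemma walSum_eq {s : ℕ} {F : (Fin s → ℝ) → ℝ} (hF : IntegrableOn F (cube s)) (L : ℕ)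
    (x : Fin s → ℝ) :
    walSum F L x = ∫ y in cube s, F y * ∏ j, walKernel L (x j) (y j) := by
  have e : ∀ y : Fin s → ℝ, F y * ∏ j, walKernel L (x j) (y j)
      = ∑ S ∈ Fintype.piFinset fun _ : Fin s => (Finset.range L).powerset,
        (F y * ∏ j, wal (S j) (y j)) * ∏ j, wal (S j) (x j) := by
    intro y
    simp only [walKernel_eq_sum, Finset.prod_univ_sum, Finset.mul_sum, Finset.prod_mul_distrib]
    refine Finset.sum_congr rfl fun S _ => ?_
    ring
  simp only [e]
  rw [integral_finsetSum]
  · simp only [integral_mul_const]; rfl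
  · intro S _
    exact (integrableOn_mul_prod hF fun j => (isNice_wal (S j)).isBddMeas).mul_const _

/-- The product kernel is nonnegative, has integral one and vanishes almost everywhere outside the
dyadic box of `x` of side `2^(-L)`: an approximate identity. Continuity relative to the cube is
enough. -/
lemma tendsto_walSum {s : ℕ} {F : (Fin s → ℝ) → ℝ} (hF : ContinuousOn F (cube s))
    {x : Fin s → ℝ} (hx : ∀ j, x j ∈ Set.Ico (0 : ℝ) 1) :
    Filter.Tendsto (fun L => walSum F L x) Filter.atTop (nhds (F x)) := by
  have hxc : x ∈ cube s := ⟨fun j => (hx j).1, fun j => (hx j).2.le⟩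
  have hFi : IntegrableOn F (cube s) := hF.integrableOn_compact isCompact_Icc
  have hone : ∀ L, ∫ y in cube s, ∏ j, walKernel L (x j) (y j) = 1 := by
    intro L
    rw [cube, integral_Icc_prod fun j y => walKernel L (x j) y]
    simp [integral_walKernel]
  have hKi : ∀ L, IntegrableOn (fun y : Fin s → ℝ => ∏ j, walKernel L (x j) (y j)) (cube s) := by
    intro L
    have := integrableOn_mul_prod (H := fun _ : Fin s → ℝ => (1 : ℝ))
      (by simpa using volume_cube_lt_top s)
      fun j => isBddMeas_walKernel L (x j)
    simpa using this
  rw [Metric.tendsto_atTop]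
  intro ε hε
  obtain ⟨δ, hδ, hFδ⟩ := Metric.continuousOn_iff.1 hF x hxc (ε / 2) (by positivity)
  obtain ⟨L₀, hL₀⟩ := exists_pow_lt_of_lt_one hδ (by norm_num : (1 / 2 : ℝ) < 1)
  refine ⟨L₀, fun L hL => ?_⟩
  have hLδ : (1 / 2 : ℝ) ^ L < δ :=
    lt_of_le_of_lt (pow_le_pow_of_le_one (by norm_num) (by norm_num) hL) hL₀
  have e1 : walSum F L x - F x = ∫ y in cube s, (F y - F x) * ∏ j, walKernel L (x j) (y j) := by
    have : ∀ y : Fin s → ℝ, (F y - F x) * ∏ j, walKernel L (x j) (y j)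
      = F y * ∏ j, walKernel L (x j) (y j) - F x * ∏ j, walKernel L (x j) (y j) :=
      fun y => by ring
    simp only [this]
    rw [integral_sub (integrableOn_mul_prod hFi fun j => isBddMeas_walKernel L (x j))
      ((hKi L).const_mul _), integral_const_mul, hone, walSum_eq hFi, mul_one]
  rw [Real.dist_eq, e1]
  refine lt_of_le_of_lt ?_ (half_lt_self hε)
  calc |∫ y in cube s, (F y - F x) * ∏ j, walKernel L (x j) (y j)|
      ≤ ∫ y in cube s, |(F y - F x) * ∏ j, walKernel L (x j) (y j)| :=
        abs_integral_le_integral_abs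
    _ ≤ ∫ y in cube s, ε / 2 * ∏ j, walKernel L (x j) (y j) := by
        refine integral_mono_of_nonneg (Filter.Eventually.of_forall fun _ => abs_nonneg _)
          ((hKi L).const_mul _) ?_
        have hc : ∀ᵐ y ∂(volume.restrict (cube s)), y ∈ cube s :=
          ae_restrict_mem (measurableSet_cube s)
        filter_upwards [ae_notMem_dyadicPoints s, hc] with y hy hyc
        have hK : 0 ≤ ∏ j, walKernel L (x j) (y j) :=
          Finset.prod_nonneg fun j _ => walKernel_nonneg L _ _
        simp only [abs_mul, abs_of_nonneg hK]
        rcases eq_or_ne (∏ j, walKernel L (x j) (y j)) 0 with h0 | h0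
        · rw [h0, mul_zero, mul_zero]
        · refine mul_le_mul_of_nonneg_right ?_ hK
          have hd : dist y x < δ := by
            refine lt_of_le_of_lt ((dist_pi_le_iff (by positivity)).2 fun j => ?_) hLδ
            rw [dist_comm, Real.dist_eq]
            exact abs_sub_le_of_walKernel_ne_zero (hx j) ⟨(hy j).1.1.le, (hy j).1.2⟩
              (Finset.prod_ne_zero_iff.1 h0 j (Finset.mem_univ j))
          exact (hFδ y hyc hd).le
    _ = ε / 2 := by rw [integral_const_mul, hone, mul_one]

/-- The integration error of an equal weight cubature rule in terms of its character sums. -/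
theorem abs_integral_sub_le {s α n : ℕ} {F : (Fin s → ℝ) → ℝ}
    (hF : MemH α F) {x : ℕ → Fin s → ℝ} (hx : ∀ k j, x k j ∈ Set.Ico (0 : ℝ) 1)
    {w : (Fin s → Finset ℕ) → ℝ}
    (hw : ∀ S, ∃ U : Fin s → Finset ℕ, (∀ j, U j ⊆ S j) ∧ (∀ j, (U j).card ≤ α) ∧
      ∏ j, (1 / 2 : ℝ) ^ (∑ i ∈ U j, (i + 1)) ≤ w S) (hn : 0 < n)
    {ℓ : ℕ → ℕ} (hℓ : Filter.Tendsto ℓ Filter.atTop Filter.atTop) {B : ℝ}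
    (hB : ∀ L, ∑ S ∈ (Fintype.piFinset fun _ : Fin s => (Finset.range (ℓ L)).powerset).erase
      (fun _ => ∅), w S * |1 / n * ∑ k ∈ Finset.range n, ∏ j, wal (S j) (x k j)| ≤ B) :
    |(∫ y in cube s, F y) - 1 / n * ∑ k ∈ Finset.range n, F (x k)| ≤ B * normH α F := by
  have hnorm : 0 ≤ normH α F := Real.sqrt_nonneg _
  have hn' : (n : ℝ) ≠ 0 := by exact_mod_cast hn.ne'
  -- The bound is proved for the partial sums along `ℓ` and passes to the limit, so absolute
  -- convergence of the Walsh series is never needed.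
  have hlim : Filter.Tendsto (fun L => |(∫ y in cube s, F y)
      - 1 / n * ∑ k ∈ Finset.range n, walSum F (ℓ L) (x k)|) Filter.atTop
      (nhds |(∫ y in cube s, F y) - 1 / n * ∑ k ∈ Finset.range n, F (x k)|) :=
    (((tendsto_finsetSum _ fun k _ => (tendsto_walSum hF.1 (hx k)).comp hℓ).const_mul _).const_sub _).abs
  refine le_of_tendsto' hlim fun L => ?_
  set I := Fintype.piFinset fun _ : Fin s => (Finset.range (ℓ L)).powerset with hI
  have hmem : (fun _ => ∅ : Fin s → Finset ℕ) ∈ I := by simp [hI]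
  set c : (Fin s → Finset ℕ) → ℝ := fun S => ∫ y in cube s, F y * ∏ j, wal (S j) (y j) with hc
  set d : (Fin s → Finset ℕ) → ℝ := fun S =>
    1 / n * ∑ k ∈ Finset.range n, ∏ j, wal (S j) (x k j) with hd
  have e1 : 1 / n * ∑ k ∈ Finset.range n, walSum F (ℓ L) (x k) = ∑ S ∈ I, c S * d S := by
    simp only [walSum, ← hI, hd]
    rw [Finset.sum_comm, Finset.mul_sum]
    refine Finset.sum_congr rfl fun S _ => ?_
    rw [← Finset.mul_sum]; ring
  have e2 : c (fun _ => ∅) * d (fun _ => ∅) = ∫ y in cube s, F y := by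
    simp [hc, hd, wal, hn']
  rw [e1, ← Finset.add_sum_erase _ _ hmem, e2, sub_add_cancel_left, abs_neg]
  calc |∑ S ∈ I.erase fun _ => ∅, c S * d S| ≤ ∑ S ∈ I.erase fun _ => ∅, |c S * d S| :=
        Finset.abs_sum_le_sum_abs _ _
    _ ≤ ∑ S ∈ I.erase fun _ => ∅, w S * |d S| * normH α F := by
        refine Finset.sum_le_sum fun S _ => ?_
        obtain ⟨U, hU, hUα, hUw⟩ := hw S
        rw [abs_mul]
        have := (abs_integral_mul_prod_wal_le hF hU hUα).trans
          (mul_le_mul_of_nonneg_right hUw hnorm)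
        calc |c S| * |d S| ≤ (w S * normH α F) * |d S| :=
              mul_le_mul_of_nonneg_right this (abs_nonneg _)
          _ = _ := by ring
    _ ≤ B * normH α F := by
        rw [← Finset.sum_mul]
        exact mul_le_mul_of_nonneg_right (hB L) hnorm

end QMC

end

/-! ### Greedy choice of components over a finite field -/

noncomputable section

namespace QMC

/-! ### Component-by-component choice over a finite field -/

/-- Subadditivity of `t ↦ t ^ κ`. It is what moves the exponent from a dual sum onto the individual
weights. -/
lemma rpow_sum_le_sum_rpow {ι : Type*} (s : Finset ι) {f : ι → ℝ} (hf : ∀ i ∈ s, 0 ≤ f i)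
    {κ : ℝ} (h0 : 0 < κ) (h1 : κ ≤ 1) : (∑ i ∈ s, f i) ^ κ ≤ ∑ i ∈ s, f i ^ κ := by
  classical
  induction s using Finset.induction_on with
  | empty => simp [Real.zero_rpow h0.ne']
  | insert a s ha ih =>
    rw [Finset.sum_insert ha, Finset.sum_insert ha]
    have hs : ∀ i ∈ s, 0 ≤ f i := fun i hi => hf i (Finset.mem_insert_of_mem hi)
    exact (Real.rpow_add_le_add_rpow (hf a (Finset.mem_insert_self a s)) (Finset.sum_nonneg hs)
      h0.le h1).trans (by gcongr; exact ih hs)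

section

variable {F : Type*} [Field F] [Fintype F]

open scoped Classical in
/-- The sum of the products `R(h₁)⋯R(h_d)` over the solutions of `h₁q₁ + ⋯ + h_d q_d = a`. -/
def dualSum (R : F → ℝ) (q : ℕ → F) : ℕ → F → ℝ
  | 0, a => if a = 0 then 1 else 0
  | d + 1, a => ∑ x, R x * dualSum R q d (a - x * q d)

variable {R R' : F → ℝ} {q : ℕ → F}

lemma dualSum_nonneg (hR : ∀ x, 0 ≤ R x) (d : ℕ) (a : F) : 0 ≤ dualSum R q d a := by
  induction d generalizing a with
  | zero => unfold dualSum; split_ifs <;> norm_num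
  | succ d ih => exact Finset.sum_nonneg fun x _ => mul_nonneg (hR x) (ih _)

lemma dualSum_mono (hR : ∀ x, 0 ≤ R x) (hRR : ∀ x, R x ≤ R' x) (d : ℕ) (a : F) :
    dualSum R q d a ≤ dualSum R' q d a := by
  induction d generalizing a with
  | zero => exact le_rfl
  | succ d ih =>
    exact Finset.sum_le_sum fun x _ => mul_le_mul (hRR x) (ih _) (dualSum_nonneg hR _ _)
      ((hR x).trans (hRR x))

lemma dualSum_congr {q' : ℕ → F} {d : ℕ} (h : ∀ i < d, q i = q' i) (a : F) :
    dualSum R q d a = dualSum R q' d a := by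
  induction d generalizing a with
  | zero => rfl
  | succ d ih =>
    simp only [dualSum, h d (Nat.lt_succ_self d)]
    exact Finset.sum_congr rfl fun x _ => by rw [ih fun i hi => h i (by omega)]

/-- Summing over all right-hand sides removes the linear constraint, and the product of sums
remains. -/
lemma sum_dualSum (d : ℕ) : ∑ a, dualSum R q d a = (∑ x, R x) ^ d := by
  classical
  induction d with
  | zero => simp [dualSum]
  | succ d ih =>
    simp only [dualSum]
    rw [Finset.sum_comm, pow_succ, ← ih, mul_comm, Finset.sum_mul]
    refine Finset.sum_congr rfl fun x _ => ?_
    rw [← Finset.mul_sum]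
    congr 1
    exact Fintype.sum_equiv (Equiv.subRight (x * q d)) _ _ fun a => rfl

lemma one_le_dualSum_zero (hR : ∀ x, 0 ≤ R x) (hR0 : 1 ≤ R 0) (d : ℕ) :
    1 ≤ dualSum R q d 0 := by
  induction d with
  | zero => simp [dualSum]
  | succ d ih =>
    have : R 0 * dualSum R q d (0 - 0 * q d) ≤ dualSum R q (d + 1) 0 :=
      Finset.single_le_sum (f := fun x => R x * dualSum R q d (0 - x * q d))
        (fun x _ => mul_nonneg (hR x) (dualSum_nonneg hR d _)) (Finset.mem_univ 0)
    rw [zero_mul, sub_zero] at this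
    nlinarith

lemma dualSum_rpow_le {κ : ℝ} (h0 : 0 < κ) (h1 : κ ≤ 1) (hR : ∀ x, 0 ≤ R x)
    (hRR : ∀ x, R x ^ κ ≤ R' x) (d : ℕ) (a : F) :
    dualSum R q d a ^ κ ≤ dualSum R' q d a := by
  induction d generalizing a with
  | zero =>
    simp only [dualSum]
    split_ifs
    · simp
    · rw [Real.zero_rpow h0.ne']
  | succ d ih =>
    refine (rpow_sum_le_sum_rpow _ (fun x _ => mul_nonneg (hR x) (dualSum_nonneg hR d _))
      h0 h1).trans (Finset.sum_le_sum fun x _ => ?_)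
    rw [Real.mul_rpow (hR x) (dualSum_nonneg hR d _)]
    exact mul_le_mul (hRR x) (ih _) (Real.rpow_nonneg (dualSum_nonneg hR d _) _)
      ((Real.rpow_nonneg (hR x) _).trans (hRR x))

/-- For fixed `x ≠ 0` the map `y ↦ -(x * y)` permutes the nonzero elements, so summing over the
candidates `y` decouples `x` from the earlier components. This uses that the residue ring is a
field. -/
lemma sum_ne_zero_mul_dualSum (d : ℕ) [DecidableEq F] :
    ∑ y ∈ Finset.univ.erase (0 : F), ∑ x ∈ Finset.univ.erase (0 : F),
        R x * dualSum R q d (0 - x * y)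
      = (∑ x ∈ Finset.univ.erase (0 : F), R x) *
          ∑ a ∈ Finset.univ.erase (0 : F), dualSum R q d a := by
  rw [Finset.sum_comm, Finset.sum_mul]
  refine Finset.sum_congr rfl fun x hx => ?_
  have hx0 : x ≠ 0 := (Finset.mem_erase.1 hx).1
  rw [← Finset.mul_sum]
  congr 1
  refine Finset.sum_bij' (fun y _ => 0 - x * y) (fun a _ => -a / x) ?_ ?_ ?_ ?_ ?_
  · intro y hy; simpa [hx0] using hy
  · intro a ha; simpa [hx0] using ha
  · intro y _; field_simp; ring
  · intro a _; field_simp; ring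
  · intro y _; rfl

/-- The mean value argument for the greedy choice of a generating vector, simultaneously for all
exponents `κ` at which the weights `R` are dominated. -/
theorem dualSum_greedy_rpow_le [DecidableEq F] {κ T T' c : ℝ} (h0 : 0 < κ) (h1 : κ ≤ 1)
    (hR : ∀ x, 0 ≤ R x) (hRR : ∀ x ≠ 0, R x ^ κ ≤ R' x) (hT : 0 ≤ T) (hTT : T ^ κ ≤ T')
    (hR0 : R 0 = 1 + T) (hR0' : R' 0 = 1 + T') {N : ℝ}
    (hN : N = (Finset.univ.erase (0 : F)).card) (hN0 : 0 < N)
    (hc : T' + ∑ x ∈ Finset.univ.erase (0 : F), R' x = c) (hTc : T' ≤ c / N) {D : ℕ}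
    (hq : ∀ d < D, ∀ y ≠ 0, ∑ x, R x * dualSum R q d (0 - x * q d)
      ≤ ∑ x, R x * dualSum R q d (0 - x * y)) :
    (dualSum R q D 0 - 1) ^ κ ≤ ((1 + c) ^ D - 1) / N := by
  have hT' : 0 ≤ T' := (Real.rpow_nonneg hT κ).trans hTT
  have hRR' : ∀ x, R x ^ κ ≤ R' x := by
    intro x
    rcases eq_or_ne x 0 with rfl | hx
    · rw [hR0, hR0']
      exact (Real.rpow_add_le_add_rpow zero_le_one hT h0.le h1).trans (by
        rw [Real.one_rpow]; gcongr)
    · exact hRR x hx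
  have hR'0 : ∀ x, 0 ≤ R' x := fun x => (Real.rpow_nonneg (hR x) κ).trans (hRR' x)
  have hsumR' : ∑ x, R' x = 1 + c := by
    rw [← Finset.add_sum_erase _ _ (Finset.mem_univ (0 : F)), hR0', ← hc]; ring
  have hc0 : 0 ≤ c := by
    rw [← hc]; exact add_nonneg hT' (Finset.sum_nonneg fun x _ => hR'0 x)
  induction D with
  | zero => simp [dualSum, Real.zero_rpow h0.ne']
  | succ d ih =>
    have ih := ih fun e he => hq e (by omega)
    -- `θ y` is the growth of the dual sum when the component `y` is appended. The class `x = 0`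
    -- enters only with the excess `T` of its weight over one.
    set θ : F → ℝ := fun y => T * dualSum R q d 0 +
      ∑ x ∈ Finset.univ.erase (0 : F), R x * dualSum R q d (0 - x * y) with hθ
    have hA := dualSum_nonneg (q := q) hR d
    have hA' := dualSum_nonneg (q := q) hR'0 d
    have hsplit : ∀ y, ∑ x, R x * dualSum R q d (0 - x * y) = dualSum R q d 0 + θ y := by
      intro y
      rw [← Finset.add_sum_erase _ _ (Finset.mem_univ (0 : F)), hR0, hθ, zero_mul, sub_zero]
      ring
    have hθ0 : ∀ y, 0 ≤ θ y := fun y =>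
      add_nonneg (mul_nonneg hT (hA 0)) (Finset.sum_nonneg fun x _ => mul_nonneg (hR x) (hA _))
    have hθκ : ∀ y, θ y ^ κ ≤ T' * dualSum R' q d 0 +
        ∑ x ∈ Finset.univ.erase (0 : F), R' x * dualSum R' q d (0 - x * y) := by
      intro y
      refine (Real.rpow_add_le_add_rpow (mul_nonneg hT (hA 0))
        (Finset.sum_nonneg fun x _ => mul_nonneg (hR x) (hA _)) h0.le h1).trans ?_
      refine add_le_add ?_ ((rpow_sum_le_sum_rpow _
        (fun x _ => mul_nonneg (hR x) (hA _)) h0 h1).trans (Finset.sum_le_sum fun x _ => ?_))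
      · rw [Real.mul_rpow hT (hA 0)]
        exact mul_le_mul hTT (dualSum_rpow_le h0 h1 hR hRR' d 0) (Real.rpow_nonneg (hA 0) _) hT'
      · rw [Real.mul_rpow (hR x) (hA _)]
        exact mul_le_mul (hRR' x) (dualSum_rpow_le h0 h1 hR hRR' d _)
          (Real.rpow_nonneg (hA _) _) (hR'0 x)
    have hmin : ∀ y ≠ 0, θ (q d) ≤ θ y := by
      intro y hy
      have := hq d (Nat.lt_succ_self d) y hy
      rw [hsplit, hsplit] at this
      linarith
    -- The minimum is at most the mean over the nonzero `y`. The part with `x ≠ 0` is summed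
    -- exactly; the part with `x = 0` does not depend on `y` and is controlled by `N * T' ≤ c`.
    have hmean : N * θ (q d) ^ κ ≤ c * (1 + c) ^ d := by
      have e1 : N * θ (q d) ^ κ ≤ ∑ y ∈ Finset.univ.erase (0 : F), (T' * dualSum R' q d 0 +
          ∑ x ∈ Finset.univ.erase (0 : F), R' x * dualSum R' q d (0 - x * y)) := by
        rw [hN, ← nsmul_eq_mul, ← Finset.sum_const]
        refine Finset.sum_le_sum fun y hy => le_trans ?_ (hθκ y)
        exact Real.rpow_le_rpow (hθ0 _) (hmin y (Finset.mem_erase.1 hy).1) h0.le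
      rw [Finset.sum_add_distrib, sum_ne_zero_mul_dualSum, Finset.sum_const, nsmul_eq_mul,
        ← hN] at e1
      have e2 : ∑ a ∈ Finset.univ.erase (0 : F), dualSum R' q d a
          = (1 + c) ^ d - dualSum R' q d 0 := by
        rw [← hsumR', ← sum_dualSum (q := q),
          ← Finset.add_sum_erase _ _ (Finset.mem_univ (0 : F))]
        ring
      have e3 : ∑ x ∈ Finset.univ.erase (0 : F), R' x = c - T' := by rw [← hc]; ring
      rw [e2, e3] at e1
      have e4 : 0 ≤ (1 + c) ^ d - dualSum R' q d 0 := by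
        rw [← e2]; exact Finset.sum_nonneg fun a _ => hA' a
      have e5 : N * T' ≤ c := by rwa [le_div_iff₀ hN0, mul_comm] at hTc
      nlinarith [hA' 0, mul_nonneg hT' e4, mul_le_mul_of_nonneg_right e5 (hA' 0)]
    have hR01 : 1 ≤ R 0 := by rw [hR0]; linarith
    have h1A : 0 ≤ dualSum R q d 0 - 1 := by
      linarith [one_le_dualSum_zero (q := q) hR hR01 d]
    have : dualSum R q (d + 1) 0 - 1 = (dualSum R q d 0 - 1) + θ (q d) := by
      change ∑ x, R x * dualSum R q d (0 - x * q d) - 1 = _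
      rw [hsplit]; ring
    rw [this]
    refine (Real.rpow_add_le_add_rpow h1A (hθ0 _) h0.le h1).trans ?_
    have h6 : θ (q d) ^ κ ≤ c * (1 + c) ^ d / N := by
      rw [le_div_iff₀ hN0, mul_comm]; exact hmean
    calc _ ≤ ((1 + c) ^ d - 1) / N + c * (1 + c) ^ d / N := add_le_add ih h6
      _ = _ := by rw [← add_div, pow_succ]; congr 1; ring

variable {χ : AddChar F ℝ}

/-- `dualSum` is an iterated convolution of dilated weights, which a character turns into a product.
-/
lemma sum_dualSum_mul_char (d : ℕ) (k : F) :
    ∑ a, dualSum R q d a * χ (a * k) = ∏ i ∈ Finset.range d, ∑ x, R x * χ (x * q i * k) := by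
  classical
  induction d with
  | zero => simp [dualSum]
  | succ d ih =>
    rw [Finset.prod_range_succ, ← ih, mul_comm, Finset.sum_mul]
    simp only [dualSum, Finset.sum_mul]
    rw [Finset.sum_comm]
    refine Finset.sum_congr rfl fun x _ => ?_
    rw [Finset.mul_sum]
    refine Fintype.sum_equiv (Equiv.subRight (x * q d)) _ _ fun a => ?_
    have : a * k = x * q d * k + (a - x * q d) * k := by ring
    rw [this, AddChar.map_add_eq_mul, Equiv.subRight_apply]
    ring

/-- The sum over the dual as a character sum. -/
lemma dualSum_zero_eq (hχ : χ.IsPrimitive) (d : ℕ) :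
    (Fintype.card F : ℝ) * dualSum R q d 0
      = ∑ k, ∏ i ∈ Finset.range d, ∑ x, R x * χ (x * q i * k) := by
  classical
  simp only [← sum_dualSum_mul_char]
  rw [Finset.sum_comm]
  simp only [← Finset.mul_sum]
  rw [Finset.sum_eq_single 0]
  · simp [mul_comm]
  · intro a _ ha
    have := AddChar.sum_mulShift a hχ
    rw [if_neg ha] at this
    simp only [mul_comm a, this]
    simp
  · simp

end

/-! ### Sums over sets of digit positions -/

/-- The length of the binary expansion with digits `1` in the positions `S`. -/
def topDigit (S : Finset ℕ) : ℕ := S.sup (· + 1)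

lemma topDigit_insert {L : ℕ} {S : Finset ℕ} (hS : S ⊆ Finset.range L) :
    topDigit (insert L S) = L + 1 := by
  unfold topDigit
  rw [Finset.sup_insert, sup_eq_left]
  exact Finset.sup_le fun i hi => by have := hS hi; simp at this; omega

lemma sum_powerset_range_succ {M : Type*} [AddCommMonoid M] (L : ℕ) (f : Finset ℕ → M) :
    ∑ S ∈ (Finset.range (L + 1)).powerset, f S
      = ∑ S ∈ (Finset.range L).powerset, f S
        + ∑ S ∈ (Finset.range L).powerset, f (insert L S) := by
  rw [Finset.range_add_one, Finset.sum_powerset_insert Finset.notMem_range_self]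

/-- Nonempty sets are grouped by their largest element `t`; the elements below `t` are free. -/
lemma sum_pow_topDigit_mul_prod (b : ℝ) (σ : ℕ → ℝ) (L : ℕ) :
    ∑ S ∈ (Finset.range L).powerset, b ^ topDigit S * ∏ i ∈ S, σ i
      = 1 + ∑ t ∈ Finset.range L, b ^ (t + 1) * σ t * ∏ i ∈ Finset.range t, (1 + σ i) := by
  induction L with
  | zero => simp [topDigit]
  | succ L ih =>
    rw [sum_powerset_range_succ, ih, Finset.sum_range_succ, ← add_assoc]
    congr 1
    rw [Finset.prod_one_add, Finset.mul_sum]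
    refine Finset.sum_congr rfl fun S hS => ?_
    have hS := Finset.mem_powerset.1 hS
    have hL : L ∉ S := fun h => by simpa using hS h
    rw [topDigit_insert hS, Finset.prod_insert hL, mul_assoc]

end QMC

end

/-! ### The residue field, its character and the kernel -/

noncomputable section

namespace QMC

/-! ### The residue field of an irreducible modulus -/

/-- The additive character of `ℤ/2` with values `±1`. -/
def sgn (a : ZMod 2) : ℝ := if a = 0 then 1 else -1

lemma sgn_zero : sgn 0 = 1 := rfl

lemma sgn_one : sgn 1 = -1 := by simp [sgn]

lemma sgn_add (a b : ZMod 2) : sgn (a + b) = sgn a * sgn b := by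
  revert a b
  have h : ∀ a b : ZMod 2, a + b = 0 ↔ (a = 0 ↔ b = 0) := by decide
  intro a b
  unfold sgn
  by_cases ha : a = 0 <;> by_cases hb : b = 0 <;> simp [h, ha, hb]

section

open Polynomial

variable {p : (ZMod 2)[X]}

lemma monic_of_ne_zero (hp : p ≠ 0) : p.Monic := by
  have h : ∀ a : ZMod 2, a ≠ 0 → a = 1 := by decide
  exact h _ (leadingCoeff_ne_zero.2 hp)

variable [hpi : Fact (Irreducible p)]

variable (p) in
lemma monic_of_irreducible : p.Monic := monic_of_ne_zero hpi.out.ne_zero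

variable (p) in
lemma one_le_natDegree_of_irreducible : 1 ≤ p.natDegree := hpi.out.natDegree_pos

/-- The representative of degree less than the degree of the modulus. -/
def rep (x : AdjoinRoot p) : (ZMod 2)[X] := AdjoinRoot.modByMonicHom (monic_of_irreducible p) x

lemma rep_mk (f : (ZMod 2)[X]) : rep (AdjoinRoot.mk p f) = f %ₘ p :=
  AdjoinRoot.modByMonicHom_mk _ f

lemma mk_rep (x : AdjoinRoot p) : AdjoinRoot.mk p (rep x) = x :=
  AdjoinRoot.mk_leftInverse (monic_of_irreducible p) x

lemma rep_mk_of_natDegree_lt {f : (ZMod 2)[X]} (hf : f.natDegree < p.natDegree) :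
    rep (AdjoinRoot.mk p f) = f := by
  rw [rep_mk, modByMonic_eq_self_iff (monic_of_irreducible p)]
  exact degree_lt_degree hf

lemma natDegree_rep_lt (x : AdjoinRoot p) : (rep x).natDegree < p.natDegree := by
  rw [← mk_rep x, rep_mk]
  exact natDegree_modByMonic_lt _ (monic_of_irreducible p) hpi.out.ne_one

/-- The nontrivial additive character of the residue field given by the leading coefficient. -/
def fieldChar : AddChar (AdjoinRoot p) ℝ where
  toFun x := sgn ((rep x).coeff (p.natDegree - 1))
  map_zero_eq_one' := by simp [rep, sgn]
  map_add_eq_mul' x y := by simp [rep, sgn_add]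

lemma fieldChar_apply (x : AdjoinRoot p) :
    fieldChar x = sgn ((rep x).coeff (p.natDegree - 1)) := rfl

lemma fieldChar_mk (f : (ZMod 2)[X]) :
    fieldChar (AdjoinRoot.mk p f) = sgn ((f %ₘ p).coeff (p.natDegree - 1)) := by
  rw [fieldChar_apply, rep_mk]

/-- Over a field a nontrivial additive character is primitive. The power of the indeterminate just
below the degree of the modulus has the value `-1`. -/
lemma isPrimitive_fieldChar : (fieldChar : AddChar (AdjoinRoot p) ℝ).IsPrimitive := by
  refine AddChar.IsPrimitive.of_ne_one fun h => ?_
  have hm := one_le_natDegree_of_irreducible p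
  have h1 := DFunLike.congr_fun h (AdjoinRoot.mk p (X ^ (p.natDegree - 1)))
  rw [fieldChar_apply, rep_mk_of_natDegree_lt (by rw [natDegree_X_pow]; omega), coeff_X_pow_self,
    sgn_one, AddChar.one_apply] at h1
  norm_num at h1

variable (p) in
/-- The field element with the binary digits `S`. -/
def encSet (S : Finset ℕ) : AdjoinRoot p := ∑ i ∈ S, AdjoinRoot.root p ^ i

/-- The polynomial with the binary digits `S`. -/
def polyOfSet (S : Finset ℕ) : (ZMod 2)[X] := ∑ i ∈ S, X ^ i

lemma coeff_polyOfSet (S : Finset ℕ) (i : ℕ) :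
    (polyOfSet S).coeff i = if i ∈ S then 1 else 0 := by
  simp [polyOfSet, coeff_X_pow]

lemma support_polyOfSet (S : Finset ℕ) : (polyOfSet S).support = S := by
  ext i
  simp [coeff_polyOfSet]

lemma polyOfSet_support (f : (ZMod 2)[X]) : polyOfSet f.support = f := by
  have h : ∀ a : ZMod 2, a ≠ 0 → a = 1 := by decide
  ext i
  rw [coeff_polyOfSet]
  split_ifs with hi
  · exact (h _ (mem_support_iff.1 hi)).symm
  · exact (notMem_support_iff.1 hi).symm

lemma encSet_eq_mk (S : Finset ℕ) : encSet p S = AdjoinRoot.mk p (polyOfSet S) := by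
  simp [encSet, polyOfSet]

lemma degree_polyOfSet_lt {S : Finset ℕ} {m : ℕ} (hS : S ⊆ Finset.range m) :
    (polyOfSet S).degree < m := by
  rw [degree_lt_iff_coeff_zero]
  intro i hi
  rw [coeff_polyOfSet, if_neg]
  intro h
  have := hS h
  simp at this
  omega

/-- The set of binary digits of a field element. -/
def decSet (x : AdjoinRoot p) : Finset ℕ := (rep x).support

lemma decSet_subset (x : AdjoinRoot p) : decSet x ⊆ Finset.range p.natDegree := by
  intro i hi
  have := le_natDegree_of_mem_supp i hi
  have := natDegree_rep_lt x
  simp; omega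

lemma encSet_decSet (x : AdjoinRoot p) : encSet p (decSet x) = x := by
  rw [encSet_eq_mk, decSet, polyOfSet_support, mk_rep]

lemma decSet_encSet {S : Finset ℕ} (hS : S ⊆ Finset.range p.natDegree) :
    decSet (encSet p S) = S := by
  rw [encSet_eq_mk, decSet, rep_mk, (modByMonic_eq_self_iff (monic_of_irreducible p)).2,
    support_polyOfSet]
  rw [degree_eq_natDegree hpi.out.ne_zero]
  exact degree_polyOfSet_lt hS

instance finite_adjoinRoot : Finite (AdjoinRoot p) :=
  Finite.of_injective (fun x : AdjoinRoot p =>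
    (⟨decSet x, Finset.mem_powerset.2 (decSet_subset x)⟩ :
      (Finset.range p.natDegree).powerset)) fun x y h => by
    have : decSet x = decSet y := congrArg Subtype.val h
    rw [← encSet_decSet x, this, encSet_decSet]

instance fintype_adjoinRoot : Fintype (AdjoinRoot p) := Fintype.ofFinite _

lemma sum_adjoinRoot {M : Type*} [AddCommMonoid M] (f : AdjoinRoot p → M) :
    ∑ x, f x = ∑ S ∈ (Finset.range p.natDegree).powerset, f (encSet p S) :=
  Finset.sum_bij' (fun x _ => decSet x) (fun S _ => encSet p S)
    (fun x _ => Finset.mem_powerset.2 (decSet_subset x)) (fun _ _ => Finset.mem_univ _)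
    (fun x _ => encSet_decSet x) (fun _ hS => decSet_encSet (Finset.mem_powerset.1 hS))
    (fun x _ => by rw [encSet_decSet])

variable (p) in
lemma card_adjoinRoot : Fintype.card (AdjoinRoot p) = 2 ^ p.natDegree := by
  have := sum_adjoinRoot (p := p) fun _ => 1
  simpa using this

lemma fieldChar_encSet_mul (S : Finset ℕ) (y : AdjoinRoot p) :
    fieldChar (encSet p S * y) = ∏ i ∈ S, fieldChar (AdjoinRoot.root p ^ i * y) := by
  rw [encSet, Finset.sum_mul]
  induction S using Finset.induction_on with
  | empty => simp
  | insert a S ha ih => rw [Finset.sum_insert ha, Finset.prod_insert ha, AddChar.map_add_eq_mul, ih]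

lemma decSet_zero : decSet (0 : AdjoinRoot p) = ∅ := by simp [decSet, rep]

/-- The weights of the residue classes of frequencies, with total weight `T` of the frequencies
beyond the resolution. -/
def resWeight (b T : ℝ) (x : AdjoinRoot p) : ℝ := b ^ topDigit (decSet x) + T

lemma resWeight_zero (b T : ℝ) : resWeight b T (0 : AdjoinRoot p) = 1 + T := by
  simp [resWeight, decSet_zero, topDigit]

/-- The one-dimensional kernel of the figure of merit. -/
def meritKernel (b : ℝ) (y : AdjoinRoot p) : ℝ :=
  1 + ∑ t ∈ Finset.range p.natDegree, b ^ (t + 1) * fieldChar (AdjoinRoot.root p ^ t * y) *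
    ∏ i ∈ Finset.range t, (1 + fieldChar (AdjoinRoot.root p ^ i * y))

lemma sum_pow_topDigit_mul_char (b : ℝ) (y : AdjoinRoot p) :
    ∑ x, b ^ topDigit (decSet x) * fieldChar (x * y) = meritKernel b y := by
  rw [sum_adjoinRoot, meritKernel, ← sum_pow_topDigit_mul_prod]
  refine Finset.sum_congr rfl fun S hS => ?_
  rw [decSet_encSet (Finset.mem_powerset.1 hS), fieldChar_encSet_mul]

/-- The character `x ↦ fieldChar (x * y)` sums to zero, so the constant `T` drops out: the greedy
criterion does not involve the tail of the weights. -/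
lemma sum_resWeight_mul_char (b T : ℝ) {y : AdjoinRoot p} (hy : y ≠ 0) :
    ∑ x, resWeight b T x * fieldChar (x * y) = meritKernel b y := by
  classical
  simp only [resWeight, add_mul, Finset.sum_add_distrib, ← Finset.mul_sum]
  have := AddChar.sum_mulShift y (isPrimitive_fieldChar (p := p))
  rw [if_neg hy] at this
  rw [this, sum_pow_topDigit_mul_char]
  simp

lemma sum_pow_topDigit (b : ℝ) :
    ∑ x : AdjoinRoot p, b ^ topDigit (decSet x)
      = 1 + ∑ t ∈ Finset.range p.natDegree, b ^ (t + 1) * 2 ^ t := by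
  have := sum_pow_topDigit_mul_prod b (fun _ => 1) p.natDegree
  simp only [mul_one, Finset.prod_const_one, Finset.prod_const, Finset.card_range] at this
  rw [sum_adjoinRoot]
  norm_num at this
  rw [← this]
  refine Finset.sum_congr rfl fun S hS => ?_
  rw [decSet_encSet (Finset.mem_powerset.1 hS)]

/-- The values of the kernel of the figure of merit. -/
def kernelValue (b : ℝ) (t : ℕ) : ℝ := 1 + ∑ i ∈ Finset.range t, b ^ (i + 1) * 2 ^ i - b ^ (t + 1) * 2 ^ t

/-- The products `X ^ i * f` reach the top degree for the first time at `i = e`. Up to there no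
reduction modulo `p` takes place; the characters are `1` before `e` and `-1` at `e`, and every later
term contains the factor `1 + (-1)`. So the kernel depends on the degree of `f` only, and all its
values fit in a table of length `p.natDegree`. -/
lemma meritKernel_mk (b : ℝ) {f : (ZMod 2)[X]} (hf0 : f ≠ 0) {e : ℕ}
    (hf : f.natDegree + e + 1 = p.natDegree) :
    meritKernel b (AdjoinRoot.mk p f) = kernelValue b e := by
  have h1 : ∀ i ≤ e, AdjoinRoot.root p ^ i * AdjoinRoot.mk p f = AdjoinRoot.mk p (X ^ i * f) := by
    intro i _; simp
  have hdeg : ∀ i, (X ^ i * f).natDegree = i + f.natDegree := fun i => by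
    rw [natDegree_mul (pow_ne_zero _ X_ne_zero) hf0, natDegree_X_pow]
  have hlow : ∀ i < e, fieldChar (AdjoinRoot.root p ^ i * AdjoinRoot.mk p f) = 1 := by
    intro i hi
    rw [h1 i hi.le, fieldChar_apply, rep_mk_of_natDegree_lt (by rw [hdeg]; omega),
      coeff_eq_zero_of_natDegree_lt (by rw [hdeg]; omega), sgn_zero]
  have hmid : fieldChar (AdjoinRoot.root p ^ e * AdjoinRoot.mk p f) = -1 := by
    rw [h1 e le_rfl, fieldChar_apply, rep_mk_of_natDegree_lt (by rw [hdeg]; omega)]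
    have : p.natDegree - 1 = (X ^ e * f).natDegree := by rw [hdeg]; omega
    rw [this, coeff_natDegree, (monic_of_ne_zero (mul_ne_zero (pow_ne_zero _ X_ne_zero) hf0))]
    exact sgn_one
  have hprod : ∀ t ≤ e, ∏ i ∈ Finset.range t,
      (1 + fieldChar (AdjoinRoot.root p ^ i * AdjoinRoot.mk p f)) = 2 ^ t := by
    intro t ht
    rw [Finset.prod_congr rfl (g := fun _ => (2 : ℝ))]
    · simp
    · intro i hi
      rw [hlow i (by have := Finset.mem_range.1 hi; omega)]; norm_num
  have hzero : ∀ t, e < t → ∏ i ∈ Finset.range t,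
      (1 + fieldChar (AdjoinRoot.root p ^ i * AdjoinRoot.mk p f)) = 0 := by
    intro t ht
    refine Finset.prod_eq_zero (Finset.mem_range.2 ht) ?_
    rw [hmid]; norm_num
  unfold meritKernel kernelValue
  rw [show p.natDegree = e + 1 + f.natDegree by omega, Finset.sum_range_add,
    Finset.sum_range_succ, hmid, hprod e le_rfl]
  have e1 : ∀ t ∈ Finset.range e, b ^ (t + 1) *
      fieldChar (AdjoinRoot.root p ^ t * AdjoinRoot.mk p f) *
      ∏ i ∈ Finset.range t, (1 + fieldChar (AdjoinRoot.root p ^ i * AdjoinRoot.mk p f))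
      = b ^ (t + 1) * 2 ^ t := by
    intro t ht
    have ht := Finset.mem_range.1 ht
    rw [hlow t ht, hprod t ht.le, mul_one]
  rw [Finset.sum_congr rfl e1, Finset.sum_eq_zero (s := Finset.range f.natDegree)]
  · ring
  · intro t _
    rw [hzero _ (by omega), mul_zero]

/-! ### Grouping frequencies by residue classes -/

/-- A residue class contains one frequency without digits beyond the resolution, and `2 ^ t`
frequencies whose top digit has position `p.natDegree + t`: the lowest `p.natDegree` digits are
prescribed, the `t` digits between are free. -/
lemma sum_powerset_filter_encSet (b : ℝ) (x : AdjoinRoot p) (l : ℕ) :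
    ∑ S ∈ (Finset.range (p.natDegree + l)).powerset,
        (if encSet p (S ∩ Finset.range p.natDegree) = x then b ^ topDigit S else 0)
      = b ^ topDigit (decSet x) + ∑ t ∈ Finset.range l, b ^ (p.natDegree + t + 1) * 2 ^ t := by
  have hins : ∀ l (S : Finset ℕ), insert (p.natDegree + l) S ∩ Finset.range p.natDegree
      = S ∩ Finset.range p.natDegree := by
    intro l S
    rw [Finset.insert_inter_of_notMem (by simp)]
  have hcount : ∀ l, ∑ S ∈ (Finset.range (p.natDegree + l)).powerset,
      (if encSet p (S ∩ Finset.range p.natDegree) = x then (1 : ℝ) else 0) = 2 ^ l := by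
    intro l
    induction l with
    | zero =>
      rw [add_zero, pow_zero, Finset.sum_eq_single (decSet x)]
      · rw [Finset.inter_eq_left.2 (decSet_subset x), if_pos (encSet_decSet x)]
      · intro S hS hne
        have hS := Finset.mem_powerset.1 hS
        rw [Finset.inter_eq_left.2 hS, if_neg]
        rintro rfl
        exact hne (decSet_encSet hS).symm
      · intro h
        exact absurd (Finset.mem_powerset.2 (decSet_subset x)) h
    | succ l ih =>
      rw [← add_assoc, sum_powerset_range_succ]
      simp only [hins, ih]
      ring
  induction l with
  | zero =>
    rw [add_zero, Finset.sum_range_zero, add_zero, Finset.sum_eq_single (decSet x)]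
    · rw [Finset.inter_eq_left.2 (decSet_subset x), if_pos (encSet_decSet x)]
    · intro S hS hne
      have hS := Finset.mem_powerset.1 hS
      rw [Finset.inter_eq_left.2 hS, if_neg]
      rintro rfl
      exact hne (decSet_encSet hS).symm
    · intro h
      exact absurd (Finset.mem_powerset.2 (decSet_subset x)) h
  | succ l ih =>
    rw [← add_assoc, sum_powerset_range_succ, ih, Finset.sum_range_succ, ← hcount l,
      Finset.mul_sum, ← add_assoc]
    congr 1
    refine Finset.sum_congr rfl fun S hS => ?_
    rw [hins, topDigit_insert (Finset.mem_powerset.1 hS)]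
    split_ifs <;> simp

lemma sum_geometric_le {b : ℝ} (hb0 : 0 < b) (hb : 2 * b < 1) (m l : ℕ) :
    ∑ t ∈ Finset.range l, b ^ (m + t + 1) * 2 ^ t ≤ b ^ m * (b / (1 - 2 * b)) := by
  have e : ∀ t, b ^ (m + t + 1) * 2 ^ t = b ^ m * b * (2 * b) ^ t := fun t => by
    rw [mul_pow]; ring
  simp only [e, ← Finset.mul_sum]
  rw [mul_assoc, div_eq_mul_inv]
  have h := Summable.sum_le_tsum (Finset.range l) (fun t _ => by positivity)
    (summable_geometric_of_lt_one (by positivity) hb)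
  rw [tsum_geometric_of_lt_one (by positivity) hb] at h
  gcongr

/-- The tails of all `2 ^ m` residue classes complete the partial geometric sum to the weight of all
nonzero frequencies. -/
lemma sum_geometric_eq {b : ℝ} (hb : 2 * b < 1) (m : ℕ) :
    ∑ t ∈ Finset.range m, b ^ (t + 1) * 2 ^ t + 2 ^ m * (b ^ m * (b / (1 - 2 * b)))
      = b / (1 - 2 * b) := by
  have hb' : 1 - 2 * b ≠ 0 := by linarith
  induction m with
  | zero => simp
  | succ m ih =>
    have e : (2 : ℝ) ^ (m + 1) * (b ^ (m + 1) * (b / (1 - 2 * b))) + b ^ (m + 1) * 2 ^ m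
        = 2 ^ m * (b ^ m * (b / (1 - 2 * b))) := by
      have h := div_mul_cancel₀ b hb'
      linear_combination 2 ^ m * b ^ m * (-h)
    rw [Finset.sum_range_succ]
    linarith

end

end QMC

end

/-! ### The figure of merit, and digits of rational functions -/

noncomputable section

namespace QMC

section

open Polynomial

variable {p : (ZMod 2)[X]} [hpi : Fact (Irreducible p)]

/-! ### The figure of merit of a greedy generating vector -/

/-- Subadditivity gives `1 ≤ (1 - 2b)^κ + (2b)^κ`, and `2^κ ≤ 2`. -/
lemma rpow_geometric_le {b κ : ℝ} (h0 : 0 < κ) (h1 : κ ≤ 1) (hb0 : 0 < b) (hb : 2 * b < 1)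
    (hβ : 2 * b ^ κ < 1) : (b / (1 - 2 * b)) ^ κ ≤ b ^ κ / (1 - 2 * b ^ κ) := by
  have hb1 : 0 < 1 - 2 * b := by linarith
  rw [Real.div_rpow hb0.le hb1.le]
  have e1 := Real.rpow_add_le_add_rpow hb1.le (by positivity : 0 ≤ 2 * b) h0.le h1
  rw [sub_add_cancel, Real.one_rpow, Real.mul_rpow (by norm_num) hb0.le] at e1
  have e2 : (2 : ℝ) ^ κ ≤ 2 := by
    simpa using Real.rpow_le_rpow_of_exponent_le (by norm_num : (1 : ℝ) ≤ 2) h1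
  have e3 : (2 : ℝ) ^ κ * b ^ κ ≤ 2 * b ^ κ :=
    mul_le_mul_of_nonneg_right e2 (Real.rpow_nonneg hb0.le _)
  gcongr
  linarith

/-- The bound on the figure of merit of a generating vector which was chosen component by component,
for all exponents at once. -/
theorem dualSum_sub_one_le_of_greedy {α : ℕ} {b : ℝ} (hb : b = (1 / 2) ^ α)
    {lam : ℝ} (hl1 : 1 ≤ lam) (hlα : lam < α) {q : ℕ → AdjoinRoot p} {D : ℕ}
    (hq0 : ∀ i < D, q i ≠ 0) [DecidableEq (AdjoinRoot p)]
    (hq : ∀ d < D, ∀ y ≠ 0, ∑ k ∈ Finset.univ.erase (0 : AdjoinRoot p),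
        (∏ i ∈ Finset.range d, meritKernel b (q i * k)) * meritKernel b (q d * k)
      ≤ ∑ k ∈ Finset.univ.erase (0 : AdjoinRoot p),
        (∏ i ∈ Finset.range d, meritKernel b (q i * k)) * meritKernel b (y * k)) :
    dualSum (resWeight b (b ^ p.natDegree * (b / (1 - 2 * b)))) q D 0 - 1
      ≤ 4 ^ lam / (2 ^ p.natDegree) ^ lam *
        ((1 + 1 / ((2 : ℝ) ^ ((α : ℝ) / lam) - 2)) ^ D - 1) ^ lam := by
  set m := p.natDegree with hm
  have hm1 : 1 ≤ m := one_le_natDegree_of_irreducible p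
  have hl0 : 0 < lam := by linarith
  set κ := lam⁻¹ with hκ
  have hκ0 : 0 < κ := inv_pos.2 hl0
  have hκ1 : κ ≤ 1 := inv_le_one_of_one_le₀ hl1
  have hb0 : 0 < b := by rw [hb]; positivity
  have hpow : (2 : ℝ) < 2 ^ ((α : ℝ) / lam) := by
    have : (1 : ℝ) < α / lam := by rwa [one_lt_div hl0]
    simpa using Real.rpow_lt_rpow_of_exponent_lt (by norm_num : (1 : ℝ) < 2) this
  have hβ : b ^ κ = ((2 : ℝ) ^ ((α : ℝ) / lam))⁻¹ := by
    rw [hb, ← Real.rpow_natCast, ← Real.rpow_mul (by norm_num), one_div,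
      Real.inv_rpow (by norm_num), hκ, div_eq_mul_inv]
  set β := b ^ κ with hβd
  have hβ0 : 0 < β := Real.rpow_pos_of_pos hb0 _
  have hβ2 : 2 * β < 1 := by
    rw [hβ, ← div_eq_mul_inv, div_lt_one (by linarith)]; exact hpow
  have hb1 : b ≤ 1 := by rw [hb]; exact pow_le_one₀ (by norm_num) (by norm_num)
  have hbβ : b ≤ β := by
    simpa using Real.rpow_le_rpow_of_exponent_ge hb0 hb1 hκ1
  have hb2 : 2 * b < 1 := by linarith
  -- `c` is the total weight of the nonzero frequencies for the base `β`; it is the fraction which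
  -- appears in `Ctilde`.
  set c := β / (1 - 2 * β) with hc
  have hc' : c = 1 / ((2 : ℝ) ^ ((α : ℝ) / lam) - 2) := by
    rw [hc, hβ]
    have : (2 : ℝ) ^ ((α : ℝ) / lam) ≠ 0 := by linarith
    have h2 : (2 : ℝ) ^ ((α : ℝ) / lam) - 2 ≠ 0 := by linarith
    have h3 : 1 - 2 * ((2 : ℝ) ^ ((α : ℝ) / lam))⁻¹ ≠ 0 := by rw [← hβ]; linarith
    field_simp
  have hc0 : 0 < c := div_pos hβ0 (by linarith)
  set T := b ^ m * (b / (1 - 2 * b)) with hT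
  set T' := β ^ m * c with hT'
  have hT0 : 0 ≤ T := mul_nonneg (by positivity) (div_nonneg hb0.le (by linarith))
  set N : ℝ := ((Finset.univ.erase (0 : AdjoinRoot p)).card : ℝ) with hN
  have hN' : N = 2 ^ m - 1 := by
    rw [hN, Finset.card_erase_of_mem (Finset.mem_univ _), Finset.card_univ, card_adjoinRoot,
      Nat.cast_sub Nat.one_le_two_pow]
    simp [hm]
  have h2m : (2 : ℝ) ≤ 2 ^ m := by
    simpa using pow_le_pow_right₀ (by norm_num : (1 : ℝ) ≤ 2) hm1
  have hN0 : 0 < N := by rw [hN']; linarith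
  have hpowκ : ∀ t : ℕ, (b ^ t) ^ κ = β ^ t := fun t => by
    rw [hβd, ← Real.rpow_natCast, ← Real.rpow_natCast, ← Real.rpow_mul hb0.le,
      ← Real.rpow_mul hb0.le, mul_comm]
  have hTT : T ^ κ ≤ T' := by
    rw [hT, Real.mul_rpow (by positivity) (div_nonneg hb0.le (by linarith)), hpowκ]
    exact mul_le_mul_of_nonneg_left (rpow_geometric_le hκ0 hκ1 hb0 hb2 hβ2) (by positivity)
  have hRn : ∀ x : AdjoinRoot p, 0 ≤ resWeight b T x := fun x =>
    add_nonneg (pow_nonneg hb0.le _) hT0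
  have hRR : ∀ x ≠ (0 : AdjoinRoot p), resWeight b T x ^ κ ≤ resWeight β T' x := by
    intro x _
    refine (Real.rpow_add_le_add_rpow (pow_nonneg hb0.le _) hT0 hκ0.le hκ1).trans ?_
    rw [hpowκ]
    exact add_le_add le_rfl hTT
  have hcsum : T' + ∑ x ∈ Finset.univ.erase (0 : AdjoinRoot p), resWeight β T' x = c := by
    have h1 : ∑ x : AdjoinRoot p, resWeight β T' x = 1 + c := by
      simp only [resWeight, Finset.sum_add_distrib, Finset.sum_const, Finset.card_univ,
        card_adjoinRoot, nsmul_eq_mul]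
      have h2 := sum_geometric_eq hβ2 m
      rw [← hc, ← hT'] at h2
      rw [sum_pow_topDigit]
      push_cast
      rw [← hm]
      linarith
    rw [← Finset.add_sum_erase _ _ (Finset.mem_univ (0 : AdjoinRoot p)), resWeight_zero] at h1
    linarith
  have hTc : T' ≤ c / N := by
    rw [le_div_iff₀ hN0, hT', hN']
    have e1 : (2 * β) ^ m ≤ 1 := pow_le_one₀ (by positivity) hβ2.le
    rw [mul_pow] at e1
    have e2 : 0 < β ^ m := by positivity
    nlinarith
  -- The dual sum as a character sum over `k`: the term `k = 0` is the same for every candidate, and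
  -- in all others the weights collapse to the kernel because `q i * k` and `y * k` are nonzero.
  -- Hence minimizing the kernel sums minimizes the dual sum.
  have hkey : ∀ d ≤ D, ∀ y : AdjoinRoot p, y ≠ 0 → (2 : ℝ) ^ m *
      (∑ x : AdjoinRoot p, resWeight b T x * dualSum (resWeight b T) q d (0 - x * y))
      = (∑ x : AdjoinRoot p, resWeight b T x) ^ (d + 1) + ∑ k ∈ Finset.univ.erase (0 : AdjoinRoot p),
        (∏ i ∈ Finset.range d, meritKernel b (q i * k)) * meritKernel b (y * k) := by
    intro d hd y hy
    have e1 := dualSum_zero_eq (R := resWeight b T) (q := Function.update q d y)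
      (isPrimitive_fieldChar (p := p)) (d + 1)
    have e2 : dualSum (resWeight b T) (Function.update q d y) (d + 1) 0
        = ∑ x : AdjoinRoot p, resWeight b T x * dualSum (resWeight b T) q d (0 - x * y) := by
      simp only [dualSum, Function.update_self]
      refine Finset.sum_congr rfl fun x _ => ?_
      rw [dualSum_congr fun i hi => Function.update_of_ne hi.ne _ _]
    rw [e2, card_adjoinRoot] at e1
    push_cast at e1
    rw [← hm] at e1
    refine (e1.trans (Finset.add_sum_erase _ _ (Finset.mem_univ (0 : AdjoinRoot p))).symm).trans ?_
    congr 1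
    · simp
    · refine Finset.sum_congr rfl fun k hk => ?_
      have hk0 : k ≠ 0 := (Finset.mem_erase.1 hk).1
      rw [Finset.prod_range_succ, Function.update_self]
      congr 1
      · refine Finset.prod_congr rfl fun i hi => ?_
        have hi := Finset.mem_range.1 hi
        rw [Function.update_of_ne hi.ne,
          ← sum_resWeight_mul_char b T (mul_ne_zero (hq0 i (by omega)) hk0)]
        simp only [mul_assoc]
      · rw [← sum_resWeight_mul_char b T (mul_ne_zero hy hk0)]
        simp only [mul_assoc]
  have hmain := dualSum_greedy_rpow_le (R := resWeight b T) (R' := resWeight β T') (q := q)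
    hκ0 hκ1 hRn hRR hT0 hTT (resWeight_zero b T) (resWeight_zero β T') hN hN0 hcsum hTc (D := D)
    (fun d hd y hy => by
      have h2 : (0 : ℝ) < 2 ^ m := by positivity
      refine le_of_mul_le_mul_left ?_ h2
      rw [hkey d hd.le _ (hq0 d hd), hkey d hd.le y hy]
      have := hq d hd y hy
      linarith)
  have hA1 : 0 ≤ dualSum (resWeight b T) q D 0 - 1 := by
    linarith [one_le_dualSum_zero (q := q) hRn (by rw [resWeight_zero]; linarith) D]
  have hG0 : 0 ≤ (1 + c) ^ D - 1 := by
    linarith [one_le_pow₀ (by linarith : (1 : ℝ) ≤ 1 + c) (n := D)]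
  -- `N = 2 ^ m - 1` is at least `2 ^ m / 4`, which is the origin of the factor `4 ^ lam`.
  have h3 : (dualSum (resWeight b T) q D 0 - 1) ^ κ ≤ 4 / 2 ^ m * ((1 + c) ^ D - 1) := by
    refine hmain.trans ?_
    rw [div_eq_mul_inv, mul_comm]
    refine mul_le_mul_of_nonneg_right ?_ hG0
    rw [inv_le_iff_one_le_mul₀ hN0, hN', div_mul_eq_mul_div, le_div_iff₀ (by positivity)]
    linarith
  have h4 := Real.rpow_le_rpow (Real.rpow_nonneg hA1 κ) h3 hl0.le
  rw [← Real.rpow_mul hA1, hκ, inv_mul_cancel₀ hl0.ne', Real.rpow_one,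
    Real.mul_rpow (by positivity) hG0, Real.div_rpow (by norm_num) (by positivity), hc'] at h4
  exact h4

end

/-! ### Natural numbers as polynomials -/

section

open Polynomial

lemma coeff_polyOfNat (k i : ℕ) : (polyOfNat k).coeff i = if k.testBit i then 1 else 0 := by
  unfold polyOfNat
  rw [finsetSum_coeff]
  have : ∀ j, ((if k.testBit j then (X : (ZMod 2)[X]) ^ j else 0) : (ZMod 2)[X]).coeff i
      = if j = i then (if k.testBit i then 1 else 0) else 0 := by
    intro j
    by_cases hj : j = i
    · subst hj
      by_cases h : k.testBit j <;> simp [h]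
    · rw [if_neg hj]
      split_ifs
      · rw [coeff_X_pow, if_neg (Ne.symm hj)]
      · simp
  simp only [this, Finset.sum_ite_eq', Finset.mem_range]
  by_cases h2 : k.testBit i
  · rw [if_pos (Nat.lt_size.2 (Nat.ge_two_pow_of_testBit h2))]
  · simp [h2]

lemma polyOfNat_injective : Function.Injective polyOfNat := by
  intro a b h
  refine Nat.eq_of_testBit_eq fun i => ?_
  have := congrArg (fun f => f.coeff i) h
  simp only [coeff_polyOfNat] at this
  by_cases ha : a.testBit i <;> by_cases hb : b.testBit i <;> simp_all

lemma polyOfNat_zero : polyOfNat 0 = 0 := by ext i; simp [coeff_polyOfNat]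

lemma polyOfNat_eq_zero_iff {k : ℕ} : polyOfNat k = 0 ↔ k = 0 := by
  rw [← polyOfNat_zero]; exact polyOfNat_injective.eq_iff

lemma degree_polyOfNat_lt_iff {k m : ℕ} : (polyOfNat k).degree < m ↔ k < 2 ^ m := by
  rw [degree_lt_iff_coeff_zero]
  constructor
  · intro h
    refine Nat.lt_pow_two_of_testBit k fun i hi => ?_
    have := h i hi
    rw [coeff_polyOfNat] at this
    by_contra hb
    rw [Bool.not_eq_false] at hb
    simp [hb] at this
  · intro h i hi
    rw [coeff_polyOfNat, Nat.testBit_lt_two_pow (h.trans_le (Nat.pow_le_pow_right two_pos hi))]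
    simp

lemma exists_polyOfNat_eq (f : (ZMod 2)[X]) : ∃ k, polyOfNat k = f := by
  have hcard : ∀ m : ℕ, f.degree < m → ∃ k, polyOfNat k = f := by
    intro m hm
    refine ⟨∑ i ∈ f.support, 2 ^ i, ?_⟩
    have h : ∀ a : ZMod 2, a ≠ 0 → a = 1 := by decide
    ext i
    rw [coeff_polyOfNat]
    have key : (∑ i ∈ f.support, 2 ^ i).testBit i = decide (i ∈ f.support) := by
      rw [Bool.eq_iff_iff, ← Nat.mem_bitIndices, decide_eq_true_iff, ← List.mem_toFinset,
        Finset.toFinset_bitIndices_sum_two_pow]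
    rw [key]
    by_cases hi : i ∈ f.support
    · simp only [hi, decide_true, if_true]
      exact (h _ (mem_support_iff.1 hi)).symm
    · simp only [hi, decide_false]
      exact (notMem_support_iff.1 hi).symm
  exact hcard (f.natDegree + 1) (degree_le_natDegree.trans_lt (by exact_mod_cast Nat.lt_succ_self _))

variable {p : (ZMod 2)[X]} [hpi : Fact (Irreducible p)]

variable (p) in
/-- The residue class of the polynomial identified with a natural number. -/
def encNat (k : ℕ) : AdjoinRoot p := AdjoinRoot.mk p (polyOfNat k)

lemma rep_encNat {k : ℕ} (hk : k < 2 ^ p.natDegree) : rep (encNat p k) = polyOfNat k := by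
  rw [encNat, rep_mk, modByMonic_eq_self_iff (monic_of_irreducible p),
    degree_eq_natDegree hpi.out.ne_zero]
  exact degree_polyOfNat_lt_iff.2 hk

lemma encNat_injOn {a b : ℕ} (ha : a < 2 ^ p.natDegree) (hb : b < 2 ^ p.natDegree)
    (h : encNat p a = encNat p b) : a = b := by
  have := congrArg rep h
  rw [rep_encNat ha, rep_encNat hb] at this
  exact polyOfNat_injective this

lemma encNat_zero : encNat p 0 = 0 := by simp [encNat, polyOfNat_zero]

lemma encNat_bijective :
    Function.Bijective fun k : Fin (2 ^ p.natDegree) => encNat p k := by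
  rw [Fintype.bijective_iff_injective_and_card]
  refine ⟨fun a b h => Fin.ext (encNat_injOn a.2 b.2 h), ?_⟩
  rw [card_adjoinRoot, Fintype.card_fin]

lemma exists_encNat_eq (x : AdjoinRoot p) : ∃ k < 2 ^ p.natDegree, encNat p k = x := by
  obtain ⟨k, hk⟩ := encNat_bijective.2 x
  exact ⟨k, k.2, hk⟩

lemma sum_encNat {M : Type*} [AddCommMonoid M] (f : AdjoinRoot p → M) :
    ∑ k ∈ Finset.range (2 ^ p.natDegree), f (encNat p k) = ∑ x, f x := by
  rw [Finset.sum_range]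
  exact encNat_bijective.sum_comp f

/-! ### Laurent expansions of rational functions -/

lemma toLaurentInv_monomial (n : ℕ) (a : ZMod 2) :
    toLaurentInv (monomial n a) = HahnSeries.single (-(n : ℤ)) a := by
  rw [toLaurentInv, aeval_monomial, HahnSeries.single_pow]
  have : algebraMap (ZMod 2) (LaurentSeries (ZMod 2)) a = HahnSeries.single (0 : ℤ) a := by
    exact RingHom.congr_fun (Subsingleton.elim (algebraMap (ZMod 2) (LaurentSeries (ZMod 2)))
      (HahnSeries.C : ZMod 2 →+* HahnSeries ℤ (ZMod 2))) a
  rw [this, HahnSeries.single_mul_single]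
  simp

lemma coeff_toLaurentInv (f : (ZMod 2)[X]) (j : ℤ) :
    (toLaurentInv f).coeff j = if j ≤ 0 then f.coeff (-j).toNat else 0 := by
  induction f using Polynomial.induction_on' with
  | add f g hf hg =>
    have : toLaurentInv (f + g) = toLaurentInv f + toLaurentInv g := by simp [toLaurentInv]
    rw [this, HahnSeries.coeff_add, hf, hg]
    split_ifs <;> simp
  | monomial n a =>
    rw [toLaurentInv_monomial, HahnSeries.coeff_single, coeff_monomial]
    by_cases h : j = -(n : ℤ)
    · subst h; simp
    · rw [if_neg h]
      split_ifs with h1 h2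
      · exact absurd (by omega : j = -(n : ℤ)) h
      · rfl
      · rfl

lemma toLaurentInv_ne_zero {f : (ZMod 2)[X]} (hf : f ≠ 0) : toLaurentInv f ≠ 0 := by
  intro h
  have := coeff_toLaurentInv f (-(f.natDegree : ℤ))
  rw [h] at this
  simp only [HahnSeries.coeff_zero, neg_neg, Int.toNat_natCast, coeff_natDegree,
    Left.neg_nonpos_iff, Nat.cast_nonneg, if_true] at this
  exact leadingCoeff_ne_zero.2 hf this.symm

lemma order_toLaurentInv {f : (ZMod 2)[X]} (hf : f ≠ 0) :
    (toLaurentInv f).order = -(f.natDegree : ℤ) := by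
  have h0 := toLaurentInv_ne_zero hf
  refine le_antisymm (HahnSeries.order_le_of_coeff_ne_zero ?_) ?_
  · rw [coeff_toLaurentInv]
    simp [hf]
  · have h1 := mt HahnSeries.coeff_order_eq_zero.1 h0
    rw [coeff_toLaurentInv] at h1
    split_ifs at h1 with h2
    · have := le_natDegree_of_ne_zero h1
      omega
    · exact absurd rfl h1

/-- The quotient of the division with remainder has no coefficient at `x⁻¹`. The order of the
remaining proper fraction is the difference of the degrees, so its coefficient there is nonzero,
hence one, exactly if the remainder has the largest possible degree. -/
lemma coeff_one_div (f : (ZMod 2)[X]) :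
    (toLaurentInv f / toLaurentInv p).coeff 1 = (f %ₘ p).coeff (p.natDegree - 1) := by
  have hp0 := hpi.out.ne_zero
  have hm1 := one_le_natDegree_of_irreducible p
  have hP := toLaurentInv_ne_zero hp0
  have hdecomp : toLaurentInv f / toLaurentInv p
      = toLaurentInv (f /ₘ p) + toLaurentInv (f %ₘ p) / toLaurentInv p := by
    have h1 : toLaurentInv f
        = toLaurentInv (f %ₘ p) + toLaurentInv p * toLaurentInv (f /ₘ p) := by
      conv_lhs => rw [← modByMonic_add_div f p]
      simp [toLaurentInv]
    rw [h1]
    field_simp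
    ring
  rw [hdecomp, HahnSeries.coeff_add, coeff_toLaurentInv, if_neg (by norm_num), zero_add]
  have hdeg := natDegree_modByMonic_lt f (monic_of_irreducible p) hpi.out.ne_one
  set r := f %ₘ p with hr
  rcases eq_or_ne r 0 with h0 | h0
  · rw [h0]; simp [toLaurentInv]
  set u := toLaurentInv r / toLaurentInv p with hu
  have hu0 : u ≠ 0 := div_ne_zero (toLaurentInv_ne_zero h0) hP
  have hmul : u * toLaurentInv p = toLaurentInv r := div_mul_cancel₀ _ hP
  have hord := HahnSeries.order_mul hu0 hP
  rw [hmul, order_toLaurentInv h0, order_toLaurentInv hp0] at hord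
  have h2 : ∀ a : ZMod 2, a ≠ 0 → a = 1 := by decide
  rcases eq_or_ne r.natDegree (p.natDegree - 1) with h | h
  · have h3 : u.order = 1 := by omega
    have h4 := mt HahnSeries.coeff_order_eq_zero.1 hu0
    rw [h3] at h4
    rw [h2 _ h4, ← h, coeff_natDegree, h2 _ (leadingCoeff_ne_zero.2 h0)]
  · rw [HahnSeries.coeff_eq_zero_of_lt_order (by omega),
      coeff_eq_zero_of_natDegree_lt (by omega)]

/-- The digits of the points of a polynomial lattice. -/
lemma coeff_div (f : (ZMod 2)[X]) (c : ℕ) :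
    (toLaurentInv f / toLaurentInv p).coeff (c + 1)
      = ((X ^ c * f) %ₘ p).coeff (p.natDegree - 1) := by
  rw [← coeff_one_div]
  have h1 : toLaurentInv (X ^ c * f) = HahnSeries.single (-(c : ℤ)) 1 * toLaurentInv f := by
    have h2 : toLaurentInv (X ^ c) = HahnSeries.single (-(c : ℤ)) 1 := by
      rw [X_pow_eq_monomial, toLaurentInv_monomial]
    rw [← h2]
    simp [toLaurentInv]
  rw [h1, mul_div_assoc]
  have := HahnSeries.coeff_single_mul_add (r := (1 : ZMod 2))
    (x := toLaurentInv f / toLaurentInv p) (a := (c + 1 : ℤ)) (b := -(c : ℤ))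
  rw [show (c + 1 : ℤ) + -(c : ℤ) = 1 by ring, one_mul] at this
  exact this.symm

lemma sgn_coeff_div (f : (ZMod 2)[X]) (c : ℕ) :
    sgn ((toLaurentInv f / toLaurentInv p).coeff (c + 1))
      = fieldChar (AdjoinRoot.root p ^ c * AdjoinRoot.mk p f) := by
  rw [coeff_div, ← fieldChar_mk]
  simp

end

end QMC

end

/-! ### Digit interlacing and the product form of the weights -/

noncomputable section

namespace QMC

/-! ### Numbers with prescribed binary digits -/

/-- The number in `[0,1)` whose first `M` binary digits are `e 0, …, e (M-1)`. -/
def binNum (M : ℕ) (e : ℕ → ZMod 2) : ℝ := ∑ c ∈ Finset.range M, ((e c).val : ℝ) / 2 ^ (c + 1)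

lemma binNum_succ (M : ℕ) (e : ℕ → ZMod 2) :
    binNum (M + 1) e = ((e 0).val : ℝ) / 2 + binNum M (fun c => e (c + 1)) / 2 := by
  unfold binNum
  rw [Finset.sum_range_succ', Finset.sum_div, zero_add, pow_one, add_comm]
  congr 1
  refine Finset.sum_congr rfl fun c _ => ?_
  rw [pow_succ _ (c + 1), div_div]

lemma val_eq_zero_or_one (a : ZMod 2) :
    (a.val : ℝ) = 0 ∧ sgn a = 1 ∨ (a.val : ℝ) = 1 ∧ sgn a = -1 := by
  have h : ∀ a : ZMod 2, a = 0 ∨ a = 1 := by decide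
  rcases h a with rfl | rfl
  · left; simp [sgn_zero]
  · right; rw [sgn_one, ZMod.val_one]; simp

lemma binNum_mem_Ico (M : ℕ) (e : ℕ → ZMod 2) : binNum M e ∈ Set.Ico (0 : ℝ) 1 := by
  induction M generalizing e with
  | zero => simp [binNum]
  | succ M ih =>
    have h := ih fun c => e (c + 1)
    rw [binNum_succ]
    rcases val_eq_zero_or_one (e 0) with ⟨h0, -⟩ | ⟨h0, -⟩ <;> rw [h0] <;>
      constructor <;> linarith [h.1, h.2]

/-- Doubling drops the first digit, and `rad` has period one. Beyond the `M` prescribed digits all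
digits are zero, hence the value `1`. -/
lemma rad_binNum (a M : ℕ) (e : ℕ → ZMod 2) :
    rad a (binNum M e) = if a < M then sgn (e a) else 1 := by
  induction a generalizing M e with
  | zero =>
    cases M with
    | zero => rw [if_neg (lt_irrefl _)]; exact rad_zero_left (by simp [binNum]) (by simp [binNum])
    | succ M =>
      have h := binNum_mem_Ico M fun c => e (c + 1)
      rw [if_pos (Nat.succ_pos _), binNum_succ]
      rcases val_eq_zero_or_one (e 0) with ⟨h0, h1⟩ | ⟨h0, h1⟩ <;> rw [h0, h1]
      · exact rad_zero_left (by linarith [h.1]) (by linarith [h.2])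
      · exact rad_zero_right (by linarith [h.1]) (by linarith [h.2])
  | succ a ih =>
    cases M with
    | zero =>
      have := ih 0 e
      rw [rad_succ]
      simpa [binNum] using this
    | succ M =>
      have h2 : 2 * binNum (M + 1) e = binNum M (fun c => e (c + 1)) + ((e 0).val : ℝ) := by
        rw [binNum_succ]; ring
      have h3 : rad a (2 * binNum (M + 1) e) = rad a (binNum M fun c => e (c + 1)) := by
        rw [h2]
        rcases val_eq_zero_or_one (e 0) with ⟨h0, -⟩ | ⟨h0, -⟩ <;> rw [h0]
        · rw [add_zero]
        · exact rad_add_one _ _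
      rw [rad_succ, h3, ih]
      simp

lemma binDigit_succ (i : ℕ) (y : ℝ) : binDigit (i + 1) y = (1 - rad i y) / 2 := by
  unfold binDigit rad
  split_ifs with h
  · rw [Int.even_iff.1 h]; norm_num
  · rw [Int.not_even_iff.1 h]; norm_num

lemma binDigit_binNum (i M : ℕ) (e : ℕ → ZMod 2) :
    binDigit (i + 1) (binNum M e) = if i < M then ((e i).val : ℝ) else 0 := by
  rw [binDigit_succ, rad_binNum]
  split_ifs
  · rcases val_eq_zero_or_one (e i) with ⟨h0, h1⟩ | ⟨h0, h1⟩ <;> rw [h0, h1] <;> norm_num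
  · norm_num

@[to_additive]
lemma prod_range_eq_prod_prod {M : Type*} [CommMonoid M] (α n : ℕ) (f : ℕ → M) :
    ∏ c ∈ Finset.range (α * n), f c
      = ∏ a ∈ Finset.range n, ∏ i ∈ Finset.range α, f (α * a + i) := by
  induction n with
  | zero => simp
  | succ n ih => rw [Nat.mul_succ, Finset.prod_range_add, ih, Finset.prod_range_succ]

lemma mul_add_div_of_lt {α a i : ℕ} (hi : i < α) : (α * a + i) / α = a := by
  rw [Nat.mul_add_div (by omega), Nat.div_eq_of_lt hi, add_zero]

lemma mul_add_mod_of_lt {α a i : ℕ} (hi : i < α) : (α * a + i) % α = i := by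
  rw [Nat.mul_add_mod, Nat.mod_eq_of_lt hi]

/-- Interlacing interlaces the binary digits. -/
lemma interlace_binNum {α : ℕ} (M : ℕ) (e : ℕ → ℕ → ZMod 2) :
    interlace (fun i : Fin α => binNum M (e i)) = binNum (α * M) fun c => e (c % α) (c / α) := by
  unfold interlace
  simp only [binDigit_binNum]
  rw [tsum_eq_sum (s := Finset.range M)]
  · rw [binNum, sum_range_eq_sum_sum]
    refine Finset.sum_congr rfl fun a ha => ?_
    rw [Finset.sum_range]
    refine Finset.sum_congr rfl fun i _ => ?_
    rw [if_pos (Finset.mem_range.1 ha), mul_add_div_of_lt i.2, mul_add_mod_of_lt i.2, add_assoc]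
  · intro a ha
    refine Finset.sum_eq_zero fun i _ => ?_
    rw [if_neg (by simpa using ha), zero_div]

/-! ### Splitting frequencies into the frequencies of the components -/

/-- The digit positions of the `i`-th component of a number with digits in the positions `S` which
was obtained by interlacing `α` components. -/
def deinterlace (α : ℕ) (S : Finset ℕ) (i : ℕ) : Finset ℕ :=
  (S.filter fun c => c % α = i).image (· / α)

lemma deinterlace_empty (α i : ℕ) : deinterlace α ∅ i = ∅ := rfl

lemma mem_deinterlace {α i : ℕ} (hi : i < α) {S : Finset ℕ} {a : ℕ} :
    a ∈ deinterlace α S i ↔ α * a + i ∈ S := by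
  unfold deinterlace
  rw [Finset.mem_image]
  constructor
  · rintro ⟨c, hc, rfl⟩
    rw [Finset.mem_filter] at hc
    rw [← hc.2, Nat.div_add_mod]
    exact hc.1
  · intro h
    exact ⟨α * a + i, Finset.mem_filter.2 ⟨h, mul_add_mod_of_lt hi⟩, mul_add_div_of_lt hi⟩

lemma deinterlace_subset {α i M : ℕ} (hi : i < α) {S : Finset ℕ}
    (hS : S ⊆ Finset.range (α * M)) : deinterlace α S i ⊆ Finset.range M := by
  intro a ha
  have h := hS ((mem_deinterlace hi).1 ha)
  rw [Finset.mem_range] at h ⊢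
  by_contra! h2
  have := Nat.mul_le_mul_left α h2
  omega

lemma prod_deinterlace {N : Type*} [CommMonoid N] {α M : ℕ} {S : Finset ℕ}
    (hS : S ⊆ Finset.range (α * M)) (f : ℕ → ℕ → N) :
    ∏ c ∈ S, f (c % α) (c / α) = ∏ i ∈ Finset.range α, ∏ a ∈ deinterlace α S i, f i a := by
  have h1 : ∏ c ∈ S, f (c % α) (c / α)
      = ∏ c ∈ Finset.range (α * M), if c ∈ S then f (c % α) (c / α) else 1 := by
    rw [← Finset.prod_filter, Finset.filter_mem_eq_inter, Finset.inter_eq_right.2 hS]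
  rw [h1, prod_range_eq_prod_prod, Finset.prod_comm]
  refine Finset.prod_congr rfl fun i hi => ?_
  have hi := Finset.mem_range.1 hi
  rw [← Finset.inter_eq_right.2 (deinterlace_subset hi hS), ← Finset.filter_mem_eq_inter,
    Finset.prod_filter]
  refine Finset.prod_congr rfl fun a _ => ?_
  simp only [mem_deinterlace hi, mul_add_div_of_lt hi, mul_add_mod_of_lt hi]

/-- Subsets of `range (α * M)` correspond bijectively to families of `α` subsets of `range M`. -/
lemma sum_prod_deinterlace (α M : ℕ) (h : ℕ → Finset ℕ → ℝ) :
    ∑ S ∈ (Finset.range (α * M)).powerset, ∏ i ∈ Finset.range α, h i (deinterlace α S i)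
      = ∏ i ∈ Finset.range α, ∑ T ∈ (Finset.range M).powerset, h i T := by
  rw [Finset.prod_range (fun i => ∑ T ∈ (Finset.range M).powerset, h i T), Finset.prod_univ_sum]
  refine Finset.sum_bij' (fun S _ => fun i : Fin α => deinterlace α S i)
    (fun T _ => (Finset.range (α * M)).filter fun c => ∃ hc : c % α < α, c / α ∈ T ⟨c % α, hc⟩)
    ?_ ?_ ?_ ?_ ?_
  · intro S hS
    rw [Fintype.mem_piFinset]
    exact fun i => Finset.mem_powerset.2 (deinterlace_subset i.2 (Finset.mem_powerset.1 hS))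
  · intro T _
    exact Finset.mem_powerset.2 (Finset.filter_subset _ _)
  · intro S hS
    have hS := Finset.mem_powerset.1 hS
    ext c
    rw [Finset.mem_filter]
    constructor
    · rintro ⟨-, hc, h⟩
      rw [mem_deinterlace hc, Nat.div_add_mod] at h
      exact h
    · intro hc
      have h1 := hS hc
      have hα : 0 < α := by
        rcases Nat.eq_zero_or_pos α with rfl | h
        · simp at h1
        · exact h
      refine ⟨h1, Nat.mod_lt _ hα, ?_⟩
      rw [mem_deinterlace (Nat.mod_lt _ hα), Nat.div_add_mod]
      exact hc
  · intro T hT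
    rw [Fintype.mem_piFinset] at hT
    funext i
    ext a
    have hdiv := mul_add_div_of_lt (a := a) i.2
    have hmod := mul_add_mod_of_lt (a := a) i.2
    rw [mem_deinterlace i.2, Finset.mem_filter, hdiv]
    have e : ∀ hc : (α * a + i) % α < α, (⟨(α * a + i) % α, hc⟩ : Fin α) = i :=
      fun hc => Fin.ext hmod
    constructor
    · rintro ⟨-, hc, h⟩
      rwa [e] at h
    · intro h
      refine ⟨?_, by rw [hmod]; exact i.2, by rwa [e]⟩
      have h2 := Finset.mem_powerset.1 (hT i) h
      rw [Finset.mem_range] at h2 ⊢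
      have := Nat.mul_le_mul_left α h2
      have := i.2
      rw [Nat.mul_succ] at *
      omega
  · intro S _
    rw [Finset.prod_range]

/-- The decay of Walsh coefficients in terms of the frequencies of the components. -/
lemma exists_subset_sum_ge (α : ℕ) (S : Finset ℕ) :
    ∃ U ⊆ S, U.card ≤ α ∧
      α * ∑ i ∈ Finset.range α, topDigit (deinterlace α S i)
        ≤ ∑ c ∈ U, (c + 1) + α * (α - 1) / 2 := by
  set A := (Finset.range α).filter fun i => (deinterlace α S i).Nonempty with hA
  have hinj : Set.InjOn (fun i => α * (topDigit (deinterlace α S i) - 1) + i) A := by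
    intro i hi j hj h
    have hi' : i < α := by simp [hA] at hi; exact hi.1
    have hj' : j < α := by simp [hA] at hj; exact hj.1
    have := congrArg (· % α) h
    simpa only [mul_add_mod_of_lt hi', mul_add_mod_of_lt hj'] using this
  have htop : ∀ {T : Finset ℕ}, T.Nonempty → ∃ t ∈ T, topDigit T = t + 1 := fun hT =>
    Finset.exists_mem_eq_sup _ hT _
  -- `U` collects the top digit of each nonempty component, at the position it has after
  -- interlacing.
  refine ⟨A.image fun i => α * (topDigit (deinterlace α S i) - 1) + i, ?_, ?_, ?_⟩
  · intro c hc
    obtain ⟨i, hi, rfl⟩ := Finset.mem_image.1 hc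
    rw [hA, Finset.mem_filter, Finset.mem_range] at hi
    obtain ⟨t, ht, h⟩ := htop hi.2
    rw [h, Nat.add_sub_cancel]
    exact (mem_deinterlace hi.1).1 ht
  · refine Finset.card_image_le.trans ((Finset.card_filter_le _ _).trans ?_)
    rw [Finset.card_range]
  -- A top digit `t` of component `i` contributes `α * t + i + 1` in place of `α * (t + 1)`. The
  -- defect `α - 1 - i` is matched by summing `0, …, α - 1` in reversed order.
  · rw [Finset.sum_image hinj, hA, Finset.sum_filter, ← Finset.sum_range_id,
      ← Finset.sum_range_reflect (fun i => i), ← Finset.sum_add_distrib, Finset.mul_sum]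
    refine Finset.sum_le_sum fun i hi => ?_
    have hi := Finset.mem_range.1 hi
    split_ifs with h
    · obtain ⟨t, -, ht⟩ := htop h
      rw [ht, Nat.add_sub_cancel, Nat.mul_succ]
      omega
    · rw [Finset.not_nonempty_iff_eq_empty.1 h]
      simp [topDigit]

/-- The majorant of the Walsh coefficients. -/
def walshWeight (α : ℕ) {s : ℕ} (S : Fin s → Finset ℕ) : ℝ :=
  ∏ j, (2 ^ (α * (α - 1) / 2) *
    ∏ i ∈ Finset.range α, ((1 / 2 : ℝ) ^ α) ^ topDigit (deinterlace α (S j) i))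

lemma exists_prod_le_walshWeight (α : ℕ) {s : ℕ} (S : Fin s → Finset ℕ) :
    ∃ U : Fin s → Finset ℕ, (∀ j, U j ⊆ S j) ∧ (∀ j, (U j).card ≤ α) ∧
      ∏ j, (1 / 2 : ℝ) ^ (∑ i ∈ U j, (i + 1)) ≤ walshWeight α S := by
  choose U hU hc hle using fun j => exists_subset_sum_ge α (S j)
  refine ⟨U, hU, hc, Finset.prod_le_prod (fun _ _ => by positivity) fun j _ => ?_⟩
  have h1 : ∏ i ∈ Finset.range α, ((1 / 2 : ℝ) ^ α) ^ topDigit (deinterlace α (S j) i)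
      = (1 / 2) ^ (α * ∑ i ∈ Finset.range α, topDigit (deinterlace α (S j) i)) := by
    rw [Finset.prod_pow_eq_pow_sum, ← pow_mul]
  rw [h1]
  have h2 := pow_le_pow_of_le_one (by norm_num : (0 : ℝ) ≤ 1 / 2) (by norm_num) (hle j)
  have h3 : (2 : ℝ) ^ (α * (α - 1) / 2) * (1 / 2) ^ (α * (α - 1) / 2) = 1 := by
    rw [← mul_pow]; norm_num
  calc (1 / 2 : ℝ) ^ (∑ i ∈ U j, (i + 1))
      = 2 ^ (α * (α - 1) / 2) * (1 / 2) ^ (∑ i ∈ U j, (i + 1) + α * (α - 1) / 2) := by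
        rw [pow_add, mul_left_comm, h3, mul_one]
    _ ≤ _ := mul_le_mul_of_nonneg_left h2 (by positivity)

end QMC

end

/-! ### The worst-case error as a sum over the dual lattice -/

noncomputable section

namespace QMC

section

open Polynomial Filter

variable {p : (ZMod 2)[X]}

/-! ### The worst-case error of interlaced polynomial lattice rules -/

variable (p) in
/-- The residue classes of the components of a generating vector. -/
def genClass {D : ℕ} (q : Fin D → (ZMod 2)[X]) (l : ℕ) : AdjoinRoot p :=
  AdjoinRoot.mk p (if h : l < D then q ⟨l, h⟩ else 0)

lemma vartheta_eq_binNum (m : ℕ) (w : LaurentSeries (ZMod 2)) :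
    vartheta m w = binNum m fun c => w.coeff (c + 1) := by
  unfold vartheta binNum
  rw [← Finset.Ico_add_one_right_eq_Icc, Finset.sum_Ico_eq_sum_range]
  refine Finset.sum_congr rfl fun c _ => ?_
  rw [add_comm]; norm_cast

lemma iplrPoint_eq_binNum {α s : ℕ} (m : ℕ) (q : Fin (s * α) → (ZMod 2)[X]) (k : ℕ)
    (j : Fin s) :
    iplrPoint m p q k j = binNum (α * m) fun c =>
      (toLaurentInv (polyOfNat k *
        if h : α * j + c % α < s * α then q ⟨α * j + c % α, h⟩ else 0) /
          toLaurentInv p).coeff ((c / α : ℕ) + 1) := by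
  rw [iplrPoint, interlaceVec, ← interlace_binNum (α := α) m fun i c =>
      (toLaurentInv (polyOfNat k *
        if h : α * j + i < s * α then q ⟨α * j + i, h⟩ else 0) / toLaurentInv p).coeff (c + 1)]
  congr 1
  funext i
  rw [polyLatticePoint, vartheta_eq_binNum]
  have h : α * (j : ℕ) + i < s * α := by
    have := (finProdFinEquiv (j, i)).2
    rw [finProdFinEquiv_apply_val] at this
    simpa [add_comm] using this
  have e : finProdFinEquiv (j, i) = ⟨α * (j : ℕ) + i, h⟩ :=
    Fin.ext (by rw [finProdFinEquiv_apply_val, add_comm])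
  rw [e, dif_pos h]

lemma iplrPoint_mem_Ico {α s : ℕ} (m : ℕ) (q : Fin (s * α) → (ZMod 2)[X]) (k : ℕ) (j : Fin s) :
    iplrPoint m p q k j ∈ Set.Ico (0 : ℝ) 1 := by
  rw [iplrPoint_eq_binNum]
  exact binNum_mem_Ico _ _

variable [hpi : Fact (Irreducible p)]

/-- Each component of a point has only `p.natDegree` binary digits, so higher digits of a frequency
have no effect. -/
lemma wal_iplrPoint {α s : ℕ} (hα : 0 < α) (q : Fin (s * α) → (ZMod 2)[X]) (k : ℕ)
    (j : Fin s) {M : ℕ} {S : Finset ℕ} (hS : S ⊆ Finset.range (α * M)) :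
    wal S (iplrPoint p.natDegree p q k j) = ∏ i ∈ Finset.range α,
      fieldChar (encSet p (deinterlace α S i ∩ Finset.range p.natDegree) *
        (genClass p q (α * j + i) * encNat p k)) := by
  have h1 : wal S (iplrPoint p.natDegree p q k j) = ∏ c ∈ S,
      (fun i a => if a < p.natDegree then
        fieldChar (AdjoinRoot.root p ^ a * (genClass p q (α * j + i) * encNat p k)) else 1)
        (c % α) (c / α) := by
    refine Finset.prod_congr rfl fun c _ => ?_
    rw [iplrPoint_eq_binNum, rad_binNum]
    simp only [Nat.div_lt_iff_lt_mul hα, mul_comm α p.natDegree]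
    refine if_congr Iff.rfl ?_ rfl
    rw [sgn_coeff_div, map_mul (AdjoinRoot.mk p), mul_comm (AdjoinRoot.mk p (polyOfNat k))]
    rfl
  rw [h1, prod_deinterlace hS fun i a => if a < p.natDegree then
    fieldChar (AdjoinRoot.root p ^ a * (genClass p q (α * j + i) * encNat p k)) else 1]
  refine Finset.prod_congr rfl fun i _ => ?_
  rw [fieldChar_encSet_mul, ← Finset.prod_filter]
  refine Finset.prod_congr ?_ fun _ _ => rfl
  ext a
  simp

lemma addChar_sum {A M ι : Type*} [AddCommMonoid A] [CommMonoid M] (χ : AddChar A M)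
    (t : Finset ι) (f : ι → A) : χ (∑ i ∈ t, f i) = ∏ i ∈ t, χ (f i) := by
  classical
  induction t using Finset.induction_on with
  | empty => simp
  | insert a t ha ih => rw [Finset.sum_insert ha, Finset.prod_insert ha, AddChar.map_add_eq_mul, ih]

/-- The sum is either the number of points or zero. Thanks to nonnegativity the absolute values in
the error bound can be dropped, after which the sum over frequencies factors. -/
lemma sum_fieldChar_nonneg (z : AdjoinRoot p) :
    0 ≤ ∑ k ∈ Finset.range (2 ^ p.natDegree), fieldChar (z * encNat p k) := by
  classical
  rw [sum_encNat fun k => fieldChar (z * k)]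
  have := AddChar.sum_mulShift z (isPrimitive_fieldChar (p := p))
  simp only [mul_comm _ z] at this
  rw [this]
  split_ifs <;> simp

/-- The weights of the residue classes of the frequencies with `p.natDegree + l` digits. -/
lemma sum_powerset_mul_char (b : ℝ) (y : AdjoinRoot p) (l : ℕ) :
    ∑ S ∈ (Finset.range (p.natDegree + l)).powerset,
        b ^ topDigit S * fieldChar (encSet p (S ∩ Finset.range p.natDegree) * y)
      = ∑ x, resWeight b (∑ t ∈ Finset.range l, b ^ (p.natDegree + t + 1) * 2 ^ t) x *
          fieldChar (x * y) := by
  classical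
  have h : ∀ x, resWeight b (∑ t ∈ Finset.range l, b ^ (p.natDegree + t + 1) * 2 ^ t) x
      = ∑ S ∈ (Finset.range (p.natDegree + l)).powerset,
        (if encSet p (S ∩ Finset.range p.natDegree) = x then b ^ topDigit S else 0) := fun x => by
    rw [resWeight, ← sum_powerset_filter_encSet]
  simp only [h, Finset.sum_mul, ite_mul, zero_mul]
  rw [Finset.sum_comm]
  refine Finset.sum_congr rfl fun S _ => ?_
  rw [Finset.sum_ite_eq]
  simp

/-- Weights and characters are both products over the components, and the components of a frequency
range independently. -/
lemma sum_walshWeight_mul (α : ℕ) {s : ℕ} (y : ℕ → AdjoinRoot p) (l : ℕ) :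
    ∑ S ∈ Fintype.piFinset fun _ : Fin s => (Finset.range (α * (p.natDegree + l))).powerset,
        walshWeight α S * ∏ j, ∏ i ∈ Finset.range α,
          fieldChar (encSet p (deinterlace α (S j) i ∩ Finset.range p.natDegree) * y (α * j + i))
      = (2 ^ (α * (α - 1) / 2)) ^ s * ∏ d ∈ Finset.range (α * s),
        ∑ x, resWeight ((1 / 2) ^ α)
          (∑ t ∈ Finset.range l, ((1 / 2 : ℝ) ^ α) ^ (p.natDegree + t + 1) * 2 ^ t) x *
            fieldChar (x * y d) := by
  rw [prod_range_eq_prod_prod, Finset.prod_range (fun a => ∏ i ∈ Finset.range α, _)]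
  simp only [← sum_powerset_mul_char]
  simp only [← sum_prod_deinterlace]
  have h : ((2 : ℝ) ^ (α * (α - 1) / 2)) ^ s = ∏ _j : Fin s, 2 ^ (α * (α - 1) / 2) := by simp
  rw [h, ← Finset.prod_mul_distrib]
  simp only [Finset.mul_sum]
  rw [Finset.prod_univ_sum]
  refine Finset.sum_congr rfl fun S _ => ?_
  rw [walshWeight, ← Finset.prod_mul_distrib]
  refine Finset.prod_congr rfl fun j _ => ?_
  rw [mul_assoc, ← Finset.prod_mul_distrib]

/-- The worst-case error is bounded by the figure of merit. -/
theorem abs_integral_sub_iplrRule_le {α s : ℕ} (hα : 2 ≤ α) (q : Fin (s * α) → (ZMod 2)[X])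
    {F : (Fin s → ℝ) → ℝ} (hF : MemH α F) {b : ℝ} (hb : b = (1 / 2) ^ α) :
    |(∫ y in cube s, F y) - iplrRule p.natDegree p q F|
      ≤ (2 ^ (α * (α - 1) / 2)) ^ s *
        (dualSum (resWeight b (b ^ p.natDegree * (b / (1 - 2 * b)))) (genClass p q) (α * s) 0 - 1) *
          normH α F := by
  set m := p.natDegree with hm
  have hb0 : 0 < b := by rw [hb]; positivity
  have hb2 : 2 * b < 1 := by
    have : b ≤ (1 / 2) ^ 2 := by
      rw [hb]; exact pow_le_pow_of_le_one (by norm_num) (by norm_num) hα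
    linarith [show (1 / 2 : ℝ) ^ 2 = 1 / 4 by norm_num]
  have hrule : iplrRule m p q F
      = 1 / ((2 ^ m : ℕ) : ℝ) * ∑ k ∈ Finset.range (2 ^ m), F (iplrPoint m p q k) := by
    rw [iplrRule]; push_cast; rfl
  rw [hrule]
  refine abs_integral_sub_le hF (fun k j => iplrPoint_mem_Ico m q k j)
    (exists_prod_le_walshWeight α) (by positivity) (ℓ := fun L => α * (m + L)) ?_ ?_
  · refine tendsto_atTop_mono (fun L => ?_) tendsto_id
    exact (Nat.le_add_left L m).trans (Nat.le_mul_of_pos_left _ (by omega))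
  intro L
  -- The tail cut off after `L` further digits. It is bounded by the complete geometric series,
  -- which makes the final bound uniform in `L`.
  set T := ∑ t ∈ Finset.range L, b ^ (m + t + 1) * 2 ^ t with hT
  have hT0 : 0 ≤ T := Finset.sum_nonneg fun _ _ => by positivity
  have hTle : T ≤ b ^ m * (b / (1 - 2 * b)) := sum_geometric_le hb0 hb2 m L
  have hwal : ∀ S ∈ Fintype.piFinset fun _ : Fin s => (Finset.range (α * (m + L))).powerset,
      ∀ k, ∏ j, wal (S j) (iplrPoint m p q k j) = ∏ j : Fin s, ∏ i ∈ Finset.range α,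
        fieldChar (encSet p (deinterlace α (S j) i ∩ Finset.range m) *
          (genClass p q (α * j + i) * encNat p k)) := by
    intro S hS k
    rw [Fintype.mem_piFinset] at hS
    exact Finset.prod_congr rfl fun j _ =>
      wal_iplrPoint (by omega) q k j (Finset.mem_powerset.1 (hS j))
  have hnn : ∀ S ∈ Fintype.piFinset fun _ : Fin s => (Finset.range (α * (m + L))).powerset,
      0 ≤ 1 / ((2 ^ m : ℕ) : ℝ) * ∑ k ∈ Finset.range (2 ^ m),
        ∏ j, wal (S j) (iplrPoint m p q k j) := by
    intro S hS
    refine mul_nonneg (by positivity) ?_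
    have h := sum_fieldChar_nonneg (p := p) (∑ j : Fin s, ∑ i ∈ Finset.range α,
      encSet p (deinterlace α (S j) i ∩ Finset.range m) * genClass p q (α * j + i))
    refine h.trans_eq (Finset.sum_congr rfl fun k _ => ?_)
    rw [hwal S hS k, Finset.sum_mul, addChar_sum]
    refine Finset.prod_congr rfl fun j _ => ?_
    rw [Finset.sum_mul, addChar_sum]
    simp only [mul_assoc]
  have hempty : (fun _ : Fin s => (∅ : Finset ℕ)) ∈
      Fintype.piFinset fun _ : Fin s => (Finset.range (α * (m + L))).powerset := by
    rw [Fintype.mem_piFinset]; exact fun _ => Finset.mem_powerset.2 (Finset.empty_subset _)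
  have h1 : ∑ S ∈ (Fintype.piFinset fun _ : Fin s =>
        (Finset.range (α * (m + L))).powerset).erase (fun _ => ∅), walshWeight α S *
          |1 / ((2 ^ m : ℕ) : ℝ) * ∑ k ∈ Finset.range (2 ^ m),
            ∏ j, wal (S j) (iplrPoint m p q k j)|
      = (∑ S ∈ Fintype.piFinset fun _ : Fin s =>
        (Finset.range (α * (m + L))).powerset, walshWeight α S *
          (1 / ((2 ^ m : ℕ) : ℝ) * ∑ k ∈ Finset.range (2 ^ m),
            ∏ j, wal (S j) (iplrPoint m p q k j))) - (2 ^ (α * (α - 1) / 2)) ^ s := by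
    rw [← Finset.add_sum_erase _ _ hempty]
    have h2 : walshWeight α (fun _ : Fin s => ∅) = (2 ^ (α * (α - 1) / 2)) ^ s := by
      simp [walshWeight, deinterlace_empty, topDigit]
    have h3 : 1 / ((2 ^ m : ℕ) : ℝ) * ∑ k ∈ Finset.range (2 ^ m),
        ∏ j, wal ((fun _ : Fin s => (∅ : Finset ℕ)) j) (iplrPoint m p q k j) = 1 := by
      simp [wal]
    rw [h2, h3, mul_one, add_sub_cancel_left]
    refine Finset.sum_congr rfl fun S hS => ?_
    rw [abs_of_nonneg (hnn S (Finset.mem_of_mem_erase hS))]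
  have h2 : ∑ S ∈ Fintype.piFinset fun _ : Fin s =>
        (Finset.range (α * (m + L))).powerset, walshWeight α S *
          (1 / ((2 ^ m : ℕ) : ℝ) * ∑ k ∈ Finset.range (2 ^ m),
            ∏ j, wal (S j) (iplrPoint m p q k j))
      = (2 ^ (α * (α - 1) / 2)) ^ s * dualSum (resWeight b T) (genClass p q) (α * s) 0 := by
    have h3 : ∑ S ∈ Fintype.piFinset fun _ : Fin s =>
        (Finset.range (α * (m + L))).powerset, walshWeight α S *
          (1 / ((2 ^ m : ℕ) : ℝ) * ∑ k ∈ Finset.range (2 ^ m),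
            ∏ j, wal (S j) (iplrPoint m p q k j))
      = 1 / ((2 ^ m : ℕ) : ℝ) * ∑ k ∈ Finset.range (2 ^ m), ((2 ^ (α * (α - 1) / 2)) ^ s *
          ∏ d ∈ Finset.range (α * s), ∑ x, resWeight b T x *
            fieldChar (x * genClass p q d * encNat p k)) := by
      simp only [Finset.mul_sum]
      rw [Finset.sum_comm]
      refine Finset.sum_congr rfl fun k _ => ?_
      simp only [mul_assoc]
      rw [hT, hb, ← sum_walshWeight_mul α (fun d => genClass p q d * encNat p k) L, Finset.mul_sum]
      refine Finset.sum_congr rfl fun S hS => ?_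
      rw [hwal S hS k]
      ring
    rw [h3, ← Finset.mul_sum, sum_encNat fun κ => ∏ d ∈ Finset.range (α * s),
      ∑ x, resWeight b T x * fieldChar (x * genClass p q d * κ),
      ← dualSum_zero_eq isPrimitive_fieldChar, card_adjoinRoot, ← hm]
    have : ((2 ^ m : ℕ) : ℝ) ≠ 0 := by positivity
    field_simp
  rw [h1, h2, mul_sub, mul_one]
  refine sub_le_sub_right (mul_le_mul_of_nonneg_left ?_ (by positivity)) _
  exact dualSum_mono (fun x => add_nonneg (pow_nonneg hb0.le _) hT0)
    (fun x => add_le_add le_rfl hTle) _ _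

/-- The error bound for a generating vector which was chosen component by component. -/
theorem abs_integral_sub_iplrRule_le_of_greedy {α s : ℕ} (hα : 2 ≤ α)
    (q : Fin (s * α) → (ZMod 2)[X]) [DecidableEq (AdjoinRoot p)]
    (hq0 : ∀ i < α * s, genClass p q i ≠ 0)
    (hq : ∀ d < α * s, ∀ y ≠ 0, ∑ k ∈ Finset.univ.erase (0 : AdjoinRoot p),
        (∏ i ∈ Finset.range d, meritKernel ((1 / 2) ^ α) (genClass p q i * k)) *
          meritKernel ((1 / 2) ^ α) (genClass p q d * k)
      ≤ ∑ k ∈ Finset.univ.erase (0 : AdjoinRoot p),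
        (∏ i ∈ Finset.range d, meritKernel ((1 / 2) ^ α) (genClass p q i * k)) *
          meritKernel ((1 / 2) ^ α) (y * k))
    {lam : ℝ} (hl1 : 1 ≤ lam) (hlα : lam < α) {F : (Fin s → ℝ) → ℝ} (hF : MemH α F) :
    |(∫ y in cube s, F y) - iplrRule p.natDegree p q F|
      ≤ Ctilde α lam s / (2 ^ p.natDegree) ^ lam * normH α F := by
  refine (abs_integral_sub_iplrRule_le hα q hF rfl).trans ?_
  refine mul_le_mul_of_nonneg_right ?_ (Real.sqrt_nonneg _)
  have h1 := dualSum_sub_one_le_of_greedy rfl hl1 hlα hq0 hq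
  refine (mul_le_mul_of_nonneg_left h1 (by positivity)).trans_eq ?_
  have h2 : ((2 : ℝ) ^ (α * (α - 1) / 2)) ^ s
      = (2 : ℝ) ^ ((α : ℝ) * ((α : ℝ) - 1) * (s : ℝ) / 2) := by
    rw [← pow_mul, ← Real.rpow_natCast]
    congr 1
    -- The division of natural numbers is exact, `α * (α - 1)` being twice a sum of consecutive
    -- integers.
    have h3 : ((α * (α - 1) / 2 : ℕ) : ℝ) * 2 = α * (α - 1) := by
      have h4 := Finset.sum_range_id_mul_two α
      rw [Finset.sum_range_id] at h4
      have h5 := congrArg (Nat.cast : ℕ → ℝ) h4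
      push_cast [Nat.cast_sub (show 1 ≤ α by omega)] at h5
      exact h5
    rw [Nat.cast_mul]
    linear_combination (s / 2 : ℝ) * h3
  rw [h2, Ctilde]
  ring

end

end QMC

end

/-! ### A calculus of postconditions and costs for programs -/

noncomputable section

namespace QMC

/-! ### Reasoning about programs -/

namespace Program

/-- The natural number arrays to which a program writes. -/
def wN : Program → List ℕ
  | skip => []
  | setN a _ _ => [a]
  | setR _ _ _ => []
  | seq P Q => P.wN ++ Q.wN
  | ite _ P Q => P.wN ++ Q.wN
  | loop _ P => P.wN

/-- The real arrays to which a program writes. -/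
def wR : Program → List ℕ
  | skip => []
  | setN _ _ _ => []
  | setR a _ _ => [a]
  | seq P Q => P.wR ++ Q.wR
  | ite _ P Q => P.wR ++ Q.wR
  | loop _ P => P.wR

/-- The memories `σ` and `τ` agree on the arrays to which the program does not write. -/
def Fr (P : Program) (σ τ : Memory) : Prop :=
  (∀ a ∉ P.wN, τ.nat a = σ.nat a) ∧ ∀ a ∉ P.wR, τ.real a = σ.real a

lemma Fr.refl (P : Program) (σ : Memory) : P.Fr σ σ := ⟨fun _ _ => rfl, fun _ _ => rfl⟩

lemma Fr.trans {P : Program} {σ τ υ : Memory} (h : P.Fr σ τ) (h' : P.Fr τ υ) : P.Fr σ υ :=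
  ⟨fun a ha => (h'.1 a ha).trans (h.1 a ha), fun a ha => (h'.2 a ha).trans (h.2 a ha)⟩

lemma Fr.mono {P Q : Program} {σ τ : Memory} (h : P.Fr σ τ) (hN : P.wN ⊆ Q.wN)
    (hR : P.wR ⊆ Q.wR) : Q.Fr σ τ :=
  ⟨fun a ha => h.1 a fun h' => ha (hN h'), fun a ha => h.2 a fun h' => ha (hR h')⟩

end Program

/-- The frame rule. The arrays written to are read off from the syntax, so that frame conditions of
concrete programs are decidable. -/
lemma Runs.fr {P : Program} {σ τ : Memory} {t : ℕ} (h : Runs P σ t τ) : P.Fr σ τ := by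
  induction h with
  | skip σ => exact .refl _ _
  | setN σ a i e =>
    refine ⟨fun b hb => ?_, fun _ _ => rfl⟩
    have hb : b ≠ a := by simpa [Program.wN] using hb
    simp [Memory.writeN, hb]
  | setR σ a i e =>
    refine ⟨fun _ _ => rfl, fun b hb => ?_⟩
    have hb : b ≠ a := by simpa [Program.wR] using hb
    simp [Memory.writeR, hb]
  | seq _ _ h1 h2 =>
    exact (h1.mono (List.subset_append_left _ _) (List.subset_append_left _ _)).trans
      (h2.mono (List.subset_append_right _ _) (List.subset_append_right _ _))
  | iteTrue _ _ h1 => exact h1.mono (List.subset_append_left _ _) (List.subset_append_left _ _)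
  | iteFalse _ _ h1 => exact h1.mono (List.subset_append_right _ _) (List.subset_append_right _ _)
  | loopStep _ _ _ h1 h2 =>
    exact Program.Fr.trans (h1.mono (Q := .loop _ _) (List.Subset.refl _) (List.Subset.refl _)) h2
  | loopDone _ => exact .refl _ _

/-- Started on `σ`, the program `P` halts at cost at most `T`, with a memory which satisfies `Q`. -/
def Ends (P : Program) (σ : Memory) (T : ℕ) (Q : Memory → Prop) : Prop :=
  ∃ t τ, Runs P σ t τ ∧ t ≤ T ∧ Q τ

lemma Ends.mono {P : Program} {σ : Memory} {T T' : ℕ} {Q Q' : Memory → Prop} (h : Ends P σ T Q)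
    (hT : T ≤ T') (hQ : ∀ τ, P.Fr σ τ → Q τ → Q' τ) : Ends P σ T' Q' := by
  obtain ⟨t, τ, h1, h2, h3⟩ := h
  exact ⟨t, τ, h1, h2.trans hT, hQ τ h1.fr h3⟩

lemma Ends.seq {P P' : Program} {σ : Memory} {T T' : ℕ} {Q Q' : Memory → Prop} (h : Ends P σ T Q)
    (h' : ∀ τ, P.Fr σ τ → Q τ → Ends P' τ T' Q') : Ends (.seq P P') σ (T + T') Q' := by
  obtain ⟨t, τ, h1, h2, h3⟩ := h
  obtain ⟨t', τ', h1', h2', h3'⟩ := h' τ h1.fr h3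
  exact ⟨t + t', τ', h1.seq h1', by omega, h3'⟩

lemma Ends.ite {P P' : Program} {b : BExp} {σ : Memory} {T : ℕ} {Q : Memory → Prop}
    (h : b.holds σ → Ends P σ T Q) (h' : ¬ b.holds σ → Ends P' σ T Q) :
    Ends (.ite b P P') σ (b.cost + T + 1) Q := by
  by_cases hb : b.holds σ
  · obtain ⟨t, τ, h1, h2, h3⟩ := h hb
    exact ⟨_, τ, .iteTrue hb h1, by omega, h3⟩
  · obtain ⟨t, τ, h1, h2, h3⟩ := h' hb
    exact ⟨_, τ, .iteFalse hb h1, by omega, h3⟩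

namespace Program

/-- The program contains no loop. -/
def loopFree : Program → Bool
  | seq P Q => P.loopFree && Q.loopFree
  | ite _ P Q => P.loopFree && Q.loopFree
  | loop _ _ => false
  | _ => true

/-- A bound for the cost of a program without loops. -/
def maxCost : Program → ℕ
  | skip => 1
  | setN _ i e => i.cost + e.cost + 1
  | setR _ i x => i.cost + x.cost + 1
  | seq P Q => P.maxCost + Q.maxCost
  | ite b P Q => b.cost + (P.maxCost + Q.maxCost) + 1
  | loop _ _ => 0

open scoped Classical in
/-- The effect of a program without loops. -/
def step : Program → Memory → Memory
  | skip, σ => σ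
  | setN a i e, σ => σ.writeN a (i.eval σ) (e.eval σ)
  | setR a i x, σ => σ.writeR a (i.eval σ) (x.eval σ)
  | seq P Q, σ => Q.step (P.step σ)
  | ite b P Q, σ => if b.holds σ then P.step σ else Q.step σ
  | loop _ _, σ => σ

end Program

/-- Code without loops is verified by symbolic execution. Its cost bound adds up both branches of a
conditional, which loses only a constant. -/
lemma Ends.of_step {P : Program} {σ : Memory} {T : ℕ} {Q : Memory → Prop}
    (hP : P.loopFree = true) (hT : P.maxCost ≤ T) (hQ : Q (P.step σ)) : Ends P σ T Q := by
  suffices ∀ (P : Program) (σ : Memory), P.loopFree = true →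
      ∃ t ≤ P.maxCost, Runs P σ t (P.step σ) by
    obtain ⟨t, ht, h⟩ := this P σ hP
    exact ⟨t, _, h, ht.trans hT, hQ⟩
  clear hP hT hQ
  intro P
  induction P with
  | skip => exact fun σ _ => ⟨1, le_rfl, .skip σ⟩
  | setN a i e => exact fun σ _ => ⟨_, le_rfl, .setN σ a i e⟩
  | setR a i x => exact fun σ _ => ⟨_, le_rfl, .setR σ a i x⟩
  | seq P P' h h' =>
    intro σ hP
    simp only [Program.loopFree, Bool.and_eq_true] at hP
    obtain ⟨t, ht, h1⟩ := h σ hP.1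
    obtain ⟨t', ht', h1'⟩ := h' _ hP.2
    exact ⟨_, add_le_add ht ht', h1.seq h1'⟩
  | ite b P P' h h' =>
    intro σ hP
    simp only [Program.loopFree, Bool.and_eq_true] at hP
    by_cases hb : b.holds σ
    · obtain ⟨t, ht, h1⟩ := h σ hP.1
      refine ⟨_, ?_, by simpa only [Program.step, if_pos hb] using .iteTrue hb h1⟩
      simp only [Program.maxCost]; omega
    · obtain ⟨t, ht, h1⟩ := h' σ hP.2
      refine ⟨_, ?_, by simpa only [Program.step, if_neg hb] using .iteFalse hb h1⟩
      simp only [Program.maxCost]; omega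
  | loop b P h => intro σ hP; simp [Program.loopFree] at hP

/-- Loops whose number of iterations is known. -/
lemma Ends.loop {b : BExp} {P : Program} {σ : Memory} (n : ℕ) (I : ℕ → Memory → Prop) (c : ℕ → ℕ)
    (h0 : I 0 σ)
    (hstep : ∀ k < n, ∀ τ, (Program.loop b P).Fr σ τ → I k τ →
      b.holds τ ∧ Ends P τ (c k) (I (k + 1)))
    (hn : ∀ τ, (Program.loop b P).Fr σ τ → I n τ → ¬ b.holds τ) :
    Ends (.loop b P) σ (∑ k ∈ Finset.range n, (c k + b.cost + 1) + b.cost + 1) (I n) := by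
  induction n generalizing σ I c with
  | zero => exact ⟨_, σ, .loopDone (hn σ (.refl _ _) h0), by simp, h0⟩
  | succ n ih =>
    obtain ⟨hb, t, τ, h1, h2, h3⟩ := hstep 0 (Nat.succ_pos _) σ (.refl _ _) h0
    have hf : (Program.loop b P).Fr σ τ := h1.fr
    obtain ⟨t', τ', h1', h2', h3'⟩ := ih (fun k => I (k + 1)) (fun k => c (k + 1)) h3
      (fun k hk υ hυ => hstep (k + 1) (by omega) υ (hf.trans hυ))
      (fun υ hυ => hn υ (hf.trans hυ))
    refine ⟨_, τ', .loopStep hb h1 h1', ?_, h3'⟩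
    rw [Finset.sum_range_succ']
    omega

/-- `for i = 0, …, b - 1 do P`. -/
def forTo (i : ℕ) (b : NExp) (P : Program) : Program :=
  .seq (.setN i (.lit 0) (.lit 0))
    (.loop (.ltN (.get i (.lit 0)) b)
      (.seq P (.setN i (.lit 0) (.add (.get i (.lit 0)) (.lit 1)))))

/-- The invariant for the next index is demanded after the counter has been incremented, since it
speaks of the whole memory. The body must leave the counter alone; the summand `10` covers test and
increment. -/
lemma Ends.forTo {i : ℕ} {b : NExp} {P : Program} {σ : Memory} (n : ℕ) (I : ℕ → Memory → Prop)
    (c : ℕ → ℕ) {T : ℕ} {Q : Memory → Prop} (hi : i ∉ P.wN)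
    (hb : ∀ τ, (QMC.forTo i b P).Fr σ τ → b.eval τ = n)
    (h0 : I 0 (σ.writeN i 0 0))
    (hstep : ∀ k < n, ∀ τ, (QMC.forTo i b P).Fr σ τ → τ.nat i 0 = k → I k τ →
      Ends P τ (c k) fun υ => I (k + 1) (υ.writeN i 0 (k + 1)))
    (hT : ∑ k ∈ Finset.range n, (c k + b.cost + 10) + b.cost + 10 ≤ T)
    (hQ : ∀ τ, (QMC.forTo i b P).Fr σ τ → I n τ → Q τ) :
    Ends (QMC.forTo i b P) σ T Q := by
  have e : ∀ (τ : Memory) (v : ℕ), (τ.writeN i 0 v).nat i 0 = v := fun τ v => by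
    simp [Memory.writeN]
  have hsub : ∀ {τ υ : Memory}, (Program.loop (.ltN (.get i (.lit 0)) b)
      (.seq P (.setN i (.lit 0) (.add (.get i (.lit 0)) (.lit 1))))).Fr τ υ →
      (QMC.forTo i b P).Fr τ υ := fun h =>
    h.mono (List.subset_append_right _ _) (List.subset_append_right _ _)
  have hfr : (QMC.forTo i b P).Fr σ (σ.writeN i 0 0) :=
    (Runs.setN σ i (.lit 0) (.lit 0)).fr.mono (List.subset_append_left _ _)
      (List.subset_append_left _ _)
  have hloop : Ends _ (σ.writeN i 0 0) _ fun τ => τ.nat i 0 = n ∧ I n τ :=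
    Ends.loop (b := .ltN (.get i (.lit 0)) b)
      (P := .seq P (.setN i (.lit 0) (.add (.get i (.lit 0)) (.lit 1)))) n
      (fun k τ => τ.nat i 0 = k ∧ I k τ) (fun k => c k + 6) ⟨e _ _, h0⟩
      (fun k hk τ hτ hI => by
        have hτ' := hfr.trans (hsub hτ)
        refine ⟨?_, ?_⟩
        · simp only [BExp.holds, NExp.eval, hI.1, hb τ hτ', hk]
        · refine Ends.seq (hstep k hk τ hτ' hI.1 hI.2) fun υ hυ h => ?_
          have hk' : υ.nat i 0 = k := by rw [hυ.1 i hi, hI.1]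
          refine Ends.of_step rfl le_rfl ?_
          simp only [Program.step, NExp.eval, hk']
          exact ⟨e _ _, h⟩)
      (fun τ hτ hI => by
        simp only [BExp.holds, NExp.eval, hI.1, hb τ (hfr.trans (hsub hτ)), lt_irrefl,
          not_false_eq_true])
  have hall : Ends (QMC.forTo i b P) σ _ Q :=
    (Ends.of_step (P := .setN i (.lit 0) (.lit 0)) rfl le_rfl
      (Q := fun τ => τ = σ.writeN i 0 0) rfl).seq fun τ _ hτ => by
        subst hτ
        exact hloop.mono le_rfl fun υ hυ h => hQ υ (hfr.trans (hsub hυ)) h.2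
  refine hall.mono (le_trans ?_ hT) fun _ _ h => h
  simp only [Program.maxCost, NExp.cost, BExp.cost]
  have : ∑ k ∈ Finset.range n, (c k + 6 + (1 + 1 + b.cost + 1) + 1)
      = ∑ k ∈ Finset.range n, (c k + b.cost + 10) :=
    Finset.sum_congr rfl fun k _ => by ring
  rw [this]
  omega

lemma Ends.forTo_const {i : ℕ} {b : NExp} {P : Program} {σ : Memory} (n : ℕ)
    (I : ℕ → Memory → Prop) (c : ℕ) {T : ℕ} {Q : Memory → Prop} (hi : i ∉ P.wN)
    (hb : ∀ τ, (QMC.forTo i b P).Fr σ τ → b.eval τ = n)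
    (h0 : I 0 (σ.writeN i 0 0))
    (hstep : ∀ k < n, ∀ τ, (QMC.forTo i b P).Fr σ τ → τ.nat i 0 = k → I k τ →
      Ends P τ c fun υ => I (k + 1) (υ.writeN i 0 (k + 1)))
    (hT : n * (c + b.cost + 10) + b.cost + 10 ≤ T)
    (hQ : ∀ τ, (QMC.forTo i b P).Fr σ τ → I n τ → Q τ) :
    Ends (QMC.forTo i b P) σ T Q :=
  Ends.forTo n I (fun _ => c) hi hb h0 hstep (by simpa using hT) hQ

lemma Ends.step_seq {P P' : Program} {σ : Memory} (c : ℕ) {T' T : ℕ} {Q : Memory → Prop}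
    (hP : P.loopFree = true) (hc : P.maxCost ≤ c) (hT : c + T' ≤ T)
    (h : Ends P' (P.step σ) T' Q) : Ends (.seq P P') σ T Q :=
  ((Ends.of_step hP hc (Q := fun τ => τ = P.step σ) rfl).seq fun _ _ hτ => hτ ▸ h).mono hT
    fun _ _ h => h

/-! Abbreviations for writing programs. -/

/-- The value of a variable, which is kept in cell `0` of an array. -/
abbrev var (a : ℕ) : NExp := .get a (.lit 0)

/-- The last binary digit. -/
abbrev par (e : NExp) : NExp := .sub e (.add (.half e) (.half e))

/-- Assignment to a variable. -/
abbrev asg (a : ℕ) (e : NExp) : Program := .setN a (.lit 0) e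

infixr:60 " ;; " => Program.seq

lemma sub_half_add_half (v : ℕ) : v - (v / 2 + v / 2) = v % 2 := by omega

@[simp] lemma Memory.nat_writeN (σ : Memory) (a i v a' : ℕ) :
    (σ.writeN a i v).nat a' = if a' = a then Function.update (σ.nat a) i v else σ.nat a' := by
  unfold Memory.writeN
  split_ifs with h
  · subst h; simp
  · simp [h]

@[simp] lemma Memory.real_writeN (σ : Memory) (a i v : ℕ) : (σ.writeN a i v).real = σ.real := rfl

@[simp] lemma Memory.nat_writeR (σ : Memory) (a i : ℕ) (v : ℝ) : (σ.writeR a i v).nat = σ.nat := rfl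

@[simp] lemma Memory.real_writeR (σ : Memory) (a i : ℕ) (v : ℝ) (a' : ℕ) :
    (σ.writeR a i v).real a'
      = if a' = a then Function.update (σ.real a) i v else σ.real a' := by
  unfold Memory.writeR
  split_ifs with h
  · subst h; simp
  · simp [h]

end QMC

end

/-! ### Binary polynomials as natural numbers -/

noncomputable section

namespace QMC

section

open Polynomial

/-! ### Polynomial arithmetic on natural numbers -/

lemma polyOfNat_xor (a b : ℕ) : polyOfNat (Nat.xor a b) = polyOfNat a + polyOfNat b := by
  ext i
  have h : (Nat.xor a b).testBit i = (a.testBit i ^^ b.testBit i) := Nat.testBit_xor a b i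
  rw [coeff_add, coeff_polyOfNat, coeff_polyOfNat, coeff_polyOfNat, h]
  cases a.testBit i <;> cases b.testBit i <;> simp [CharTwo.add_self_eq_zero]

lemma polyOfNat_one : polyOfNat 1 = 1 := by
  ext i
  rw [coeff_polyOfNat, coeff_one]
  exact if_congr Nat.testBit_one_eq_true_iff_self_eq_zero rfl rfl

lemma polyOfNat_two_mul (a : ℕ) : polyOfNat (a + a) = X * polyOfNat a := by
  ext i
  rw [← two_mul]
  cases i with
  | zero => simp [coeff_polyOfNat]
  | succ i => rw [coeff_X_mul, coeff_polyOfNat, coeff_polyOfNat, Nat.testBit_succ, Nat.mul_div_cancel_left _ two_pos]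

lemma polyOfNat_eq_half (a : ℕ) : polyOfNat a = X * polyOfNat (a / 2) + polyOfNat (a % 2) := by
  ext i
  cases i with
  | zero => simp [coeff_polyOfNat]
  | succ i =>
    rw [coeff_add, coeff_X_mul, coeff_polyOfNat, coeff_polyOfNat, coeff_polyOfNat,
      Nat.testBit_succ, Nat.testBit_lt_two_pow (x := a % 2) (i := i + 1)]
    · simp
    · exact (Nat.mod_lt _ two_pos).trans_le
        (by simpa using Nat.pow_le_pow_right two_pos (Nat.succ_pos i))

lemma natDegree_polyOfNat {k m : ℕ} (h1 : 2 ^ m ≤ k) (h2 : k < 2 ^ (m + 1)) :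
    (polyOfNat k).natDegree = m := by
  have h0 : polyOfNat k ≠ 0 := by
    rw [Ne, polyOfNat_eq_zero_iff]
    have := Nat.two_pow_pos m
    omega
  have e1 := degree_polyOfNat_lt_iff.2 h2
  have e2 := mt degree_polyOfNat_lt_iff.1 (not_lt.2 h1)
  rw [degree_eq_natDegree h0] at e1 e2
  norm_cast at e1 e2
  omega

lemma natDegree_polyOfNat_iff {k m : ℕ} (hk : k ≠ 0) :
    (polyOfNat k).natDegree = m ↔ 2 ^ m ≤ k ∧ k < 2 ^ (m + 1) := by
  refine ⟨?_, fun h => natDegree_polyOfNat h.1 h.2⟩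
  rintro rfl
  have h0 : polyOfNat k ≠ 0 := by rwa [Ne, polyOfNat_eq_zero_iff]
  constructor
  · by_contra! h
    have := degree_polyOfNat_lt_iff.2 h
    rw [degree_eq_natDegree h0] at this
    exact lt_irrefl _ this
  · rw [← degree_polyOfNat_lt_iff, degree_eq_natDegree h0]
    exact_mod_cast Nat.lt_succ_self _

/-- The minimal polynomial of a primitive element of the field with `2 ^ m` elements has degree `m`.
-/
lemma exists_irreducible_natDegree_eq {m : ℕ} (hm : m ≠ 0) :
    ∃ f : (ZMod 2)[X], Irreducible f ∧ f.natDegree = m := by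
  obtain ⟨x, hx⟩ := Field.exists_primitive_element (ZMod 2) (GaloisField 2 m)
  refine ⟨minpoly (ZMod 2) x, minpoly.irreducible (Algebra.IsIntegral.isIntegral x), ?_⟩
  rw [(Field.primitive_element_iff_minpoly_natDegree_eq (ZMod 2) x).1 hx, GaloisField.finrank 2 hm]

/-- The numbers with `m + 1` bits which are found by sieving are the reducible polynomials. -/
lemma not_irreducible_iff_sieve {m v : ℕ} (hm : 1 ≤ m) (h1 : 2 ^ m ≤ v) (h2 : v < 2 ^ (m + 1)) :
    ¬ Irreducible (polyOfNat v) ↔ ∃ e < m - 1, ∃ j < 2 ^ (e + 1), ∃ f < 2 ^ (m - e),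
      polyOfNat v = polyOfNat (2 ^ (e + 1) + j) * polyOfNat f := by
  have hdeg := natDegree_polyOfNat h1 h2
  have hv0 : polyOfNat v ≠ 0 := fun h => by rw [h] at hdeg; simp at hdeg; omega
  have hunit : ∀ g : (ZMod 2)[X], g ≠ 0 → (IsUnit g ↔ g.natDegree = 0) := fun g hg => by
    rw [isUnit_iff_degree_eq_zero, degree_eq_natDegree hg]; norm_cast
  constructor
  · intro h
    rw [irreducible_iff] at h
    push Not at h
    obtain ⟨a, b, hab, ha, hb⟩ := h (by rw [hunit _ hv0]; omega)
    have ha0 : a ≠ 0 := fun h => hv0 (by rw [hab, h, zero_mul])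
    have hb0 : b ≠ 0 := fun h => hv0 (by rw [hab, h, mul_zero])
    rw [hunit _ ha0] at ha
    rw [hunit _ hb0] at hb
    have hsum : a.natDegree + b.natDegree = m := by rw [← natDegree_mul ha0 hb0, ← hab, hdeg]
    obtain ⟨d, rfl⟩ := exists_polyOfNat_eq a
    obtain ⟨f, rfl⟩ := exists_polyOfNat_eq b
    have hd := (natDegree_polyOfNat_iff (mt polyOfNat_eq_zero_iff.2 ha0)).1 rfl
    have hf := (natDegree_polyOfNat_iff (mt polyOfNat_eq_zero_iff.2 hb0)).1 rfl
    set da := (polyOfNat d).natDegree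
    -- A proper factor has degree `da` between `1` and `m - 1`, while the sieve counts degrees as `e
    -- + 1`.
    refine ⟨da - 1, by omega, d - 2 ^ da, ?_, f, ?_, ?_⟩
    · rw [show da - 1 + 1 = da by omega]
      have := hd.2
      rw [pow_succ] at this
      omega
    · rw [show m - (da - 1) = (polyOfNat f).natDegree + 1 by omega]
      exact hf.2
    · rw [show da - 1 + 1 = da by omega, Nat.add_sub_cancel' hd.1, hab]
  · rintro ⟨e, he, j, hj, f, hf, hv⟩ hirr
    have hd : (polyOfNat (2 ^ (e + 1) + j)).natDegree = e + 1 :=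
      natDegree_polyOfNat (by omega) (by rw [pow_succ _ (e + 1)]; omega)
    have ha0 : polyOfNat (2 ^ (e + 1) + j) ≠ 0 := fun h => hv0 (by rw [hv, h, zero_mul])
    have hb0 : polyOfNat f ≠ 0 := fun h => hv0 (by rw [hv, h, mul_zero])
    have hsum := natDegree_mul ha0 hb0
    rw [← hv, hdeg, hd] at hsum
    rcases hirr.isUnit_or_isUnit hv with h | h
    · rw [hunit _ ha0] at h; omega
    · rw [hunit _ hb0] at h; omega

end

/-! ### Finding a modulus -/

/-- Computes `n = 2 ^ m` (array `5`), `n - 1` (array `6`) and the number `α s` of components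
(array `7`). -/
def sizesProg : Program :=
  asg 5 (.lit 1) ;; forTo 2 (.get 0 (.lit 2)) (asg 5 (.add (var 5) (var 5))) ;;
  asg 6 (.sub (var 5) (.lit 1)) ;;
  forTo 2 (.get 0 (.lit 1)) (asg 7 (.add (var 7) (var 0)))

lemma sizesProg_ends {σ : Memory} {α s m : ℕ} (h0 : σ.nat 0 0 = α) (h1 : σ.nat 0 1 = s)
    (h2 : σ.nat 0 2 = m) (h7 : σ.nat 7 0 = 0) :
    Ends sizesProg σ (30 * (m + s) + 60) fun τ =>
      τ.nat 5 0 = 2 ^ m ∧ τ.nat 6 0 = 2 ^ m - 1 ∧ τ.nat 7 0 = α * s := by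
  refine Ends.mono (Ends.seq (T := 3) (Q := fun τ => τ.nat 5 0 = 1)
    (Ends.of_step rfl (by decide) (by simp [Program.step, NExp.eval])) fun τ hτ h5 =>
    Ends.seq (Q := fun υ => υ.nat 5 0 = 2 ^ m)
      (Ends.forTo_const m (fun k υ => υ.nat 5 0 = 2 ^ k) 7 (by decide) ?_ ?_ ?_ le_rfl
        fun _ _ h => h) fun υ hυ h5' =>
    Ends.seq (T := 6) (Q := fun ω => ω.nat 5 0 = 2 ^ m ∧ ω.nat 6 0 = 2 ^ m - 1)
      (Ends.of_step rfl (by decide) (by simp [Program.step, NExp.eval, h5'])) fun ω hω h6 =>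
    Ends.forTo_const (T := s * 21 + 14) s (fun k υ => υ.nat 7 0 = α * k) 7 (by decide) ?_ ?_ ?_ ?_
      fun χ hχ h => ⟨?_, ?_, h⟩) ?_ fun _ _ h => h
  · intro υ hυ
    rw [NExp.eval, NExp.eval, hυ.1 0 (by decide), hτ.1 0 (by decide), h2]
  · simp [h5]
  · intro k hk υ hυ _ h
    refine Ends.of_step rfl (by decide) ?_
    simp [Program.step, NExp.eval, h, pow_succ]; ring
  · intro χ hχ
    rw [NExp.eval, NExp.eval, hχ.1 0 (by decide), hω.1 0 (by decide), hυ.1 0 (by decide),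
      hτ.1 0 (by decide), h1]
  · simp [hω.1 7 (by decide), hυ.1 7 (by decide), hτ.1 7 (by decide), h7]
  · intro k hk χ hχ _ h
    refine Ends.of_step rfl (by decide) ?_
    simp [Program.step, NExp.eval, h, hχ.1 0 (by decide), hω.1 0 (by decide), hυ.1 0 (by decide),
      hτ.1 0 (by decide), h0]; ring
  · simp [NExp.cost]; omega
  · simp [NExp.cost]; omega
  · rw [hχ.1 5 (by decide), h6.1]
  · rw [hχ.1 6 (by decide), h6.2]

end QMC

end

/-! ### Sieving for an irreducible modulus -/

noncomputable section

namespace QMC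

open Polynomial in
-- One step of Horner's rule, `d f = X d ⌊f/2⌋ + (f mod 2) d`. A lookup in the two cells `0` and
-- `d`, indexed by the parity of `f`, takes the place of a branch.
lemma polyOfNat_xor_double_sel {sel : ℕ → ℕ} {d f t : ℕ} (h0 : sel 0 = 0) (h1 : sel 1 = d)
    (ht : polyOfNat t = polyOfNat d * polyOfNat (f / 2)) :
    polyOfNat (Nat.xor (t + t) (sel (f % 2))) = polyOfNat d * polyOfNat f := by
  rw [polyOfNat_xor, polyOfNat_two_mul, ht, polyOfNat_eq_half f]
  rcases Nat.mod_two_eq_zero_or_one f with h | h <;> rw [h]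
  · rw [h0, polyOfNat_zero]; ring
  · rw [h1, polyOfNat_one]; ring

/-- Marks in array `17` the multiples of the polynomial in cell `1` of array `15` by the polynomials
less than the variable `14`. -/
def sieveInner : Program :=
  forTo 4 (var 14)
    (.setN 16 (var 4) (.xor (.add (.get 16 (.half (var 4))) (.get 16 (.half (var 4))))
      (.get 15 (par (var 4)))) ;;
    .setN 17 (.get 16 (var 4)) (.lit 1))

lemma sieveInner_ends {σ : Memory} {d B : ℕ} (h0 : σ.nat 15 0 = 0) (h1 : σ.nat 15 1 = d)
    (hB : σ.nat 14 0 = B) (hT : σ.nat 16 0 = 0) :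
    Ends sieveInner σ (60 * B + 20) fun τ => τ.nat 16 0 = 0 ∧ ∀ v, τ.nat 17 v ≠ 0 ↔
      (σ.nat 17 v ≠ 0 ∨ ∃ f < B, polyOfNat v = polyOfNat d * polyOfNat f) := by
  refine Ends.forTo_const B (fun k τ => (τ.nat 16 0 = 0 ∧
      ∀ f < k, polyOfNat (τ.nat 16 f) = polyOfNat d * polyOfNat f) ∧ ∀ v, τ.nat 17 v ≠ 0 ↔
      (σ.nat 17 v ≠ 0 ∨ ∃ f < k, polyOfNat v = polyOfNat d * polyOfNat f)) 40 (by decide)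
    (fun τ hτ => by rw [NExp.eval, NExp.eval, hτ.1 14 (by decide), hB]) (by simp [hT]) ?_
    (by simp [NExp.cost]; omega) (fun τ _ h => ⟨h.1.1, h.2⟩)
  rintro k hk τ hτ hk4 ⟨⟨hz, hI⟩, hm⟩
  have hnew : polyOfNat (Nat.xor (τ.nat 16 (k / 2) + τ.nat 16 (k / 2)) (τ.nat 15 (k % 2)))
      = polyOfNat d * polyOfNat k := by
    refine polyOfNat_xor_double_sel (by rw [hτ.1 15 (by decide), h0])
      (by rw [hτ.1 15 (by decide), h1]) ?_
    rcases Nat.eq_zero_or_pos k with rfl | hk0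
    · simp [hz, polyOfNat_zero]
    · exact hI _ (by omega)
  refine Ends.of_step rfl (by decide) ?_
  simp only [Program.step, NExp.eval, hk4, sub_half_add_half, Memory.nat_writeN,
    Function.update_apply, reduceIte, Nat.reduceEqDiff]
  set w := Nat.xor (τ.nat 16 (k / 2) + τ.nat 16 (k / 2)) (τ.nat 15 (k % 2)) with hw
  refine ⟨⟨?_, fun f hf => ?_⟩, fun v => ?_⟩
  · split_ifs with h
    · rw [← polyOfNat_eq_zero_iff, hnew, ← h, polyOfNat_zero, mul_zero]
    · exact hz
  · split_ifs with h
    · rw [hnew, h]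
    · exact hI f (by omega)
  · have : (∃ f < k + 1, polyOfNat v = polyOfNat d * polyOfNat f)
        ↔ (∃ f < k, polyOfNat v = polyOfNat d * polyOfNat f) ∨ v = w := by
      rw [← polyOfNat_injective.eq_iff (b := w), hnew]
      constructor
      · rintro ⟨f, hf, h⟩
        rcases Nat.lt_succ_iff_lt_or_eq.1 hf with h' | rfl
        · exact .inl ⟨f, h', h⟩
        · exact .inr h
      · rintro (⟨f, hf, h⟩ | h)
        · exact ⟨f, by omega, h⟩
        · exact ⟨k, by omega, h⟩
    rw [this]
    split_ifs with h
    · simp [h]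
    · rw [hm v]; simp [h]

/-- Marks the multiples of the polynomials of degree `e` by the polynomials less than the variable
`14`, where `2 ^ e` is the variable `13`. -/
def sieveMiddle : Program :=
  forTo 3 (var 13) (.setN 15 (.lit 1) (.add (var 13) (var 3)) ;; sieveInner)

lemma sieveMiddle_ends {σ : Memory} {E B : ℕ} (h0 : σ.nat 15 0 = 0) (hE : σ.nat 13 0 = E)
    (hB : σ.nat 14 0 = B) (hT : σ.nat 16 0 = 0) :
    Ends sieveMiddle σ (E * (60 * B + 50) + 20) fun τ => (τ.nat 16 0 = 0 ∧ τ.nat 15 0 = 0) ∧ ∀ v, τ.nat 17 v ≠ 0 ↔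
      (σ.nat 17 v ≠ 0 ∨ ∃ j < E, ∃ f < B, polyOfNat v = polyOfNat (E + j) * polyOfNat f) := by
  refine Ends.forTo_const E (fun k τ => (τ.nat 16 0 = 0 ∧ τ.nat 15 0 = 0) ∧
      ∀ v, τ.nat 17 v ≠ 0 ↔
      (σ.nat 17 v ≠ 0 ∨ ∃ j < k, ∃ f < B, polyOfNat v = polyOfNat (E + j) * polyOfNat f))
    (60 * B + 30) (by decide)
    (fun τ hτ => by rw [NExp.eval, NExp.eval, hτ.1 13 (by decide), hE]) (by simp [hT, h0]) ?_
    (by simp [NExp.cost]; ring_nf; omega) (fun τ _ h => h)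
  rintro k hk τ hτ hk3 ⟨⟨hz, hz'⟩, hm⟩
  refine Ends.step_seq (T' := 60 * B + 20) 10 rfl (by decide) (by omega) ?_
  have hE' : τ.nat 13 0 = E := by rw [hτ.1 13 (by decide), hE]
  refine (sieveInner_ends (d := E + k) (B := B) ?_ ?_ ?_ ?_).mono le_rfl fun υ hυ h => ?_
  · simp [Program.step, NExp.eval, hz']
  · simp [Program.step, NExp.eval, hE', hk3]
  · simp [Program.step, hτ.1 14 (by decide), hB]
  · simp [Program.step, hz]
  · have h15 : υ.nat 15 0 = 0 := by
      rw [hυ.1 15 (by decide)]; simp [Program.step, NExp.eval, hz']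
    refine ⟨⟨by simpa using h.1, by simpa using h15⟩, fun v => ?_⟩
    have h2 := h.2 v
    simp only [Program.step, Memory.nat_writeN, Nat.reduceEqDiff, reduceIte] at h2 ⊢
    rw [h2, hm v, or_assoc]
    refine or_congr Iff.rfl ?_
    simp only [Nat.lt_succ_iff_lt_or_eq, or_and_right, exists_or, exists_eq_left]

/-- Computes a modulus (cell `0` of array `1`). -/
def modulusProg : Program :=
  asg 13 (.lit 1) ;; asg 14 (.add (var 5) (var 5)) ;;
  forTo 2 (.sub (.get 0 (.lit 2)) (.lit 1))
    (asg 13 (.add (var 13) (var 13)) ;; asg 14 (.half (var 14)) ;; sieveMiddle) ;;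
  forTo 2 (var 5) (.ite (.ltN (.get 17 (.add (var 5) (var 2))) (.lit 1))
    (.setN 1 (.lit 0) (.add (var 5) (var 2))) .skip)

/-- For factors of degree `e + 1` the sieve makes `2^(e+1) * 2^(m-e) = 2 * 2^m` marks, so all
degrees together cost of the order `m * 2^m`. An unmarked number of degree `m` remains because
irreducible polynomials of every positive degree exist. -/
lemma modulusProg_ends {σ : Memory} {m : ℕ} (hm : 1 ≤ m) (h2 : σ.nat 0 2 = m)
    (h5 : σ.nat 5 0 = 2 ^ m) (h15 : σ.nat 15 0 = 0) (h16 : σ.nat 16 0 = 0)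
    (h17 : ∀ v, σ.nat 17 v = 0) :
    Ends modulusProg σ (500 * (m * 2 ^ m)) fun τ => Irreducible (polyOfNat (τ.nat 1 0)) ∧
      2 ^ m ≤ τ.nat 1 0 ∧ τ.nat 1 0 < 2 ^ (m + 1) := by
  have hm2 : 1 ≤ 2 ^ m := Nat.one_le_two_pow
  have hmm : 2 ^ m ≤ m * 2 ^ m := Nat.le_mul_of_pos_left _ hm
  refine Ends.step_seq (T' := 350 * (m * 2 ^ m)) 5 rfl (by decide) (by nlinarith) ?_
  refine Ends.step_seq (T' := 340 * (m * 2 ^ m)) 8 rfl (by decide) (by nlinarith) ?_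
  set σ' := (asg 14 ((var 5).add (var 5))).step ((asg 13 (.lit 1)).step σ) with hσ'
  have e13 : σ'.nat 13 0 = 1 := by simp [hσ', Program.step, NExp.eval]
  have e14 : σ'.nat 14 0 = 2 ^ (m + 1) := by
    simp [hσ', Program.step, NExp.eval, h5, pow_succ]; ring
  have e : ∀ a, a ≠ 13 → a ≠ 14 → σ'.nat a = σ.nat a := fun a h h' => by
    simp [hσ', Program.step, h, h']
  clear_value σ'
  refine (Ends.seq (T := 250 * (m * 2 ^ m)) (T' := 60 * 2 ^ m + 20) (Q := fun τ => ∀ v,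
    τ.nat 17 v ≠ 0 ↔ ∃ e < m - 1, ∃ j < 2 ^ (e + 1), ∃ f < 2 ^ (m - e),
      polyOfNat v = polyOfNat (2 ^ (e + 1) + j) * polyOfNat f) ?_ fun τ hτ hτ17 => ?_).mono
      (by nlinarith) fun _ _ h => h
  · refine Ends.forTo (m - 1) (fun k τ => (τ.nat 16 0 = 0 ∧ τ.nat 15 0 = 0 ∧
      τ.nat 13 0 = 2 ^ k ∧ τ.nat 14 0 = 2 ^ (m + 1 - k)) ∧ ∀ v,
      τ.nat 17 v ≠ 0 ↔ ∃ e < k, ∃ j < 2 ^ (e + 1), ∃ f < 2 ^ (m - e),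
      polyOfNat v = polyOfNat (2 ^ (e + 1) + j) * polyOfNat f)
      (fun _ => 220 * 2 ^ m) (by decide) ?_ ?_ ?_ ?_ fun τ _ h => h.2
    · intro τ hτ
      simp only [NExp.eval, hτ.1 0 (by decide), e 0 (by decide) (by decide), h2]
    · simp [e13, e14, e 15, e 16, e 17, h15, h16, h17]
    · rintro k hk τ hτ - ⟨⟨hz, hz', h13, h14⟩, hI⟩
      have hpow : 2 ^ (m + 1 - k) = 2 * 2 ^ (m - k) := by
        rw [show m + 1 - k = m - k + 1 by omega, pow_succ, mul_comm]
      have hprod : 2 ^ (k + 1) * 2 ^ (m - k) = 2 * 2 ^ m := by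
        rw [← pow_add, show k + 1 + (m - k) = m + 1 by omega, pow_succ, mul_comm]
      have hle : 2 ^ (k + 1) ≤ 2 ^ m := Nat.pow_le_pow_right two_pos (by omega)
      refine Ends.step_seq (T' := 2 ^ (k + 1) * (60 * 2 ^ (m - k) + 50) + 40) 8 rfl (by decide)
        ?_ ?_
      · have : 2 ^ (k + 1) * (60 * 2 ^ (m - k) + 50)
            = 60 * (2 ^ (k + 1) * 2 ^ (m - k)) + 50 * 2 ^ (k + 1) := by ring
        omega
      refine Ends.step_seq (T' := 2 ^ (k + 1) * (60 * 2 ^ (m - k) + 50) + 20) 8 rfl (by decide)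
        (by omega) ?_
      refine (sieveMiddle_ends (E := 2 ^ (k + 1)) (B := 2 ^ (m - k)) ?_ ?_ ?_ ?_).mono le_rfl
        fun υ hυ h => ?_
      · simp [Program.step, hz']
      · simp [Program.step, NExp.eval, h13, pow_succ]; ring
      · simp [Program.step, NExp.eval, h14, hpow]
      · simp [Program.step, hz]
      · refine ⟨⟨by simpa using h.1.1, by simpa using h.1.2, ?_, ?_⟩, fun v => ?_⟩
        · simp [hυ.1 13 (by decide), Program.step, NExp.eval, h13, pow_succ]; ring
        · simp [hυ.1 14 (by decide), Program.step, NExp.eval, h14, hpow]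
        · have h2 := h.2 v
          simp only [Program.step, Memory.nat_writeN, Nat.reduceEqDiff, reduceIte] at h2 ⊢
          rw [h2, hI v]
          simp only [Nat.lt_succ_iff_lt_or_eq, or_and_right, exists_or, exists_eq_left]
    · obtain ⟨m, rfl⟩ := Nat.exists_eq_add_of_le' hm
      simp only [Finset.sum_const, Finset.card_range, smul_eq_mul, NExp.cost, Nat.add_sub_cancel]
      nlinarith
  · have hτ5 : τ.nat 5 0 = 2 ^ m := by
      rw [hτ.1 5 (by decide), e 5 (by decide) (by decide), h5]
    have key : ∀ v, 2 ^ m ≤ v → v < 2 ^ (m + 1) →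
        (τ.nat 17 v = 0 ↔ Irreducible (polyOfNat v)) := fun v h h' => by
      rw [← not_iff_not, not_irreducible_iff_sieve hm h h']; exact hτ17 v
    -- The invariant is conditional on an unmarked number having been passed; existence is supplied
    -- after the loop.
    refine Ends.forTo_const (2 ^ m) (fun k υ => (∃ j < k, τ.nat 17 (2 ^ m + j) = 0) →
      ∃ j < 2 ^ m, υ.nat 1 0 = 2 ^ m + j ∧ τ.nat 17 (2 ^ m + j) = 0) 30 (by decide)
      (fun υ hυ => by simp [NExp.eval, hυ.1 5 (by decide), hτ5]) (by simp) ?_ ?_ fun υ _ h => ?_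
    · intro k hk υ hυ hk2 hI
      refine Ends.of_step rfl (by decide) ?_
      simp only [Program.step, NExp.eval, BExp.holds, hk2, hυ.1 5 (by decide), hτ5,
        hυ.1 17 (by decide), Nat.lt_one_iff]
      split_ifs with h
      · intro _
        exact ⟨k, hk, by simp, h⟩
      · rintro ⟨j, hj, hj'⟩
        have : j ≠ k := by rintro rfl; exact h hj'
        simpa using hI ⟨j, by omega, hj'⟩
    · simp [NExp.cost]; omega
    · obtain ⟨f, hf, hdeg⟩ := exists_irreducible_natDegree_eq (show m ≠ 0 by omega)
      obtain ⟨v, rfl⟩ := exists_polyOfNat_eq f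
      have hv := (natDegree_polyOfNat_iff (mt polyOfNat_eq_zero_iff.2 hf.ne_zero)).1 hdeg
      obtain ⟨j, hj, h1, h3⟩ := h ⟨v - 2 ^ m, by have := hv.2; rw [pow_succ] at this; omega, by
        rw [Nat.add_sub_cancel' hv.1]; exact (key v hv.1 hv.2).2 hf⟩
      have h4 : 2 ^ m + j < 2 ^ (m + 1) := by rw [pow_succ]; omega
      rw [h1]
      exact ⟨(key _ (Nat.le_add_right _ _) h4).1 h3, Nat.le_add_right _ _, h4⟩

end QMC

end

/-! ### Tables for the arithmetic of the residue field -/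

noncomputable section

namespace QMC

section

open Polynomial

variable {p : (ZMod 2)[X]} [hpi : Fact (Irreducible p)]

lemma encNat_xor (a b : ℕ) : encNat p (Nat.xor a b) = encNat p a + encNat p b := by
  rw [encNat, polyOfNat_xor, map_add]; rfl

lemma encNat_two_mul (a : ℕ) : encNat p (a + a) = AdjoinRoot.root p * encNat p a := by
  rw [encNat, polyOfNat_two_mul, map_mul, AdjoinRoot.mk_X]; rfl

lemma encNat_one : encNat p 1 = 1 := by rw [encNat, polyOfNat_one, map_one]

lemma encNat_eq_zero_iff {k : ℕ} (hk : k < 2 ^ p.natDegree) : encNat p k = 0 ↔ k = 0 := by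
  refine ⟨fun h => encNat_injOn hk (Nat.two_pow_pos _) (h.trans encNat_zero.symm), ?_⟩
  rintro rfl
  exact encNat_zero

lemma encNat_eq_half (a : ℕ) :
    encNat p a = AdjoinRoot.root p * encNat p (a / 2) + encNat p (a % 2) := by
  rw [encNat, polyOfNat_eq_half, map_add, map_mul, AdjoinRoot.mk_X]; rfl

lemma encNat_eq_split (h a : ℕ) :
    encNat p a = AdjoinRoot.root p ^ h * encNat p (a / 2 ^ h) + encNat p (a % 2 ^ h) := by
  have : polyOfNat a = X ^ h * polyOfNat (a / 2 ^ h) + polyOfNat (a % 2 ^ h) := by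
    ext i
    rw [coeff_add, coeff_X_pow_mul', coeff_polyOfNat, coeff_polyOfNat, coeff_polyOfNat,
      Nat.testBit_mod_two_pow, Nat.testBit_div_two_pow]
    by_cases hi : h ≤ i
    · simp [hi, not_lt.2 hi]
    · simp [hi, not_le.1 hi]
  rw [encNat, this, map_add, map_mul, map_pow, AdjoinRoot.mk_X]; rfl

end

/-- The leading bits at position `m` cancel. This is the reduction modulo `p` after multiplication
by the indeterminate. -/
lemma xor_lt_two_pow_of_le {m a b : ℕ} (ha : 2 ^ m ≤ a) (ha' : a < 2 ^ (m + 1)) (hb : 2 ^ m ≤ b)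
    (hb' : b < 2 ^ (m + 1)) : Nat.xor a b < 2 ^ m := by
  refine Nat.lt_pow_two_of_testBit _ fun i hi => ?_
  have e : (Nat.xor a b).testBit i = (a.testBit i ^^ b.testBit i) := Nat.testBit_xor a b i
  have top : ∀ c, 2 ^ m ≤ c → c < 2 ^ (m + 1) → c.testBit i = decide (i = m) := by
    intro c hc hc'
    rcases hi.eq_or_lt with rfl | hi
    · rw [Nat.testBit_eq_decide_div_mod_eq]
      have : c / 2 ^ m = 1 := by
        rw [pow_succ] at hc'
        exact Nat.div_eq_of_lt_le (by omega) (by omega)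
      simp [this]
    · rw [Nat.testBit_lt_two_pow (hc'.trans_le (Nat.pow_le_pow_right two_pos hi))]
      simp; omega
  rw [e, top a ha ha', top b hb hb']
  simp

/-! ### Tables for the arithmetic of the field -/

/-- Tabulates the multiplication by the residue class of the indeterminate (array `18`). -/
def xmulProg : Program :=
  forTo 2 (var 5) (.ite (.ltN (.add (var 2) (var 2)) (var 5))
    (.setN 18 (var 2) (.add (var 2) (var 2)))
    (.setN 18 (var 2) (.xor (.add (var 2) (var 2)) (var 1))))

lemma xmulProg_ends {p : Polynomial (ZMod 2)} [hpi : Fact (Irreducible p)] {σ : Memory} {m : ℕ}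
    (hm : p.natDegree = m) (h5 : σ.nat 5 0 = 2 ^ m) (h1 : polyOfNat (σ.nat 1 0) = p) :
    Ends xmulProg σ (60 * 2 ^ m) fun τ => ∀ v < 2 ^ m, τ.nat 18 v < 2 ^ m ∧
      encNat p (τ.nat 18 v) = AdjoinRoot.root p * encNat p v := by
  have hP0 : σ.nat 1 0 ≠ 0 := by
    intro h; rw [h, polyOfNat_zero] at h1; exact hpi.out.ne_zero h1.symm
  have hP := (natDegree_polyOfNat_iff hP0).1 ((congrArg _ h1).trans hm)
  have hn := Nat.two_pow_pos m
  refine Ends.forTo_const (2 ^ m) (fun k τ => ∀ v < k, τ.nat 18 v < 2 ^ m ∧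
      encNat p (τ.nat 18 v) = AdjoinRoot.root p * encNat p v) 35 (by decide)
    (fun τ hτ => by rw [NExp.eval, NExp.eval, hτ.1 5 (by decide), h5]) (by simp) ?_
    (by simp only [NExp.cost]; omega) (fun τ _ h => h)
  intro k hk τ hτ hk2 hI
  refine Ends.of_step rfl (by decide) ?_
  simp only [Program.step, NExp.eval, BExp.holds, hk2, hτ.1 5 (by decide), h5,
    hτ.1 1 (by decide)]
  intro v hv
  split_ifs with h
  · simp only [Memory.nat_writeN, Nat.reduceEqDiff, reduceIte, Function.update_apply]
    split_ifs with h'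
    · exact ⟨h, by rw [encNat_two_mul, h']⟩
    · exact hI v (by omega)
  · simp only [Memory.nat_writeN, Nat.reduceEqDiff, reduceIte, Function.update_apply]
    split_ifs with h'
    · refine ⟨xor_lt_two_pow_of_le (by omega) (by rw [pow_succ]; omega) hP.1 hP.2, ?_⟩
      rw [encNat_xor, encNat_two_mul, h', encNat, encNat, h1, AdjoinRoot.mk_self, add_zero]
    · exact hI v (by omega)

/-- Tabulates the lower (array `19`) and the upper half (array `20`) of the binary digits; the
variable `8` is the base of the splitting. -/
def splitProg : Program :=
  asg 8 (.lit 1) ;; forTo 2 (.half (.add (.get 0 (.lit 2)) (.lit 1))) (asg 8 (.add (var 8) (var 8)))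
  ;; forTo 2 (var 5) (.ite (.ltN (var 2) (var 8))
    (.setN 19 (var 2) (var 2) ;; .setN 20 (var 2) (.lit 0))
    (.setN 19 (var 2) (.get 19 (.sub (var 2) (var 8))) ;;
      .setN 20 (var 2) (.add (.get 20 (.sub (var 2) (var 8))) (.lit 1))))

/-- Quotient and remainder by the base are copied from the entry one base earlier, since the machine
cannot divide by it directly. -/
lemma splitProg_ends {σ : Memory} {m : ℕ} (h2 : σ.nat 0 2 = m) (h5 : σ.nat 5 0 = 2 ^ m) :
    Ends splitProg σ (120 * 2 ^ m + 30 * m + 60) fun τ => τ.nat 8 0 = 2 ^ ((m + 1) / 2) ∧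
      ∀ v < 2 ^ m, τ.nat 19 v = v % 2 ^ ((m + 1) / 2) ∧ τ.nat 20 v = v / 2 ^ ((m + 1) / 2) := by
  set S := 2 ^ ((m + 1) / 2) with hS
  have hS0 : 0 < S := Nat.two_pow_pos _
  refine Ends.step_seq (T' := 120 * 2 ^ m + 30 * m + 50) 3 rfl (by decide) (by omega) ?_
  set σ' := (asg 8 (.lit 1)).step σ with hσ'
  have e8 : σ'.nat 8 0 = 1 := by simp [hσ', Program.step, NExp.eval]
  have e : ∀ a, a ≠ 8 → σ'.nat a = σ.nat a := fun a h => by simp [hσ', Program.step, h]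
  clear_value σ'
  refine (Ends.seq (T := 30 * m + 30) (T' := 120 * 2 ^ m + 20) (Q := fun τ => τ.nat 8 0 = S)
    ?_ fun τ hτ h8 => ?_).mono (by omega) fun _ _ h => h
  · refine Ends.forTo_const ((m + 1) / 2) (fun k τ => τ.nat 8 0 = 2 ^ k) 7 (by decide) ?_
      (by simp [e8]) ?_ (by simp [NExp.cost]; omega) fun _ _ h => h
    · intro τ hτ
      simp only [NExp.eval, hτ.1 0 (by decide), e 0 (by decide), h2]
    · intro k hk τ hτ _ h
      refine Ends.of_step rfl (by decide) ?_
      simp [Program.step, NExp.eval, h, pow_succ]; ring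
  · have hτ5 : τ.nat 5 0 = 2 ^ m := by rw [hτ.1 5 (by decide), e 5 (by decide), h5]
    refine Ends.forTo_const (2 ^ m) (fun k υ => ∀ v < k, υ.nat 19 v = v % S ∧ υ.nat 20 v = v / S)
      70 (by decide)
      (fun υ hυ => by rw [NExp.eval, NExp.eval, hυ.1 5 (by decide), hτ5]) (by simp) ?_
      (by simp only [NExp.cost]; omega) (fun υ hυ h => ⟨by rw [hυ.1 8 (by decide), h8], h⟩)
    intro k hk υ hυ hk2 hI
    refine Ends.of_step rfl (by decide) ?_
    simp only [Program.step, NExp.eval, BExp.holds, hk2, hυ.1 8 (by decide), h8]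
    intro v hv
    split_ifs with h
    · simp only [Memory.nat_writeN, Nat.reduceEqDiff, reduceIte, Function.update_apply, hk2]
      split_ifs with h'
      · rw [h', Nat.mod_eq_of_lt h, Nat.div_eq_of_lt h]; exact ⟨rfl, rfl⟩
      · exact hI v (by omega)
    · simp only [Memory.nat_writeN, Nat.reduceEqDiff, reduceIte, Function.update_apply, hk2,
        hυ.1 8 (by decide), h8]
      split_ifs with h'
      · have := hI (k - S) (by omega)
        rw [this.1, this.2, h', ← Nat.mod_eq_sub_mod (by omega),
          ← Nat.div_eq_sub_div hS0 (by omega)]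
        exact ⟨rfl, rfl⟩
      · exact hI v (by omega)

/-- Tabulates the numbers of binary digits (array `26`). -/
def digitsProg : Program :=
  forTo 2 (var 6) (.setN 26 (.add (var 2) (.lit 1))
    (.add (.get 26 (.half (.add (var 2) (.lit 1)))) (.lit 1)))

lemma digitsProg_ends {σ : Memory} {m : ℕ} (h6 : σ.nat 6 0 = 2 ^ m - 1) (h26 : σ.nat 26 0 = 0) :
    Ends digitsProg σ (60 * 2 ^ m) fun τ => ∀ v, v ≠ 0 → v < 2 ^ m →
      τ.nat 26 v = (polyOfNat v).natDegree + 1 := by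
  have hn := Nat.two_pow_pos m
  refine Ends.forTo_const (2 ^ m - 1) (fun k τ => τ.nat 26 0 = 0 ∧ ∀ v, v ≠ 0 → v < k + 1 →
      τ.nat 26 v = Nat.log 2 v + 1) 35 (by decide)
    (fun τ hτ => by rw [NExp.eval, NExp.eval, hτ.1 6 (by decide), h6]) (by simp [h26]; omega) ?_
    (by simp only [NExp.cost]; omega) (fun τ _ h v hv hvn => ?_)
  · rintro k hk τ hτ hk2 ⟨hz, hI⟩
    refine Ends.of_step rfl (by decide) ?_
    simp only [Program.step, NExp.eval, hk2, Memory.nat_writeN, Nat.reduceEqDiff, reduceIte,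
      Function.update_apply, (Nat.succ_ne_zero k).symm]
    refine ⟨hz, fun v hv hvk => ?_⟩
    split_ifs with h
    · subst h
      rcases Nat.eq_zero_or_pos k with rfl | hk0
      · simp [hz]
      · rw [hI _ (by omega) (by omega),
          Nat.log_of_one_lt_of_le one_lt_two (by omega : 2 ≤ k + 1)]
    · exact hI v hv (by omega)
  · rw [h.2 v hv (by omega), natDegree_polyOfNat (Nat.pow_log_le_self 2 hv)
      (Nat.lt_pow_succ_log_self one_lt_two v)]

end QMC

end

/-! ### Divisor sums, and multiplication by a fixed class -/

noncomputable section

namespace QMC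

/-! ### Sums over divisors -/

/-- Each dyadic block of denominators contributes at most `N`. -/
lemma sum_div_Ico_le (N m : ℕ) : ∑ d ∈ Finset.Ico 1 (2 ^ m), N / d ≤ m * N := by
  induction m with
  | zero => simp
  | succ m ih =>
    rw [← Finset.sum_Ico_consecutive _ (Nat.one_le_two_pow (n := m))
      (Nat.pow_le_pow_right two_pos (Nat.le_succ m)), Nat.succ_mul]
    refine add_le_add ih ?_
    have h : ∀ d ∈ Finset.Ico (2 ^ m) (2 ^ (m + 1)), N / d ≤ N / 2 ^ m := fun d hd =>
      Nat.div_le_div_left (Finset.mem_Ico.1 hd).1 (Nat.two_pow_pos m)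
    refine (Finset.sum_le_card_nsmul _ _ _ h).trans ?_
    rw [Nat.card_Ico, pow_succ, smul_eq_mul, show 2 ^ m * 2 - 2 ^ m = 2 ^ m by omega]
    exact Nat.mul_div_le N (2 ^ m)

/-- Passing to complementary divisors bounds the divisor sum by a harmonic sum. -/
lemma sum_divisors_le (m : ℕ) :
    ∑ d ∈ (2 ^ m - 1).divisors, d ≤ m * 2 ^ m := by
  rw [← Nat.sum_div_divisors (2 ^ m - 1) fun d => d]
  refine (Finset.sum_le_sum_of_subset (t := Finset.Ico 1 (2 ^ m)) fun d hd => ?_).trans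
    ((sum_div_Ico_le _ m).trans (Nat.mul_le_mul_left m (Nat.sub_le _ _)))
  have h1 := Nat.pos_of_mem_divisors hd
  have h2 := Nat.divisor_le hd
  rw [Finset.mem_Ico]
  have := Nat.two_pow_pos m
  omega

/-- A divisor `d ≥ S` absorbs the summand `S`; at most `S` divisors lie below `S`. Here `S` will be
the size of the tables built for each trial. -/
lemma sum_divisors_add_le (m S : ℕ) :
    ∑ d ∈ (2 ^ m - 1).divisors, (S + d) ≤ S * S + 2 * (m * 2 ^ m) := by
  have h1 : ∀ d ∈ (2 ^ m - 1).divisors, S + d ≤ (if d < S then S else 0) + 2 * d := by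
    intro d _; split_ifs <;> omega
  refine (Finset.sum_le_sum h1).trans ?_
  rw [Finset.sum_add_distrib, ← Finset.mul_sum, ← Finset.sum_filter]
  refine add_le_add ?_ (Nat.mul_le_mul_left _ (sum_divisors_le m))
  rw [Finset.sum_const, smul_eq_mul]
  refine Nat.mul_le_mul_right _ ?_
  refine (Finset.card_le_card (t := Finset.range S) fun d hd => ?_).trans (Finset.card_range S).le
  exact Finset.mem_range.2 (Finset.mem_filter.1 hd).2

section

open Polynomial

variable {p : (ZMod 2)[X]} [hpi : Fact (Irreducible p)]

lemma orderOf_dvd_of_ne_zero {x : AdjoinRoot p} (hx : x ≠ 0) :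
    orderOf x ∣ 2 ^ p.natDegree - 1 := by
  rw [← card_adjoinRoot p]
  exact orderOf_dvd_of_pow_eq_one (FiniteField.pow_card_sub_one_eq_one x hx)

lemma two_pow_sub_one_pos : 0 < 2 ^ p.natDegree - 1 := by
  have := one_le_natDegree_of_irreducible p
  have := Nat.pow_le_pow_right two_pos this
  omega

lemma orderOf_pos_of_ne_zero {x : AdjoinRoot p} (hx : x ≠ 0) : 0 < orderOf x :=
  Nat.pos_of_dvd_of_pos (orderOf_dvd_of_ne_zero hx) two_pow_sub_one_pos

/-- In a field the solutions of `z ^ n = 1` are exactly the powers of any element of order `n`. -/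
lemma mem_powers_of_orderOf_dvd {x y : AdjoinRoot p} (hx : x ≠ 0) (h : orderOf y ∣ orderOf x) :
    y ∈ Submonoid.powers x := by
  have : NeZero (orderOf x) := ⟨(orderOf_pos_of_ne_zero hx).ne'⟩
  obtain ⟨i, -, hi⟩ := (IsPrimitiveRoot.orderOf x).eq_pow_of_pow_eq_one
    (orderOf_dvd_iff_pow_eq_one.1 h)
  exact ⟨i, hi⟩

lemma mem_powers_iff_exists_lt {x y : AdjoinRoot p} (hx : x ≠ 0) :
    y ∈ Submonoid.powers x ↔ ∃ i < orderOf x, y = x ^ i := by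
  constructor
  · rintro ⟨i, rfl⟩
    exact ⟨i % orderOf x, Nat.mod_lt _ (orderOf_pos_of_ne_zero hx), by simp⟩
  · rintro ⟨i, -, rfl⟩
    exact ⟨i, rfl⟩

lemma orderOf_dvd_of_mem_powers {x y : AdjoinRoot p} (h : y ∈ Submonoid.powers x) :
    orderOf y ∣ orderOf x := by
  obtain ⟨i, rfl⟩ := h
  exact orderOf_pow_dvd i

lemma exists_orderOf_eq : ∃ x : AdjoinRoot p, x ≠ 0 ∧ orderOf x = 2 ^ p.natDegree - 1 := by
  obtain ⟨u, hu⟩ := IsCyclic.exists_generator (α := (AdjoinRoot p)ˣ)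
  refine ⟨u, u.ne_zero, ?_⟩
  rw [orderOf_units, orderOf_eq_card_of_forall_mem_zpowers hu, Nat.card_units,
    Nat.card_eq_fintype_card, card_adjoinRoot]

variable (p) in
/-- The residue class `k` is a power of one of the first residue classes. -/
def Covered (b k : ℕ) : Prop := ∃ c < b, encNat p k ∈ Submonoid.powers (encNat p (c + 1))

lemma covered_succ_iff {b k : ℕ} : Covered p (b + 1) k ↔
    Covered p b k ∨ encNat p k ∈ Submonoid.powers (encNat p (b + 1)) := by
  simp only [Covered, Nat.lt_succ_iff_lt_or_eq, or_and_right, exists_or, exists_eq_left]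

/-- Powers of a power are powers, so a class that is already covered contributes nothing new and can
be skipped. -/
lemma covered_succ_iff_of_covered {b k : ℕ} (h : Covered p b (b + 1)) :
    Covered p (b + 1) k ↔ Covered p b k := by
  rw [covered_succ_iff, or_iff_left_iff_imp]
  intro hk
  obtain ⟨c, hc, h'⟩ := h
  exact ⟨c, hc, Submonoid.powers_le.2 h' hk⟩

lemma encNat_succ_ne_zero {k : ℕ} (hk : k < 2 ^ p.natDegree - 1) : encNat p (k + 1) ≠ 0 := by
  rw [Ne, encNat_eq_zero_iff (by omega)]
  omega

open scoped Classical in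
/-- The elements which have to be tried have different orders. -/
lemma sum_not_covered_le (f : ℕ → ℕ) :
    ∑ k ∈ Finset.range (2 ^ p.natDegree - 1),
        (if Covered p k (k + 1) then 0 else f (orderOf (encNat p (k + 1))))
      ≤ ∑ d ∈ (2 ^ p.natDegree - 1).divisors, f d := by
  set A := (Finset.range (2 ^ p.natDegree - 1)).filter fun k => ¬ Covered p k (k + 1) with hA
  have h1 : ∑ k ∈ Finset.range (2 ^ p.natDegree - 1),
        (if Covered p k (k + 1) then 0 else f (orderOf (encNat p (k + 1))))
      = ∑ k ∈ A, f (orderOf (encNat p (k + 1))) := by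
    rw [hA, Finset.sum_filter]
    exact Finset.sum_congr rfl fun k _ => by split_ifs <;> simp_all
  have hmem : ∀ {k}, k ∈ A → k < 2 ^ p.natDegree - 1 ∧ ¬ Covered p k (k + 1) := fun hk => by
    rw [hA, Finset.mem_filter, Finset.mem_range] at hk; exact hk
  have hlt : ∀ {i j}, i ∈ A → j ∈ A → i < j →
      orderOf (encNat p (i + 1)) ≠ orderOf (encNat p (j + 1)) := by
    intro i j hi hj hij h
    exact (hmem hj).2 ⟨i, hij,
      mem_powers_of_orderOf_dvd (encNat_succ_ne_zero (hmem hi).1) h.symm.dvd⟩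
  have hinj : Set.InjOn (fun k => orderOf (encNat p (k + 1))) A := by
    intro i hi j hj h
    rcases lt_trichotomy i j with h' | h' | h'
    · exact absurd h (hlt hi hj h')
    · exact h'
    · exact absurd h.symm (hlt hj hi h')
  rw [h1, ← Finset.sum_image (f := f) hinj]
  refine Finset.sum_le_sum_of_subset fun d hd => ?_
  obtain ⟨k, hk, rfl⟩ := Finset.mem_image.1 hd
  exact Nat.mem_divisors.2 ⟨orderOf_dvd_of_ne_zero (encNat_succ_ne_zero (hmem hk).1),
    two_pow_sub_one_pos.ne'⟩

end

/-! ### Finding a generator of the multiplicative group -/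

/-- Tabulates the multiples of the residue class in cell `1` of array `15`. -/
def tableProg (a : ℕ) : Program :=
  forTo 3 (var 8) (.setN a (var 3) (.xor (.get 18 (.get a (.half (var 3)))) (.get 15 (par (var 3)))))

/-- The table of the multiplication by the residue class of the indeterminate is available. -/
def XmulTable (p : Polynomial (ZMod 2)) (σ : Memory) : Prop :=
  ∀ v < 2 ^ p.natDegree, σ.nat 18 v < 2 ^ p.natDegree ∧
    encNat p (σ.nat 18 v) = AdjoinRoot.root p * encNat p v

lemma XmulTable.congr {p : Polynomial (ZMod 2)} {σ τ : Memory} (h : XmulTable p σ)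
    (e : τ.nat 18 = σ.nat 18) : XmulTable p τ := by unfold XmulTable; rw [e]; exact h

variable {p : Polynomial (ZMod 2)} [hpi : Fact (Irreducible p)]

/-- Horner's rule again, now with the reduction modulo `p` supplied by the table of multiplication
by the indeterminate. -/
lemma tableProg_ends {a : ℕ} (ha3 : a ≠ 3) (ha8 : a ≠ 8) (ha15 : a ≠ 15) (ha18 : a ≠ 18)
    {σ : Memory} (hX : XmulTable p σ) {S y : ℕ} (hS : σ.nat 8 0 = S) (h0 : σ.nat 15 0 = 0)
    (h1 : σ.nat 15 1 = y) (hy : y < 2 ^ p.natDegree) (ha0 : σ.nat a 0 = 0) :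
    Ends (tableProg a) σ (40 * S + 20) fun τ => τ.nat a 0 = 0 ∧
      ∀ v < S, τ.nat a v < 2 ^ p.natDegree ∧ encNat p (τ.nat a v) = encNat p y * encNat p v := by
  have hX0 : σ.nat 18 0 = 0 := by
    have h := hX 0 (Nat.two_pow_pos _)
    rw [encNat_zero, mul_zero] at h
    exact (encNat_eq_zero_iff h.1).1 h.2
  refine Ends.forTo_const S (fun k τ => τ.nat a 0 = 0 ∧ ∀ v < k, τ.nat a v < 2 ^ p.natDegree ∧
    encNat p (τ.nat a v) = encNat p y * encNat p v) 22 (by simpa [Program.wN] using ha3.symm)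
    (fun τ hτ => ?_) (by simp [ha3, ha0]) ?_
    (by simp only [NExp.cost]; omega) (fun τ _ h => h)
  · rw [NExp.eval, NExp.eval, hτ.1 8 (by simp [forTo, Program.wN]; omega), hS]
  · rintro k hk τ hτ hk3 ⟨hz, hI⟩
    have e18 : τ.nat 18 = σ.nat 18 := hτ.1 18 (by simp [forTo, Program.wN]; omega)
    have e15 : τ.nat 15 = σ.nat 15 := hτ.1 15 (by simp [forTo, Program.wN]; omega)
    have hsel : encNat p (σ.nat 15 (k % 2)) = encNat p y * encNat p (k % 2) ∧
        σ.nat 15 (k % 2) < 2 ^ p.natDegree := by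
      rcases Nat.mod_two_eq_zero_or_one k with h | h <;> rw [h]
      · rw [h0, encNat_zero, mul_zero]; exact ⟨rfl, Nat.two_pow_pos _⟩
      · rw [h1, encNat_one, mul_one]; exact ⟨rfl, hy⟩
    have hhalf : τ.nat a (k / 2) < 2 ^ p.natDegree ∧
        encNat p (τ.nat a (k / 2)) = encNat p y * encNat p (k / 2) := by
      rcases Nat.eq_zero_or_pos k with rfl | hk0
      · simp [hz, encNat_zero]
      · exact hI _ (by omega)
    have hnew : encNat p (Nat.xor (σ.nat 18 (τ.nat a (k / 2))) (σ.nat 15 (k % 2)))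
        = encNat p y * encNat p k := by
      rw [encNat_xor, (hX _ hhalf.1).2, hhalf.2, hsel.1, encNat_eq_half k]; ring
    have hlt : Nat.xor (σ.nat 18 (τ.nat a (k / 2))) (σ.nat 15 (k % 2)) < 2 ^ p.natDegree :=
      Nat.xor_lt_two_pow (hX _ hhalf.1).1 hsel.2
    refine Ends.of_step rfl (by simp [Program.maxCost, NExp.cost]) ?_
    simp only [Program.step, NExp.eval, hk3, sub_half_add_half, Memory.nat_writeN,
      Function.update_apply, reduceIte, ha3, e18, e15]
    refine ⟨?_, fun v hv => ?_⟩
    · split_ifs with h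
      · subst h
        simp [hz, hX0, h0]
      · exact hz
    · split_ifs with h
      · subst h; exact ⟨hlt, hnew⟩
      · exact hI v (by omega)

/-- Tabulates the multiplication by `var 2 + 1` in two tables (arrays `16` and `22`). -/
def multProg : Program :=
  .setN 15 (.lit 1) (.add (var 2) (.lit 1)) ;; tableProg 16 ;;
  asg 23 (.add (var 2) (.lit 1)) ;;
  forTo 3 (.half (.add (.get 0 (.lit 2)) (.lit 1))) (asg 23 (.get 18 (var 23))) ;;
  .setN 15 (.lit 1) (var 23) ;; tableProg 22

/-- A class is split into its lower and upper binary digits, `h` at a time. One table multiplies the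
lower half by the given class, the other multiplies the upper half by that class times `root ^ h`;
any product then takes two lookups and one sum. Building the tables costs only about the square root
of the field size. -/
lemma multProg_ends {σ : Memory} (hX : XmulTable p σ) {h k : ℕ}
    (hh : (p.natDegree + 1) / 2 = h) (hm : σ.nat 0 2 = p.natDegree)
    (h8 : σ.nat 8 0 = 2 ^ h) (hk : σ.nat 2 0 = k) (hkn : k + 1 < 2 ^ p.natDegree)
    (h15 : σ.nat 15 0 = 0) (h16 : σ.nat 16 0 = 0) (h22 : σ.nat 22 0 = 0) :
    Ends multProg σ (200 * 2 ^ h + 100) fun τ => (τ.nat 15 0 = 0 ∧ τ.nat 16 0 = 0 ∧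
      τ.nat 22 0 = 0) ∧
      (∀ v < 2 ^ h, τ.nat 16 v < 2 ^ p.natDegree ∧
        encNat p (τ.nat 16 v) = encNat p (k + 1) * encNat p v) ∧
      ∀ v < 2 ^ h, τ.nat 22 v < 2 ^ p.natDegree ∧
        encNat p (τ.nat 22 v) = AdjoinRoot.root p ^ h * encNat p (k + 1) * encNat p v := by
  have hh2 : h < 2 ^ h := Nat.lt_two_pow_self
  refine Ends.step_seq (T' := 200 * 2 ^ h + 90) 10 rfl (by decide) (by omega) ?_
  refine (Ends.seq (T' := 70 * 2 ^ h + 70)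
    (tableProg_ends (p := p) (a := 16) (S := 2 ^ h) (y := k + 1) (by decide) (by decide)
    (by decide) (by decide) (hX.congr ?_) ?_ ?_ ?_ hkn ?_) fun τ hτ hT => ?_).mono (by omega)
    fun _ _ h => h
  · simp [Program.step]
  · simp [Program.step, h8]
  · simp [Program.step, NExp.eval, h15]
  · simp [Program.step, NExp.eval, hk]
  · simp [Program.step, h16]
  have e : ∀ a, a ≠ 15 → a ≠ 16 → a ≠ 3 → τ.nat a = σ.nat a := fun a h h' h'' => by
    rw [hτ.1 a (by simp [tableProg, forTo, Program.wN]; omega)]; simp [Program.step, h]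
  have e15 : τ.nat 15 0 = 0 := by
    rw [hτ.1 15 (by decide)]; simp [Program.step, NExp.eval, h15]
  refine Ends.step_seq (T' := 70 * 2 ^ h + 60) 10 rfl (by decide) (by omega) ?_
  set τ' := (asg 23 (.add (var 2) (.lit 1))).step τ with hτ'
  have e' : ∀ a, a ≠ 23 → τ'.nat a = τ.nat a := fun a h => by simp [hτ', Program.step, h]
  have e23 : τ'.nat 23 0 = k + 1 := by
    simp [hτ', Program.step, NExp.eval, e 2 (by decide) (by decide) (by decide), hk]
  clear_value τ'
  have hXτ : XmulTable p τ' := hX.congr (by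
    rw [e' 18 (by decide), e 18 (by decide) (by decide) (by decide)])
  refine (Ends.seq (T := 25 * h + 20) (T' := 40 * 2 ^ h + 30)
    (Q := fun υ => υ.nat 23 0 < 2 ^ p.natDegree ∧
      encNat p (υ.nat 23 0) = AdjoinRoot.root p ^ h * encNat p (k + 1)) ?_
    fun υ hυ h23 => ?_).mono (by omega) fun _ _ h => h
  · refine Ends.forTo_const h (fun l υ => υ.nat 23 0 < 2 ^ p.natDegree ∧
      encNat p (υ.nat 23 0) = AdjoinRoot.root p ^ l * encNat p (k + 1)) 8 (by decide) ?_
      (by simp [e23, hkn]) ?_ (by simp only [NExp.cost]; omega) fun _ _ h => h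
    · intro υ hυ
      simp only [NExp.eval, hυ.1 0 (by decide), e' 0 (by decide),
        e 0 (by decide) (by decide) (by decide), hm, hh]
    · rintro l hl υ hυ - ⟨hlt, hI⟩
      refine Ends.of_step rfl (by decide) ?_
      have := hXτ.congr (hυ.1 18 (by decide)) _ hlt
      simp only [Program.step, NExp.eval, Memory.nat_writeN, Nat.reduceEqDiff, reduceIte,
        Function.update_apply]
      exact ⟨this.1, by rw [this.2, hI, pow_succ']; ring⟩
  · refine Ends.step_seq (T' := 40 * 2 ^ h + 20) 8 rfl (by decide) (by omega) ?_
    refine (tableProg_ends (p := p) (a := 22) (S := 2 ^ h) (y := υ.nat 23 0) (by decide)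
      (by decide) (by decide) (by decide) (hXτ.congr ?_) ?_ ?_ ?_ h23.1 ?_).mono le_rfl
      fun ω hω hU => ?_
    · simp [Program.step, hυ.1 18 (by decide)]
    · simp [Program.step, hυ.1 8 (by decide), e' 8 (by decide),
        e 8 (by decide) (by decide) (by decide), h8]
    · simp [Program.step, NExp.eval, hυ.1 15 (by decide), e' 15 (by decide), e15]
    · simp [Program.step, NExp.eval]
    · simp [Program.step, hυ.1 22 (by decide), e' 22 (by decide),
        e 22 (by decide) (by decide) (by decide), h22]
    · have e16 : ω.nat 16 = τ.nat 16 := by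
        rw [hω.1 16 (by decide)]
        simp [Program.step, hυ.1 16 (by decide), e' 16 (by decide)]
      refine ⟨⟨?_, by rw [e16]; exact hT.1, hU.1⟩, by rw [e16]; exact hT.2, ?_⟩
      · rw [hω.1 15 (by decide)]
        simp [Program.step, NExp.eval, hυ.1 15 (by decide), e' 15 (by decide), e15]
      · rw [h23.2] at hU
        exact hU.2

end QMC

end

/-! ### Finding a generator of the multiplicative group -/

noncomputable section

namespace QMC

variable {p : Polynomial (ZMod 2)} [hpi : Fact (Irreducible p)]

/-- Lists the powers of `var 2 + 1` in array `25` and marks them in array `21`. -/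
def powersProg : Program :=
  .setN 25 (.lit 0) (.lit 1) ;; .setN 21 (.lit 1) (.lit 1) ;;
  asg 23 (.add (var 2) (.lit 1)) ;; asg 24 (.lit 1) ;;
  .loop (.ltN (.lit 1) (var 23)) (.setN 25 (var 24) (var 23) ;; .setN 21 (var 23) (.lit 1) ;;
    asg 23 (.xor (.get 16 (.get 19 (var 23))) (.get 22 (.get 20 (var 23)))) ;;
    asg 24 (.add (var 24) (.lit 1)))

/-- The numbers below `2 ^ m` are split into two halves of binary digits. -/
def SplitTable (m h : ℕ) (σ : Memory) : Prop :=
  ∀ v < 2 ^ m, σ.nat 19 v = v % 2 ^ h ∧ σ.nat 20 v = v / 2 ^ h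

/-- Starting with the first power, the loop multiplies until it returns to one, hence runs `orderOf
x - 1` times; the power zero is recorded beforehand. -/
lemma powersProg_ends {σ : Memory} {h k : ℕ} (hh : p.natDegree ≤ 2 * h)
    (hsp : SplitTable p.natDegree h σ) (hk : σ.nat 2 0 = k) (hkn : k + 1 < 2 ^ p.natDegree)
    (h16 : ∀ v < 2 ^ h, σ.nat 16 v < 2 ^ p.natDegree ∧
        encNat p (σ.nat 16 v) = encNat p (k + 1) * encNat p v)
    (h22 : ∀ v < 2 ^ h, σ.nat 22 v < 2 ^ p.natDegree ∧
        encNat p (σ.nat 22 v) = AdjoinRoot.root p ^ h * encNat p (k + 1) * encNat p v) :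
    Ends powersProg σ (60 * orderOf (encNat p (k + 1)) + 60) fun τ =>
      (∀ i < orderOf (encNat p (k + 1)), τ.nat 25 i < 2 ^ p.natDegree ∧
        encNat p (τ.nat 25 i) = encNat p (k + 1) ^ i) ∧
      ∀ v < 2 ^ p.natDegree, τ.nat 21 v ≠ 0 ↔
        (σ.nat 21 v ≠ 0 ∨ encNat p v ∈ Submonoid.powers (encNat p (k + 1))) := by
  have hx0 : encNat p (k + 1) ≠ 0 := encNat_succ_ne_zero (by omega)
  set x := encNat p (k + 1) with hx
  have hord := orderOf_pos_of_ne_zero hx0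
  have hone : (1 : ℕ) < 2 ^ p.natDegree := by omega
  refine Ends.step_seq (T' := 60 * orderOf x + 50) 5 rfl (by decide) (by omega) ?_
  refine Ends.step_seq (T' := 60 * orderOf x + 40) 5 rfl (by decide) (by omega) ?_
  refine Ends.step_seq (T' := 60 * orderOf x + 30) 8 rfl (by decide) (by omega) ?_
  refine Ends.step_seq (T' := 60 * orderOf x + 20) 3 rfl (by decide) (by omega) ?_
  set σ' := (asg 24 (.lit 1)).step ((asg 23 (.add (var 2) (.lit 1))).step
    ((Program.setN 21 (.lit 1) (.lit 1)).step ((Program.setN 25 (.lit 0) (.lit 1)).step σ)))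
    with hσ'
  have e : ∀ a, a ≠ 25 → a ≠ 21 → a ≠ 23 → a ≠ 24 → σ'.nat a = σ.nat a := fun a h h' h'' h3 => by
    simp [hσ', Program.step, h, h', h'', h3]
  have e23 : σ'.nat 23 0 = k + 1 := by simp [hσ', Program.step, NExp.eval, hk]
  have e24 : σ'.nat 24 0 = 1 := by simp [hσ', Program.step, NExp.eval]
  have e25 : σ'.nat 25 0 = 1 := by simp [hσ', Program.step, NExp.eval]
  have e21 : ∀ v, σ'.nat 21 v = if v = 1 then 1 else σ.nat 21 v := fun v => by
    simp [hσ', Program.step, NExp.eval, Function.update_apply]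
  clear_value σ'
  refine (Ends.loop (orderOf x - 1) (fun l τ => (τ.nat 24 0 = l + 1 ∧
    τ.nat 23 0 < 2 ^ p.natDegree ∧ encNat p (τ.nat 23 0) = x ^ (l + 1)) ∧
    (∀ i < l + 1, τ.nat 25 i < 2 ^ p.natDegree ∧ encNat p (τ.nat 25 i) = x ^ i) ∧
    ∀ v < 2 ^ p.natDegree, τ.nat 21 v ≠ 0 ↔ (σ.nat 21 v ≠ 0 ∨ ∃ i < l + 1, encNat p v = x ^ i))
    (fun _ => 50) ?_ ?_ ?_).mono ?_ ?_
  · refine ⟨⟨e24, by rw [e23]; exact hkn, by rw [e23, pow_one]⟩, fun i hi => ?_, fun v hv => ?_⟩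
    · rw [Nat.lt_one_iff.1 hi, e25, encNat_one, pow_zero]
      exact ⟨hone, rfl⟩
    · have h1 : (∃ i < 0 + 1, encNat p v = x ^ i) ↔ v = 1 := by
        constructor
        · rintro ⟨i, hi, hv'⟩
          rw [Nat.lt_one_iff.1 hi, pow_zero, ← encNat_one] at hv'
          exact encNat_injOn hv hone hv'
        · rintro rfl
          exact ⟨0, one_pos, by rw [encNat_one, pow_zero]⟩
      rw [h1, e21]
      split_ifs with h' <;> simp [h']
  · rintro l hl τ hτ ⟨⟨h24, hlt, h23⟩, h25, h21⟩
    set c := τ.nat 23 0 with hc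
    have hc1 : c ≠ 1 := by
      intro h
      rw [h, encNat_one] at h23
      have := Nat.le_of_dvd (Nat.succ_pos _) (orderOf_dvd_of_pow_eq_one h23.symm)
      omega
    have hc0 : c ≠ 0 := by
      intro h
      rw [h, encNat_zero] at h23
      exact pow_ne_zero _ hx0 h23.symm
    have e19 : τ.nat 19 = σ.nat 19 := by
      rw [hτ.1 19 (by decide), e 19 (by decide) (by decide) (by decide) (by decide)]
    have e20 : τ.nat 20 = σ.nat 20 := by
      rw [hτ.1 20 (by decide), e 20 (by decide) (by decide) (by decide) (by decide)]
    have e16 : τ.nat 16 = σ.nat 16 := by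
      rw [hτ.1 16 (by decide), e 16 (by decide) (by decide) (by decide) (by decide)]
    have e22 : τ.nat 22 = σ.nat 22 := by
      rw [hτ.1 22 (by decide), e 22 (by decide) (by decide) (by decide) (by decide)]
    have hlo : c % 2 ^ h < 2 ^ h := Nat.mod_lt _ (Nat.two_pow_pos h)
    have hhi : c / 2 ^ h < 2 ^ h := by
      rw [Nat.div_lt_iff_lt_mul (Nat.two_pow_pos h), ← pow_add]
      exact hlt.trans_le (Nat.pow_le_pow_right two_pos (by omega))
    have hnew : encNat p (Nat.xor (σ.nat 16 (c % 2 ^ h)) (σ.nat 22 (c / 2 ^ h))) = x ^ (l + 2) := by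
      rw [encNat_xor, (h16 _ hlo).2, (h22 _ hhi).2, pow_succ _ (l + 1), ← h23, encNat_eq_split h c]
      ring
    have hnlt : Nat.xor (σ.nat 16 (c % 2 ^ h)) (σ.nat 22 (c / 2 ^ h)) < 2 ^ p.natDegree :=
      Nat.xor_lt_two_pow (h16 _ hlo).1 (h22 _ hhi).1
    refine ⟨?_, Ends.of_step rfl (by decide) ?_⟩
    · simp only [BExp.holds, NExp.eval, ← hc]; omega
    simp only [Program.step, NExp.eval, Memory.nat_writeN, Nat.reduceEqDiff, reduceIte,
      Function.update_apply, h24, ← hc, e19, e20, e16, e22, (hsp c hlt).1, (hsp c hlt).2]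
    refine ⟨⟨trivial, hnlt, hnew⟩, fun i hi => ?_, fun v hv => ?_⟩
    · split_ifs with h'
      · rw [h']; exact ⟨hlt, h23⟩
      · exact h25 i (by omega)
    · have h1 : (∃ i < l + 1 + 1, encNat p v = x ^ i)
          ↔ (∃ i < l + 1, encNat p v = x ^ i) ∨ v = c := by
        simp only [Nat.lt_succ_iff_lt_or_eq (n := l + 1), or_and_right, exists_or, exists_eq_left]
        refine or_congr Iff.rfl ⟨fun h' => encNat_injOn hv hlt (h'.trans h23.symm), ?_⟩
        rintro rfl
        exact h23
      rw [h1]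
      split_ifs with h'
      · simp [h']
      · rw [h21 v hv]; simp [h']
  · rintro τ - ⟨⟨-, hlt, h23⟩, -⟩
    rw [Nat.sub_add_cancel hord, pow_orderOf_eq_one, ← encNat_one] at h23
    simp [BExp.holds, NExp.eval, encNat_injOn hlt hone h23]
  · simp only [Finset.sum_const, Finset.card_range, smul_eq_mul, BExp.cost, NExp.cost]
    omega
  · rintro τ - ⟨-, h25, h21⟩
    rw [Nat.sub_add_cancel hord] at h25 h21
    refine ⟨h25, fun v hv => ?_⟩
    rw [h21 v hv, mem_powers_iff_exists_lt hx0]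

/-- Lists the powers of a generator of the multiplicative group in array `25`. -/
def generatorProg : Program :=
  forTo 2 (var 6) (.ite (.ltN (.get 21 (.add (var 2) (.lit 1))) (.lit 1))
    (multProg ;; powersProg) .skip)

/-- A marked class is a power of an earlier one. Once a generator has been tried, every nonzero
class is marked, so no later trial overwrites its list of powers; a skipped generator would be a
power of an earlier generator. -/
lemma generatorProg_ends {σ : Memory} (hX : XmulTable p σ) {h : ℕ}
    (hh : (p.natDegree + 1) / 2 = h) (hm : σ.nat 0 2 = p.natDegree)
    (hsp : SplitTable p.natDegree h σ)
    (h6 : σ.nat 6 0 = 2 ^ p.natDegree - 1) (h8 : σ.nat 8 0 = 2 ^ h)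
    (h15 : σ.nat 15 0 = 0) (h16 : σ.nat 16 0 = 0) (h22 : σ.nat 22 0 = 0)
    (h21 : ∀ v, σ.nat 21 v = 0) :
    Ends generatorProg σ (2000 * (p.natDegree * 2 ^ p.natDegree)) fun τ =>
      ∃ g : AdjoinRoot p, g ≠ 0 ∧ orderOf g = 2 ^ p.natDegree - 1 ∧
        ∀ i < 2 ^ p.natDegree - 1, τ.nat 25 i < 2 ^ p.natDegree ∧
          encNat p (τ.nat 25 i) = g ^ i := by
  classical
  have hm1 : 1 ≤ p.natDegree := one_le_natDegree_of_irreducible p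
  have hN : ∀ {k}, k < 2 ^ p.natDegree - 1 → k + 1 < 2 ^ p.natDegree := fun hk => by omega
  refine Ends.forTo (2 ^ p.natDegree - 1) (fun k τ => (τ.nat 15 0 = 0 ∧ τ.nat 16 0 = 0 ∧ τ.nat 22 0 = 0) ∧
      (∀ v < 2 ^ p.natDegree, τ.nat 21 v ≠ 0 ↔ Covered p k v) ∧
      ((∃ c < k, orderOf (encNat p (c + 1)) = 2 ^ p.natDegree - 1) → ∃ g : AdjoinRoot p, g ≠ 0 ∧
        orderOf g = 2 ^ p.natDegree - 1 ∧
        ∀ i < 2 ^ p.natDegree - 1, τ.nat 25 i < 2 ^ p.natDegree ∧ encNat p (τ.nat 25 i) = g ^ i))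
    (fun k => (if Covered p k (k + 1) then 0 else 200 * (2 ^ h + orderOf (encNat p (k + 1)))) +
      200) (by decide) ?_ ?_ ?_ ?_ ?_
  · intro τ hτ
    rw [NExp.eval, NExp.eval, hτ.1 6 (by decide), h6]
  · refine ⟨by simp [h15, h16, h22], fun v _ => ?_, ?_⟩
    · simp [h21, Covered]
    · rintro ⟨c, hc, -⟩; omega
  · rintro k hk τ hτ hk2 ⟨⟨i15, i16, i22⟩, i21, iG⟩
    have hkn := hN hk
    have hx0 : encNat p (k + 1) ≠ 0 := encNat_succ_ne_zero (by omega)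
    by_cases hcov : Covered p k (k + 1)
    · rw [if_pos hcov]
      refine (Ends.ite (T := 190) (fun hb => ?_) fun _ => Ends.of_step rfl (by decide) ?_).mono
        (by decide) fun _ _ h => h
      · exfalso
        simp only [BExp.holds, NExp.eval, hk2, Nat.lt_one_iff] at hb
        exact (i21 _ hkn).2 hcov hb
      · simp only [Program.step, Memory.nat_writeN, Nat.reduceEqDiff, reduceIte]
        refine ⟨⟨i15, i16, i22⟩, fun v hv => ?_, ?_⟩
        · rw [covered_succ_iff_of_covered hcov]; exact i21 v hv
        · rintro ⟨c, hc, hord⟩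
          rcases Nat.lt_succ_iff_lt_or_eq.1 hc with hc | rfl
          · exact iG ⟨c, hc, hord⟩
          · obtain ⟨c', hc', hmem⟩ := hcov
            refine iG ⟨c', hc', Nat.dvd_antisymm
              (orderOf_dvd_of_ne_zero (encNat_succ_ne_zero (by omega))) ?_⟩
            rw [← hord]
            exact orderOf_dvd_of_mem_powers hmem
    · rw [if_neg hcov]
      refine (Ends.ite (T := 200 * (2 ^ h + orderOf (encNat p (k + 1))) + 180) (fun _ => ?_)
        fun hb => ?_).mono ?_ fun _ _ h => h
      · refine (Ends.seq (T := 200 * 2 ^ h + 100)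
          (T' := 60 * orderOf (encNat p (k + 1)) + 60)
          (multProg_ends (k := k) (hX.congr (hτ.1 18 (by decide))) hh
          (by rw [hτ.1 0 (by decide), hm]) (by rw [hτ.1 8 (by decide), h8]) hk2 hkn i15 i16 i22)
          fun υ hυ hM => (powersProg_ends (k := k) (h := h) (by omega) (fun v hv => by
            rw [hυ.1 19 (by decide), hυ.1 20 (by decide), hτ.1 19 (by decide),
              hτ.1 20 (by decide)]
            exact hsp v hv)
            (by rw [hυ.1 2 (by decide), hk2]) hkn hM.2.1 hM.2.2).mono le_rfl fun ω hω hP => ?_).mono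
          (by omega) fun _ _ h => h
        simp only [Memory.nat_writeN, Nat.reduceEqDiff, reduceIte]
        rw [hω.1 15 (by decide), hω.1 16 (by decide), hω.1 22 (by decide)]
        refine ⟨hM.1, fun v hv => ?_, ?_⟩
        · rw [hP.2 v hv, hυ.1 21 (by decide), i21 v hv, covered_succ_iff]
        · rintro ⟨c, hc, hord⟩
          have hdvd : orderOf (encNat p (k + 1)) ∣ 2 ^ p.natDegree - 1 :=
            orderOf_dvd_of_ne_zero hx0
          have hlast : orderOf (encNat p (k + 1)) = 2 ^ p.natDegree - 1 := by
            rcases Nat.lt_succ_iff_lt_or_eq.1 hc with hc | rfl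
            · exact absurd ⟨c, hc, mem_powers_of_orderOf_dvd
                (encNat_succ_ne_zero (by omega)) (by rw [hord]; exact hdvd)⟩ hcov
            · exact hord
          exact ⟨_, hx0, hlast, by rw [← hlast]; exact hP.1⟩
      · exfalso
        simp only [BExp.holds, NExp.eval, hk2, Nat.lt_one_iff] at hb
        exact hcov ((i21 _ hkn).1 hb)
      · simp [BExp.cost, NExp.cost]; omega
  -- A trial costs the table size `2 ^ h` plus the order of the class. Rounding `h` up gives `2 ^ h
  -- * 2 ^ h ≤ 2 * 2 ^ p.natDegree`, so tables and lists together stay of the order of the divisor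
  -- sum bound.
  · have h1 := sum_not_covered_le (p := p) fun d => 200 * (2 ^ h + d)
    rw [← Finset.mul_sum] at h1
    have h2 := sum_divisors_add_le p.natDegree (2 ^ h)
    have h3 : 2 ^ h * 2 ^ h ≤ 2 * 2 ^ p.natDegree := by
      rw [← pow_add, ← pow_succ']
      exact Nat.pow_le_pow_right two_pos (by omega)
    have h4 : 2 ^ p.natDegree ≤ p.natDegree * 2 ^ p.natDegree := Nat.le_mul_of_pos_left _ hm1
    have h5 := Nat.two_pow_pos p.natDegree
    simp only [add_assoc, Finset.sum_add_distrib, Finset.sum_const, Finset.card_range, smul_eq_mul,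
      NExp.cost] at h1 ⊢
    omega
  · rintro τ - ⟨-, -, hG⟩
    obtain ⟨x, hx0, hx⟩ := exists_orderOf_eq (p := p)
    obtain ⟨v, hv, rfl⟩ := exists_encNat_eq x
    have hv0 : v ≠ 0 := by rintro rfl; exact hx0 encNat_zero
    exact hG ⟨v - 1, by omega, by rw [Nat.sub_add_cancel (by omega)]; exact hx⟩

end QMC

end

/-! ### Tables of the kernel -/

noncomputable section

namespace QMC

/-! ### Tabulating the kernel -/

/-- Abbreviation for the value of a real variable. -/
abbrev rvar (a : ℕ) : RExp := .get a (.lit 0)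

/-- Assignment to a real variable. -/
abbrev rasg (a : ℕ) (x : RExp) : Program := .setR a (.lit 0) x

/-- Tabulates the possible values of the kernel (real array `0`). -/
def kernelProg : Program :=
  rasg 9 (.ofNat (.lit 1)) ;;
  forTo 2 (.get 0 (.lit 0)) (rasg 9 (.div (rvar 9) (.ofNat (.lit 2)))) ;;
  rasg 10 (rvar 9) ;; rasg 11 (.ofNat (.lit 1)) ;;
  forTo 2 (.get 0 (.lit 2)) (.setR 0 (var 2) (.sub (rvar 11) (rvar 10)) ;;
    rasg 11 (.add (rvar 11) (rvar 10)) ;; rasg 10 (.mul (rvar 10) (.add (rvar 9) (rvar 9))))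

lemma kernelProg_ends {σ : Memory} {α m : ℕ} (hα : σ.nat 0 0 = α) (hm : σ.nat 0 2 = m) :
    Ends kernelProg σ (40 * α + 60 * m + 100) fun τ =>
      ∀ t < m, τ.real 0 t = kernelValue ((1 / 2) ^ α) t := by
  refine Ends.step_seq (T' := 40 * α + 60 * m + 90) 4 rfl (by decide) (by omega) ?_
  set σ' := (rasg 9 (.ofNat (.lit 1))).step σ with hσ'
  have e9 : σ'.real 9 0 = 1 := by simp [hσ', Program.step, NExp.eval, RExp.eval]
  have e : σ'.nat = σ.nat := by simp [hσ', Program.step]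
  clear_value σ'
  set b : ℝ := (1 / 2) ^ α with hb
  refine (Ends.seq (T := 30 * α + 20) (T' := 60 * m + 40) (Q := fun τ => τ.real 9 0 = b) ?_
    fun τ hτ h9 => ?_).mono (by omega) fun _ _ h => h
  · refine Ends.forTo_const α (fun k τ => τ.real 9 0 = (1 / 2) ^ k) 8 (by decide)
      (fun τ hτ => by rw [NExp.eval, NExp.eval, hτ.1 0 (by decide), e, hα]) (by simp [e9]) ?_
      (by simp only [NExp.cost]; omega) fun _ _ h => h
    intro k hk τ hτ _ h
    refine Ends.of_step rfl (by decide) ?_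
    simp [Program.step, NExp.eval, RExp.eval, h, pow_succ]; ring
  refine Ends.step_seq (T' := 60 * m + 30) 5 rfl (by decide) (by omega) ?_
  refine Ends.step_seq (T' := 60 * m + 20) 5 rfl (by decide) (by omega) ?_
  set τ' := (rasg 11 (.ofNat (.lit 1))).step ((rasg 10 (rvar 9)).step τ) with hτ'
  have f9 : τ'.real 9 0 = b := by simp [hτ', Program.step, h9]
  have f10 : τ'.real 10 0 = b := by simp [hτ', Program.step, NExp.eval, RExp.eval, h9]
  have f11 : τ'.real 11 0 = 1 := by simp [hτ', Program.step, NExp.eval, RExp.eval]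
  have f : τ'.nat = τ.nat := by simp [hτ', Program.step]
  clear_value τ'
  refine Ends.forTo_const m (fun k υ => (υ.real 10 0 = b ^ (k + 1) * 2 ^ k ∧
      υ.real 11 0 = 1 + ∑ i ∈ Finset.range k, b ^ (i + 1) * 2 ^ i) ∧
      ∀ t < k, υ.real 0 t = kernelValue b t) 40 (by decide) (fun υ hυ => by
        rw [NExp.eval, NExp.eval, hυ.1 0 (by decide), f, hτ.1 0 (by decide), e, hm])
      (by simp [f10, f11]) ?_ (by simp only [NExp.cost]; omega) fun _ _ h => h.2
  rintro k hk υ hυ hk2 ⟨⟨h10, h11⟩, hI⟩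
  have g9 : υ.real 9 0 = b := by rw [hυ.2 9 (by decide), f9]
  refine Ends.of_step rfl (by decide) ?_
  simp only [Program.step, NExp.eval, RExp.eval, hk2, Memory.real_writeR,
    Memory.real_writeN, Nat.reduceEqDiff, reduceIte, Function.update_apply, h10, h11, g9]
  refine ⟨⟨by ring, by rw [Finset.sum_range_succ]; ring⟩, fun t ht => ?_⟩
  split_ifs with h
  · subst h; rw [kernelValue]
  · exact hI t (by omega)

variable {p : Polynomial (ZMod 2)} [hpi : Fact (Irreducible p)]

/-- The first powers of `g` are listed in array `25`. -/
def PowerList (g : AdjoinRoot p) (σ : Memory) : Prop :=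
  ∀ i < 2 ^ p.natDegree - 1, σ.nat 25 i < 2 ^ p.natDegree ∧ encNat p (σ.nat 25 i) = g ^ i

/-- Tabulates the kernel on the powers of the generator, two periods (real array `1`), and
initializes the products of kernels (real array `2`). -/
def periodProg : Program :=
  forTo 2 (var 6)
    (.setR 1 (var 2) (.get 0 (.sub (.get 0 (.lit 2)) (.get 26 (.get 25 (var 2))))) ;;
    .setR 1 (.add (var 6) (var 2)) (.get 1 (var 2)) ;;
    .setR 2 (var 2) (.ofNat (.lit 1)))

/-- The kernel depends only on the degree of the representative, so each value is a table lookup.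
Two periods are stored so that a cyclic convolution becomes part of an ordinary one. -/
lemma periodProg_ends {σ : Memory} {α : ℕ} {g : AdjoinRoot p} (hg0 : g ≠ 0)
    (hg : orderOf g = 2 ^ p.natDegree - 1) (hG : PowerList g σ)
    (hm : σ.nat 0 2 = p.natDegree) (h6 : σ.nat 6 0 = 2 ^ p.natDegree - 1)
    (h26 : ∀ v, v ≠ 0 → v < 2 ^ p.natDegree → σ.nat 26 v = (polyOfNat v).natDegree + 1)
    (hC : ∀ t < p.natDegree, σ.real 0 t = kernelValue ((1 / 2) ^ α) t)
    (h1 : ∀ i, σ.real 1 i = 0) (h2 : ∀ i, σ.real 2 i = 0) :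
    Ends periodProg σ (100 * 2 ^ p.natDegree) fun τ =>
      (∀ l, τ.real 1 l = if l < 2 * (2 ^ p.natDegree - 1) then
        meritKernel ((1 / 2) ^ α) (g ^ l) else 0) ∧
      ∀ i, τ.real 2 i = if i < 2 ^ p.natDegree - 1 then 1 else 0 := by
  have hn := Nat.two_pow_pos p.natDegree
  set N := 2 ^ p.natDegree - 1 with hN
  refine Ends.forTo_const N (fun k τ => (∀ l, τ.real 1 l =
      if l < k ∨ N ≤ l ∧ l < N + k then meritKernel ((1 / 2) ^ α) (g ^ l) else 0) ∧
      ∀ i, τ.real 2 i = if i < k then 1 else 0) 60 (by decide)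
      (fun υ hυ => by rw [NExp.eval, NExp.eval, hυ.1 6 (by decide), h6]) ?_ ?_
      (by simp only [NExp.cost]; omega) fun τ _ h => ⟨fun l => ?_, h.2⟩
  · refine ⟨fun l => ?_, fun i => by simp [h2]⟩
    rw [if_neg (by omega)]; simp [h1]
  · rintro k hk τ hτ hk2 ⟨hV, hW⟩
    obtain ⟨hlt, hpow⟩ := hG k hk
    have hv0 : σ.nat 25 k ≠ 0 := by
      intro h
      rw [h, encNat_zero] at hpow
      exact pow_ne_zero _ hg0 hpow.symm
    have hdeg : (polyOfNat (σ.nat 25 k)).natDegree < p.natDegree := by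
      have h0 : polyOfNat (σ.nat 25 k) ≠ 0 := mt polyOfNat_eq_zero_iff.1 hv0
      have := degree_polyOfNat_lt_iff.2 hlt
      rw [Polynomial.degree_eq_natDegree h0] at this
      exact_mod_cast this
    have hval : τ.real 0 (p.natDegree - τ.nat 26 (τ.nat 25 k)) = meritKernel ((1 / 2) ^ α) (g ^ k) := by
      rw [hτ.2 0 (by decide), hτ.1 26 (by decide), hτ.1 25 (by decide), h26 _ hv0 hlt,
        hC _ (by omega), ← hpow, encNat]
      exact (meritKernel_mk _ (mt polyOfNat_eq_zero_iff.1 hv0) (by omega)).symm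
    have hper : g ^ (N + k) = g ^ k := by rw [pow_add, ← hg, pow_orderOf_eq_one, one_mul]
    have h0 : τ.nat 0 2 = p.natDegree := by rw [hτ.1 0 (by decide), hm]
    have h6' : τ.nat 6 0 = N := by rw [hτ.1 6 (by decide), h6]
    refine Ends.of_step rfl (by decide) ?_
    simp only [Program.step, NExp.eval, RExp.eval, hk2, Memory.real_writeR, Memory.nat_writeR,
      Memory.real_writeN, Nat.reduceEqDiff, reduceIte, Function.update_apply, h0, h6', hval]
    refine ⟨fun l => ?_, fun i => ?_⟩
    · by_cases e1 : l = N + k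
      · rw [if_pos e1, if_pos (by omega), e1, hper]
      rw [if_neg e1]
      by_cases e2 : l = k
      · rw [if_pos e2, if_pos (by omega), e2]
      rw [if_neg e2, hV l]
      exact if_congr (by omega) rfl rfl
    · by_cases e2 : i = k
      · rw [if_pos e2, if_pos (by omega)]; simp
      rw [if_neg e2, hW i]
      exact if_congr (by omega) rfl rfl
  · rw [h.1 l]
    exact if_congr (by omega) rfl rfl

end QMC

end

/-! ### A Fourier transform built from square roots -/

noncomputable section

namespace QMC

open Complex ComplexConjugate

/-! ### The fast Fourier transform -/

/-- One of the square roots of the complex number `w` on the unit circle; the other one is obtained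
for odd `r`. -/
def sqrtSigned (r : ℕ) (w : ℂ) : ℂ :=
  ⟨(1 - ((r % 2 + r % 2 : ℕ) : ℝ)) * √((1 + w.re) / 2),
    w.im / ((1 - ((r % 2 + r % 2 : ℕ) : ℝ)) * √((1 + w.re) / 2)
      + (1 - ((r % 2 + r % 2 : ℕ) : ℝ)) * √((1 + w.re) / 2))⟩

/-- The twiddle factors: the `2 ^ l`-th roots of `i`, with period `2 ^ l`. -/
def twiddle : ℕ → ℕ → ℂ
  | 0, _ => I
  | l + 1, r => sqrtSigned r (twiddle l (r / 2))

/-- The half-angle formulas: the real part of the root is `±√((1 + Re w) / 2)`, and the imaginary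
part is `Im w` divided by twice the real part, which is nonzero for `w ≠ -1`. -/
lemma sqrtSigned_sq {w : ℂ} (hw : normSq w = 1) (hre : w.re ≠ -1) (r : ℕ) :
    sqrtSigned r w ^ 2 = w ∧ normSq (sqrtSigned r w) = 1 := by
  rw [normSq_apply] at hw
  have h1 : 0 < 1 + w.re := by
    have : -1 ≤ w.re := by nlinarith [mul_self_nonneg w.im]
    have := lt_of_le_of_ne this (Ne.symm hre)
    linarith
  set x := (1 - ((r % 2 + r % 2 : ℕ) : ℝ)) * √((1 + w.re) / 2) with hx
  have hx2 : x * x = (1 + w.re) / 2 := by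
    have hs : (1 - ((r % 2 + r % 2 : ℕ) : ℝ)) * (1 - ((r % 2 + r % 2 : ℕ) : ℝ)) = 1 := by
      rcases Nat.mod_two_eq_zero_or_one r with h | h <;> rw [h] <;> norm_num
    rw [hx, mul_mul_mul_comm, hs, one_mul, Real.mul_self_sqrt (by linarith)]
  have hx0 : x ≠ 0 := by rintro h; rw [h] at hx2; linarith
  have him : (w.im / (x + x)) * (w.im / (x + x)) = (1 - w.re) / 2 := by
    have e : (x + x) * (x + x) = 2 * (1 + w.re) := by linear_combination 4 * hx2
    rw [div_mul_div_comm, e, div_eq_div_iff (by linarith) (by norm_num)]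
    linear_combination 2 * hw
  have e : sqrtSigned r w = ⟨x, w.im / (x + x)⟩ := rfl
  rw [e]
  constructor
  · rw [sq]
    apply Complex.ext
    · simp only [mul_re, hx2, him]; ring
    · simp only [mul_im]; field_simp
  · simp only [normSq_apply, hx2, him]; ring

lemma sqrtSigned_odd (j : ℕ) (w : ℂ) : sqrtSigned (2 * j + 1) w = -sqrtSigned (2 * j) w := by
  have h1 : (2 * j + 1) % 2 = 1 := by omega
  have h2 : 2 * j % 2 = 0 := by omega
  unfold sqrtSigned
  rw [h1, h2]
  apply Complex.ext
  · simp; norm_num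
  · simp only [neg_im]
    norm_num
    rw [← div_neg]; ring_nf

/-- The tower of square roots starts at `i` and not at `1` so that it never meets `-1`, where the
half-angle formula divides by zero. -/
lemma re_ne_neg_one {w : ℂ} {l : ℕ} (h1 : normSq w = 1) (h4 : w ^ 2 ^ l = I) : w.re ≠ -1 := by
  intro h
  rw [normSq_apply, h] at h1
  have h2 : w.im = 0 := by nlinarith [mul_self_nonneg w.im]
  have h3 : w = -1 := Complex.ext (by simp [h]) (by simp [h2])
  rw [h3] at h4
  cases l with
  | zero => have := congrArg re h4; simp at this
  | succ l =>
    rw [pow_succ', pow_mul, neg_one_sq, one_pow] at h4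
    have := congrArg re h4
    simp at this

lemma twiddle_spec (l r : ℕ) : normSq (twiddle l r) = 1 ∧ twiddle l r ^ 2 ^ l = I := by
  induction l generalizing r with
  | zero => simp [twiddle]
  | succ l ih =>
    obtain ⟨h1, h2⟩ := sqrtSigned_sq (ih (r / 2)).1 (re_ne_neg_one (ih _).1 (ih _).2) r
    refine ⟨h2, ?_⟩
    rw [pow_succ', pow_mul]
    change (sqrtSigned r (twiddle l (r / 2)) ^ 2) ^ 2 ^ l = I
    rw [h1, (ih _).2]

lemma twiddle_sq (l r : ℕ) : twiddle (l + 1) r ^ 2 = twiddle l (r / 2) := by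
  exact (sqrtSigned_sq (twiddle_spec l (r / 2)).1
    (re_ne_neg_one (twiddle_spec l (r / 2)).1 (twiddle_spec l (r / 2)).2) r).1

lemma twiddle_odd (l j : ℕ) : twiddle (l + 1) (2 * j + 1) = -twiddle (l + 1) (2 * j) := by
  change sqrtSigned _ _ = -sqrtSigned _ _
  rw [sqrtSigned_odd, show (2 * j + 1) / 2 = j by omega, show 2 * j / 2 = j by omega]

lemma twiddle_mul_conj (l r : ℕ) : twiddle l r * conj (twiddle l r) = 1 := by
  rw [mul_conj, (twiddle_spec l r).1, ofReal_one]

lemma twiddle_add (l i r : ℕ) : twiddle l (i * 2 ^ l + r) = twiddle l r := by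
  induction l generalizing i r with
  | zero => rfl
  | succ l ih =>
    have e : i * 2 ^ (l + 1) = 2 * (i * 2 ^ l) := by ring
    have h1 : (i * 2 ^ (l + 1) + r) % 2 = r % 2 := by rw [e]; omega
    have h2 : (i * 2 ^ (l + 1) + r) / 2 = i * 2 ^ l + r / 2 := by rw [e]; omega
    change sqrtSigned _ _ = sqrtSigned _ _
    rw [h2, ih, sqrtSigned, h1]
    rfl

/-- The first `l` steps of the Fourier transform of a vector of length `2 H`. -/
def fourier (H : ℕ) (a : ℕ → ℂ) : ℕ → ℕ → ℂ
  | 0, r => a r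
  | l + 1, r => fourier H a l (r / 2) + twiddle (l + 1) r * fourier H a l (r / 2 + H)

lemma fourier_eval {L l : ℕ} (hl : l ≤ L + 1) (a : ℕ → ℂ) {r : ℕ} (hr : r < 2 ^ l) {x : ℂ}
    (hx : x ^ 2 ^ (L + 1 - l) = twiddle l r) :
    ∑ i ∈ Finset.range (2 ^ (L + 1 - l)), fourier (2 ^ L) a l (i * 2 ^ l + r) * x ^ i
      = ∑ i ∈ Finset.range (2 ^ (L + 1)), a i * x ^ i := by
  induction l generalizing r with
  | zero =>
    rw [pow_zero, Nat.lt_one_iff] at hr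
    subst hr
    simp [fourier]
  | succ l ih =>
    have e1 : L + 1 - l = L - l + 1 := by omega
    have e2 : L + 1 - (l + 1) = L - l := by omega
    have e3 : 2 ^ L = 2 ^ (L - l) * 2 ^ l := by rw [← pow_add, Nat.sub_add_cancel (by omega)]
    rw [e2] at hx ⊢
    rw [← ih (by omega) (r := r / 2) (by rw [pow_succ] at hr; omega)
      (by rw [e1, pow_succ, pow_mul, hx, twiddle_sq]), e1,
      show 2 ^ (L - l + 1) = 2 ^ (L - l) + 2 ^ (L - l) by ring,
      Finset.sum_range_add, ← Finset.sum_add_distrib]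
    refine Finset.sum_congr rfl fun i _ => ?_
    have h2 : (i * 2 ^ (l + 1) + r) / 2 = i * 2 ^ l + r / 2 := by
      rw [show i * 2 ^ (l + 1) = 2 * (i * 2 ^ l) by ring]; omega
    rw [fourier, twiddle_add, h2, ← hx, e3, pow_add,
      show (2 ^ (L - l) + i) * 2 ^ l + r / 2 = i * 2 ^ l + r / 2 + 2 ^ (L - l) * 2 ^ l by ring]
    ring

lemma fourier_eq_eval (L : ℕ) (a : ℕ → ℂ) {r : ℕ} (hr : r < 2 ^ (L + 1)) :
    fourier (2 ^ L) a (L + 1) r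
      = ∑ i ∈ Finset.range (2 ^ (L + 1)), a i * twiddle (L + 1) r ^ i := by
  rw [← fourier_eval le_rfl a hr (x := twiddle (L + 1) r) (by simp)]
  simp

/-- Neighbouring entries have opposite twiddle factors, so their sum and difference recover the two
halves, up to the factor two. -/
lemma fourier_inverse_left (H : ℕ) (a : ℕ → ℂ) (l j : ℕ) :
    fourier H a (l + 1) (2 * j) + fourier H a (l + 1) (2 * j + 1) = 2 * fourier H a l j := by
  rw [fourier, fourier, twiddle_odd, show (2 * j + 1) / 2 = j by omega,
    show 2 * j / 2 = j by omega]
  ring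

lemma fourier_inverse_right (H : ℕ) (a : ℕ → ℂ) (l j : ℕ) :
    (fourier H a (l + 1) (2 * j) - fourier H a (l + 1) (2 * j + 1)) *
      conj (twiddle (l + 1) (2 * j)) = 2 * fourier H a l (H + j) := by
  rw [fourier, fourier, twiddle_odd, show (2 * j + 1) / 2 = j by omega,
    show 2 * j / 2 = j by omega, add_comm H]
  linear_combination (2 * fourier H a l (j + H)) * twiddle_mul_conj (l + 1) (2 * j)

/-- The convolution of two sequences, the first one supported on `{0, …, N - 1}`. -/
def convolution (N : ℕ) (w v : ℕ → ℝ) (j : ℕ) : ℝ :=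
  ∑ i ∈ Finset.range N, if i ≤ j then w i * v (j - i) else 0

/-- Convolution is multiplication of polynomials; the length `K` has room for all coefficients of
the product, so nothing wraps around. -/
lemma convolution_eval {N M K : ℕ} (hK : N + M ≤ K) {w v : ℕ → ℝ} (hw : ∀ i, N ≤ i → w i = 0)
    (hv : ∀ i, M ≤ i → v i = 0) (x : ℂ) :
    ∑ j ∈ Finset.range K, (convolution N w v j : ℂ) * x ^ j
      = (∑ i ∈ Finset.range K, (w i : ℂ) * x ^ i) * ∑ i ∈ Finset.range K, (v i : ℂ) * x ^ i := by
  have hN : ∑ i ∈ Finset.range K, (w i : ℂ) * x ^ i = ∑ i ∈ Finset.range N, (w i : ℂ) * x ^ i := by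
    refine (Finset.sum_subset (Finset.range_mono (by omega)) fun i _ hi => ?_).symm
    rw [hw i (by simpa using hi)]; simp
  have hM : ∀ k, M ≤ k → ∑ i ∈ Finset.range k, (v i : ℂ) * x ^ i
      = ∑ i ∈ Finset.range M, (v i : ℂ) * x ^ i := fun k hk => by
    refine (Finset.sum_subset (Finset.range_mono hk) fun i _ hi => ?_).symm
    rw [hv i (by simpa using hi)]; simp
  rw [hN, Finset.sum_mul]
  simp only [convolution, ofReal_sum, Finset.sum_mul]
  rw [Finset.sum_comm]
  refine Finset.sum_congr rfl fun i hi => ?_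
  have hi := Finset.mem_range.1 hi
  obtain ⟨k, rfl⟩ : ∃ k, K = i + k := ⟨K - i, by omega⟩
  rw [hM _ (by omega), ← hM k (by omega), Finset.sum_range_add, Finset.mul_sum,
    Finset.sum_eq_zero, zero_add]
  · refine Finset.sum_congr rfl fun j _ => ?_
    rw [if_pos (Nat.le_add_right i j), Nat.add_sub_cancel_left, pow_add]
    push_cast
    ring
  · intro j hj
    rw [if_neg (by simpa using hj)]
    simp

/-- The Fourier transform turns convolutions into products. -/
lemma fourier_convolution {N M L : ℕ} (hK : N + M ≤ 2 ^ (L + 1)) {w v : ℕ → ℝ}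
    (hw : ∀ i, N ≤ i → w i = 0) (hv : ∀ i, M ≤ i → v i = 0) {r : ℕ} (hr : r < 2 ^ (L + 1)) :
    fourier (2 ^ L) (fun j => (convolution N w v j : ℂ)) (L + 1) r
      = fourier (2 ^ L) (fun i => (w i : ℂ)) (L + 1) r *
        fourier (2 ^ L) (fun i => (v i : ℂ)) (L + 1) r := by
  rw [fourier_eq_eval L _ hr, fourier_eq_eval L _ hr, fourier_eq_eval L _ hr,
    convolution_eval hK hw hv]

end QMC

end

/-! ### Running the transform on the machine -/

noncomputable section

namespace QMC

open Complex ComplexConjugate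

/-! ### Programs for the Fourier transform -/

/-- Complex numbers are stored in two real arrays. -/
def cell (a b : ℕ) (σ : Memory) (i : ℕ) : ℂ := ⟨σ.real a i, σ.real b i⟩

lemma cell_writeR {a b : ℕ} (hab : a ≠ b) (σ : Memory) (t : ℕ) (x y : ℝ) (c : ℕ) :
    cell a b ((σ.writeR a t x).writeR b t y) c = if c = t then ⟨x, y⟩ else cell a b σ c := by
  simp only [cell, Memory.real_writeR, hab, hab.symm, reduceIte, Function.update_apply]
  split_ifs <;> rfl

lemma cell_writeN (a b : ℕ) (σ : Memory) (i t v : ℕ) :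
    cell a b (σ.writeN i t v) = cell a b σ := rfl

lemma cell_congr {a b : ℕ} {σ τ : Memory} (h : τ.real a = σ.real a) (h' : τ.real b = σ.real b) :
    cell a b τ = cell a b σ := by
  funext i; rw [cell, cell, h, h']

/-- The number of steps of the Fourier transform. -/
abbrev steps : NExp := .add (.get 0 (.lit 2)) (.lit 2)

/-- Computes the length of the Fourier transform (array `9`) and its half (array `10`). -/
def lengthProg : Program := asg 10 (.add (var 5) (var 5)) ;; asg 9 (.add (var 10) (var 10))

/-- Tabulates the twiddle factors (arrays `3` and `4`). -/
def twiddleProg : Program :=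
  forTo 2 (var 9) (.setR 3 (var 2) (.ofNat (.lit 0)) ;; .setR 4 (var 2) (.ofNat (.lit 1))) ;;
  asg 12 (.lit 0) ;;
  forTo 2 steps (asg 27 (.add (var 12) (var 9)) ;;
    forTo 3 (var 9)
      (.setR 3 (.add (var 27) (var 3))
        (.mul (.sub (.ofNat (.lit 1)) (.ofNat (.add (par (var 3)) (par (var 3)))))
          (.sqrt (.div (.add (.ofNat (.lit 1)) (.get 3 (.add (var 12) (.half (var 3)))))
            (.ofNat (.lit 2))))) ;;
      .setR 4 (.add (var 27) (var 3))
        (.div (.get 4 (.add (var 12) (.half (var 3))))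
          (.add (.get 3 (.add (var 27) (var 3))) (.get 3 (.add (var 27) (var 3)))))) ;;
    asg 12 (var 27))

/-- The table of the twiddle factors of the first `ℓ` levels. -/
def TwiddleTable (K ℓ : ℕ) (σ : Memory) : Prop :=
  ∀ c < (ℓ + 1) * K, cell 3 4 σ c = twiddle (c / K) (c % K)

lemma div_mod_of_lt {K l r : ℕ} (hr : r < K) : (l * K + r) / K = l ∧ (l * K + r) % K = r := by
  have : 0 < K := by omega
  rw [mul_comm]
  exact ⟨mul_add_div_of_lt hr, mul_add_mod_of_lt hr⟩

/-- Level `l` fills the block that starts at `l * K`, continued periodically to the length `K`; the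
transform then finds each factor at the index of the entry it computes. -/
lemma twiddleProg_ends {σ : Memory} {m K : ℕ} (hm : σ.nat 0 2 = m) (hK : σ.nat 9 0 = K) :
    Ends twiddleProg σ (100 * ((m + 3) * K) + 100 * (m + 3)) fun τ => TwiddleTable K (m + 2) τ := by
  refine (Ends.seq (T := 30 * K + 20) (T' := 100 * ((m + 2) * K) + 60 * (m + 3))
    (Q := fun τ => ∀ c < K, cell 3 4 τ c = I) ?_ fun τ hτ h0 => ?_).mono
    (by ring_nf; omega) fun _ _ h => h
  · refine Ends.forTo_const K (fun k τ => ∀ c < k, cell 3 4 τ c = I) 15 (by decide)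
      (fun τ hτ => by rw [NExp.eval, NExp.eval, hτ.1 9 (by decide), hK]) (by simp) ?_
      (by simp only [NExp.cost]; omega) fun _ _ h => h
    intro k hk τ hτ hk2 hI
    refine Ends.of_step rfl (by decide) ?_
    simp only [Program.step, NExp.eval, RExp.eval, hk2, Memory.nat_writeR]
    intro c hc
    rw [cell_writeN, cell_writeR (by decide)]
    split_ifs with h
    · apply Complex.ext <;> simp
    · exact hI c (by omega)
  refine Ends.step_seq (T' := 100 * ((m + 2) * K) + 60 * (m + 2) + 40) 3 rfl (by decide)
    (by omega) ?_
  set τ' := (asg 12 (.lit 0)).step τ with hτ'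
  have e12 : τ'.nat 12 0 = 0 := by simp [hτ', Program.step, NExp.eval]
  have eK : τ'.nat 9 0 = K := by simp [hτ', Program.step, hτ.1 9 (by decide), hK]
  have em : τ'.nat 0 2 = m := by simp [hτ', Program.step, hτ.1 0 (by decide), hm]
  have ec : cell 3 4 τ' = cell 3 4 τ := rfl
  clear_value τ'
  refine Ends.forTo_const (m + 2) (fun k υ => υ.nat 12 0 = k * K ∧ TwiddleTable K k υ)
    (100 * K + 30) (by decide)
    (fun υ hυ => by simp only [NExp.eval, hυ.1 0 (by decide), em]) ?_ ?_
    (by simp only [NExp.cost]; ring_nf; omega) fun _ _ h => h.2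
  · refine ⟨by simp [e12], fun c hc => ?_⟩
    rw [zero_add, one_mul] at hc
    rw [cell_writeN, ec, h0 c hc, Nat.div_eq_of_lt hc]
    rfl
  · rintro k hk υ hυ - ⟨h12, hI⟩
    have hυK : υ.nat 9 0 = K := by rw [hυ.1 9 (by decide), eK]
    refine Ends.step_seq (T' := 100 * K + 20) 8 rfl (by decide) (by omega) ?_
    set υ' := (asg 27 (.add (var 12) (var 9))).step υ with hυ'
    have f27 : υ'.nat 27 0 = (k + 1) * K := by
      simp [hυ', Program.step, NExp.eval, h12, hυK]; ring
    have f12 : υ'.nat 12 0 = k * K := by simp [hυ', Program.step, h12]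
    have fK : υ'.nat 9 0 = K := by simp [hυ', Program.step, hυK]
    have fc : cell 3 4 υ' = cell 3 4 υ := rfl
    clear_value υ'
    refine (Ends.seq (T := 100 * K + 14) (T' := 6)
      (Q := fun ω => ∀ c < (k + 1) * K + K, cell 3 4 ω c = twiddle (c / K) (c % K)) ?_
      fun ω hω h => Ends.of_step rfl (by decide) ?_).mono (by omega) fun _ _ h => h
    · refine Ends.forTo_const K (fun j ω => ∀ c < (k + 1) * K + j,
        cell 3 4 ω c = twiddle (c / K) (c % K)) 80 (by decide)
        (fun ω hω => by rw [NExp.eval, NExp.eval, hω.1 9 (by decide), fK]) ?_ ?_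
        (by simp only [NExp.cost]; omega) fun _ _ h => h
      · intro c hc
        rw [cell_writeN, fc]
        exact hI c (by omega)
      · intro j hj ω hω hj3 hJ
        refine Ends.of_step rfl (by decide) ?_
        have g12 : ω.nat 12 0 = k * K := by rw [hω.1 12 (by decide), f12]
        have g27 : ω.nat 27 0 = (k + 1) * K := by rw [hω.1 27 (by decide), f27]
        have hexp : (k + 1) * K = k * K + K := by ring
        have hsrc : cell 3 4 ω (k * K + j / 2) = twiddle k (j / 2) := by
          rw [hJ _ (by omega), (div_mod_of_lt (by omega)).1, (div_mod_of_lt (by omega)).2]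
        have hre : ω.real 3 (k * K + j / 2) = (twiddle k (j / 2)).re := congrArg re hsrc
        have him : ω.real 4 (k * K + j / 2) = (twiddle k (j / 2)).im := congrArg im hsrc
        intro c hc
        simp only [Program.step, NExp.eval, RExp.eval, hj3, g12, g27, sub_half_add_half,
          Memory.nat_writeR, Memory.real_writeR, Nat.reduceEqDiff, reduceIte, hre, him,
          Function.update_self, Nat.cast_one, Nat.cast_ofNat]
        rw [cell_writeN, cell_writeR (by decide)]
        split_ifs with h
        · rw [h, (div_mod_of_lt hj).1, (div_mod_of_lt hj).2]
          rfl
        · exact hJ c (by omega)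
    · simp only [Program.step, NExp.eval, hω.1 27 (by decide), f27]
      refine ⟨by simp, fun c hc => ?_⟩
      rw [cell_writeN, cell_writeN]
      exact h c (by rw [add_mul, one_mul] at hc; exact hc)

/-- Computes the Fourier transform of the vector in the arrays `5` and `6`; the results of all
steps are stored. -/
def fourierProg : Program :=
  asg 12 (.lit 0) ;;
  forTo 2 steps (asg 27 (.add (var 12) (var 9)) ;;
    forTo 3 (var 9)
      (.setR 5 (.add (var 27) (var 3)) (.add (.get 5 (.add (var 12) (.half (var 3))))
        (.sub
          (.mul (.get 3 (.add (var 27) (var 3)))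
            (.get 5 (.add (.add (var 12) (.half (var 3))) (var 10))))
          (.mul (.get 4 (.add (var 27) (var 3)))
            (.get 6 (.add (.add (var 12) (.half (var 3))) (var 10)))))) ;;
      .setR 6 (.add (var 27) (var 3)) (.add (.get 6 (.add (var 12) (.half (var 3))))
        (.add
          (.mul (.get 3 (.add (var 27) (var 3)))
            (.get 6 (.add (.add (var 12) (.half (var 3))) (var 10))))
          (.mul (.get 4 (.add (var 27) (var 3)))
            (.get 5 (.add (.add (var 12) (.half (var 3))) (var 10))))))) ;;
    asg 12 (var 27))

lemma fourierProg_ends {σ : Memory} {m K H : ℕ} {a : ℕ → ℂ} (hm : σ.nat 0 2 = m)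
    (hK : σ.nat 9 0 = K) (hH : σ.nat 10 0 = H) (hKH : K = 2 * H) (hZ : TwiddleTable K (m + 2) σ)
    (ha : ∀ c < K, cell 5 6 σ c = a c) :
    Ends fourierProg σ (150 * ((m + 2) * K) + 60 * (m + 2) + 50) fun τ =>
      τ.nat 12 0 = (m + 2) * K ∧
      ∀ r < K, cell 5 6 τ ((m + 2) * K + r) = fourier H a (m + 2) r := by
  refine Ends.step_seq (T' := 150 * ((m + 2) * K) + 60 * (m + 2) + 40) 3 rfl (by decide)
    (by omega) ?_
  set τ' := (asg 12 (.lit 0)).step σ with hτ'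
  have e12 : τ'.nat 12 0 = 0 := by simp [hτ', Program.step, NExp.eval]
  have eK : τ'.nat 9 0 = K := by simp [hτ', Program.step, hK]
  have eH : τ'.nat 10 0 = H := by simp [hτ', Program.step, hH]
  have em : τ'.nat 0 2 = m := by simp [hτ', Program.step, hm]
  have ec : cell 5 6 τ' = cell 5 6 σ := rfl
  have eZ : TwiddleTable K (m + 2) τ' := hZ
  clear_value τ'
  refine Ends.forTo_const (m + 2) (fun k υ => υ.nat 12 0 = k * K ∧
    ∀ c < (k + 1) * K, cell 5 6 υ c = fourier H a (c / K) (c % K))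
    (150 * K + 30) (by decide)
    (fun υ hυ => by simp only [NExp.eval, hυ.1 0 (by decide), em]) ?_ ?_
    (by simp only [NExp.cost]; ring_nf; omega) fun υ _ h => ⟨h.1, fun r hr => ?_⟩
  · refine ⟨by simp [e12], fun c hc => ?_⟩
    rw [zero_add, one_mul] at hc
    rw [cell_writeN, ec, ha c hc, Nat.div_eq_of_lt hc, Nat.mod_eq_of_lt hc]
    rfl
  · rintro k hk υ hυ - ⟨h12, hI⟩
    have hυK : υ.nat 9 0 = K := by rw [hυ.1 9 (by decide), eK]
    have hυH : υ.nat 10 0 = H := by rw [hυ.1 10 (by decide), eH]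
    have hυZ : cell 3 4 υ = cell 3 4 τ' := cell_congr (hυ.2 3 (by decide)) (hυ.2 4 (by decide))
    refine Ends.step_seq (T' := 150 * K + 20) 8 rfl (by decide) (by omega) ?_
    set υ' := (asg 27 (.add (var 12) (var 9))).step υ with hυ'
    have f27 : υ'.nat 27 0 = (k + 1) * K := by
      simp [hυ', Program.step, NExp.eval, h12, hυK]; ring
    have f12 : υ'.nat 12 0 = k * K := by simp [hυ', Program.step, h12]
    have fK : υ'.nat 9 0 = K := by simp [hυ', Program.step, hυK]
    have fH : υ'.nat 10 0 = H := by simp [hυ', Program.step, hυH]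
    have fc : cell 5 6 υ' = cell 5 6 υ := rfl
    have fZ : cell 3 4 υ' = cell 3 4 υ := rfl
    clear_value υ'
    refine (Ends.seq (T := 150 * K + 14) (T' := 6)
      (Q := fun ω => ∀ c < (k + 1) * K + K, cell 5 6 ω c = fourier H a (c / K) (c % K)) ?_
      fun ω hω h => Ends.of_step rfl (by decide) ?_).mono (by omega) fun _ _ h => h
    · refine Ends.forTo_const K (fun j ω => ∀ c < (k + 1) * K + j,
        cell 5 6 ω c = fourier H a (c / K) (c % K)) 130 (by decide)
        (fun ω hω => by rw [NExp.eval, NExp.eval, hω.1 9 (by decide), fK]) ?_ ?_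
        (by simp only [NExp.cost]; omega) fun _ _ h => h
      · intro c hc
        rw [cell_writeN, fc]
        exact hI c (by omega)
      · intro j hj ω hω hj3 hJ
        refine Ends.of_step rfl (by decide) ?_
        have g12 : ω.nat 12 0 = k * K := by rw [hω.1 12 (by decide), f12]
        have g27 : ω.nat 27 0 = (k + 1) * K := by rw [hω.1 27 (by decide), f27]
        have g10 : ω.nat 10 0 = H := by rw [hω.1 10 (by decide), fH]
        have hexp : (k + 1) * K = k * K + K := by ring
        have hsrc : cell 5 6 ω (k * K + j / 2) = fourier H a k (j / 2) := by
          rw [hJ _ (by omega), (div_mod_of_lt (by omega)).1, (div_mod_of_lt (by omega)).2]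
        have hsrc' : cell 5 6 ω (k * K + j / 2 + H) = fourier H a k (j / 2 + H) := by
          rw [add_assoc, hJ _ (by omega), (div_mod_of_lt (by omega)).1,
            (div_mod_of_lt (by omega)).2]
        have hz : cell 3 4 ω ((k + 1) * K + j) = twiddle (k + 1) j := by
          rw [cell_congr (hω.2 3 (by decide)) (hω.2 4 (by decide)), fZ, hυZ, eZ,
            (div_mod_of_lt hj).1, (div_mod_of_lt hj).2]
          have := Nat.mul_le_mul_right K (show k + 1 ≤ m + 2 by omega)
          rw [add_mul (m + 2), one_mul]
          omega
        have r1 : ω.real 5 (k * K + j / 2) = (fourier H a k (j / 2)).re := congrArg re hsrc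
        have r2 : ω.real 6 (k * K + j / 2) = (fourier H a k (j / 2)).im := congrArg im hsrc
        have r3 : ω.real 5 (k * K + j / 2 + H) = (fourier H a k (j / 2 + H)).re :=
          congrArg re hsrc'
        have r4 : ω.real 6 (k * K + j / 2 + H) = (fourier H a k (j / 2 + H)).im :=
          congrArg im hsrc'
        have r5 : ω.real 3 ((k + 1) * K + j) = (twiddle (k + 1) j).re := congrArg re hz
        have r6 : ω.real 4 ((k + 1) * K + j) = (twiddle (k + 1) j).im := congrArg im hz
        -- The real part is written before the imaginary part is computed; the entry that is still
        -- needed lies in the preceding block.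
        have hne : k * K + j / 2 + H ≠ (k + 1) * K + j := by omega
        intro c hc
        simp only [Program.step, NExp.eval, RExp.eval, hj3, g12, g27, g10, Memory.nat_writeR,
          Memory.real_writeR, Nat.reduceEqDiff, reduceIte, Function.update_apply, hne,
          r1, r2, r3, r4, r5, r6]
        rw [cell_writeN, cell_writeR (by decide)]
        split_ifs with h
        · rw [h, (div_mod_of_lt hj).1, (div_mod_of_lt hj).2]
          apply Complex.ext <;> simp [fourier]
        · exact hJ c (by omega)
    · simp only [Program.step, NExp.eval, hω.1 27 (by decide), f27]
      refine ⟨by simp, fun c hc => ?_⟩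
      rw [cell_writeN, cell_writeN]
      exact h c (by rw [add_mul, one_mul] at hc; exact hc)
  · rw [h.2 _ (by rw [add_mul (m + 2), one_mul]; omega), (div_mod_of_lt hr).1,
      (div_mod_of_lt hr).2]

end QMC

end

/-! ### Products and inversion of Fourier transforms -/

noncomputable section

namespace QMC

open Complex ComplexConjugate

/-- Copies a real vector to the input of the Fourier transform. -/
def loadProg (a : ℕ) : Program :=
  forTo 3 (var 9) (.setR 5 (var 3) (.get a (var 3)) ;; .setR 6 (var 3) (.ofNat (.lit 0)))

lemma loadProg_ends {a : ℕ} (h5 : a ≠ 5) (h6 : a ≠ 6) {σ : Memory} {K : ℕ} (hK : σ.nat 9 0 = K) :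
    Ends (loadProg a) σ (40 * K + 20) fun τ => ∀ c < K, cell 5 6 τ c = (σ.real a c : ℂ) := by
  refine Ends.forTo_const K (fun k τ => ∀ c < k, cell 5 6 τ c = (σ.real a c : ℂ)) 15
    (by simp [Program.wN])
    (fun τ hτ => by rw [NExp.eval, NExp.eval, hτ.1 9 (by simp [forTo, Program.wN]), hK]) (by simp) ?_
    (by simp only [NExp.cost]; omega) fun _ _ h => h
  intro k hk τ hτ hk2 hI
  refine Ends.of_step rfl (by simp [Program.maxCost, NExp.cost, RExp.cost]) ?_
  simp only [Program.step, NExp.eval, RExp.eval, hk2, Memory.nat_writeR,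
    hτ.2 a (by simp [forTo, Program.wR]; omega)]
  intro c hc
  rw [cell_writeN, cell_writeR (by decide)]
  split_ifs with h
  · rw [h]; apply Complex.ext <;> simp
  · exact hI c (by omega)

/-- Stores the result of the Fourier transform. -/
def saveProg : Program :=
  forTo 3 (var 9) (.setR 7 (var 3) (.get 5 (.add (var 12) (var 3))) ;;
    .setR 8 (var 3) (.get 6 (.add (var 12) (var 3))))

lemma saveProg_ends {σ : Memory} {K o : ℕ} (hK : σ.nat 9 0 = K) (ho : σ.nat 12 0 = o) :
    Ends saveProg σ (40 * K + 20) fun τ => ∀ c < K, cell 7 8 τ c = cell 5 6 σ (o + c) := by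
  refine Ends.forTo_const K (fun k τ => ∀ c < k, cell 7 8 τ c = cell 5 6 σ (o + c)) 24
    (by decide)
    (fun τ hτ => by rw [NExp.eval, NExp.eval, hτ.1 9 (by decide), hK]) (by simp) ?_
    (by simp only [NExp.cost]; omega) fun _ _ h => h
  intro k hk τ hτ hk2 hI
  refine Ends.of_step rfl (by decide) ?_
  simp only [Program.step, NExp.eval, RExp.eval, hk2, Memory.nat_writeR, Memory.real_writeR,
    Nat.reduceEqDiff, reduceIte, hτ.2 5 (by decide), hτ.2 6 (by decide), hτ.1 12 (by decide), ho]
  intro c hc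
  rw [cell_writeN, cell_writeR (by decide)]
  split_ifs with h
  · rw [h]; rfl
  · exact hI c (by omega)

/-- Multiplies two Fourier transforms. -/
def productProg : Program :=
  forTo 3 (var 9)
    (.setR 12 (.add (var 12) (var 3))
      (.sub (.mul (.get 5 (.add (var 12) (var 3))) (.get 7 (var 3)))
        (.mul (.get 6 (.add (var 12) (var 3))) (.get 8 (var 3)))) ;;
    .setR 13 (.add (var 12) (var 3))
      (.add (.mul (.get 5 (.add (var 12) (var 3))) (.get 8 (var 3)))
        (.mul (.get 6 (.add (var 12) (var 3))) (.get 7 (var 3)))))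

lemma productProg_ends {σ : Memory} {K o : ℕ} (hK : σ.nat 9 0 = K) (ho : σ.nat 12 0 = o) :
    Ends productProg σ (80 * K + 20) fun τ =>
      ∀ c < K, cell 12 13 τ (o + c) = cell 5 6 σ (o + c) * cell 7 8 σ c := by
  refine Ends.forTo_const K (fun k τ => ∀ c < k,
    cell 12 13 τ (o + c) = cell 5 6 σ (o + c) * cell 7 8 σ c) 60 (by decide)
    (fun τ hτ => by rw [NExp.eval, NExp.eval, hτ.1 9 (by decide), hK]) (by simp) ?_
    (by simp only [NExp.cost]; omega) fun _ _ h => h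
  intro k hk τ hτ hk2 hI
  refine Ends.of_step rfl (by decide) ?_
  simp only [Program.step, NExp.eval, RExp.eval, hk2, Memory.nat_writeR, Memory.real_writeR,
    Nat.reduceEqDiff, reduceIte, hτ.2 5 (by decide), hτ.2 6 (by decide), hτ.2 7 (by decide),
    hτ.2 8 (by decide), hτ.1 12 (by decide), ho]
  intro c hc
  rw [cell_writeN, cell_writeR (by decide)]
  split_ifs with h
  · have : c = k := by omega
    subst this
    apply Complex.ext <;> simp [cell]
  · exact hI c (by omega)

/-- Inverts the Fourier transform, up to a factor. -/
def inverseProg : Program :=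
  forTo 2 steps (asg 27 (.sub (var 12) (var 9)) ;;
    forTo 3 (var 10)
      (.setR 12 (.add (var 27) (var 3))
        (.add (.get 12 (.add (var 12) (.add (var 3) (var 3))))
          (.get 12 (.add (var 12) (.add (.add (var 3) (var 3)) (.lit 1))))) ;;
      .setR 13 (.add (var 27) (var 3))
        (.add (.get 13 (.add (var 12) (.add (var 3) (var 3))))
          (.get 13 (.add (var 12) (.add (.add (var 3) (var 3)) (.lit 1))))) ;;
      .setR 12 (.add (var 27) (.add (var 10) (var 3)))
        (.add
          (.mul (.sub (.get 12 (.add (var 12) (.add (var 3) (var 3))))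
            (.get 12 (.add (var 12) (.add (.add (var 3) (var 3)) (.lit 1)))))
            (.get 3 (.add (var 12) (.add (var 3) (var 3)))))
          (.mul (.sub (.get 13 (.add (var 12) (.add (var 3) (var 3))))
            (.get 13 (.add (var 12) (.add (.add (var 3) (var 3)) (.lit 1)))))
            (.get 4 (.add (var 12) (.add (var 3) (var 3)))))) ;;
      .setR 13 (.add (var 27) (.add (var 10) (var 3)))
        (.sub
          (.mul (.sub (.get 13 (.add (var 12) (.add (var 3) (var 3))))
            (.get 13 (.add (var 12) (.add (.add (var 3) (var 3)) (.lit 1)))))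
            (.get 3 (.add (var 12) (.add (var 3) (var 3)))))
          (.mul (.sub (.get 12 (.add (var 12) (.add (var 3) (var 3))))
            (.get 12 (.add (var 12) (.add (.add (var 3) (var 3)) (.lit 1)))))
            (.get 4 (.add (var 12) (.add (var 3) (var 3))))))) ;;
    asg 12 (var 27))

/-- The levels are undone one by one without halving. The accumulated factor `2 ^ (m + 2)` is
positive, hence irrelevant for finding a minimum. -/
lemma inverseProg_ends {σ : Memory} {m K H : ℕ} {a : ℕ → ℂ} (hm : σ.nat 0 2 = m)
    (hK : σ.nat 9 0 = K) (hH : σ.nat 10 0 = H) (hKH : K = 2 * H) (hZ : TwiddleTable K (m + 2) σ)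
    (ho : σ.nat 12 0 = (m + 2) * K)
    (ha : ∀ r < K, cell 12 13 σ ((m + 2) * K + r) = fourier H a (m + 2) r) :
    Ends inverseProg σ (200 * ((m + 2) * K) + 60 * (m + 2) + 50) fun τ =>
      ∀ r < K, cell 12 13 τ r = 2 ^ (m + 2) * a r := by
  refine Ends.forTo_const (m + 2) (fun k υ => υ.nat 12 0 = (m + 2 - k) * K ∧
    ∀ r < K, cell 12 13 υ ((m + 2 - k) * K + r) = 2 ^ k * fourier H a (m + 2 - k) r)
    (200 * K + 30) (by decide)
    (fun υ hυ => by simp only [NExp.eval, hυ.1 0 (by decide), hm]) ?_ ?_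
    (by simp only [NExp.cost]; ring_nf; omega) fun υ _ h => fun r hr => ?_
  · refine ⟨by simp [ho], fun r hr => ?_⟩
    rw [cell_writeN, Nat.sub_zero, ha r hr, pow_zero, one_mul]
  · rintro k hk υ hυ - ⟨h12, hI⟩
    obtain ⟨l, hl⟩ : ∃ l, m + 2 = l + 1 + k := ⟨m + 1 - k, by omega⟩
    rw [show m + 2 - k = l + 1 by omega] at h12 hI
    rw [show m + 2 - (k + 1) = l by omega]
    have hυK : υ.nat 9 0 = K := by rw [hυ.1 9 (by decide), hK]
    have hυH : υ.nat 10 0 = H := by rw [hυ.1 10 (by decide), hH]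
    have hυZ : cell 3 4 υ = cell 3 4 σ := cell_congr (hυ.2 3 (by decide)) (hυ.2 4 (by decide))
    have hexp : (l + 1) * K = l * K + K := by ring
    refine Ends.step_seq (T' := 200 * K + 20) 8 rfl (by decide) (by omega) ?_
    set υ' := (asg 27 (.sub (var 12) (var 9))).step υ with hυ'
    have f27 : υ'.nat 27 0 = l * K := by
      simp [hυ', Program.step, NExp.eval, h12, hυK, hexp]
    have f12 : υ'.nat 12 0 = (l + 1) * K := by simp [hυ', Program.step, h12]
    have fH : υ'.nat 10 0 = H := by simp [hυ', Program.step, hυH]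
    have fc : cell 12 13 υ' = cell 12 13 υ := rfl
    have fZ : cell 3 4 υ' = cell 3 4 υ := rfl
    clear_value υ'
    refine (Ends.seq (T := 200 * K + 14) (T' := 6)
      (Q := fun ω => (∀ r < K, cell 12 13 ω (l * K + K + r) = 2 ^ k * fourier H a (l + 1) r) ∧
        ∀ r < H, cell 12 13 ω (l * K + r) = 2 ^ (k + 1) * fourier H a l r ∧
          cell 12 13 ω (l * K + (H + r)) = 2 ^ (k + 1) * fourier H a l (H + r)) ?_
      fun ω hω h => Ends.of_step rfl (by decide) ?_).mono (by omega) fun _ _ h => h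
    · refine Ends.forTo_const H (fun j ω =>
        (∀ r < K, cell 12 13 ω (l * K + K + r) = 2 ^ k * fourier H a (l + 1) r) ∧
        ∀ r < j, cell 12 13 ω (l * K + r) = 2 ^ (k + 1) * fourier H a l r ∧
          cell 12 13 ω (l * K + (H + r)) = 2 ^ (k + 1) * fourier H a l (H + r)) 300 (by decide)
        (fun ω hω => by rw [NExp.eval, NExp.eval, hω.1 10 (by decide), fH]) ?_ ?_
        (by simp only [NExp.cost]; omega) fun _ _ h => h
      · refine ⟨fun r hr => ?_, by simp⟩
        rw [cell_writeN, fc, ← hexp]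
        exact hI r hr
      · rintro j hj ω hω hj3 ⟨hJ, hJ'⟩
        refine Ends.of_step rfl (by decide) ?_
        have g12 : ω.nat 12 0 = l * K + K := by rw [hω.1 12 (by decide), f12, hexp]
        have g27 : ω.nat 27 0 = l * K := by rw [hω.1 27 (by decide), f27]
        have g10 : ω.nat 10 0 = H := by rw [hω.1 10 (by decide), fH]
        have hz : cell 3 4 ω (l * K + K + (j + j)) = twiddle (l + 1) (2 * j) := by
          rw [cell_congr (hω.2 3 (by decide)) (hω.2 4 (by decide)), fZ, hυZ, ← hexp, hZ,
            (div_mod_of_lt (by omega)).1, (div_mod_of_lt (by omega)).2, two_mul]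
          have := Nat.mul_le_mul_right K (show l + 1 ≤ m + 2 by omega)
          rw [add_mul (m + 2), one_mul]
          omega
        have hu := hJ (j + j) (by omega)
        have hv := hJ (j + j + 1) (by omega)
        have hne1 : ∀ i, l * K + K + i ≠ l * K + j := fun i => by omega
        have hne2 : ∀ i, l * K + K + i ≠ l * K + (H + j) := fun i => by omega
        have hne3 : l * K + j ≠ l * K + (H + j) := by omega
        simp only [Program.step, NExp.eval, RExp.eval, hj3, g12, g27, g10, Memory.nat_writeR,
          Memory.real_writeR, Nat.reduceEqDiff, reduceIte, Function.update_apply, hne1]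
        rw [cell_writeN]
        simp only [cell_writeR (show 12 ≠ 13 by decide), hne1, hne2, reduceIte]
        refine ⟨hJ, fun r hr => ?_⟩
        by_cases h : r = j
        · subst h
          rw [if_neg hne3, if_pos rfl, if_pos rfl]
          have h1 : (⟨ω.real 12 (l * K + K + (r + r)) + ω.real 12 (l * K + K + (r + r + 1)),
              ω.real 13 (l * K + K + (r + r)) + ω.real 13 (l * K + K + (r + r + 1))⟩ : ℂ)
              = cell 12 13 ω (l * K + K + (r + r)) + cell 12 13 ω (l * K + K + (r + r + 1)) := rfl
          constructor
          · rw [h1, hu, hv, ← two_mul r]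
            linear_combination 2 ^ k * fourier_inverse_left H a l r
          · have h2 := fourier_inverse_right H a l r
            rw [← hz, two_mul r] at h2
            have h3 : (cell 12 13 ω (l * K + K + (r + r)) - cell 12 13 ω (l * K + K + (r + r + 1)))
                * conj (cell 3 4 ω (l * K + K + (r + r)))
                = 2 ^ (k + 1) * fourier H a l (H + r) := by
              rw [hu, hv]; linear_combination 2 ^ k * h2
            rw [← h3]
            apply Complex.ext
            · simp [cell]
            · simp [cell]; ring
        · rw [if_neg (by omega), if_neg (by omega), if_neg (by omega), if_neg (by omega)]
          exact hJ' r (by omega)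
    · simp only [Program.step, NExp.eval, hω.1 27 (by decide), f27]
      refine ⟨by simp, fun r hr => ?_⟩
      rw [cell_writeN, cell_writeN]
      by_cases h' : r < H
      · exact (h.2 r h').1
      · have := (h.2 (r - H) (by omega)).2
        rwa [Nat.add_sub_cancel' (by omega)] at this
  · have h2 := h.2 r hr
    rw [Nat.sub_self, zero_mul, zero_add] at h2
    exact h2

end QMC

end

/-! ### One step of the component-by-component construction -/

noncomputable section

namespace QMC

/-! ### The component-by-component construction -/

/-- Finds the index of the smallest result of the convolution (array `11`). -/
def argminProg : Program :=
  asg 11 (.lit 0) ;;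
  forTo 2 (var 6) (.ite (.ltR (.get 12 (.add (var 6) (var 2))) (.get 12 (.add (var 6) (var 11))))
    (asg 11 (var 2)) .skip)

lemma argminProg_ends {σ : Memory} {N : ℕ} (hN : 0 < N) (h6 : σ.nat 6 0 = N) :
    Ends argminProg σ (60 * N + 40) fun τ => τ.nat 11 0 < N ∧
      ∀ j < N, σ.real 12 (N + τ.nat 11 0) ≤ σ.real 12 (N + j) := by
  refine Ends.step_seq (T' := 60 * N + 20) 3 rfl (by decide) (by omega) ?_
  set σ' := (asg 11 (.lit 0)).step σ with hσ'
  have e11 : σ'.nat 11 0 = 0 := by simp [hσ', Program.step, NExp.eval]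
  have e6 : σ'.nat 6 0 = N := by simp [hσ', Program.step, h6]
  have er : σ'.real = σ.real := rfl
  clear_value σ'
  refine Ends.forTo_const N (fun k τ => τ.nat 11 0 < N ∧
      ∀ j < k, σ.real 12 (N + τ.nat 11 0) ≤ σ.real 12 (N + j)) 30 (by decide)
    (fun τ hτ => by rw [NExp.eval, NExp.eval, hτ.1 6 (by decide), e6]) (by simp [e11, hN]) ?_
    (by simp only [NExp.cost]; omega) fun _ _ h => h
  rintro k hk τ hτ hk2 ⟨hlt, hI⟩
  refine Ends.of_step rfl (by decide) ?_
  simp only [Program.step, NExp.eval, RExp.eval, BExp.holds, hk2, hτ.1 6 (by decide), e6,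
    hτ.2 12 (by decide), er]
  split_ifs with h
  · simp only [Memory.nat_writeN, Nat.reduceEqDiff, reduceIte, Function.update_self]
    refine ⟨hk, fun j hj => ?_⟩
    rcases Nat.lt_succ_iff_lt_or_eq.1 hj with hj | rfl
    · exact h.le.trans (hI j hj)
    · exact le_rfl
  · simp only [Memory.nat_writeN, Nat.reduceEqDiff, reduceIte]
    refine ⟨hlt, fun j hj => ?_⟩
    rcases Nat.lt_succ_iff_lt_or_eq.1 hj with hj | rfl
    · exact hI j hj
    · exact not_lt.1 h

/-- Updates the products of kernels. -/
def updateProg : Program :=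
  forTo 2 (var 6) (.setR 2 (var 2) (.mul (.get 2 (var 2))
    (.get 1 (.sub (.add (var 6) (var 11)) (var 2)))))

lemma updateProg_ends {σ : Memory} {N j : ℕ} (h6 : σ.nat 6 0 = N) (h11 : σ.nat 11 0 = j) :
    Ends updateProg σ (40 * N + 20) fun τ => ∀ i, τ.real 2 i =
      if i < N then σ.real 2 i * σ.real 1 (N + j - i) else σ.real 2 i := by
  refine Ends.forTo_const N (fun k τ => ∀ i, τ.real 2 i =
      if i < k then σ.real 2 i * σ.real 1 (N + j - i) else σ.real 2 i) 25 (by decide)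
    (fun τ hτ => by rw [NExp.eval, NExp.eval, hτ.1 6 (by decide), h6]) (by simp) ?_
    (by simp only [NExp.cost]; omega) fun _ _ h => h
  intro k hk τ hτ hk2 hI
  refine Ends.of_step rfl (by decide) ?_
  simp only [Program.step, NExp.eval, RExp.eval, hk2, hτ.1 6 (by decide), h6,
    hτ.1 11 (by decide), h11, hτ.2 1 (by decide), Memory.real_writeN, Memory.real_writeR,
    reduceIte, Function.update_apply]
  intro i
  by_cases h : i = k
  · rw [if_pos h, if_pos (by omega), hI k, if_neg (lt_irrefl _), h]
  · rw [if_neg h, hI i]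
    exact if_congr (by omega) rfl rfl

/-- Chooses the component with the number kept in array `28`. -/
def componentProg : Program :=
  loadProg 2 ;; fourierProg ;; productProg ;; inverseProg ;; argminProg ;;
  .setN 1 (.add (var 28) (.lit 1)) (.get 25 (var 11)) ;; updateProg

/-- What the preparations provide for the construction of the components. -/
structure Prepared (m : ℕ) (V : ℕ → ℝ) (G : ℕ → ℕ) (σ : Memory) : Prop where
  h2 : σ.nat 0 2 = m
  h6 : σ.nat 6 0 = 2 ^ m - 1
  h9 : σ.nat 9 0 = 2 ^ (m + 2)
  h10 : σ.nat 10 0 = 2 ^ (m + 1)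
  h25 : σ.nat 25 = G
  table : TwiddleTable (2 ^ (m + 2)) (m + 2) σ
  values : σ.real 1 = V
  transform : ∀ c < 2 ^ (m + 2),
    cell 7 8 σ c = fourier (2 ^ (m + 1)) (fun i => (V i : ℂ)) (m + 2) c

lemma Prepared.congr {m : ℕ} {V : ℕ → ℝ} {G : ℕ → ℕ} {σ τ : Memory} (h : Prepared m V G σ)
    (hN : ∀ a ∈ [0, 6, 9, 10, 25], τ.nat a = σ.nat a)
    (hR : ∀ a ∈ [1, 3, 4, 7, 8], τ.real a = σ.real a) : Prepared m V G τ where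
  h2 := by rw [hN 0 (by decide), h.h2]
  h6 := by rw [hN 6 (by decide), h.h6]
  h9 := by rw [hN 9 (by decide), h.h9]
  h10 := by rw [hN 10 (by decide), h.h10]
  h25 := by rw [hN 25 (by decide), h.h25]
  table := fun c hc => by
    rw [cell_congr (hR 3 (by decide)) (hR 4 (by decide)), h.table c hc]
  values := by rw [hR 1 (by decide), h.values]
  transform := fun c hc => by
    rw [cell_congr (hR 7 (by decide)) (hR 8 (by decide)), h.transform c hc]

/-- The entries of the convolution with indices `N, …, 2 * N - 1` are the values of the criterion at
all `N` candidates. One component thus costs one transform, one inversion and linear work, the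
transform of the kernel being prepared once. -/
lemma componentProg_ends {m : ℕ} (hm : 1 ≤ m) {V : ℕ → ℝ} {G : ℕ → ℕ} {σ : Memory}
    (hP : Prepared m V G σ) (hV : ∀ i, 2 * (2 ^ m - 1) ≤ i → V i = 0) {W : ℕ → ℝ}
    (hσW : σ.real 2 = W) (hW : ∀ i, 2 ^ m - 1 ≤ i → W i = 0) {d : ℕ} (h28 : σ.nat 28 0 = d) :
    Ends componentProg σ (6000 * (m * 2 ^ m)) fun τ => ∃ j < 2 ^ m - 1,
      (∀ i, τ.nat 1 i = if i = d + 1 then G j else σ.nat 1 i) ∧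
      (∀ i, τ.real 2 i = if i < 2 ^ m - 1 then W i * V (2 ^ m - 1 + j - i) else 0) ∧
      ∀ j' < 2 ^ m - 1, ∑ i ∈ Finset.range (2 ^ m - 1), W i * V (2 ^ m - 1 + j - i)
        ≤ ∑ i ∈ Finset.range (2 ^ m - 1), W i * V (2 ^ m - 1 + j' - i) := by
  have h2m : 2 ≤ 2 ^ m := by simpa using Nat.pow_le_pow_right two_pos hm
  have hK : 2 ^ (m + 2) = 4 * 2 ^ m := by ring
  have hKH : 2 ^ (m + 2) = 2 * 2 ^ (m + 1) := by ring
  have hmm : 2 ^ m ≤ m * 2 ^ m := Nat.le_mul_of_pos_left _ hm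
  have hmK : (m + 2) * 2 ^ (m + 2) ≤ 12 * (m * 2 ^ m) := by
    rw [hK]; nlinarith
  have hmm' : m ≤ m * 2 ^ m := Nat.le_mul_of_pos_right _ (by omega)
  set N := 2 ^ m - 1 with hN
  set K := 2 ^ (m + 2) with hKdef
  refine (Ends.seq (loadProg_ends (a := 2) (by decide) (by decide) hP.h9) fun τ hτ h1 =>
    Ends.seq (fourierProg_ends (K := K) (H := 2 ^ (m + 1)) (m := m) (a := fun i => (W i : ℂ))
      ?_ ?_ ?_ hKH ?_ fun c hc => by rw [h1 c hc, hσW]) fun υ hυ h2 =>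
    Ends.seq (productProg_ends (K := K) ?_ h2.1) fun ω hω h3 =>
    Ends.seq (inverseProg_ends (K := K) (H := 2 ^ (m + 1)) (m := m)
      (a := fun j => (convolution N W V j : ℂ)) ?_ ?_ ?_ hKH ?_ ?_ ?_) fun χ hχ h4 =>
    Ends.seq (argminProg_ends (N := N) (by omega) ?_) fun ψ hψ h5 =>
    Ends.step_seq 12 (T := 40 * N + 40) (T' := 40 * N + 20) rfl (by decide) (by omega)
      ((updateProg_ends (N := N) (j := ψ.nat 11 0) ?_ ?_).mono le_rfl fun φ hφ h6 =>
        ?_)).mono ?_ fun _ _ h => h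
  · rw [hτ.1 0 (by decide), hP.h2]
  · rw [hτ.1 9 (by decide), hP.h9]
  · rw [hτ.1 10 (by decide), hP.h10]
  · exact fun c hc => by
      rw [cell_congr (hτ.2 3 (by decide)) (hτ.2 4 (by decide)), hP.table c hc]
  · rw [hυ.1 9 (by decide), hτ.1 9 (by decide), hP.h9]
  · rw [hω.1 0 (by decide), hυ.1 0 (by decide), hτ.1 0 (by decide), hP.h2]
  · rw [hω.1 9 (by decide), hυ.1 9 (by decide), hτ.1 9 (by decide), hP.h9]
  · rw [hω.1 10 (by decide), hυ.1 10 (by decide), hτ.1 10 (by decide), hP.h10]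
  · exact fun c hc => by
      rw [cell_congr (hω.2 3 (by decide)) (hω.2 4 (by decide)),
        cell_congr (hυ.2 3 (by decide)) (hυ.2 4 (by decide)),
        cell_congr (hτ.2 3 (by decide)) (hτ.2 4 (by decide)), hP.table c hc]
  · rw [hω.1 12 (by decide), h2.1]
  · intro r hr
    -- The supports have lengths `N` and `2 * N`, and `3 * N` is less than `2 ^ (m + 2)`, so this
    -- transform length suffices.
    rw [h3 r hr, h2.2 r hr, cell_congr (hυ.2 7 (by decide)) (hυ.2 8 (by decide)),
      cell_congr (hτ.2 7 (by decide)) (hτ.2 8 (by decide)), hP.transform r hr,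
      fourier_convolution (L := m + 1) (by omega) hW hV hr]
  · rw [hχ.1 6 (by decide), hω.1 6 (by decide), hυ.1 6 (by decide), hτ.1 6 (by decide), hP.h6]
  · simp [Program.step, hψ.1 6 (by decide), hχ.1 6 (by decide), hω.1 6 (by decide),
      hυ.1 6 (by decide), hτ.1 6 (by decide), hP.h6, hN]
  · simp [Program.step]
  · simp only [Program.step, NExp.eval, Memory.real_writeN] at h6 hφ
    have f28 : ψ.nat 28 0 = d := by
      rw [hψ.1 28 (by decide), hχ.1 28 (by decide), hω.1 28 (by decide), hυ.1 28 (by decide),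
        hτ.1 28 (by decide), h28]
    have f25 : ψ.nat 25 = G := by
      rw [hψ.1 25 (by decide), hχ.1 25 (by decide), hω.1 25 (by decide), hυ.1 25 (by decide),
        hτ.1 25 (by decide), hP.h25]
    have f1 : ψ.nat 1 = σ.nat 1 := by
      rw [hψ.1 1 (by decide), hχ.1 1 (by decide), hω.1 1 (by decide), hυ.1 1 (by decide),
        hτ.1 1 (by decide)]
    have r1 : ψ.real 1 = V := by
      rw [hψ.2 1 (by decide), hχ.2 1 (by decide), hω.2 1 (by decide), hυ.2 1 (by decide),
        hτ.2 1 (by decide), hP.values]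
    have r2 : ψ.real 2 = W := by
      rw [hψ.2 2 (by decide), hχ.2 2 (by decide), hω.2 2 (by decide), hυ.2 2 (by decide),
        hτ.2 2 (by decide), hσW]
    refine ⟨ψ.nat 11 0, h5.1, fun i => ?_, fun i => ?_, fun j' hj' => ?_⟩
    · rw [hφ.1 1 (by decide)]
      simp [Function.update_apply, f28, f25, f1]
    · rw [h6 i, r1, r2]
      exact if_ctx_congr Iff.rfl (fun _ => rfl) fun h => hW i (by omega)
    · have key : ∀ j < N, χ.real 12 (N + j)
          = 2 ^ (m + 2) * ∑ i ∈ Finset.range N, W i * V (N + j - i) := fun j hj => by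
        have := congrArg Complex.re (h4 (N + j) (by omega))
        rw [show (2 : ℂ) ^ (m + 2) = ((2 ^ (m + 2) : ℝ) : ℂ) by push_cast; rfl,
          ← Complex.ofReal_mul, Complex.ofReal_re] at this
        refine this.trans ?_
        rw [convolution]
        congr 1
        refine Finset.sum_congr rfl fun i hi => if_pos ?_
        have := Finset.mem_range.1 hi
        omega
      have := h5.2 j' hj'
      rw [key _ h5.1, key j' hj'] at this
      exact le_of_mul_le_mul_left this (by positivity)
  · omega

end QMC

end

/-! ### From powers of the generator back to the residue field -/

noncomputable section

namespace QMC

/-! ### All components -/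

/-- Chooses the components of the generating vector one after another. -/
def componentsProg : Program := forTo 28 (var 7) componentProg

lemma componentsProg_ends {m D : ℕ} (hm : 1 ≤ m) {V : ℕ → ℝ} {G : ℕ → ℕ} {σ : Memory}
    (hP : Prepared m V G σ) (hV : ∀ i, 2 * (2 ^ m - 1) ≤ i → V i = 0)
    (h7 : σ.nat 7 0 = D) (hW : ∀ i, σ.real 2 i = if i < 2 ^ m - 1 then 1 else 0) :
    Ends componentsProg σ (D * (6000 * (m * 2 ^ m) + 20) + 20) fun τ =>
      τ.nat 1 0 = σ.nat 1 0 ∧ ∃ js : ℕ → ℕ,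
        (∀ i < D, js i < 2 ^ m - 1 ∧ τ.nat 1 (i + 1) = G (js i)) ∧
        ∀ d < D, ∀ j < 2 ^ m - 1,
          ∑ i ∈ Finset.range (2 ^ m - 1),
            (∏ e ∈ Finset.range d, V (2 ^ m - 1 + js e - i)) * V (2 ^ m - 1 + js d - i)
          ≤ ∑ i ∈ Finset.range (2 ^ m - 1),
            (∏ e ∈ Finset.range d, V (2 ^ m - 1 + js e - i)) * V (2 ^ m - 1 + j - i) := by
  set N := 2 ^ m - 1 with hN
  refine Ends.forTo_const D (fun k τ => τ.nat 1 0 = σ.nat 1 0 ∧ ∃ js : ℕ → ℕ,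
      (∀ i, τ.real 2 i = if i < N then ∏ e ∈ Finset.range k, V (N + js e - i) else 0) ∧
        (∀ i < k, js i < N ∧ τ.nat 1 (i + 1) = G (js i)) ∧
        ∀ d < k, ∀ j < N,
          ∑ i ∈ Finset.range N, (∏ e ∈ Finset.range d, V (N + js e - i)) * V (N + js d - i)
          ≤ ∑ i ∈ Finset.range N, (∏ e ∈ Finset.range d, V (N + js e - i)) * V (N + j - i))
    (6000 * (m * 2 ^ m)) (by decide)
    (fun τ hτ => by rw [NExp.eval, NExp.eval, hτ.1 7 (by decide), h7])
    ⟨by simp, fun _ => 0, by simp [hW]⟩ ?_ (by simp only [NExp.cost]; ring_nf; omega)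
    fun τ _ h => ⟨h.1, h.2.imp fun js h => h.2⟩
  rintro k hk τ hτ hk28 ⟨h10, js, h2, hjs, hgr⟩
  have hPτ : Prepared m V G τ := hP.congr
    (fun a ha => hτ.1 a (by fin_cases ha <;> decide))
    (fun a ha => hτ.2 a (by fin_cases ha <;> decide))
  refine (componentProg_ends hm hPτ hV (W := τ.real 2) rfl
    (fun i hi => by rw [h2 i, if_neg (by omega)]) hk28).mono le_rfl fun υ hυ h => ?_
  obtain ⟨j, hj, h1, h2', hmin⟩ := h
  have hprod : ∀ i, ∀ d ≤ k, ∏ e ∈ Finset.range d, V (N + Function.update js k j e - i)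
      = ∏ e ∈ Finset.range d, V (N + js e - i) := fun i d hd =>
    Finset.prod_congr rfl fun e he => by
      rw [Function.update_of_ne (by have := Finset.mem_range.1 he; omega)]
  simp only [Memory.nat_writeN, Nat.reduceEqDiff, reduceIte, Memory.real_writeN]
  refine ⟨by rw [h1, if_neg (by omega), h10], Function.update js k j, fun i => ?_,
    fun i hi => ?_, fun d hd j' hj' => ?_⟩
  · rw [h2' i]
    split_ifs with h
    · rw [Finset.prod_range_succ, hprod i k le_rfl, Function.update_self, h2 i, if_pos h]
    · rfl
  · rcases Nat.lt_succ_iff_lt_or_eq.1 hi with hi | rfl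
    · rw [Function.update_of_ne (by omega), h1, if_neg (by omega)]
      exact hjs i hi
    · rw [Function.update_self, h1, if_pos rfl]
      exact ⟨hj, rfl⟩
  · simp only [hprod _ d (Nat.lt_succ_iff.1 hd)]
    rcases Nat.lt_succ_iff_lt_or_eq.1 hd with hd | rfl
    · rw [Function.update_of_ne (by omega)]
      exact hgr d hd j' hj'
    · rw [Function.update_self]
      have e : ∀ j, ∑ i ∈ Finset.range N, τ.real 2 i * V (N + j - i)
          = ∑ i ∈ Finset.range N, (∏ e ∈ Finset.range d, V (N + js e - i)) * V (N + j - i) :=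
        fun j => Finset.sum_congr rfl fun i hi => by rw [h2 i, if_pos (Finset.mem_range.1 hi)]
      rw [← e, ← e]
      exact hmin j' hj'

variable {p : Polynomial (ZMod 2)} [hpi : Fact (Irreducible p)]

/-- Nonzero classes are enumerated as `g ^ (N - i)`, with a negative sign at `i`. A product with `g
^ j` then has the exponent `N + j - i`, which makes the criterion a convolution. -/
lemma sum_erase_zero_eq [DecidableEq (AdjoinRoot p)] {g : AdjoinRoot p} (hg0 : g ≠ 0)
    (hg : orderOf g = 2 ^ p.natDegree - 1) (f : AdjoinRoot p → ℝ) :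
    ∑ k ∈ Finset.univ.erase 0, f k
      = ∑ i ∈ Finset.range (2 ^ p.natDegree - 1), f (g ^ (2 ^ p.natDegree - 1 - i)) := by
  set N := 2 ^ p.natDegree - 1 with hN
  rw [← Finset.sum_range_reflect]
  refine (Finset.sum_bij (fun i _ => g ^ (i + 1)) (fun i _ => ?_) (fun i hi j hj h => ?_)
    (fun y hy => ?_) fun i hi => ?_).symm
  · exact Finset.mem_erase.2 ⟨pow_ne_zero _ hg0, Finset.mem_univ _⟩
  · have h' : g ^ i = g ^ j := mul_right_cancel₀ hg0 (by simpa [pow_succ] using h)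
    rw [Finset.mem_range, ← hg] at hi hj
    exact pow_injOn_Iio_orderOf hi hj h'
  · have hy0 : y * g⁻¹ ≠ 0 := mul_ne_zero (Finset.mem_erase.1 hy).1 (inv_ne_zero hg0)
    obtain ⟨i, hi, h⟩ := (mem_powers_iff_exists_lt hg0).1
      (mem_powers_of_orderOf_dvd (y := y * g⁻¹) hg0
        (by rw [hg]; exact orderOf_dvd_of_ne_zero hy0))
    refine ⟨i, Finset.mem_range.2 (hg ▸ hi), ?_⟩
    rw [pow_succ, ← h, inv_mul_cancel_right₀ hg0]
  · have := Finset.mem_range.1 hi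
    rw [show N - (N - 1 - i) = i + 1 by omega]

/-- Minimality among the powers of a generator is minimality among all nonzero elements. -/
lemma greedy_of_powers [DecidableEq (AdjoinRoot p)] {g : AdjoinRoot p} (hg0 : g ≠ 0)
    (hg : orderOf g = 2 ^ p.natDegree - 1) {c : ℝ} {V : ℕ → ℝ}
    (hV : ∀ l < 2 * (2 ^ p.natDegree - 1), V l = meritKernel c (g ^ l)) {D : ℕ} {js : ℕ → ℕ}
    (hjs : ∀ i < D, js i < 2 ^ p.natDegree - 1)
    (h : ∀ d < D, ∀ j < 2 ^ p.natDegree - 1,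
      ∑ i ∈ Finset.range (2 ^ p.natDegree - 1),
        (∏ e ∈ Finset.range d, V (2 ^ p.natDegree - 1 + js e - i)) *
          V (2 ^ p.natDegree - 1 + js d - i)
      ≤ ∑ i ∈ Finset.range (2 ^ p.natDegree - 1),
        (∏ e ∈ Finset.range d, V (2 ^ p.natDegree - 1 + js e - i)) *
          V (2 ^ p.natDegree - 1 + j - i))
    {d : ℕ} (hd : d < D) {y : AdjoinRoot p} (hy : y ≠ 0) :
    ∑ k ∈ Finset.univ.erase (0 : AdjoinRoot p),
        (∏ i ∈ Finset.range d, meritKernel c (g ^ js i * k)) * meritKernel c (g ^ js d * k)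
      ≤ ∑ k ∈ Finset.univ.erase (0 : AdjoinRoot p),
        (∏ i ∈ Finset.range d, meritKernel c (g ^ js i * k)) * meritKernel c (y * k) := by
  set N := 2 ^ p.natDegree - 1 with hN
  obtain ⟨j, hj, rfl⟩ := (mem_powers_iff_exists_lt hg0).1
    (mem_powers_of_orderOf_dvd (y := y) hg0
      (by rw [hg]; exact orderOf_dvd_of_ne_zero hy))
  rw [hg] at hj
  -- The index lies strictly between `0` and `2 * N`, hence within the two stored periods, and the
  -- subtraction is never truncated.
  have key : ∀ i < N, ∀ j < N, meritKernel c (g ^ j * g ^ (N - i)) = V (N + j - i) :=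
    fun i hi j hj => by
      have hper : g ^ N = 1 := by rw [← hg, pow_orderOf_eq_one]
      rcases Nat.eq_zero_or_pos (N + j - i) with h0 | h0
      · omega
      · rw [hV _ (by omega), ← pow_add, show j + (N - i) = N + j - i by omega]
  have hsum : ∀ j < N, ∑ k ∈ Finset.univ.erase (0 : AdjoinRoot p),
      (∏ i ∈ Finset.range d, meritKernel c (g ^ js i * k)) * meritKernel c (g ^ j * k)
      = ∑ i ∈ Finset.range N, (∏ e ∈ Finset.range d, V (N + js e - i)) * V (N + j - i) :=
    fun j hj => by
      rw [sum_erase_zero_eq hg0 hg]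
      refine Finset.sum_congr rfl fun i hi => ?_
      have hi := Finset.mem_range.1 hi
      rw [key i hi j hj]
      congr 1
      exact Finset.prod_congr rfl fun e he =>
        key i hi _ (hjs e ((Finset.mem_range.1 he).trans hd))
  rw [hsum _ (hjs d hd), hsum _ hj]
  exact h d hd j hj

end QMC

end

/-! ### Assembling the program and its total cost -/

noncomputable section

namespace QMC

/-! ### The whole program -/

/-- Computes the modulus and the powers of a generator of the multiplicative group of the field. -/
def fieldProg : Program :=
  sizesProg ;; modulusProg ;; xmulProg ;; splitProg ;; digitsProg ;; asg 15 (.lit 0) ;;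
  asg 16 (.lit 0) ;; generatorProg

/-- The sizes and the tables of discrete exponentials and logarithms in the field. -/
structure FieldData (α s : ℕ) (p : Polynomial (ZMod 2)) [Fact (Irreducible p)] (g : AdjoinRoot p)
    (σ : Memory) : Prop where
  modulus : polyOfNat (σ.nat 1 0) = p
  h0 : σ.nat 0 0 = α
  h2 : σ.nat 0 2 = p.natDegree
  h5 : σ.nat 5 0 = 2 ^ p.natDegree
  h6 : σ.nat 6 0 = 2 ^ p.natDegree - 1
  h7 : σ.nat 7 0 = α * s
  h26 : ∀ v, v ≠ 0 → v < 2 ^ p.natDegree → σ.nat 26 v = (polyOfNat v).natDegree + 1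
  ne_zero : g ≠ 0
  order : orderOf g = 2 ^ p.natDegree - 1
  powers : PowerList g σ

lemma fieldProg_ends {α s m : ℕ} (hm : 1 ≤ m) :
    Ends fieldProg (inputMemory α s m) (3500 * (m * 2 ^ m) + 30 * s) fun τ =>
      ∃ (p : Polynomial (ZMod 2)) (_ : Fact (Irreducible p)) (g : AdjoinRoot p),
        p.natDegree = m ∧ FieldData α s p g τ := by
  have h2m : 2 ≤ 2 ^ m := by simpa using Nat.pow_le_pow_right two_pos hm
  have hmm : 2 ^ m ≤ m * 2 ^ m := Nat.le_mul_of_pos_left _ hm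
  have hmm' : m ≤ m * 2 ^ m := Nat.le_mul_of_pos_right _ (by omega)
  have hin : ∀ a, a ≠ 0 → ∀ i, (inputMemory α s m).nat a i = 0 := fun a ha i => by
    simp [inputMemory, ha]
  have in0 : (inputMemory α s m).nat 0 0 = α := by simp [inputMemory]
  have in1 : (inputMemory α s m).nat 0 1 = s := by simp [inputMemory]
  have in2 : (inputMemory α s m).nat 0 2 = m := by simp [inputMemory]
  generalize inputMemory α s m = σ at *
  refine (Ends.seq (sizesProg_ends in0 in1 in2 (hin 7 (by decide) 0)) fun σ₁ f₁ h₁ =>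
    Ends.seq (modulusProg_ends hm ?_ h₁.1 ?_ ?_ ?_) (T' := 2900 * (m * 2 ^ m)) fun σ₂ f₂ h₂ =>
      ?_).mono (by omega) fun _ _ h => h
  · rw [f₁.1 0 (by decide), in2]
  · rw [f₁.1 15 (by decide), hin 15 (by decide)]
  · rw [f₁.1 16 (by decide), hin 16 (by decide)]
  · intro v; rw [f₁.1 17 (by decide), hin 17 (by decide)]
  obtain ⟨hirr, hle, hlt⟩ := h₂
  obtain ⟨p, hp⟩ : ∃ p, polyOfNat (σ₂.nat 1 0) = p := ⟨_, rfl⟩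
  have hdeg : p.natDegree = m := hp ▸ natDegree_polyOfNat hle hlt
  have hpi : Fact (Irreducible p) := ⟨hp ▸ hirr⟩
  have g5 : σ₂.nat 5 0 = 2 ^ m := by rw [f₂.1 5 (by decide), h₁.1]
  have g2 : σ₂.nat 0 2 = m := by rw [f₂.1 0 (by decide), f₁.1 0 (by decide), in2]
  refine (Ends.seq (xmulProg_ends hdeg g5 hp) fun σ₃ f₃ h₃ =>
    Ends.seq (splitProg_ends (m := m) ?_ ?_) fun σ₄ f₄ h₄ =>
    Ends.seq (digitsProg_ends (m := m) ?_ ?_) fun σ₅ f₅ h₅ =>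
    Ends.step_seq 3 rfl (by decide) le_rfl (Ends.step_seq 3 rfl (by decide) le_rfl
      ((generatorProg_ends (p := p) (h := (m + 1) / 2) ?_ ?_ ?_ ?_ ?_ ?_ ?_ ?_ ?_ ?_).mono le_rfl
        fun σ₆ f₆ h₆ => ?_))).mono ?_ fun _ _ h => h
  · rw [f₃.1 0 (by decide), g2]
  · rw [f₃.1 5 (by decide), g5]
  · rw [f₄.1 6 (by decide), f₃.1 6 (by decide), f₂.1 6 (by decide), h₁.2.1]
  · rw [f₄.1 26 (by decide), f₃.1 26 (by decide), f₂.1 26 (by decide), f₁.1 26 (by decide),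
      hin 26 (by decide)]
  · refine XmulTable.congr (σ := σ₃) (by simpa only [XmulTable, hdeg] using h₃) ?_
    simp [Program.step, f₅.1 18 (by decide), f₄.1 18 (by decide)]
  · rw [hdeg]
  · simp [Program.step, f₅.1 0 (by decide), f₄.1 0 (by decide), f₃.1 0 (by decide), g2, hdeg]
  · intro v hv
    have := h₄.2 v (hdeg ▸ hv)
    simpa [Program.step, f₅.1 19 (by decide), f₅.1 20 (by decide)] using this
  · simp [Program.step, f₅.1 6 (by decide), f₄.1 6 (by decide), f₃.1 6 (by decide),
      f₂.1 6 (by decide), h₁.2.1, hdeg]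
  · simp [Program.step, f₅.1 8 (by decide), h₄.1]
  -- The postcondition of the sieve says nothing about these two work cells, which is why they are
  -- reset beforehand.
  · simp [Program.step, NExp.eval]
  · simp [Program.step, NExp.eval]
  · simp [Program.step, f₅.1 22 (by decide), f₄.1 22 (by decide), f₃.1 22 (by decide),
      f₂.1 22 (by decide), f₁.1 22 (by decide), hin 22]
  · intro v
    simp [Program.step, f₅.1 21 (by decide), f₄.1 21 (by decide), f₃.1 21 (by decide),
      f₂.1 21 (by decide), f₁.1 21 (by decide), hin 21]
  · obtain ⟨g, hg0, hg, hG⟩ := h₆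
    refine ⟨p, hpi, g, hdeg, ?_, ?_, ?_, ?_, ?_, ?_, ?_, hg0, hg, hG⟩
    · rw [f₆.1 1 (by decide)]
      simp [Program.step, f₅.1 1 (by decide), f₄.1 1 (by decide), f₃.1 1 (by decide), hp]
    · rw [f₆.1 0 (by decide)]
      simp [Program.step, f₅.1 0 (by decide), f₄.1 0 (by decide), f₃.1 0 (by decide),
        f₂.1 0 (by decide), f₁.1 0 (by decide), in0]
    · rw [f₆.1 0 (by decide)]
      simp [Program.step, f₅.1 0 (by decide), f₄.1 0 (by decide), f₃.1 0 (by decide), g2, hdeg]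
    · rw [f₆.1 5 (by decide)]
      simp [Program.step, f₅.1 5 (by decide), f₄.1 5 (by decide), f₃.1 5 (by decide), g5, hdeg]
    · rw [f₆.1 6 (by decide)]
      simp [Program.step, f₅.1 6 (by decide), f₄.1 6 (by decide), f₃.1 6 (by decide),
        f₂.1 6 (by decide), h₁.2.1, hdeg]
    · rw [f₆.1 7 (by decide)]
      simp [Program.step, f₅.1 7 (by decide), f₄.1 7 (by decide), f₃.1 7 (by decide),
        f₂.1 7 (by decide), h₁.2.2]
    · rw [f₆.1 26 (by decide)]
      simpa [Program.step, hdeg] using h₅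
  · rw [hdeg]; omega

/-- Tabulates the kernel and its Fourier transform. -/
def transformProg : Program :=
  kernelProg ;; periodProg ;; lengthProg ;; twiddleProg ;; loadProg 1 ;; fourierProg ;; saveProg

lemma transformProg_ends {α s : ℕ} {p : Polynomial (ZMod 2)} [Fact (Irreducible p)]
    {g : AdjoinRoot p} {σ : Memory} (hm : 1 ≤ p.natDegree) (hσ : FieldData α s p g σ)
    (hr : ∀ a i, σ.real a i = 0) :
    Ends transformProg σ (12000 * (p.natDegree * 2 ^ p.natDegree) + 40 * α) fun τ =>
      Prepared p.natDegree (fun l => if l < 2 * (2 ^ p.natDegree - 1) then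
        meritKernel ((1 / 2) ^ α) (g ^ l) else 0) (σ.nat 25) τ ∧
      ∀ i, τ.real 2 i = if i < 2 ^ p.natDegree - 1 then 1 else 0 := by
  set m := p.natDegree with hmdef
  have h2m : 2 ≤ 2 ^ m := by simpa using Nat.pow_le_pow_right two_pos hm
  have hmm : 2 ^ m ≤ m * 2 ^ m := Nat.le_mul_of_pos_left _ hm
  have hmm' : m ≤ m * 2 ^ m := Nat.le_mul_of_pos_right _ (by omega)
  have hK : 2 ^ (m + 2) = 4 * 2 ^ m := by ring
  have hKH : 2 ^ (m + 2) = 2 * 2 ^ (m + 1) := by ring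
  have hmK : (m + 2) * 2 ^ (m + 2) ≤ 12 * (m * 2 ^ m) := by rw [hK]; nlinarith
  have hmK' : (m + 3) * 2 ^ (m + 2) ≤ 16 * (m * 2 ^ m) := by rw [hK]; nlinarith
  set K := 2 ^ (m + 2) with hKdef
  set V : ℕ → ℝ := fun l => if l < 2 * (2 ^ m - 1) then meritKernel ((1 / 2) ^ α) (g ^ l) else 0
    with hV
  refine (Ends.seq (kernelProg_ends hσ.h0 hσ.h2) fun σ₁ f₁ h₁ =>
    Ends.seq (periodProg_ends (α := α) hσ.ne_zero hσ.order ?_ ?_ ?_ ?_ h₁ ?_ ?_) fun σ₂ f₂ h₂ =>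
    Ends.seq (T := 14) (Q := fun τ => τ.nat 9 0 = K ∧ τ.nat 10 0 = 2 ^ (m + 1))
      (Ends.of_step rfl (by decide) ?_) fun σ₃ f₃ h₃ =>
    Ends.seq (twiddleProg_ends (m := m) ?_ h₃.1) fun σ₄ f₄ h₄ =>
    Ends.seq (loadProg_ends (a := 1) (K := K) (by decide) (by decide) ?_) fun σ₅ f₅ h₅ =>
    Ends.seq (fourierProg_ends (K := K) (H := 2 ^ (m + 1)) (m := m) (a := fun i => (V i : ℂ))
      ?_ ?_ ?_ hKH ?_ fun c hc => ?_) fun σ₆ f₆ h₆ =>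
    (saveProg_ends (K := K) ?_ h₆.1).mono le_rfl fun σ₇ f₇ h₇ => ?_).mono ?_ fun _ _ h => h
  · intro i hi
    rw [f₁.1 25 (by decide)]
    exact hσ.powers i hi
  · rw [f₁.1 0 (by decide), hσ.h2]
  · rw [f₁.1 6 (by decide), hσ.h6]
  · rw [f₁.1 26 (by decide)]; exact hσ.h26
  · intro i; rw [f₁.2 1 (by decide), hr]
  · intro i; rw [f₁.2 2 (by decide), hr]
  · have : σ₂.nat 5 0 = 2 ^ m := by rw [f₂.1 5 (by decide), f₁.1 5 (by decide), hσ.h5]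
    simp only [lengthProg, Program.step, NExp.eval, Memory.nat_writeN, Nat.reduceEqDiff, reduceIte,
      Function.update_self, this]
    omega
  · rw [f₃.1 0 (by decide), f₂.1 0 (by decide), f₁.1 0 (by decide), hσ.h2]
  · rw [f₄.1 9 (by decide), h₃.1]
  · rw [f₅.1 0 (by decide), f₄.1 0 (by decide), f₃.1 0 (by decide), f₂.1 0 (by decide),
      f₁.1 0 (by decide), hσ.h2]
  · rw [f₅.1 9 (by decide), f₄.1 9 (by decide), h₃.1]
  · rw [f₅.1 10 (by decide), f₄.1 10 (by decide), h₃.2]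
  · intro c hc
    rw [cell_congr (f₅.2 3 (by decide)) (f₅.2 4 (by decide)), h₄ c hc]
  · rw [h₅ c hc, f₄.2 1 (by decide), f₃.2 1 (by decide), h₂.1 c]
  · rw [f₆.1 9 (by decide), f₅.1 9 (by decide), f₄.1 9 (by decide), h₃.1]
  · refine ⟨⟨?_, ?_, ?_, ?_, ?_, ?_, ?_, ?_⟩, fun i => ?_⟩
    · rw [f₇.1 0 (by decide), f₆.1 0 (by decide), f₅.1 0 (by decide), f₄.1 0 (by decide),
        f₃.1 0 (by decide), f₂.1 0 (by decide), f₁.1 0 (by decide), hσ.h2]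
    · rw [f₇.1 6 (by decide), f₆.1 6 (by decide), f₅.1 6 (by decide), f₄.1 6 (by decide),
        f₃.1 6 (by decide), f₂.1 6 (by decide), f₁.1 6 (by decide), hσ.h6]
    · rw [f₇.1 9 (by decide), f₆.1 9 (by decide), f₅.1 9 (by decide), f₄.1 9 (by decide), h₃.1]
    · rw [f₇.1 10 (by decide), f₆.1 10 (by decide), f₅.1 10 (by decide), f₄.1 10 (by decide),
        h₃.2]
    · rw [f₇.1 25 (by decide), f₆.1 25 (by decide), f₅.1 25 (by decide), f₄.1 25 (by decide),
        f₃.1 25 (by decide), f₂.1 25 (by decide), f₁.1 25 (by decide)]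
    · intro c hc
      rw [cell_congr (f₇.2 3 (by decide)) (f₇.2 4 (by decide)),
        cell_congr (f₆.2 3 (by decide)) (f₆.2 4 (by decide)),
        cell_congr (f₅.2 3 (by decide)) (f₅.2 4 (by decide)), h₄ c hc]
    · funext l
      rw [f₇.2 1 (by decide), f₆.2 1 (by decide), f₅.2 1 (by decide), f₄.2 1 (by decide),
        f₃.2 1 (by decide), h₂.1 l]
    · intro c hc
      rw [h₇ c hc, h₆.2 c hc]
    · rw [f₇.2 2 (by decide), f₆.2 2 (by decide), f₅.2 2 (by decide), f₄.2 2 (by decide),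
        f₃.2 2 (by decide), h₂.2 i]
  · rw [← hmdef]
    omega

/-- Constructs the modulus and the generating vector. -/
def iplrProg : Program := fieldProg ;; transformProg ;; componentsProg

open scoped Classical in
/-- What the constructed modulus and generating vector satisfy. -/
lemma iplrProg_ends {α s m : ℕ} (hα : 2 ≤ α) (hs : 1 ≤ s) (hm : 1 ≤ m) :
    Ends iplrProg (inputMemory α s m) (30000 * (α * s * (m * 2 ^ m))) fun τ =>
      IsIPLR α s m (outputModulus τ) (outputVector α s τ) ∧
      ∀ lam : ℝ, 1 ≤ lam → lam < α → ∀ F : (Fin s → ℝ) → ℝ, MemH α F →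
        |(∫ y in cube s, F y) - iplrRule m (outputModulus τ) (outputVector α s τ) F|
          ≤ Ctilde α lam s / (2 ^ m) ^ lam * normH α F := by
  have hE : 1 ≤ m * 2 ^ m := Nat.mul_pos hm (Nat.two_pow_pos m)
  have hαs : 1 ≤ α * s := Nat.mul_pos (by omega) hs
  refine Ends.mono (Ends.seq (T' := 12000 * (m * 2 ^ m) + 40 * α +
    (α * s * (6000 * (m * 2 ^ m) + 20) + 20)) (fieldProg_ends (α := α) (s := s) hm)
    fun σ₁ f₁ h₁ => ?_) ?_ fun _ _ h => h
  · obtain ⟨p, hpi, g, rfl, hF⟩ := h₁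
    have hr : ∀ a i, σ₁.real a i = 0 := fun a i => by
      rw [f₁.2 a (by rw [show fieldProg.wR = [] from rfl]; exact List.not_mem_nil)]; rfl
    refine Ends.seq (transformProg_ends hm hF hr) fun σ₂ f₂ h₂ =>
      (componentsProg_ends (D := α * s) hm h₂.1 (fun i hi => if_neg (by omega)) ?_
        h₂.2).mono le_rfl fun τ f₃ h₃ => ?_
    · rw [f₂.1 7 (by decide), hF.h7]
    obtain ⟨h10, js, hjs, hgr⟩ := h₃
    have hmod : outputModulus τ = p := by
      rw [outputModulus, h10, f₂.1 1 (by decide), hF.modulus]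
    rw [hmod]
    have hG : ∀ i < α * s, τ.nat 1 (i + 1) < 2 ^ p.natDegree ∧
        encNat p (τ.nat 1 (i + 1)) = g ^ js i := fun i hi => by
      rw [(hjs i hi).2]
      exact hF.powers _ (hjs i hi).1
    have hclass : ∀ i < α * s, genClass p (outputVector α s τ) i = g ^ js i := fun i hi => by
      rw [genClass, dif_pos (by rwa [mul_comm])]
      exact (hG i hi).2
    refine ⟨⟨hpi.out, rfl, fun j => degree_polyOfNat_lt_iff.2 (hG j ?_).1⟩, ?_⟩
    · exact j.2.trans_eq (mul_comm s α)
    · intro lam hl1 hl2 F hMem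
      refine abs_integral_sub_iplrRule_le_of_greedy hα _ (fun i hi => ?_)
        (fun d hd y hy => ?_) hl1 hl2 hMem
      · rw [hclass i hi]
        exact pow_ne_zero _ hF.ne_zero
      · have := greedy_of_powers hF.ne_zero hF.order (c := (1 / 2) ^ α)
          (fun l hl => if_pos hl) (fun i hi => (hjs i hi).1) hgr hd hy
        rw [hclass d hd]
        have hprod : ∀ k, ∏ i ∈ Finset.range d,
            meritKernel ((1 / 2) ^ α) (genClass p (outputVector α s τ) i * k)
            = ∏ i ∈ Finset.range d, meritKernel ((1 / 2) ^ α) (g ^ js i * k) := fun k =>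
          Finset.prod_congr rfl fun i hi => by
            rw [hclass i ((Finset.mem_range.1 hi).trans hd)]
        simp only [hprod]
        exact this
  -- The preparations are independent of the number of components up to linear terms in `α` and `s`;
  -- everything is absorbed by the cost of the `α * s` components.
  · have h1 : m * 2 ^ m ≤ α * s * (m * 2 ^ m) := Nat.le_mul_of_pos_left _ hαs
    have h2 : s ≤ α * s := Nat.le_mul_of_pos_left _ (by omega)
    have h3 : α ≤ α * s := Nat.le_mul_of_pos_right _ hs
    have h4 : α * s ≤ α * s * (m * 2 ^ m) := Nat.le_mul_of_pos_right _ hE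
    have h5 : α * s * (6000 * (m * 2 ^ m) + 20)
        = 6000 * (α * s * (m * 2 ^ m)) + 20 * (α * s) := by ring
    omega

end QMC

end

theorem mainTheorem3 :
    ∃ (P : QMC.Program) (C : ℝ), ∀ (α s m : ℕ), 2 ≤ α → 1 ≤ s → 1 ≤ m →
      ∃ (t : ℕ) (σ : QMC.Memory),
        QMC.Runs P (QMC.inputMemory α s m) t σ ∧
        (t : ℝ) ≤ C * ((α : ℝ) * (s : ℝ) * (2 : ℝ) ^ m * Real.log ((2 : ℝ) ^ m)) ∧
        QMC.IsIPLR α s m (QMC.outputModulus σ) (QMC.outputVector α s σ) ∧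
        ∀ (lam : ℝ), 1 ≤ lam → lam < (α : ℝ) →
          ∀ (F : (Fin s → ℝ) → ℝ), QMC.MemH α F →
            |(∫ y in QMC.cube s, F y)
                - QMC.iplrRule m (QMC.outputModulus σ) (QMC.outputVector α s σ) F|
              ≤ QMC.Ctilde α lam s / ((2 : ℝ) ^ m) ^ lam * QMC.normH α F := by
  -- The program counts `m`, which is `log n / log 2` for the natural logarithm.
  refine ⟨QMC.iplrProg, 30000 / Real.log 2, fun α s m hα hs hm => ?_⟩
  obtain ⟨t, σ, hrun, ht, hrule, herr⟩ := QMC.iplrProg_ends hα hs hm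
  refine ⟨t, σ, hrun, (Nat.cast_le.2 ht).trans_eq ?_, hrule, herr⟩
  have hlog : Real.log 2 ≠ 0 := (Real.log_pos one_lt_two).ne'
  rw [Real.log_pow]
  push_cast
  field_simp
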